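/- Let $G$ be a finite metric graph, with finitely many vertices (set $V$) and edges of finite positive length (loops and multiple edges are allowed). Let $U$ be a real potential on $G$ that is smooth on each closed edge and such that at every vertex $v$ all odd derivatives of $U$ vanish, $U_\alpha^{(2l+1)}(v)=0$, and all even derivatives are continuous, $U_\alpha^{(2l)}(v)=U_{\alpha'}^{(2l)}(v)$, for all edge ends $\alpha,\alpha'$ at $v$ and all $l\ge 0$. Let $D=-(\partial_x^2+U(x))$ with self-adjoint vertex conditions $A_v\vec f_v+B_v\vec f_v'=0$ ($A_v,B_v$ complex $d_v\times d_v$ matrices, where $d_v$ is the number of edge ends at $v$; $A_vB_v^*$ self-adjoint, $(A_v,B_v)$ of full rank; derivatives taken away from the vertex) of non-Robin type: $\sigma_v=-(A_v+ikB_v)^{-1}(A_v-ikB_v)$ does not depend on $k\in\mathbb R\setminus\{0\}$. A heat kernel of $D$ is a function $e(t,x,y)$, continuous for $t>0$ and $x,y$ in closed edges (so that it may have one value for each edge end at a vertex), such that for each $x$ it is a classical solution of $(\partial_t+D_y)e=0$, with $e,\partial_ye,\partial_y^2e$ continuous in $(t,y)$ for $t>0$ and $y$ in each closed edge, it satisfies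 the vertex conditions in $y$, and for each $x$ in the interior of an edge $\lim_{t\to0^+}\int_G e(t,x,y)\psi(y)\,dy=\psi(x)$ for all functions $\psi$ that are continuous on each closed edge. Call functions $a_n$ ($n=0,1,2,\dots$) on $G$, real valued and continuous on each closed edge, and real numbers $a_n^b(v)$ ($v\in V$, $n=0,\tfrac12,1,\tfrac32,\dots$), heat coefficients of $(G,U)$ if for all non-Robin vertex conditions and every corresponding heat kernel $e$ the following asymptotic expansions hold as $t\to0^+$: for every $x$ in the interior of an edge $$e(t,x,x)\sim\frac1{\sqrt{4\pi t}}\sum_{n=0}^\infty a_n(x)\,t^n,$$ and $$\int_G e(t,x,x)\,dx\sim\frac1{\sqrt{4\pi t}}\sum_{n=0}^\infty\int_G a_n(x)\,dx\cdot t^n+\frac14\sum_{v\in V}\sum_{\alpha\sim v}\sigma_v^{\alpha\alpha}\sum_{n=0,\frac12,1,\frac32,\dots}a_n^b(v)\,t^n,$$ where $\alpha\sim v$ runs over the edge ends at $v$. Then for all non-Robin vertex conditions a heat kernel exists, and heat coefficients of $(G,U)$ exist. They are local and universal: there are real polynomials $P_n$ ($n=0,1,2,\dots$) and $Q_n$ ($n=0,\frac12,1,\dots$),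 the same for all $G$ and $U$, such that all heat coefficients satisfy $a_n(x)=P_n(U(x),U'(x),U''(x),\dots)$ at all points $x$ of the closed edges and $a_n^b(v)=Q_n(U(v),U'(v),U''(v),\dots)$ at all vertices $v$ with at least one edge. Moreover, at all such vertices, $a_n^b(v)=0$ whenever $n$ is not an integer, and the first coefficients are \begin{align*} & a_0(x) = 1, && a_0^b(v)=1,\\ & a_1(x) = U(x), && a_1^b(v)=U(v),\\ & a_2(x) = \tfrac16U''(x)+\tfrac12U(x)^2, && a_2^b(v)=\tfrac14U''(v)+\tfrac12U(v)^2,\\ & a_3(x) = \tfrac1{60}U^{(4)}(x)+\tfrac16U''(x)U(x)+\tfrac1{12}U'(x)^2+\tfrac16U(x)^3, && a_3^b(v)=\tfrac1{32}U^{(4)}(v)+\tfrac14U(v)U''(v)+\tfrac16U(v)^3. \end{align*} -/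

import Mathlib

open Set Filter Topology Asymptotics
open scoped ContDiff Real Matrix

/-- A finite metric graph with vertex set `V` and edge set `E` (both finite wherever this matters).
The edge `e` is identified with the segment `[0, len e]`. Its two ends are the half-edges
`(e, false)`, at the coordinate `0`, and `(e, true)`, at the coordinate `len e`; `vert` maps each
half-edge to its vertex. Loops and multiple edges are allowed. -/
structure MetricGraph (V E : Type*) where
  len : E → ℝ
  len_pos : ∀ e, 0 < len e
  vert : E × Bool → V

namespace MetricGraph

variable {V E : Type*}

/-- The closed segment that parametrises the edge `e`. -/
def seg (Γ : MetricGraph V E) (e : E) : Set ℝ := Icc 0 (Γ.len e)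

/-- The half-edges at the vertex `v`. -/
abbrev Star (Γ : MetricGraph V E) (v : V) : Type _ := {h : E × Bool // Γ.vert h = v}

/-- The coordinate of the end `h` on its edge. -/
def endPos (Γ : MetricGraph V E) (h : E × Bool) : ℝ := if h.2 then Γ.len h.1 else 0

/-- The `j`-th derivative, along the parametrisation of the edge `e`, of a function on the graph
at the point with coordinate `x` of `e` (one-sided at the two ends). -/
noncomputable def edgeDeriv (Γ : MetricGraph V E) {F : Type*} [NormedAddCommGroup F]
    [NormedSpace ℝ F] (f : E → ℝ → F) (j : ℕ) (e : E) (x : ℝ) : F :=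
  iteratedDerivWithin j (f e) (Γ.seg e) x

/-- The `j`-th (one-sided) derivative of a function on the graph at the end `h` of an edge, taken in
the direction pointing away from the vertex. -/
noncomputable def endDeriv (Γ : MetricGraph V E) {F : Type*} [NormedAddCommGroup F]
    [NormedSpace ℝ F] (f : E → ℝ → F) (j : ℕ) (h : E × Bool) : F :=
  ((if h.2 then -1 else 1 : ℝ) ^ j) •
    Γ.edgeDeriv f j h.1 (Γ.endPos h)

/-- Smooth potentials: `U` is smooth on every closed edge, its odd derivatives vanish at
the vertices, and its even derivatives are continuous on the whole graph. -/
structure IsSmoothPotential (Γ : MetricGraph V E) (U : E → ℝ → ℝ) : Prop where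
  contDiffOn : ∀ e, ContDiffOn ℝ ∞ (U e) (Γ.seg e)
  odd_eq_zero : ∀ (l : ℕ) (h : E × Bool), Γ.endDeriv U (2 * l + 1) h = 0
  even_eq : ∀ (l : ℕ) (h h' : E × Bool), Γ.vert h = Γ.vert h' →
    Γ.endDeriv U (2 * l) h = Γ.endDeriv U (2 * l) h'

end MetricGraph

/-- The matrix `-(A + ikB)⁻¹ (A - ikB)` attached to the vertex condition `A f + B f' = 0`. -/
noncomputable def vertexScattering {ι : Type*} [Fintype ι] [DecidableEq ι]
    (A B : Matrix ι ι ℂ) (k : ℝ) : Matrix ι ι ℂ :=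
  -((A + (Complex.I * (k : ℂ)) • B)⁻¹ * (A - (Complex.I * (k : ℂ)) • B))

/-- Self-adjoint vertex conditions `A f + B f' = 0` of non-Robin type: `A B*` is self-adjoint,
`(A, B)` has full rank, and the matrix `-(A + ikB)⁻¹ (A - ikB)` does not depend on `k`. (For real
`k ≠ 0` the inverse exists by the first two conditions.) -/
structure IsNonRobin {ι : Type*} [Fintype ι] [DecidableEq ι] (A B : Matrix ι ι ℂ) : Prop where
  selfAdjoint : (A * Bᴴ).IsHermitian
  fullRank : (Matrix.fromCols A B).rank = Fintype.card ι
  const : ∀ k k' : ℝ, k ≠ 0 → k' ≠ 0 → vertexScattering A B k = vertexScattering A B k'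

/-- For a non-Robin vertex condition, the `k`-independent value of `-(A + ikB)⁻¹ (A - ikB)`. -/
noncomputable def vertexSigma {ι : Type*} [Fintype ι] [DecidableEq ι]
    (A B : Matrix ι ι ℂ) : Matrix ι ι ℂ := vertexScattering A B 1

namespace MetricGraph

variable {V E : Type*}

/-- `k t e x f y` is a heat kernel `(t, x, y) ↦ k`, where `x` is the point with coordinate `x` on
the edge `e` and `y` the point with coordinate `y` on the edge `f`, of the operator
`D = -(∂² + U)` with vertex conditions `A v f + B v f' = 0`:
it is continuous in `(t, x, y)` for `t > 0` and on closed edges, it is a classical solution of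
`(∂_t + D_y) k = 0` in `(t, y)`, it satisfies the vertex conditions in `y`, and it tends to the
delta distribution at `x` as `t → 0⁺`, for every `x` inside an edge. As vertex conditions need not
force continuity at the vertices, a test function is any function continuous on each closed edge.
The values at a vertex `x` are limits of values at inner points of the edge. -/
structure IsHeatKernel [Fintype E] [DecidableEq V] (Γ : MetricGraph V E)
    (U : E → ℝ → ℝ) (A B : ∀ v, Matrix (Γ.Star v) (Γ.Star v) ℂ)
    (k : ℝ → E → ℝ → E → ℝ → ℂ) : Prop where
  continuousOn : ∀ e f, ContinuousOn (fun p : ℝ × ℝ × ℝ => k p.1 e p.2.1 f p.2.2)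
    (Ioi 0 ×ˢ Γ.seg e ×ˢ Γ.seg f)
  contDiffOn : ∀ t, 0 < t → ∀ e, ∀ x ∈ Γ.seg e, ∀ f, ContDiffOn ℝ 2 (k t e x f) (Γ.seg f)
  continuousOn_deriv : ∀ e, ∀ x ∈ Γ.seg e, ∀ f, ∀ j ≤ 2,
    ContinuousOn (fun p : ℝ × ℝ => Γ.edgeDeriv (k p.1 e x) j f p.2)
      (Ioi 0 ×ˢ Γ.seg f)
  heat_eq : ∀ t, 0 < t → ∀ e, ∀ x ∈ Γ.seg e, ∀ f, ∀ y ∈ Γ.seg f,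
    HasDerivAt (fun s => k s e x f y)
      (Γ.edgeDeriv (k t e x) 2 f y + (U f y : ℂ) * k t e x f y) t
  vertex_cond : ∀ t, 0 < t → ∀ e, ∀ x ∈ Γ.seg e, ∀ v,
    A v *ᵥ (fun h : Γ.Star v => Γ.endDeriv (k t e x) 0 h)
      + B v *ᵥ (fun h : Γ.Star v => Γ.endDeriv (k t e x) 1 h) = 0
  initial : ∀ e, ∀ x ∈ Ioo 0 (Γ.len e), ∀ ψ : E → ℝ → ℂ, (∀ f, ContinuousOn (ψ f) (Γ.seg f)) →
    Tendsto (fun t => ∑ f, ∫ y in (0 : ℝ)..Γ.len f, k t e x f y * ψ f y) (𝓝[>] 0) (𝓝 (ψ e x))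

/-- `∫_G k(t,x,x) dx`. -/
noncomputable def heatTrace [Fintype E] (Γ : MetricGraph V E)
    (k : ℝ → E → ℝ → E → ℝ → ℂ) (t : ℝ) : ℂ :=
  ∑ e, ∫ x in (0 : ℝ)..Γ.len e, k t e x e x

/-- The diagonal of the kernel has, inside every edge, the asymptotic expansion
`k(t,x,x) ~ (4πt)^(-1/2) ∑ a_n(x) t^n` as `t → 0⁺`. -/
def HasDiagonalExpansion (Γ : MetricGraph V E) (k : ℝ → E → ℝ → E → ℝ → ℂ)
    (a : ℕ → E → ℝ → ℝ) : Prop :=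
  ∀ e, ∀ x ∈ Ioo 0 (Γ.len e), ∀ N : ℕ,
    (fun t : ℝ => k t e x e x
        - ((1 / √(4 * π * t) * ∑ n ∈ Finset.range (N + 1), a n e x * t ^ n : ℝ) : ℂ))
      =O[𝓝[>] 0] fun t : ℝ => t ^ ((N : ℝ) + 1 / 2)

/-- The asymptotic expansion as `t → 0⁺`
`∫_G k(t,x,x) dx ~ (4πt)^(-1/2) ∑_{n = 0, 1, …} (∫_G a_n(x) dx) t^n
  + 1/4 ∑_v ∑_{α ∼ v} σ_v^{αα} ∑_{n = 0, 1/2, 1, …} a_n^b(v) t^n`,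
where `b m v` is `a_{m/2}^b(v)`. The first omitted powers of `t` are both `N + 1/2`. -/
def HasTraceExpansion [Fintype V] [Fintype E] [DecidableEq V] [DecidableEq E]
    (Γ : MetricGraph V E) (A B : ∀ v, Matrix (Γ.Star v) (Γ.Star v) ℂ)
    (k : ℝ → E → ℝ → E → ℝ → ℂ) (a : ℕ → E → ℝ → ℝ) (b : ℕ → V → ℝ) : Prop :=
  ∀ N : ℕ,
    (fun t : ℝ => Γ.heatTrace k t
        - ((1 / √(4 * π * t) * ∑ n ∈ Finset.range (N + 1),
            (∑ e, ∫ x in (0 : ℝ)..Γ.len e, a n e x) * t ^ n : ℝ) : ℂ)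
        - 1 / 4 * ∑ v, ∑ α : Γ.Star v, vertexSigma (A v) (B v) α α *
            ((∑ m ∈ Finset.range (2 * N + 1), b m v * t ^ ((m : ℝ) / 2) : ℝ) : ℂ))
      =O[𝓝[>] 0] fun t : ℝ => t ^ ((N : ℝ) + 1 / 2)

/-- `a n` and `b m` are the heat coefficients `a_n(x)` and `a_{m/2}^b(v)` of the metric graph `Γ`
with potential `U`: the `a n` are continuous on the edges, and the expansions of the diagonal and
of the trace of the heat kernel hold with them for all non-Robin vertex conditions. In particular
neither `a` nor `b` depends on the vertex conditions. -/
def IsHeatCoefficients [Fintype V] [Fintype E] [DecidableEq V] [DecidableEq E]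
    (Γ : MetricGraph V E) (U : E → ℝ → ℝ) (a : ℕ → E → ℝ → ℝ) (b : ℕ → V → ℝ) : Prop :=
  (∀ n e, ContinuousOn (a n e) (Γ.seg e)) ∧
  ∀ A B : ∀ v, Matrix (Γ.Star v) (Γ.Star v) ℂ, (∀ v, IsNonRobin (A v) (B v)) →
    ∀ k, Γ.IsHeatKernel U A B k →
      Γ.HasDiagonalExpansion k a ∧ Γ.HasTraceExpansion A B k a b

end MetricGraph

/-!
Why the heat coefficients exist, are local, and are universal.

*Scattering picture.* For a non-Robin condition the matrix `σ_v` is a Hermitian involution, and the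
condition says that the boundary values `f` satisfy `σ f = f` and the outward derivatives satisfy
`σ f' = -f'` (`IsNonRobin.condition_iff`). Hence a wave that arrives at a vertex along the end `h`
may be continued into every end `h'` at the vertex with the amplitude `σ h' h`, and any
superposition obtained in this way satisfies the vertex conditions (`sum_mul_endDeriv_fold`). The
conditions on the derivatives of `U` at the vertices say that the potential stays smooth along every
path that passes a vertex, including a path that turns back (`passJet_hasDerivWithinAt`).

*Parametrix.* On the line the heat kernel has the formal expansion
`exp(-(y - x)² / 4t) / √(4πt) * ∑ t ^ k u_k(x, y)`, and the transport equations express the Taylor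
coefficients of `u_k(x, ·)` at `x` by universal polynomials in the derivatives of `U` at `x`
(`transportJet`). Truncated Taylor polynomials of the `u_k` suffice for a remainder of any given
order (`exists_norm_heatRemainder_le`), since a Gaussian turns powers of `y - x` into powers of
`t`. The parametrix `graphWave` of the graph consists of this wave on the edge of the source and its
scattered images in the edges next to it, cut off before they reach the next vertex.

*Existence and uniqueness.* To correct the parametrix one solves the inhomogeneous heat equation in
a Banach space of `C²` functions with the vertex conditions (`exists_cauchy_solution`): averaging
with a Gaussian cut off below the minimal edge length, applied to functions continued through the
vertices, is a heat semigroup up to a bounded defect, and a Volterra equation removes the defect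
and adds the potential. The result is a heat kernel that differs from the parametrix by `O(t ^ M)`
(`exists_heatKernel`). By Green's formula any two heat kernels for the same conditions are adjoint
to each other (`IsHeatKernel.eq_conj_swap`). Therefore the heat kernel is unique, and every
heat kernel is close to the parametrix.

*Expansions.* On the diagonal inside an edge the images are negligible, which yields
`a_n = u_n(x, x)`. In the trace only those images contribute that return to their own edge at the
same end: with `s` the distance from the vertex they give `σ^{αα} ∫ γ_t(2s) ∑ t ^ k u_k(s, -s) ds`
for the Gaussian `γ_t`. Watson's lemma (`isBigO_integral_gaussKernel`) expands this in powers of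
`√t`. The Taylor coefficients of odd order of `u_k(s, -s)` vanish, as the potential is even along
the reflected path (`eval_mirrorJet_odd`), so only integer powers of `t` remain.

*Uniqueness of the coefficients.* Inside the edges they are determined by a single kernel. At a
vertex `v` the traces for Neumann conditions everywhere (`σ = 1`) and for the Dirichlet condition at
`v` alone (`σ_v = -1`) differ by twice the contribution of `v`.
-/

/-! ### Non-Robin vertex conditions -/

section VertexAlgebra

variable {ι : Type*} [Fintype ι] [DecidableEq ι]

open scoped ComplexOrder in
/-- A square matrix `M` for which `M Mᴴ` has full rank is invertible. -/
theorem isUnit_of_rank_mul_conjTranspose {M : Matrix ι ι ℂ}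
    (h : (M * Mᴴ).rank = Fintype.card ι) : IsUnit M := by
  rw [Matrix.rank_self_mul_conjTranspose] at h
  rw [← Matrix.mulVec_surjective_iff_isUnit]
  have : LinearMap.range M.mulVecLin = ⊤ := by
    apply Submodule.eq_top_of_finrank_eq
    rw [Module.finrank_fintype_fun_eq_card]
    exact h
  exact LinearMap.range_eq_top.1 this

open scoped ComplexOrder in
/-- For a non-Robin condition `A f + B f' = 0` the matrix `σ` is a Hermitian involution with
`A (1 + σ) = 0` and `B (1 - σ) = 0`, and `A + iB` is invertible. -/
theorem IsNonRobin.sigma_spec {A B : Matrix ι ι ℂ} (h : IsNonRobin A B) :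
    A * vertexSigma A B = -A ∧ B * vertexSigma A B = B ∧
      vertexSigma A B * vertexSigma A B = 1 ∧ (vertexSigma A B)ᴴ = vertexSigma A B ∧
      IsUnit (A + Complex.I • B) := by
  set M : Matrix ι ι ℂ := A + Complex.I • B with hM
  set N : Matrix ι ι ℂ := A - Complex.I • B with hN
  have hAB : B * Aᴴ = A * Bᴴ := by
    have := h.selfAdjoint
    rw [Matrix.IsHermitian, Matrix.conjTranspose_mul, Matrix.conjTranspose_conjTranspose] at this
    exact this
  have e1 : M * Mᴴ = A * Aᴴ + B * Bᴴ := by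
    simp only [hM, Matrix.conjTranspose_add, Matrix.conjTranspose_smul, add_mul, mul_add,
      Matrix.smul_mul, Matrix.mul_smul, smul_smul, hAB, Complex.star_def, Complex.conj_I]
    simp only [neg_mul, Complex.I_mul_I, neg_neg, one_smul, neg_smul]
    abel
  have e2 : N * Nᴴ = A * Aᴴ + B * Bᴴ := by
    simp only [hN, Matrix.conjTranspose_sub, Matrix.conjTranspose_smul, sub_mul, mul_sub,
      Matrix.smul_mul, Matrix.mul_smul, smul_smul, hAB, Complex.star_def, Complex.conj_I]
    simp only [neg_mul, Complex.I_mul_I, neg_neg, one_smul, neg_smul]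
    abel
  have hrank : (A * Aᴴ + B * Bᴴ).rank = Fintype.card ι := by
    have := h.fullRank
    rw [← Matrix.rank_self_mul_conjTranspose] at this
    rw [← this, Matrix.conjTranspose_fromCols_eq_fromRows_conjTranspose,
      Matrix.fromCols_mul_fromRows]
  have uM : IsUnit M := isUnit_of_rank_mul_conjTranspose (by rw [e1, hrank])
  have uN : IsUnit N := isUnit_of_rank_mul_conjTranspose (by rw [e2, hrank])
  have s1 : vertexSigma A B = -(M⁻¹ * N) := by
    simp [vertexSigma, vertexScattering, hM, hN]
  have s2 : vertexSigma A B = -(N⁻¹ * M) := by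
    rw [vertexSigma, h.const 1 (-1) one_ne_zero (by norm_num)]
    simp [vertexScattering, hM, hN, sub_eq_add_neg]
  have dM : IsUnit M.det := (Matrix.isUnit_iff_isUnit_det M).1 uM
  have dN : IsUnit N.det := (Matrix.isUnit_iff_isUnit_det N).1 uN
  have m1 : M * vertexSigma A B = -N := by
    rw [s1, mul_neg, Matrix.mul_nonsing_inv_cancel_left M N dM]
  have m2 : N * vertexSigma A B = -M := by
    rw [s2, mul_neg, Matrix.mul_nonsing_inv_cancel_left N M dN]
  -- `σ` is the same for `k = 1` and `k = -1`, so it agrees with its inverse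
  have sq : vertexSigma A B * vertexSigma A B = 1 := by
    apply uM.mul_left_cancel
    rw [← mul_assoc, m1, neg_mul, m2, neg_neg, mul_one]
  have cA : A = (1 / 2 : ℂ) • (M + N) := by
    rw [hM, hN, add_add_sub_cancel, ← two_smul ℂ A, smul_smul]; norm_num
  have cB : B = (-Complex.I / 2) • (M - N) := by
    rw [hM, hN, add_sub_sub_cancel, ← two_smul ℂ (Complex.I • B), smul_smul, smul_smul]
    rw [show -Complex.I / 2 * 2 * Complex.I = -(Complex.I * Complex.I) by ring]
    simp
  refine ⟨?_, ?_, sq, ?_, uM⟩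
  · calc A * vertexSigma A B = ((1 / 2 : ℂ) • (M + N)) * vertexSigma A B := by rw [← cA]
      _ = -((1 / 2 : ℂ) • (M + N)) := by
        rw [Matrix.smul_mul, add_mul, m1, m2, ← smul_neg]
        congr 1; abel
      _ = -A := by rw [← cA]
  · calc B * vertexSigma A B = ((-Complex.I / 2) • (M - N)) * vertexSigma A B := by rw [← cB]
      _ = (-Complex.I / 2) • (M - N) := by
        rw [Matrix.smul_mul, sub_mul, m1, m2]
        congr 1; abel
      _ = B := cB.symm
  · -- `M Mᴴ = N Nᴴ` makes `σ` unitary, and a unitary involution is Hermitian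
    have key : vertexSigma A B * (vertexSigma A B)ᴴ = 1 := by
      have uMs : IsUnit Mᴴ := by
        rw [Matrix.isUnit_iff_isUnit_det, Matrix.det_conjTranspose]; exact dM.star
      apply uM.mul_left_cancel
      apply uMs.mul_right_cancel
      calc M * (vertexSigma A B * (vertexSigma A B)ᴴ) * Mᴴ
          = (M * vertexSigma A B) * (M * vertexSigma A B)ᴴ := by
            rw [Matrix.conjTranspose_mul]; simp only [mul_assoc]
        _ = M * 1 * Mᴴ := by
            rw [m1, Matrix.conjTranspose_neg, neg_mul_neg, e2, mul_one, e1]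
    calc (vertexSigma A B)ᴴ = (vertexSigma A B * vertexSigma A B) * (vertexSigma A B)ᴴ := by
          rw [sq, one_mul]
      _ = vertexSigma A B := by rw [mul_assoc, key, mul_one]

/-- A non-Robin condition says that `f` lies in the `1`-eigenspace and `f'` in the
`-1`-eigenspace of `σ`. -/
theorem IsNonRobin.condition_iff {A B : Matrix ι ι ℂ} (h : IsNonRobin A B) (f f' : ι → ℂ) :
    A *ᵥ f + B *ᵥ f' = 0 ↔ vertexSigma A B *ᵥ f = f ∧ vertexSigma A B *ᵥ f' = -f' := by
  obtain ⟨hA, hB, sq, -, hu⟩ := h.sigma_spec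
  set σ := vertexSigma A B
  have hAm : ∀ u, A *ᵥ (σ *ᵥ u) = -(A *ᵥ u) := fun u => by
    rw [Matrix.mulVec_mulVec, hA, Matrix.neg_mulVec]
  have hBm : ∀ u, B *ᵥ (σ *ᵥ u) = B *ᵥ u := fun u => by rw [Matrix.mulVec_mulVec, hB]
  have hσ : ∀ u, σ *ᵥ (σ *ᵥ u) = u := fun u => by
    rw [Matrix.mulVec_mulVec, sq, Matrix.one_mulVec]
  constructor
  · intro h0
    -- the components `p` of `f` and `q` of `f'` that have to vanish
    set p := f - σ *ᵥ f with hp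
    set q := f' + σ *ᵥ f' with hq
    have hσp : σ *ᵥ p = -p := by rw [hp, Matrix.mulVec_sub, hσ]; abel
    have hσq : σ *ᵥ q = q := by rw [hq, Matrix.mulVec_add, hσ]; abel
    have hBp : B *ᵥ p = 0 := by rw [hp, Matrix.mulVec_sub, hBm, sub_self]
    have hAq : A *ᵥ q = 0 := by rw [hq, Matrix.mulVec_add, hAm, add_neg_cancel]
    have hAp : A *ᵥ p + B *ᵥ q = 0 := by
      rw [hp, hq, Matrix.mulVec_sub, Matrix.mulVec_add, hAm, hBm]
      calc A *ᵥ f - -(A *ᵥ f) + (B *ᵥ f' + B *ᵥ f')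
          = (A *ᵥ f + B *ᵥ f') + (A *ᵥ f + B *ᵥ f') := by abel
        _ = 0 := by rw [h0, add_zero]
    have hz : (A + Complex.I • B) *ᵥ (p - Complex.I • q) = 0 := by
      rw [Matrix.add_mulVec, Matrix.mulVec_sub _ p, Matrix.mulVec_sub _ p, Matrix.mulVec_smul,
        Matrix.mulVec_smul, Matrix.smul_mulVec, Matrix.smul_mulVec, hBp, hAq, smul_smul,
        Complex.I_mul_I]
      simpa using hAp
    have hpq : p = Complex.I • q := by
      have := (Matrix.mulVec_injective_iff_isUnit.2 hu) (hz.trans (Matrix.mulVec_zero _).symm)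
      exact sub_eq_zero.1 this
    have hp0 : p = 0 := by
      have : σ *ᵥ p = p := by rw [hpq, Matrix.mulVec_smul, hσq]
      have h2 : p = -p := this.symm.trans hσp
      exact self_eq_neg.1 h2
    have hq0 : q = 0 := by
      have : Complex.I • q = 0 := by rw [← hpq, hp0]
      simpa using this
    exact ⟨(sub_eq_zero.1 hp0).symm, eq_neg_of_add_eq_zero_right hq0⟩
  · rintro ⟨h1, h2⟩
    have a0 : A *ᵥ f = 0 := by
      have := hAm f
      rw [h1] at this
      exact self_eq_neg.1 this
    have b0 : B *ᵥ f' = 0 := by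
      have := hBm f'
      rw [h2, Matrix.mulVec_neg] at this
      exact neg_eq_self.1 this
    rw [a0, b0, add_zero]

open scoped ComplexOrder in
theorem isNonRobin_neumann : IsNonRobin (0 : Matrix ι ι ℂ) 1 ∧
    vertexSigma (0 : Matrix ι ι ℂ) 1 = 1 := by
  have key : ∀ k : ℝ, k ≠ 0 → vertexScattering (0 : Matrix ι ι ℂ) 1 k = 1 := fun k hk => by
    have hu : IsUnit ((Complex.I * (k : ℂ)) • (1 : Matrix ι ι ℂ)).det := by
      simp [hk]
    rw [vertexScattering, zero_add, zero_sub, mul_neg, neg_neg, Matrix.nonsing_inv_mul _ hu]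
  refine ⟨⟨by simp [Matrix.IsHermitian], ?_, fun k k' hk hk' => by rw [key k hk, key k' hk']⟩,
    key 1 one_ne_zero⟩
  rw [← Matrix.rank_self_mul_conjTranspose,
    Matrix.conjTranspose_fromCols_eq_fromRows_conjTranspose, Matrix.fromCols_mul_fromRows]
  simp

open scoped ComplexOrder in
theorem isNonRobin_dirichlet : IsNonRobin (1 : Matrix ι ι ℂ) 0 ∧
    vertexSigma (1 : Matrix ι ι ℂ) 0 = -1 := by
  have key : ∀ k : ℝ, vertexScattering (1 : Matrix ι ι ℂ) 0 k = -1 := fun k => by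
    simp [vertexScattering]
  refine ⟨⟨by simp [Matrix.IsHermitian], ?_, fun k k' _ _ => by rw [key k, key k']⟩, key 1⟩
  rw [← Matrix.rank_self_mul_conjTranspose,
    Matrix.conjTranspose_fromCols_eq_fromRows_conjTranspose, Matrix.fromCols_mul_fromRows]
  simp

end VertexAlgebra

namespace MetricGraph

variable {V E : Type*}

/-- The matrices `σ_v` of all vertices as one matrix indexed by the edge ends. -/
noncomputable def scatter [Fintype E] [DecidableEq V] [DecidableEq E] (Γ : MetricGraph V E)
    (A B : ∀ v, Matrix (Γ.Star v) (Γ.Star v) ℂ) (h h' : E × Bool) : ℂ :=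
  if e : Γ.vert h' = Γ.vert h then
    vertexSigma (A (Γ.vert h)) (B (Γ.vert h)) ⟨h, rfl⟩ ⟨h', e⟩ else 0

/-- What the construction uses of a scattering matrix on the edge ends: it couples only ends at
the same vertex, and it is an involution. -/
structure IsScattering [Fintype E] [DecidableEq E] (Γ : MetricGraph V E)
    (S : E × Bool → E × Bool → ℂ) : Prop where
  vert_eq : ∀ h h', S h h' ≠ 0 → Γ.vert h' = Γ.vert h
  sq : ∀ h h'', ∑ h', S h h' * S h' h'' = if h = h'' then 1 else 0

section

variable [Fintype E] [DecidableEq V] [DecidableEq E] (Γ : MetricGraph V E)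
    (A B : ∀ v, Matrix (Γ.Star v) (Γ.Star v) ℂ)

theorem scatter_apply (v : V) (α β : Γ.Star v) :
    Γ.scatter A B α β = vertexSigma (A v) (B v) α β := by
  obtain ⟨h, rfl⟩ := α
  simp [scatter, β.2]

theorem sum_scatter_mul (u : E × Bool → ℂ) (v : V) (α : Γ.Star v) :
    ∑ h', Γ.scatter A B α h' * u h' = (vertexSigma (A v) (B v) *ᵥ fun β => u β) α := by
  rw [Matrix.mulVec, dotProduct,
    ← Finset.sum_filter_of_ne (p := fun h' => Γ.vert h' = v)]
  · rw [Finset.sum_subtype (p := fun h' => Γ.vert h' = v) _ (by simp)]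
    exact Finset.sum_congr rfl fun β _ => by rw [scatter_apply]
  · intro h' _ hne
    by_contra hv
    apply hne
    rw [scatter, dif_neg, zero_mul]
    rw [α.2]; exact hv

variable {A B}

theorem isScattering_scatter (hAB : ∀ v, IsNonRobin (A v) (B v)) :
    Γ.IsScattering (Γ.scatter A B) where
  vert_eq h h' hne := by
    by_contra hv
    exact hne (by rw [scatter, dif_neg hv])
  sq h h'' := by
    rw [sum_scatter_mul Γ A B (fun h' => Γ.scatter A B h' h'') _ ⟨h, rfl⟩]
    by_cases hv : Γ.vert h'' = Γ.vert h
    · have := (hAB (Γ.vert h)).sigma_spec.2.2.1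
      have h2 := congrFun (congrFun this ⟨h, rfl⟩) ⟨h'', hv⟩
      rw [Matrix.mul_apply] at h2
      rw [Matrix.mulVec, dotProduct]
      rw [Matrix.one_apply] at h2
      simp only [Subtype.mk.injEq] at h2
      rw [← h2]
      refine Finset.sum_congr rfl fun β _ => ?_
      rw [← scatter_apply Γ A B _ β ⟨h'', hv⟩]
    · rw [if_neg (fun hh => hv (by rw [hh]))]
      rw [Matrix.mulVec, dotProduct]
      refine Finset.sum_eq_zero fun β _ => ?_
      rw [scatter, dif_neg, mul_zero]
      rw [β.2]; exact hv

theorem scatter_conj (hAB : ∀ v, IsNonRobin (A v) (B v)) (h h' : E × Bool) :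
    (starRingEnd ℂ) (Γ.scatter A B h h') = Γ.scatter A B h' h := by
  by_cases hv : Γ.vert h' = Γ.vert h
  · have := (hAB (Γ.vert h)).sigma_spec.2.2.2.1
    have h2 := congrFun (congrFun this ⟨h', hv⟩) ⟨h, rfl⟩
    rw [Matrix.conjTranspose_apply] at h2
    rw [← scatter_apply Γ A B, ← scatter_apply Γ A B] at h2
    exact h2
  · rw [scatter, dif_neg hv, scatter, dif_neg (fun e => hv e.symm), map_zero]

/-- The vertex conditions at all vertices, in terms of the scattering matrix. -/
theorem vertex_cond_iff (hAB : ∀ v, IsNonRobin (A v) (B v)) (u u' : E × Bool → ℂ) :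
    (∀ v, A v *ᵥ (fun h : Γ.Star v => u h) + B v *ᵥ (fun h : Γ.Star v => u' h) = 0) ↔
      (∀ h, ∑ h', Γ.scatter A B h h' * u h' = u h) ∧
      ∀ h, ∑ h', Γ.scatter A B h h' * u' h' = -u' h := by
  have hs := fun w => sum_scatter_mul Γ A B w
  constructor
  · intro H
    refine ⟨fun h => ?_, fun h => ?_⟩
    · rw [hs u _ ⟨h, rfl⟩, (((hAB _).condition_iff _ _).1 (H (Γ.vert h))).1]
    · rw [hs u' _ ⟨h, rfl⟩, (((hAB _).condition_iff _ _).1 (H (Γ.vert h))).2]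
      rfl
  · rintro ⟨h1, h2⟩ v
    rw [(hAB v).condition_iff]
    refine ⟨funext fun α => ?_, funext fun α => ?_⟩
    · rw [← hs u v α, h1]
    · rw [← hs u' v α, h2]; rfl

end

end MetricGraph

/-! ### Calculus with parameter integrals -/

section ParameterIntegrals

variable {F : Type*} [NormedAddCommGroup F] [NormedSpace ℝ F]

/-- Differentiation under an integral over a compact interval. -/
theorem hasDerivAt_intervalIntegral_of_continuousOn {a b t₀ : ℝ} (hab : a ≤ b) {u : Set ℝ}
    (hu : u ∈ 𝓝 t₀) {f f' : ℝ → ℝ → F}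
    (hf : ∀ t ∈ u, ContinuousOn (f t) (Icc a b))
    (hf' : ContinuousOn (fun p : ℝ × ℝ => f' p.1 p.2) (u ×ˢ Icc a b))
    (hd : ∀ t ∈ u, ∀ y ∈ Icc a b, HasDerivAt (fun s => f s y) (f' t y) t) :
    HasDerivAt (fun t => ∫ y in a..b, f t y) (∫ y in a..b, f' t₀ y) t₀ := by
  obtain ⟨ε, hε, hball⟩ := Metric.nhds_basis_closedBall.mem_iff.1 hu
  have hcpt : IsCompact (Metric.closedBall t₀ ε ×ˢ Icc a b) :=
    (isCompact_closedBall _ _).prod isCompact_Icc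
  obtain ⟨C, hC⟩ := hcpt.exists_bound_of_continuousOn
    (hf'.mono (prod_mono hball subset_rfl))
  have hI : uIoc a b ⊆ Icc a b := by rw [uIoc_of_le hab]; exact Ioc_subset_Icc_self
  have ht₀ : t₀ ∈ u := mem_of_mem_nhds hu
  have hf't : ContinuousOn (f' t₀) (Icc a b) :=
    hf'.comp (continuousOn_const.prodMk continuousOn_id) fun y hy => ⟨ht₀, hy⟩
  refine (intervalIntegral.hasDerivAt_integral_of_dominated_loc_of_deriv_le
    (bound := fun _ => C) (F' := f') (Metric.closedBall_mem_nhds t₀ hε) ?_ ?_ ?_ ?_ ?_ ?_).2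
  · filter_upwards [hu] with t ht
    exact ((hf t ht).mono hI).aestronglyMeasurable measurableSet_uIoc
  · exact ContinuousOn.intervalIntegrable (by rw [uIcc_of_le hab]; exact hf t₀ ht₀)
  · exact (hf't.mono hI).aestronglyMeasurable measurableSet_uIoc
  · exact Eventually.of_forall fun y hy t ht => hC (t, y) ⟨ht, hI hy⟩
  · exact intervalIntegrable_const
  · exact Eventually.of_forall fun y hy t ht => hd t (hball ht) y (hI hy)

/-- Differentiation of `∫₀ᵗ Φ(t - s, s) ds` for a kernel `Φ` that vanishes at `τ = 0`: the
endpoint contributes nothing. -/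
theorem hasDerivAt_integral_triangle [CompleteSpace F] {ψ : ℝ → ℝ → F}
    (hψ : Continuous fun p : ℝ × ℝ => ψ p.1 p.2) {t : ℝ} (ht : 0 < t) :
    HasDerivAt (fun t => ∫ s in (0 : ℝ)..t, ∫ u in (0 : ℝ)..(t - s), ψ u s)
      (∫ s in (0 : ℝ)..t, ψ (t - s) s) t := by
  set Φ : ℝ → ℝ → F := fun τ s => ∫ u in (0 : ℝ)..τ, ψ u s with hΦ
  have hψs : ∀ s, Continuous fun u => ψ u s := fun s =>
    hψ.comp (continuous_id.prodMk continuous_const)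
  have hΦc : Continuous fun p : ℝ × ℝ => Φ p.1 p.2 :=
    intervalIntegral.continuous_parametric_intervalIntegral_of_continuous
      (f := fun (p : ℝ × ℝ) u => ψ u p.2)
      (hψ.comp (continuous_snd.prodMk (continuous_snd.comp continuous_fst))) continuous_fst
  have hΦd : ∀ τ s, HasDerivAt (fun τ => Φ τ s) (ψ τ s) τ := fun τ s =>
    intervalIntegral.integral_hasDerivAt_right ((hψs s).intervalIntegrable _ _)
      ((hψs s).stronglyMeasurableAtFilter _ _) (hψs s).continuousAt
  have hI : ∀ t' a b, IntervalIntegrable (fun s => Φ (t' - s) s) MeasureTheory.volume a b :=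
    fun t' a b => (hΦc.comp ((continuous_const.sub continuous_id).prodMk
      continuous_id)).intervalIntegrable _ _
  have hA : HasDerivAt (fun t' => ∫ s in (0 : ℝ)..t, Φ (t' - s) s)
      (∫ s in (0 : ℝ)..t, ψ (t - s) s) t := by
    refine hasDerivAt_intervalIntegral_of_continuousOn ht.le (u := univ) univ_mem
      (f := fun t' s => Φ (t' - s) s) (f' := fun t' s => ψ (t' - s) s) ?_ ?_ ?_
    · intro t' _
      exact (hΦc.comp ((continuous_const.sub continuous_id).prodMk continuous_id)).continuousOn
    · exact (hψ.comp ((continuous_fst.sub continuous_snd).prodMk continuous_snd)).continuousOn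
    · intro t' _ s _
      exact (hΦd (t' - s) s).comp_sub_const t' s
  have hB : HasDerivAt (fun t' => ∫ s in t..t', Φ (t' - s) s) (0 : F) t := by
    -- `Φ(τ, s) = O(τ)`, so the integral over `[t, t']` is `O((t' - t)²)`
    obtain ⟨C, hC⟩ := ((isCompact_Icc (a := (-1 : ℝ)) (b := 1)).prod
      (isCompact_Icc (a := t - 1) (b := t + 1))).exists_bound_of_continuousOn hψ.continuousOn
    have hC0 : 0 ≤ C := (norm_nonneg _).trans (hC (0, t) ⟨by simp, by simp⟩)
    have hbound : ∀ τ s, |τ| ≤ 1 → |s - t| ≤ 1 → ‖Φ τ s‖ ≤ C * |τ| := by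
      intro τ s hτ hs
      have := intervalIntegral.norm_integral_le_of_norm_le_const (a := 0) (b := τ)
        (f := fun u => ψ u s) (C := C) (fun u hu => ?_)
      · simpa using this
      · refine hC (u, s) ⟨?_, ?_⟩
        · have h1 : |u| ≤ |τ| := by
            rcases le_total 0 τ with h | h
            · rw [uIoc_of_le h] at hu
              rw [abs_of_pos hu.1, abs_of_nonneg h]; exact hu.2
            · rw [uIoc_of_ge h] at hu
              rw [abs_of_nonpos hu.2, abs_of_nonpos h]; linarith [hu.1]
          exact abs_le.1 (h1.trans hτ)
        · have := abs_le.1 hs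
          constructor <;> linarith [this.1, this.2]
    have hO : (fun t' => ∫ s in t..t', Φ (t' - s) s) =O[𝓝 t] fun t' => (t' - t) ^ 2 := by
      refine IsBigO.of_bound C ?_
      filter_upwards [Metric.closedBall_mem_nhds t one_pos] with t' ht'
      rw [Metric.mem_closedBall, Real.dist_eq] at ht'
      have := intervalIntegral.norm_integral_le_of_norm_le_const (a := t) (b := t')
        (f := fun s => Φ (t' - s) s) (C := C * |t' - t|) (fun s hs => ?_)
      · rw [norm_pow, Real.norm_eq_abs, sq, ← mul_assoc]; exact this
      · have h12 : |t' - s| ≤ |t' - t| ∧ |s - t| ≤ |t' - t| := by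
          rcases le_total t t' with h | h
          · rw [uIoc_of_le h] at hs
            rw [abs_of_nonneg (sub_nonneg.2 hs.2), abs_of_nonneg (sub_nonneg.2 h),
              abs_of_nonneg (sub_nonneg.2 hs.1.le)]
            constructor <;> linarith [hs.1, hs.2]
          · rw [uIoc_of_ge h] at hs
            rw [abs_of_nonpos (sub_nonpos.2 hs.1.le), abs_of_nonpos (sub_nonpos.2 h),
              abs_of_nonpos (sub_nonpos.2 hs.2)]
            constructor <;> linarith [hs.1, hs.2]
        exact (hbound _ _ (h12.1.trans ht') (h12.2.trans ht')).trans
          (mul_le_mul_of_nonneg_left h12.1 hC0)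
    have ho : (fun t' : ℝ => (t' - t) ^ 2) =o[𝓝 t] fun t' => t' - t := by
      have := (isLittleO_pow_id (𝕜 := ℝ) (n := 2) (by norm_num)).comp_tendsto
        (k := fun t' : ℝ => t' - t) (l' := 𝓝 t) (by
          have : Tendsto (fun t' : ℝ => t' - t) (𝓝 t) (𝓝 (t - t)) :=
            (continuous_id.sub continuous_const).tendsto t
          simpa using this)
      exact this
    rw [hasDerivAt_iff_isLittleO]
    simpa using hO.trans_isLittleO ho
  have := hA.add hB
  rw [add_zero] at this
  refine this.congr_of_eventuallyEq (Eventually.of_forall fun t' => ?_)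
  exact (intervalIntegral.integral_add_adjacent_intervals (hI t' 0 t) (hI t' t t')).symm

end ParameterIntegrals

/-! ### A linear Volterra equation -/

section Volterra

variable {X : Type*} [NormedAddCommGroup X] [NormedSpace ℂ X]
  {Z : Type*}

/-- The iterates of the Volterra operator with kernel `K` on `[0, ∞)`. Negative times are replaced
by `0`, so that all functions are continuous on the whole line. -/
noncomputable def volterraIterate (K : ℝ → X →L[ℂ] X) (F : ℝ × Z → X) : ℕ → ℝ × Z → X
  | 0 => fun p => F (max p.1 0, p.2)
  | n + 1 => fun p =>
      ∫ s in (0 : ℝ)..max p.1 0, K (max p.1 0 - s) (volterraIterate K F n (s, p.2))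

theorem continuous_volterraIterate [TopologicalSpace Z] {K : ℝ → X →L[ℂ] X}
    (hK : Continuous fun p : ℝ × X => K p.1 p.2) {F : ℝ × Z → X} (hF : Continuous F) (n : ℕ) :
    Continuous (volterraIterate K F n) := by
  induction n with
  | zero => exact hF.comp ((continuous_fst.max continuous_const).prodMk continuous_snd)
  | succ n ih =>
    refine intervalIntegral.continuous_parametric_intervalIntegral_of_continuous
      (f := fun (p : ℝ × Z) s => K (max p.1 0 - s) (volterraIterate K F n (s, p.2))) ?_
      (continuous_fst.max continuous_const)
    exact hK.comp ((((continuous_fst.comp continuous_fst).max continuous_const).sub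
      continuous_snd).prodMk (ih.comp (continuous_snd.prodMk
        (continuous_snd.comp continuous_fst))))

theorem norm_volterraIterate_le {K : ℝ → X →L[ℂ] X} {M : ℝ} (hM : ∀ τ, ‖K τ‖ ≤ M)
    {F : ℝ × Z → X} {T B : ℝ} (hT : 0 ≤ T) {z : Z}
    (hB : ∀ s ∈ Icc 0 T, ‖F (s, z)‖ ≤ B) (n : ℕ) {t : ℝ} (ht : t ≤ T) :
    ‖volterraIterate K F n (t, z)‖ ≤ B * (M * max t 0) ^ n / n.factorial := by
  have hM0 : 0 ≤ M := (norm_nonneg _).trans (hM 0)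
  induction n generalizing t with
  | zero => simpa [volterraIterate] using hB (max t 0) ⟨le_max_right _ _, max_le ht hT⟩
  | succ n ih =>
    rw [volterraIterate]
    set τ := max t 0 with hτ
    have h0 : 0 ≤ τ := le_max_right _ _
    have hτT : τ ≤ T := max_le ht hT
    refine (intervalIntegral.norm_integral_le_of_norm_le h0
      (g := fun s => M * (B * M ^ n / n.factorial) * s ^ n) (Eventually.of_forall fun s hs => ?_)
      (Continuous.intervalIntegrable (by fun_prop) _ _)).trans (le_of_eq ?_)
    · have h1 := ih (hs.2.trans hτT)
      rw [max_eq_left hs.1.le] at h1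
      refine ((K _).le_opNorm _).trans ((mul_le_mul (hM _) h1 (norm_nonneg _) hM0).trans
        (le_of_eq ?_))
      rw [mul_pow]; ring
    · rw [intervalIntegral.integral_const_mul, integral_pow, Nat.factorial_succ]
      push_cast
      have : (n.factorial : ℝ) ≠ 0 := by positivity
      have h2 : (n : ℝ) + 1 ≠ 0 := by positivity
      field_simp
      simp
      ring

/-- A linear Volterra equation with a bounded, strongly continuous kernel has a solution that is
continuous also in a parameter, with an exponential bound. -/
theorem exists_volterra_solution [CompleteSpace X] [TopologicalSpace Z] [CompactSpace Z]
    {K : ℝ → X →L[ℂ] X} {M : ℝ} (hM : ∀ τ, ‖K τ‖ ≤ M)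
    (hK : Continuous fun p : ℝ × X => K p.1 p.2) {F : ℝ × Z → X} (hF : Continuous F) :
    ∃ f : ℝ × Z → X, Continuous f ∧
      (∀ t z, 0 ≤ t → f (t, z) = F (t, z) + ∫ s in (0 : ℝ)..t, K (t - s) (f (s, z))) ∧
      ∀ T B z, 0 ≤ T → (∀ s ∈ Icc 0 T, ‖F (s, z)‖ ≤ B) →
        ∀ t ∈ Icc 0 T, ‖f (t, z)‖ ≤ B * Real.exp (M * T) := by
  have hM0 : 0 ≤ M := (norm_nonneg _).trans (hM 0)
  set a : ℕ → ℝ × Z → X := volterraIterate K F with ha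
  have hac : ∀ n, Continuous (a n) := continuous_volterraIterate hK hF
  have hbd : ∀ T, 0 ≤ T → ∃ B, 0 ≤ B ∧ ∀ s ∈ Icc 0 T, ∀ z, ‖F (s, z)‖ ≤ B := by
    intro T hT
    obtain ⟨B, hB⟩ := ((isCompact_Icc (a := (0 : ℝ)) (b := T)).prod
      (isCompact_univ (X := Z))).exists_bound_of_continuousOn hF.continuousOn
    exact ⟨max B 0, le_max_right _ _, fun s hs z =>
      (hB (s, z) ⟨hs, mem_univ _⟩).trans (le_max_left _ _)⟩
  have hterm : ∀ T B, 0 ≤ T → 0 ≤ B → ∀ z, (∀ s ∈ Icc 0 T, ‖F (s, z)‖ ≤ B) → ∀ n t, t ≤ T →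
      ‖a n (t, z)‖ ≤ B * ((M * T) ^ n / n.factorial) := by
    intro T B hT hB0 z hB n t ht
    refine (norm_volterraIterate_le hM hT hB n ht).trans ?_
    rw [mul_div_assoc]
    have h1 : max t 0 ≤ T := max_le ht hT
    have h2 : 0 ≤ max t 0 := le_max_right _ _
    gcongr
  have hsum : ∀ x B : ℝ, Summable fun n : ℕ => B * (x ^ n / n.factorial) := fun x B =>
    (Real.summable_pow_div_factorial x).mul_left B
  have hs : ∀ p, Summable fun n => a n p := by
    rintro ⟨t, z⟩
    obtain ⟨B, hB0, hB⟩ := hbd (max t 0) (le_max_right _ _)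
    exact Summable.of_norm_bounded (hsum (M * max t 0) B) fun n =>
      hterm _ B (le_max_right _ _) hB0 z (fun s hs => hB s hs z) n t (le_max_left _ _)
  refine ⟨fun p => ∑' n, a n p, ?_, ?_, ?_⟩
  · rw [continuous_iff_continuousAt]
    rintro ⟨t, z⟩
    set T := max t 0 + 1 with hTdef
    have hT : 0 ≤ T := by positivity
    obtain ⟨B, hB0, hB⟩ := hbd T hT
    have : ContinuousOn (fun p => ∑' n, a n p) (Iio T ×ˢ univ) :=
      continuousOn_tsum (fun n => (hac n).continuousOn) (hsum (M * T) B)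
        fun n p hp => hterm T B hT hB0 p.2 (fun s hs => hB s hs p.2) n p.1 (le_of_lt hp.1)
    refine this.continuousAt ((isOpen_Iio.prod isOpen_univ).mem_nhds ⟨?_, mem_univ _⟩)
    exact (le_max_left t 0).trans_lt (by rw [hTdef]; linarith)
  · intro t z ht
    obtain ⟨B, hB0, hB⟩ := hbd t ht
    have hsucc : ∀ n, a (n + 1) (t, z) = ∫ s in (0 : ℝ)..t, K (t - s) (a n (s, z)) := by
      intro n
      show (∫ s in (0 : ℝ)..max t 0, K (max t 0 - s) (a n (s, z))) = _
      rw [max_eq_left ht]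
    have hint : HasSum (fun n => ∫ s in (0 : ℝ)..t, K (t - s) (a n (s, z)))
        (∫ s in (0 : ℝ)..t, K (t - s) (∑' n, a n (s, z))) := by
      refine intervalIntegral.hasSum_integral_of_dominated_convergence
        (fun n _ => M * (B * ((M * t) ^ n / n.factorial))) ?_ ?_ ?_ ?_ ?_
      · intro n
        exact Continuous.aestronglyMeasurable (hK.comp ((continuous_const.sub
          continuous_id).prodMk ((hac n).comp (continuous_id.prodMk continuous_const))))
      · refine fun n => Eventually.of_forall fun s hs' => ?_
        rw [uIoc_of_le ht] at hs'
        exact ((K _).le_opNorm _).trans (mul_le_mul (hM _)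
          (hterm t B ht hB0 z (fun s hs => hB s hs z) n s hs'.2) (norm_nonneg _) hM0)
      · exact Eventually.of_forall fun s _ => (hsum _ _).mul_left _
      · exact intervalIntegrable_const
      · exact Eventually.of_forall fun s _ => (hs (s, z)).hasSum.mapL (K (t - s))
    show (∑' n, a n (t, z)) = _
    rw [(hs (t, z)).tsum_eq_zero_add]
    congr 1
    · show F (max t 0, z) = _
      rw [max_eq_left ht]
    · rw [← hint.tsum_eq]
      exact tsum_congr hsucc
  · intro T B z hT hB t ht
    have hB0 : 0 ≤ B := (norm_nonneg _).trans (hB 0 ⟨le_rfl, hT⟩)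
    have h1 : HasSum (fun n : ℕ => B * ((M * T) ^ n / n.factorial)) (B * Real.exp (M * T)) := by
      rw [Real.exp_eq_exp_ℝ]
      exact (NormedSpace.expSeries_div_hasSum_exp (M * T)).mul_left B
    exact tsum_of_norm_bounded h1 fun n => hterm T B hT hB0 z hB n t ht.2

end Volterra

/-! ### Uniqueness of the heat kernel -/

/-- The derivatives of a `C²` function on a closed interval. -/
theorem ContDiffOn.hasDerivWithinAt_iteratedDerivWithin {F : Type*} [NormedAddCommGroup F]
    [NormedSpace ℝ F] {g : ℝ → F} {L : ℝ} (hL : 0 < L) {n : ℕ∞} (hg : ContDiffOn ℝ n g (Icc 0 L))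
    {j : ℕ} (hj : (j : ℕ∞) < n) {y : ℝ} (hy : y ∈ Icc 0 L) :
    HasDerivWithinAt (iteratedDerivWithin j g (Icc 0 L))
      (iteratedDerivWithin (j + 1) g (Icc 0 L) y) (Icc 0 L) y := by
  rw [iteratedDerivWithin_succ]
  exact ((hg.differentiableOn_iteratedDerivWithin (by exact_mod_cast hj)
    (uniqueDiffOn_Icc hL)) y hy).hasDerivWithinAt

namespace MetricGraph

variable {V E : Type*}

/-- The integral over the graph of a product of two functions. -/
noncomputable def pairingFun [Fintype E] (Γ : MetricGraph V E)
    (c g : ∀ f, C(Icc (0 : ℝ) (Γ.len f), ℂ)) : ℂ :=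
  ∑ f, ∫ y in (0 : ℝ)..Γ.len f,
    IccExtend (Γ.len_pos f).le (c f) y * IccExtend (Γ.len_pos f).le (g f) y

theorem isLinearMap_pairingFun [Fintype E] (Γ : MetricGraph V E)
    (c : ∀ f, C(Icc (0 : ℝ) (Γ.len f), ℂ)) : IsLinearMap ℂ (Γ.pairingFun c) where
  map_add g g' := by
    simp only [pairingFun]
    rw [← Finset.sum_add_distrib]
    refine Finset.sum_congr rfl fun f _ => ?_
    rw [← intervalIntegral.integral_add]
    · refine intervalIntegral.integral_congr fun y _ => ?_
      simp [IccExtend, mul_add]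
    all_goals
      refine Continuous.intervalIntegrable ?_ _ _
      exact ((c f).continuous.Icc_extend'.mul (ContinuousMap.continuous _).Icc_extend')
  map_smul a g := by
    simp only [pairingFun]
    rw [Finset.smul_sum]
    refine Finset.sum_congr rfl fun f _ => ?_
    rw [← intervalIntegral.integral_smul]
    refine intervalIntegral.integral_congr fun y _ => ?_
    simp only [IccExtend, Function.comp_apply, Pi.smul_apply, ContinuousMap.smul_apply,
      smul_eq_mul]
    ring

/-- Pairing of two functions on the graph as a continuous functional of the second one. -/
noncomputable def pairing [Fintype E] (Γ : MetricGraph V E)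
    (c : ∀ f, C(Icc (0 : ℝ) (Γ.len f), ℂ)) : (∀ f, C(Icc (0 : ℝ) (Γ.len f), ℂ)) →L[ℂ] ℂ :=
  LinearMap.mkContinuous ((Γ.isLinearMap_pairingFun c).mk' _) (∑ f, ‖c f‖ * Γ.len f) (fun g => by
      rw [Finset.sum_mul]
      refine (norm_sum_le _ _).trans (Finset.sum_le_sum fun f _ => ?_)
      have := intervalIntegral.norm_integral_le_of_norm_le_const (a := 0) (b := Γ.len f)
        (f := fun y => IccExtend (Γ.len_pos f).le (c f) y * IccExtend (Γ.len_pos f).le (g f) y)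
        (C := ‖c f‖ * ‖g‖) (fun y _ => by
          rw [norm_mul]
          exact mul_le_mul ((c f).norm_coe_le_norm _)
            (((g f).norm_coe_le_norm _).trans (norm_le_pi_norm g f)) (norm_nonneg _)
            (norm_nonneg _))
      refine this.trans (le_of_eq ?_)
      rw [sub_zero, abs_of_pos (Γ.len_pos f)]
      ring)

theorem pairing_apply [Fintype E] (Γ : MetricGraph V E) (c g : ∀ f, C(Icc (0 : ℝ) (Γ.len f), ℂ))
    (u v : E → ℝ → ℂ) (hu : ∀ f, ∀ y : Icc (0 : ℝ) (Γ.len f), c f y = u f y)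
    (hv : ∀ f, ∀ y : Icc (0 : ℝ) (Γ.len f), g f y = v f y) :
    Γ.pairing c g = ∑ f, ∫ y in (0 : ℝ)..Γ.len f, u f y * v f y := by
  refine Finset.sum_congr rfl fun f _ => intervalIntegral.integral_congr fun y hy => ?_
  rw [uIcc_of_le (Γ.len_pos f).le] at hy
  rw [IccExtend_of_mem _ _ hy, IccExtend_of_mem _ _ hy, hu, hv]

variable [Fintype E] [DecidableEq V] {Γ : MetricGraph V E} {U : E → ℝ → ℝ}
  {A B : ∀ v, Matrix (Γ.Star v) (Γ.Star v) ℂ} {k K : ℝ → E → ℝ → E → ℝ → ℂ}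

theorem IsHeatKernel.continuousOn_right (hk : Γ.IsHeatKernel U A B k) {e : E} {x : ℝ}
    (hx : x ∈ Γ.seg e) (f : E) :
    ContinuousOn (fun p : ℝ × ℝ => k p.1 e x f p.2) (Ioi 0 ×ˢ Γ.seg f) :=
  (hk.continuousOn e f).comp (f := fun p : ℝ × ℝ => (p.1, x, p.2)) (by fun_prop)
    fun _ hp => ⟨hp.1, hx, hp.2⟩

/-- The initial condition of a heat kernel for test functions that depend on time. By the uniform
boundedness principle the functionals `∫ k(t,x,y) · dy` are bounded along every sequence
`t → 0⁺`. -/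
theorem IsHeatKernel.tendsto_of_continuousOn (hk : Γ.IsHeatKernel U A B k) {e : E} {x : ℝ}
    (hx : x ∈ Ioo 0 (Γ.len e)) {ψ : ℝ → E → ℝ → ℂ} {u : Set ℝ} (hu : u ∈ 𝓝 (0 : ℝ))
    (hψ : ∀ f, ContinuousOn (fun p : ℝ × ℝ => ψ p.1 f p.2) (u ×ˢ Γ.seg f)) :
    Tendsto (fun t => ∑ f, ∫ y in (0 : ℝ)..Γ.len f, k t e x f y * ψ t f y)
      (𝓝[>] 0) (𝓝 (ψ 0 e x)) := by
  classical
  have hxs : x ∈ Γ.seg e := Ioo_subset_Icc_self hx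
  have hψt : ∀ t ∈ u, ∀ f, ContinuousOn (ψ t f) (Γ.seg f) := fun t ht f =>
    (hψ f).comp (f := fun y => (t, y)) (by fun_prop) fun y hy => ⟨ht, hy⟩
  have hkt : ∀ t, 0 < t → ∀ f, ContinuousOn (k t e x f) (Γ.seg f) := fun t ht f =>
    (hk.continuousOn_right hxs f).comp (f := fun y => (t, y)) (by fun_prop) fun y hy => ⟨ht, hy⟩
  let c : ℝ → ∀ f, C(Icc (0 : ℝ) (Γ.len f), ℂ) := fun t f =>
    if h : 0 < t then ⟨fun y => k t e x f y, (hkt t h f).domRestrict⟩ else 0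
  let g : ℝ → ∀ f, C(Icc (0 : ℝ) (Γ.len f), ℂ) := fun t f =>
    if h : t ∈ u then ⟨fun y => ψ t f y, (hψt t h f).domRestrict⟩ else 0
  have h0u : (0 : ℝ) ∈ u := mem_of_mem_nhds hu
  have hc : ∀ t, 0 < t → ∀ f, ∀ y : Icc (0 : ℝ) (Γ.len f), c t f y = k t e x f y :=
    fun t ht f y => by simp only [c, dif_pos ht]; rfl
  have hg : ∀ t ∈ u, ∀ f, ∀ y : Icc (0 : ℝ) (Γ.len f), g t f y = ψ t f y :=
    fun t ht f y => by simp only [g, dif_pos ht]; rfl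
  have hgcont : Tendsto g (𝓝 0) (𝓝 (g 0)) := by
    rw [tendsto_pi_nhds]
    intro f
    rw [ContinuousMap.tendsto_iff_tendstoUniformly]
    have h1 : TendstoUniformly (fun t (y : Icc (0 : ℝ) (Γ.len f)) => ψ t f y)
        (fun y : Icc (0 : ℝ) (Γ.len f) => ψ 0 f y) (𝓝 0) := by
      refine ContinuousOn.tendstoUniformly hu ?_
      exact (hψ f).comp (f := fun p : ℝ × Icc (0 : ℝ) (Γ.len f) => (p.1, (p.2 : ℝ)))
        (by fun_prop) fun p hp => ⟨hp.1, p.2.2⟩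
    have e0 : (g 0 f : Icc (0 : ℝ) (Γ.len f) → ℂ) =
        fun y : Icc (0 : ℝ) (Γ.len f) => ψ 0 f y :=
      funext fun y => hg 0 h0u f y
    rw [e0]
    intro w hw
    filter_upwards [h1 w hw, hu] with t h2 ht y
    rw [hg t ht f y]
    exact h2 y
  refine tendsto_of_seq_tendsto fun s hs => ?_
  have hs0 : Tendsto s atTop (𝓝 0) := hs.mono_right nhdsWithin_le_nhds
  have hspos : ∀ᶠ n in atTop, 0 < s n := hs.eventually self_mem_nhdsWithin
  have hsu : ∀ᶠ n in atTop, s n ∈ u := hs0.eventually hu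
  -- convergence for a fixed test function
  have hfix : ∀ w : ∀ f, C(Icc (0 : ℝ) (Γ.len f), ℂ),
      Tendsto (fun n => Γ.pairing (c (s n)) w) atTop
        (𝓝 (IccExtend (Γ.len_pos e).le (w e) x)) := by
    intro w
    have := (hk.initial e x hx (fun f => IccExtend (Γ.len_pos f).le (w f))
      (fun f => (w f).continuous.Icc_extend'.continuousOn)).comp hs
    refine this.congr' ?_
    filter_upwards [hspos] with n hn
    exact (pairing_apply Γ _ _ _ _ (hc _ hn) (fun f y => by simp)).symm
  obtain ⟨C, hC⟩ := banach_steinhaus (g := fun n => Γ.pairing (c (s n))) (fun w => by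
    obtain ⟨C, hC⟩ := (Metric.isBounded_range_of_tendsto _ (hfix w)).exists_norm_le
    exact ⟨C, fun n => hC _ (mem_range_self n)⟩)
  have hdiff : Tendsto (fun n => Γ.pairing (c (s n)) (g (s n) - g 0)) atTop (𝓝 0) := by
    have hz : Tendsto (fun n => C * ‖g (s n) - g 0‖) atTop (𝓝 0) := by
      have := ((hgcont.comp hs0).sub_const (g 0)).norm.const_mul C
      simpa using this
    refine squeeze_zero_norm (fun n => ?_) hz
    exact (ContinuousLinearMap.le_opNorm _ _).trans
      (mul_le_mul_of_nonneg_right (hC n) (norm_nonneg _))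
  have hlim := (hfix (g 0)).add hdiff
  rw [add_zero, IccExtend_of_mem _ _ hxs, hg 0 h0u] at hlim
  refine hlim.congr' ?_
  filter_upwards [hspos, hsu] with n hn hn'
  rw [map_sub, add_sub_cancel]
  exact pairing_apply Γ _ _ _ _ (hc _ hn) (hg _ hn')

/-- The boundary terms in Green's formula vanish for functions that satisfy the vertex conditions:
eigenvectors of the Hermitian matrix `S` for the eigenvalues `1` and `-1` are orthogonal. -/
theorem sum_mul_conj_eq_zero {S : E × Bool → E × Bool → ℂ}
    (hS : ∀ h h', (starRingEnd ℂ) (S h h') = S h' h) {a b : E × Bool → ℂ}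
    (ha : ∀ h, ∑ h', S h h' * a h' = -a h) (hb : ∀ h, ∑ h', S h h' * b h' = b h) :
    ∑ h, a h * (starRingEnd ℂ) (b h) = 0 := by
  have : ∑ h, a h * (starRingEnd ℂ) (b h) = -∑ h, a h * (starRingEnd ℂ) (b h) := by
    calc ∑ h, a h * (starRingEnd ℂ) (b h)
        = ∑ h, ∑ h', S h' h * a h * (starRingEnd ℂ) (b h') := by
          refine Finset.sum_congr rfl fun h _ => ?_
          conv_lhs => rw [← hb h, map_sum, Finset.mul_sum]
          refine Finset.sum_congr rfl fun h' _ => ?_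
          rw [map_mul, hS]; ring
      _ = ∑ h', (∑ h, S h' h * a h) * (starRingEnd ℂ) (b h') := by
          rw [Finset.sum_comm]
          exact Finset.sum_congr rfl fun h' _ => (Finset.sum_mul _ _ _).symm
      _ = _ := by
          rw [← Finset.sum_neg_distrib]
          exact Finset.sum_congr rfl fun h' _ => by rw [ha]; ring
  exact self_eq_neg.1 this

omit [DecidableEq V] in
/-- Integration by parts on the whole graph. -/
theorem sum_integral_green (u v : E → ℝ → ℂ)
    (hu : ∀ f, ContDiffOn ℝ 2 (u f) (Γ.seg f)) (hv : ∀ f, ContDiffOn ℝ 2 (v f) (Γ.seg f)) :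
    ∑ f, ∫ y in (0 : ℝ)..Γ.len f, (Γ.edgeDeriv u 2 f y * (starRingEnd ℂ) (v f y)
        - u f y * (starRingEnd ℂ) (Γ.edgeDeriv v 2 f y))
      = -∑ h, (Γ.endDeriv u 1 h * (starRingEnd ℂ) (Γ.endDeriv v 0 h)
          - Γ.endDeriv u 0 h * (starRingEnd ℂ) (Γ.endDeriv v 1 h)) := by
  have hW : ∀ g : E → ℝ → ℂ, (∀ f, ContDiffOn ℝ 2 (g f) (Γ.seg f)) → ∀ f, ∀ y ∈ Icc 0 (Γ.len f),
      HasDerivWithinAt (g f) (Γ.edgeDeriv g 1 f y) (Icc 0 (Γ.len f)) y ∧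
      HasDerivWithinAt (Γ.edgeDeriv g 1 f) (Γ.edgeDeriv g 2 f y) (Icc 0 (Γ.len f)) y := by
    intro g hg f y hy
    have h0 := (hg f).hasDerivWithinAt_iteratedDerivWithin (Γ.len_pos f) (n := 2) (j := 0)
      (by norm_num) hy
    have h1 := (hg f).hasDerivWithinAt_iteratedDerivWithin (Γ.len_pos f) (n := 2) (j := 1)
      (by norm_num) hy
    rw [iteratedDerivWithin_zero] at h0
    exact ⟨h0, h1⟩
  have h2c : ∀ g : E → ℝ → ℂ, (∀ f, ContDiffOn ℝ 2 (g f) (Γ.seg f)) → ∀ f,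
      ContinuousOn (Γ.edgeDeriv g 2 f) (Icc 0 (Γ.len f)) := fun g hg f =>
    (hg f).continuousOn_iteratedDerivWithin le_rfl (uniqueDiffOn_Icc (Γ.len_pos f))
  rw [Fintype.sum_prod_type, ← Finset.sum_neg_distrib]
  refine Finset.sum_congr rfl fun f _ => ?_
  have hL := Γ.len_pos f
  set W : ℝ → ℂ := fun y => Γ.edgeDeriv u 1 f y * (starRingEnd ℂ) (v f y)
    - u f y * (starRingEnd ℂ) (Γ.edgeDeriv v 1 f y) with hWdef
  have hWd : ∀ y ∈ Icc 0 (Γ.len f), HasDerivWithinAt W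
      (Γ.edgeDeriv u 2 f y * (starRingEnd ℂ) (v f y)
        - u f y * (starRingEnd ℂ) (Γ.edgeDeriv v 2 f y)) (Icc 0 (Γ.len f)) y := by
    intro y hy
    have hconj : ∀ {φ : ℝ → ℂ} {φ' : ℂ}, HasDerivWithinAt φ φ' (Icc 0 (Γ.len f)) y →
        HasDerivWithinAt (fun y => (starRingEnd ℂ) (φ y)) ((starRingEnd ℂ) φ')
          (Icc 0 (Γ.len f)) y := fun h => h.star
    have := ((hW u hu f y hy).2.mul (hconj (hW v hv f y hy).1)).sub
      ((hW u hu f y hy).1.mul (hconj (hW v hv f y hy).2))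
    refine this.congr_deriv ?_
    ring
  rw [intervalIntegral.integral_eq_sub_of_hasDerivAt_of_le hL.le
    (fun y hy => (hWd y hy).continuousWithinAt)
    (fun y hy => (hWd y (Ioo_subset_Icc_self hy)).hasDerivAt (Icc_mem_nhds hy.1 hy.2))]
  · simp only [Fintype.sum_bool, endDeriv, endPos, hWdef, edgeDeriv, iteratedDerivWithin_zero]
    simp
    ring
  · refine ContinuousOn.intervalIntegrable ?_
    rw [uIcc_of_le hL.le]
    have hc : ∀ {φ : ℝ → ℂ}, ContinuousOn φ (Icc 0 (Γ.len f)) →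
        ContinuousOn (fun y => (starRingEnd ℂ) (φ y)) (Icc 0 (Γ.len f)) := fun h => h.star
    exact ((h2c u hu f).mul (hc (hv f).continuousOn)).sub
      ((hu f).continuousOn.mul (hc (h2c v hv f)))

variable [DecidableEq E]

/-- Any two heat kernels for the same vertex conditions are adjoint to each other. By Green's formula
`∫ k(s, x, y) conj K(t - s, z, y) dy` does not depend on `s ∈ (0, t)`; its limits at `s = 0` and
`s = t` are the two sides. -/
theorem IsHeatKernel.eq_conj_swap (hAB : ∀ v, IsNonRobin (A v) (B v))
    (hk : Γ.IsHeatKernel U A B k) (hK : Γ.IsHeatKernel U A B K) {t : ℝ} (ht : 0 < t) {e e' : E}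
    {x z : ℝ} (hx : x ∈ Ioo 0 (Γ.len e)) (hz : z ∈ Ioo 0 (Γ.len e')) :
    k t e x e' z = (starRingEnd ℂ) (K t e' z e x) := by
  have hxs : x ∈ Γ.seg e := Ioo_subset_Icc_self hx
  have hzs : z ∈ Γ.seg e' := Ioo_subset_Icc_self hz
  set F : ℝ → ℂ := fun s => ∑ f, ∫ y in (0 : ℝ)..Γ.len f,
    k s e x f y * (starRingEnd ℂ) (K (t - s) e' z f y) with hF
  have hcK : ∀ f, ContinuousOn (fun p : ℝ × ℝ => (starRingEnd ℂ) (K (t - p.1) e' z f p.2))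
      (Iio t ×ˢ Γ.seg f) := fun f => by
    refine ContinuousOn.star ?_
    exact (hK.continuousOn_right hzs f).comp (f := fun p : ℝ × ℝ => (t - p.1, p.2))
      (by fun_prop) fun p hp => ⟨mem_Ioi.2 (sub_pos.2 hp.1), hp.2⟩
  have hck : ∀ f, ContinuousOn (fun p : ℝ × ℝ => (starRingEnd ℂ) (k (t - p.1) e x f p.2))
      (Iio t ×ˢ Γ.seg f) := fun f => by
    refine ContinuousOn.star ?_
    exact (hk.continuousOn_right hxs f).comp (f := fun p : ℝ × ℝ => (t - p.1, p.2))
      (by fun_prop) fun p hp => ⟨mem_Ioi.2 (sub_pos.2 hp.1), hp.2⟩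
  have hl0 : Tendsto F (𝓝[>] 0) (𝓝 ((starRingEnd ℂ) (K t e' z e x))) := by
    have := hk.tendsto_of_continuousOn hx (Iio_mem_nhds ht)
      (ψ := fun s f y => (starRingEnd ℂ) (K (t - s) e' z f y)) hcK
    simpa using this
  have hl1 : Tendsto (fun s => F (t - s)) (𝓝[>] 0) (𝓝 (k t e x e' z)) := by
    have h1 := hK.tendsto_of_continuousOn hz (Iio_mem_nhds ht)
      (ψ := fun s f y => (starRingEnd ℂ) (k (t - s) e x f y)) hck
    have h2 := (Complex.continuous_conj.tendsto _).comp h1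
    simp only [sub_zero, Complex.conj_conj] at h2
    refine h2.congr fun s => ?_
    simp only [Function.comp_apply, map_sum, hF, sub_sub_cancel]
    refine Finset.sum_congr rfl fun f _ => ?_
    rw [intervalIntegral.integral_of_le (Γ.len_pos f).le,
      intervalIntegral.integral_of_le (Γ.len_pos f).le, ← integral_conj]
    refine MeasureTheory.integral_congr_ae (Eventually.of_forall fun y => ?_)
    simp [mul_comm]
  have hderiv : ∀ s ∈ Ioo 0 t, HasDerivAt F 0 s := by
    intro s hs
    have hts : 0 < t - s := sub_pos.2 hs.2
    have hsum : HasDerivAt F (∑ f, ∫ y in (0 : ℝ)..Γ.len f,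
        (Γ.edgeDeriv (k s e x) 2 f y * (starRingEnd ℂ) (K (t - s) e' z f y)
          - k s e x f y * (starRingEnd ℂ) (Γ.edgeDeriv (K (t - s) e' z) 2 f y))) s := by
      refine HasDerivAt.fun_sum fun f _ => ?_
      have hm : MapsTo (fun p : ℝ × ℝ => (t - p.1, p.2)) (Ioo 0 t ×ˢ Γ.seg f)
          (Ioi 0 ×ˢ Γ.seg f) := fun p hp => ⟨sub_pos.2 hp.1.2, hp.2⟩
      have hm' : Ioo 0 t ×ˢ Γ.seg f ⊆ Ioi 0 ×ˢ Γ.seg f := fun p hp => ⟨hp.1.1, hp.2⟩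
      have c1 := (hk.continuousOn_right hxs f).mono hm'
      have c2 := (hcK f).mono (fun p (hp : p ∈ Ioo 0 t ×ˢ Γ.seg f) => ⟨hp.1.2, hp.2⟩)
      have c3 := (hk.continuousOn_deriv e x hxs f 2 le_rfl).mono hm'
      have c4 := ContinuousOn.star ((hK.continuousOn_deriv e' z hzs f 2 le_rfl).comp
        (f := fun p : ℝ × ℝ => (t - p.1, p.2)) (by fun_prop) hm)
      refine hasDerivAt_intervalIntegral_of_continuousOn (Γ.len_pos f).le
        (u := Ioo 0 t) (Ioo_mem_nhds hs.1 hs.2)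
        (f := fun s y => k s e x f y * (starRingEnd ℂ) (K (t - s) e' z f y))
        (f' := fun s y => Γ.edgeDeriv (k s e x) 2 f y * (starRingEnd ℂ) (K (t - s) e' z f y)
          - k s e x f y * (starRingEnd ℂ) (Γ.edgeDeriv (K (t - s) e' z) 2 f y)) ?_ ?_ ?_
      · intro r hr
        exact (c1.mul c2).comp (f := fun y => (r, y)) (by fun_prop) fun y hy => ⟨hr, hy⟩
      · exact (c3.mul c2).sub (c1.mul c4)
      · intro r hr y hy
        have d1 := hk.heat_eq r hr.1 e x hxs f y hy
        have d2 : HasDerivAt (fun s => (starRingEnd ℂ) (K (t - s) e' z f y)) _ r :=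
          ((hK.heat_eq (t - r) (sub_pos.2 hr.2) e' z hzs f y hy).comp_const_sub t r).star
        refine (d1.mul d2).congr_deriv ?_
        simp
        ring
    rw [sum_integral_green _ _ (hk.contDiffOn s hs.1 e x hxs) (hK.contDiffOn _ hts e' z hzs)]
      at hsum
    have hb1 := (vertex_cond_iff Γ hAB _ _).1 (hk.vertex_cond s hs.1 e x hxs)
    have hb2 := (vertex_cond_iff Γ hAB _ _).1 (hK.vertex_cond (t - s) hts e' z hzs)
    have z1 := sum_mul_conj_eq_zero (scatter_conj Γ hAB) hb1.2 hb2.1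
    have z2 := sum_mul_conj_eq_zero (scatter_conj Γ hAB) hb2.2 hb1.1
    have z3 : ∑ h, Γ.endDeriv (k s e x) 0 h *
        (starRingEnd ℂ) (Γ.endDeriv (K (t - s) e' z) 1 h) = 0 := by
      have := congrArg (starRingEnd ℂ) z2
      rw [map_sum, map_zero] at this
      rw [← this]
      refine Finset.sum_congr rfl fun h _ => ?_
      rw [map_mul, Complex.conj_conj, mul_comm]
    rw [Finset.sum_sub_distrib, z1, z3, sub_zero, neg_zero] at hsum
    exact hsum
  have hconst : ∀ s ∈ Ioo 0 t, F s = F (t / 2) := by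
    intro s hs
    have hmid : t / 2 ∈ Ioo 0 t := ⟨by linarith, by linarith⟩
    exact isOpen_Ioo.is_const_of_deriv_eq_zero isPreconnected_Ioo
      (fun r hr => (hderiv r hr).differentiableAt.differentiableWithinAt)
      (fun r hr => (hderiv r hr).deriv) hs hmid
  have hev : ∀ᶠ s in 𝓝[>] (0 : ℝ), s ∈ Ioo 0 t := Ioo_mem_nhdsGT ht
  have e0 : F (t / 2) = (starRingEnd ℂ) (K t e' z e x) :=
    tendsto_nhds_unique (tendsto_const_nhds.congr' (by
      filter_upwards [hev] with s hs using (hconst s hs).symm)) hl0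
  have e1 : F (t / 2) = k t e x e' z :=
    tendsto_nhds_unique (tendsto_const_nhds.congr' (by
      filter_upwards [hev] with s hs
      exact (hconst (t - s) ⟨sub_pos.2 hs.2, sub_lt_self t hs.1⟩).symm)) hl1
  rw [← e1, e0]

/-- The heat kernel is unique: two kernels are both adjoint to the same kernel. -/
theorem IsHeatKernel.unique (hAB : ∀ v, IsNonRobin (A v) (B v))
    (hk : Γ.IsHeatKernel U A B k) (hK : Γ.IsHeatKernel U A B K) {t : ℝ} (ht : 0 < t) {e f : E}
    {x y : ℝ} (hx : x ∈ Γ.seg e) (hy : y ∈ Γ.seg f) : k t e x f y = K t e x f y := by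
  have hin : EqOn (fun p : ℝ × ℝ => k t e p.1 f p.2) (fun p : ℝ × ℝ => K t e p.1 f p.2)
      (Ioo 0 (Γ.len e) ×ˢ Ioo 0 (Γ.len f)) := by
    intro p hp
    simp only
    rw [hk.eq_conj_swap hAB hK ht hp.1 hp.2, hK.eq_conj_swap hAB hK ht hp.1 hp.2]
  have hc : ∀ {κ : ℝ → E → ℝ → E → ℝ → ℂ}, Γ.IsHeatKernel U A B κ →
      ContinuousOn (fun p : ℝ × ℝ => κ t e p.1 f p.2)
        (Icc 0 (Γ.len e) ×ˢ Icc 0 (Γ.len f)) := fun hκ =>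
    (hκ.continuousOn e f).comp (f := fun p : ℝ × ℝ => (t, p.1, p.2)) (by fun_prop)
      fun p hp => ⟨ht, hp.1, hp.2⟩
  have := hin.of_subset_closure (hc hk) (hc hK)
    (prod_mono Ioo_subset_Icc_self Ioo_subset_Icc_self)
    (by rw [closure_prod_eq, closure_Ioo (Γ.len_pos e).ne, closure_Ioo (Γ.len_pos f).ne])
  exact this (x := (x, y)) ⟨hx, hy⟩

end MetricGraph

/-! ### Two times differentiable functions on the graph -/

namespace MetricGraph

variable {V E : Type*}

/-- `1` at the left end of an edge and `-1` at the right end: the orientation of the edge relative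
to the direction away from the vertex. -/
def sgn (h : E × Bool) : ℝ := if h.2 then -1 else 1

/-- The coordinate, on its edge, of the point at (signed) distance `s` from the end `h`. -/
def pos (Γ : MetricGraph V E) (h : E × Bool) (s : ℝ) : ℝ := if h.2 then Γ.len h.1 - s else s

theorem sgn_mul_self (h : E × Bool) : sgn h * sgn h = 1 := by
  unfold sgn; split_ifs <;> norm_num

theorem pos_eq (Γ : MetricGraph V E) (h : E × Bool) (s : ℝ) :
    Γ.pos h s = Γ.endPos h + sgn h * s := by
  unfold pos endPos sgn; split_ifs <;> ring

theorem pos_zero (Γ : MetricGraph V E) (h : E × Bool) : Γ.pos h 0 = Γ.endPos h := by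
  rw [pos_eq]; ring

theorem pos_pos (Γ : MetricGraph V E) (h : E × Bool) (s : ℝ) : Γ.pos h (Γ.pos h s) = s := by
  unfold pos; split_ifs <;> ring

theorem pos_mem (Γ : MetricGraph V E) (h : E × Bool) {s : ℝ} (hs : s ∈ Icc 0 (Γ.len h.1)) :
    Γ.pos h s ∈ Icc 0 (Γ.len h.1) := by
  unfold pos; split_ifs
  · exact ⟨by linarith [hs.2], by linarith [hs.1]⟩
  · exact hs

theorem endPos_mem (Γ : MetricGraph V E) (h : E × Bool) : Γ.endPos h ∈ Icc 0 (Γ.len h.1) := by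
  rw [← pos_zero]; exact Γ.pos_mem h ⟨le_rfl, (Γ.len_pos _).le⟩

theorem hasDerivAt_pos (Γ : MetricGraph V E) (h : E × Bool) (s : ℝ) :
    HasDerivAt (Γ.pos h) (sgn h) s := by
  have : Γ.pos h = fun s => Γ.endPos h + sgn h * s := funext (Γ.pos_eq h)
  rw [this]
  simpa using ((hasDerivAt_id s).const_mul (sgn h)).const_add (Γ.endPos h)

/-- Triples of continuous functions on the closed edges. They stand for a function on the graph
and its first two derivatives. -/
abbrev Jet (Γ : MetricGraph V E) : Type _ := Fin 3 → ∀ f : E, C(Icc (0 : ℝ) (Γ.len f), ℂ)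

/-- The components of a jet as functions of the coordinate, constant outside the edge. -/
noncomputable def ev (Γ : MetricGraph V E) (g : Γ.Jet) (j : Fin 3) (f : E) : ℝ → ℂ :=
  IccExtend (Γ.len_pos f).le (g j f)

theorem continuous_ev (Γ : MetricGraph V E) (g : Γ.Jet) (j : Fin 3) (f : E) :
    Continuous (Γ.ev g j f) := (g j f).continuous.Icc_extend'

theorem ev_apply (Γ : MetricGraph V E) (g : Γ.Jet) (j : Fin 3) (f : E) {y : ℝ}
    (hy : y ∈ Icc 0 (Γ.len f)) : Γ.ev g j f y = g j f ⟨y, hy⟩ := IccExtend_of_mem _ _ hy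

theorem continuous_ev_uncurry (Γ : MetricGraph V E) (j : Fin 3) (f : E) :
    Continuous fun p : Γ.Jet × ℝ => Γ.ev p.1 j f p.2 := by
  show Continuous fun p : Γ.Jet × ℝ => p.1 j f (projIcc 0 (Γ.len f) (Γ.len_pos f).le p.2)
  have h1 : Continuous fun p : Γ.Jet × ℝ => p.1 j f :=
    (continuous_apply f).comp ((continuous_apply j).comp continuous_fst)
  exact h1.eval (continuous_projIcc.comp continuous_snd)

/-- The components of a jet in the direction away from the vertex of the end `h`, as functions of
the distance from it. -/
noncomputable def bond (Γ : MetricGraph V E) (g : Γ.Jet) (j : Fin 3) (h : E × Bool) (s : ℝ) : ℂ :=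
  ((sgn h ^ (j : ℕ) : ℝ) : ℂ) * Γ.ev g j h.1 (Γ.pos h s)

theorem continuous_bond (Γ : MetricGraph V E) (g : Γ.Jet) (j : Fin 3) (h : E × Bool) :
    Continuous (Γ.bond g j h) := by
  have : Continuous (Γ.pos h) := continuous_iff_continuousAt.2
    fun s => (Γ.hasDerivAt_pos h s).continuousAt
  exact continuous_const.mul ((Γ.continuous_ev g j h.1).comp this)

variable [Fintype E]

theorem norm_ev_le (Γ : MetricGraph V E) (g : Γ.Jet) (j : Fin 3) (f : E) (y : ℝ) :
    ‖Γ.ev g j f y‖ ≤ ‖g‖ :=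
  ((g j f).norm_coe_le_norm _).trans ((norm_le_pi_norm (g j) f).trans (norm_le_pi_norm g j))

theorem norm_bond_le (Γ : MetricGraph V E) (g : Γ.Jet) (j : Fin 3) (h : E × Bool) (s : ℝ) :
    ‖Γ.bond g j h s‖ ≤ ‖g‖ := by
  have h1 : |sgn h| = 1 := by unfold sgn; split_ifs <;> norm_num
  rw [bond, norm_mul, Complex.norm_real, norm_pow, Real.norm_eq_abs, h1, one_pow, one_mul]
  exact Γ.norm_ev_le g j _ _

/-- The Banach space of `C²` functions on the graph, given with their derivatives, that satisfy the
vertex conditions of the scattering matrix `S`, also for the second derivative: in the direction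
away from the vertex, `S g = g`, `S g' = -g'` and `S g'' = g''`. -/
def stateSpace (Γ : MetricGraph V E) (S : E × Bool → E × Bool → ℂ) : Submodule ℂ Γ.Jet where
  carrier := {g | (∀ (j : Fin 2) (f : E), ∀ y ∈ Icc 0 (Γ.len f),
      Γ.ev g j.castSucc f y = Γ.ev g j.castSucc f 0 + ∫ u in (0 : ℝ)..y, Γ.ev g j.succ f u) ∧
    ∀ (j : Fin 3) (h : E × Bool),
      ∑ h', S h h' * Γ.bond g j h' 0 = (-1) ^ (j : ℕ) * Γ.bond g j h 0}
  zero_mem' := by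
    refine ⟨fun j f y hy => ?_, fun j h => ?_⟩ <;> simp [ev, bond, IccExtend]
  add_mem' := by
    rintro a b ⟨ha1, ha2⟩ ⟨hb1, hb2⟩
    have hev : ∀ j f y, Γ.ev (a + b) j f y = Γ.ev a j f y + Γ.ev b j f y := fun j f y => by
      simp [ev, IccExtend]
    refine ⟨fun j f y hy => ?_, fun j h => ?_⟩
    · simp only [hev]
      rw [ha1 j f y hy, hb1 j f y hy, intervalIntegral.integral_add
        ((Γ.continuous_ev a _ f).intervalIntegrable _ _)
        ((Γ.continuous_ev b _ f).intervalIntegrable _ _)]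
      ring
    · have := congrArg₂ (· + ·) (ha2 j h) (hb2 j h)
      simp only [bond, hev] at this ⊢
      simp only [mul_add, Finset.sum_add_distrib]
      linear_combination this
  smul_mem' := by
    rintro c a ⟨ha1, ha2⟩
    have hev : ∀ j f y, Γ.ev (c • a) j f y = c * Γ.ev a j f y := fun j f y => by
      simp [ev, IccExtend]
    refine ⟨fun j f y hy => ?_, fun j h => ?_⟩
    · simp only [hev]
      rw [ha1 j f y hy, intervalIntegral.integral_const_mul]
      ring
    · have := congrArg (c * ·) (ha2 j h)
      simp only [bond, hev, Finset.mul_sum] at this ⊢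
      rw [show (-1 : ℂ) ^ (j : ℕ) * (((sgn h ^ (j : ℕ) : ℝ) : ℂ) *
        (c * Γ.ev a j h.1 (Γ.pos h 0))) = c * ((-1) ^ (j : ℕ) * (((sgn h ^ (j : ℕ) : ℝ) : ℂ) *
        Γ.ev a j h.1 (Γ.pos h 0))) by ring, ← this]
      refine Finset.sum_congr rfl fun h' _ => ?_
      ring

theorem isClosed_stateSpace (Γ : MetricGraph V E) (S : E × Bool → E × Bool → ℂ) :
    IsClosed (Γ.stateSpace S : Set Γ.Jet) := by
  have hev : ∀ j f y, Continuous fun g : Γ.Jet => Γ.ev g j f y := fun j f y =>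
    (Γ.continuous_ev_uncurry j f).comp (continuous_id.prodMk continuous_const)
  have h1 : IsClosed {g : Γ.Jet | ∀ (j : Fin 2) (f : E), ∀ y ∈ Icc 0 (Γ.len f),
      Γ.ev g j.castSucc f y = Γ.ev g j.castSucc f 0 +
        ∫ u in (0 : ℝ)..y, Γ.ev g j.succ f u} := by
    simp only [ofPred_forall]
    refine isClosed_iInter fun j => isClosed_iInter fun f => isClosed_iInter fun y =>
      isClosed_iInter fun _ => isClosed_eq (hev _ _ _) ((hev _ _ _).add ?_)
    exact intervalIntegral.continuous_parametric_intervalIntegral_of_continuous'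
      (f := fun (g : Γ.Jet) u => Γ.ev g j.succ f u) (Γ.continuous_ev_uncurry _ f) 0 y
  have h2 : IsClosed {g : Γ.Jet | ∀ (j : Fin 3) (h : E × Bool),
      ∑ h', S h h' * Γ.bond g j h' 0 = (-1) ^ (j : ℕ) * Γ.bond g j h 0} := by
    simp only [ofPred_forall]
    refine isClosed_iInter fun j => isClosed_iInter fun h => isClosed_eq ?_ ?_
    · exact continuous_finsetSum _ fun h' _ =>
        continuous_const.mul (continuous_const.mul (hev _ _ _))
    · exact continuous_const.mul (continuous_const.mul (hev _ _ _))
  exact h1.inter h2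

instance (Γ : MetricGraph V E) (S : E × Bool → E × Bool → ℂ) :
    CompleteSpace (Γ.stateSpace S) := (Γ.isClosed_stateSpace S).completeSpace_coe

variable {Γ : MetricGraph V E} {S : E × Bool → E × Bool → ℂ}

theorem ev_hasDerivWithinAt (g : Γ.stateSpace S) (j : Fin 2) (f : E) {y : ℝ}
    (hy : y ∈ Icc 0 (Γ.len f)) :
    HasDerivWithinAt (Γ.ev g j.castSucc f) (Γ.ev g j.succ f y) (Icc 0 (Γ.len f)) y := by
  have hc := Γ.continuous_ev g j.succ f
  have h1 : HasDerivAt (fun y => Γ.ev g j.castSucc f 0 + ∫ u in (0 : ℝ)..y, Γ.ev g j.succ f u)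
      (Γ.ev g j.succ f y) y :=
    (intervalIntegral.integral_hasDerivAt_right (hc.intervalIntegrable _ _)
      (hc.stronglyMeasurableAtFilter _ _) hc.continuousAt).const_add _
  exact h1.hasDerivWithinAt.congr (fun z hz => g.2.1 j f z hz) (g.2.1 j f y hy)

theorem mem_stateSpace {g : Γ.Jet}
    (h1 : ∀ (j : Fin 2) (f : E), ∀ y ∈ Icc 0 (Γ.len f),
      HasDerivWithinAt (Γ.ev g j.castSucc f) (Γ.ev g j.succ f y) (Icc 0 (Γ.len f)) y)
    (h2 : ∀ (j : Fin 3) (h : E × Bool),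
      ∑ h', S h h' * Γ.bond g j h' 0 = (-1) ^ (j : ℕ) * Γ.bond g j h 0) :
    g ∈ Γ.stateSpace S := by
  refine ⟨fun j f y hy => ?_, h2⟩
  rw [intervalIntegral.integral_eq_sub_of_hasDerivAt_of_le hy.1
    (f := Γ.ev g j.castSucc f) (Γ.continuous_ev g _ f).continuousOn (fun z hz => ?_)
    ((Γ.continuous_ev g _ f).intervalIntegrable _ _)]
  · ring
  · exact (h1 j f z ⟨hz.1.le, hz.2.le.trans hy.2⟩).hasDerivAt
      (Icc_mem_nhds hz.1 (hz.2.trans_le hy.2))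

theorem bond_hasDerivWithinAt (g : Γ.stateSpace S) (j : Fin 2) (h : E × Bool) {s : ℝ}
    (hs : s ∈ Icc 0 (Γ.len h.1)) :
    HasDerivWithinAt (Γ.bond g j.castSucc h) (Γ.bond g j.succ h s) (Icc 0 (Γ.len h.1)) s := by
  have := ((ev_hasDerivWithinAt g j h.1 (Γ.pos_mem h hs)).scomp s
    (Γ.hasDerivAt_pos h s).hasDerivWithinAt (fun z hz => Γ.pos_mem h hz)).const_mul
    (((sgn h ^ (j : ℕ) : ℝ) : ℂ))
  refine this.congr_deriv ?_
  rw [bond, Fin.val_succ, pow_succ, Complex.real_smul]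
  push_cast
  ring

/-- The continuation of a function beyond the vertex of the end `h`, by scattering. -/
noncomputable def extBond (Γ : MetricGraph V E) (S : E × Bool → E × Bool → ℂ) (g : Γ.Jet)
    (j : Fin 3) (h : E × Bool) (s : ℝ) : ℂ :=
  if 0 ≤ s then Γ.bond g j h s else (-1) ^ (j : ℕ) * ∑ h', S h h' * Γ.bond g j h' (-s)

theorem extBond_of_nonpos (g : Γ.stateSpace S) (j : Fin 3) (h : E × Bool) {s : ℝ} (hs : s ≤ 0) :
    Γ.extBond S g j h s = (-1) ^ (j : ℕ) * ∑ h', S h h' * Γ.bond g j h' (-s) := by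
  rcases hs.lt_or_eq with hs | rfl
  · rw [extBond, if_neg (not_le.2 hs)]
  · rw [extBond, if_pos le_rfl, neg_zero, g.2.2 j h, ← mul_assoc, ← pow_add,
      Even.neg_one_pow ⟨_, rfl⟩, one_mul]

theorem continuous_extBond (g : Γ.stateSpace S) (j : Fin 3) (h : E × Bool) :
    Continuous (Γ.extBond S g j h) := by
  refine Continuous.if_le (Γ.continuous_bond g j h) ?_ continuous_const continuous_id ?_
  · exact continuous_const.mul (continuous_finsetSum _ fun h' _ =>
      continuous_const.mul ((Γ.continuous_bond g j h').comp continuous_neg))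
  · rintro s rfl
    rw [← extBond_of_nonpos g j h le_rfl, extBond, if_pos le_rfl]

theorem norm_extBond_le (g : Γ.Jet) (j : Fin 3) (h : E × Bool) (s : ℝ) :
    ‖Γ.extBond S g j h s‖ ≤ (1 + ∑ h, ∑ h', ‖S h h'‖) * ‖g‖ := by
  have h0 : 0 ≤ ∑ h, ∑ h', ‖S h h'‖ := by positivity
  rw [extBond]
  split_ifs
  · refine (Γ.norm_bond_le g j h s).trans ?_
    nlinarith [norm_nonneg g]
  · rw [norm_mul, norm_pow, norm_neg, norm_one, one_pow, one_mul]
    refine (norm_sum_le _ _).trans ?_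
    have h1 : ∑ h', ‖S h h' * Γ.bond g j h' (-s)‖ ≤ (∑ h', ‖S h h'‖) * ‖g‖ := by
      rw [Finset.sum_mul]
      refine Finset.sum_le_sum fun h' _ => ?_
      rw [norm_mul]
      exact mul_le_mul_of_nonneg_left (Γ.norm_bond_le g j h' _) (norm_nonneg _)
    have h2 : ∑ h', ‖S h h'‖ ≤ ∑ h, ∑ h', ‖S h h'‖ :=
      Finset.single_le_sum (f := fun h => ∑ h', ‖S h h'‖) (fun _ _ => by positivity)
        (Finset.mem_univ h)
    nlinarith [norm_nonneg g]

/-- The vertex conditions on `g`, `g'` and `g''` are those under which the continuation is `C²`. -/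
theorem extBond_hasDerivAt (g : Γ.stateSpace S) (j : Fin 2) (h : E × Bool) {ℓ s : ℝ}
    (hℓ : ∀ f, ℓ ≤ Γ.len f) (hs : -ℓ < s) (hs' : s < Γ.len h.1) :
    HasDerivAt (Γ.extBond S g j.castSucc h) (Γ.extBond S g j.succ h s) s := by
  have hright : 0 ≤ s → HasDerivWithinAt (Γ.extBond S g j.castSucc h)
      (Γ.extBond S g j.succ h s) (Ici 0) s := by
    intro h0
    have h1 := bond_hasDerivWithinAt g j h ⟨h0, hs'.le⟩
    have h2 : HasDerivWithinAt (Γ.bond g j.castSucc h) (Γ.bond g j.succ h s) (Ici 0) s := by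
      refine h1.mono_of_mem_nhdsWithin ?_
      rw [← Ici_inter_Iic]
      exact inter_mem_nhdsWithin _ (Iic_mem_nhds hs')
    have e : ∀ i, ∀ z ∈ Ici (0 : ℝ), Γ.extBond S g i h z = Γ.bond g i h z := fun i z hz =>
      if_pos hz
    rw [e j.succ s h0]
    exact h2.congr (e _) (e _ s h0)
  have hleft : s ≤ 0 → HasDerivWithinAt (Γ.extBond S g j.castSucc h)
      (Γ.extBond S g j.succ h s) (Iic 0) s := by
    intro h0
    have h2 : ∀ h', HasDerivWithinAt (fun z => Γ.bond g j.castSucc h' (-z))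
        (-(Γ.bond g j.succ h' (-s))) (Iic 0) s := by
      intro h'
      have hlt : -s < Γ.len h'.1 := by linarith [hℓ h'.1]
      have h1 := bond_hasDerivWithinAt g j h' (s := -s) ⟨by linarith, hlt.le⟩
      have h3 : HasDerivWithinAt (Γ.bond g j.castSucc h') (Γ.bond g j.succ h' (-s))
          (Ici 0) (-s) := by
        refine h1.mono_of_mem_nhdsWithin ?_
        rw [← Ici_inter_Iic]
        exact inter_mem_nhdsWithin _ (Iic_mem_nhds hlt)
      have h4 := h3.scomp s (hasDerivAt_neg s).hasDerivWithinAt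
        (s := Iic 0) (fun z hz => by simpa using hz)
      exact h4.congr_deriv (by simp)
    have h5 : HasDerivWithinAt
        (fun z => (-1 : ℂ) ^ (j : ℕ) * ∑ h', S h h' * Γ.bond g j.castSucc h' (-z))
        ((-1) ^ (j : ℕ) * ∑ h', S h h' * (-(Γ.bond g j.succ h' (-s)))) (Iic 0) s :=
      (HasDerivWithinAt.fun_sum fun h' _ => (h2 h').const_mul (S h h')).const_mul _
    have e : (-1 : ℂ) ^ (j : ℕ) * ∑ h', S h h' * (-(Γ.bond g j.succ h' (-s)))
        = Γ.extBond S g j.succ h s := by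
      rw [extBond_of_nonpos g _ h h0, Fin.val_succ, pow_succ]
      simp only [mul_neg, Finset.sum_neg_distrib]
      ring
    rw [← e]
    exact h5.congr (fun z hz => extBond_of_nonpos g _ h hz) (extBond_of_nonpos g _ h h0)
  rcases lt_trichotomy s 0 with h0 | rfl | h0
  · exact (hleft h0.le).hasDerivAt (Iic_mem_nhds h0)
  · have := (hleft le_rfl).union (hright le_rfl)
    rw [Iic_union_Ici] at this
    exact this.hasDerivAt univ_mem
  · exact (hright h0.le).hasDerivAt (Ici_mem_nhds h0)

/-- The continued function turns into itself under scattering and reflection, as `S` is an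
involution. Therefore averages of it satisfy the vertex conditions. -/
theorem sum_mul_extBond [DecidableEq E] (hS : Γ.IsScattering S) (g : Γ.stateSpace S) (j : Fin 3)
    (h : E × Bool) (s : ℝ) :
    ∑ h', S h h' * Γ.extBond S g j h' s = (-1) ^ (j : ℕ) * Γ.extBond S g j h (-s) := by
  have hsq : ((-1 : ℂ) ^ (j : ℕ)) * (-1) ^ (j : ℕ) = 1 := by
    rw [← pow_add, Even.neg_one_pow ⟨_, rfl⟩]
  rcases le_total 0 s with h0 | h0
  · rw [extBond_of_nonpos g j h (neg_nonpos.2 h0), ← mul_assoc, hsq, one_mul, neg_neg]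
    exact Finset.sum_congr rfl fun h' _ => by rw [extBond, if_pos h0]
  · rw [extBond, if_pos (neg_nonneg.2 h0)]
    have : ∀ h', S h h' * Γ.extBond S g j h' s
        = ∑ h'', (-1) ^ (j : ℕ) * (S h h' * S h' h'') * Γ.bond g j h'' (-s) := fun h' => by
      rw [extBond_of_nonpos g j h' h0, Finset.mul_sum, Finset.mul_sum]
      exact Finset.sum_congr rfl fun h'' _ => by ring
    simp only [this]
    rw [Finset.sum_comm]
    have h2 : ∀ h'', ∑ h', (-1) ^ (j : ℕ) * (S h h' * S h' h'') * Γ.bond g j h'' (-s)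
        = (-1) ^ (j : ℕ) * (if h = h'' then 1 else 0) * Γ.bond g j h'' (-s) := fun h'' => by
      rw [← Finset.sum_mul, ← Finset.mul_sum, hS.sq]
    simp only [h2]
    simp

/-- The continuation of a function on an edge beyond both of its ends. -/
noncomputable def ext (Γ : MetricGraph V E) (S : E × Bool → E × Bool → ℂ) (g : Γ.Jet)
    (j : Fin 3) (f : E) (y : ℝ) : ℂ :=
  if y ≤ Γ.len f then Γ.extBond S g j (f, false) y
  else (-1) ^ (j : ℕ) * Γ.extBond S g j (f, true) (Γ.len f - y)

theorem ext_of_le (g : Γ.Jet) (j : Fin 3) (f : E) {y : ℝ} (hy : y ≤ Γ.len f) :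
    Γ.ext S g j f y = Γ.extBond S g j (f, false) y := if_pos hy

theorem ext_of_nonneg (g : Γ.Jet) (j : Fin 3) (f : E) {y : ℝ} (hy : 0 ≤ y) :
    Γ.ext S g j f y = (-1) ^ (j : ℕ) * Γ.extBond S g j (f, true) (Γ.len f - y) := by
  rw [ext]
  split_ifs with h
  · rw [extBond, if_pos hy, extBond, if_pos (sub_nonneg.2 h)]
    simp only [bond, pos, sgn, Bool.false_eq_true, if_false, if_true, sub_sub_cancel]
    push_cast
    rw [one_pow, one_mul, ← mul_assoc, ← pow_add, Even.neg_one_pow ⟨_, rfl⟩, one_mul]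
  · rfl

theorem ext_of_mem (g : Γ.Jet) (j : Fin 3) (f : E) {y : ℝ} (hy : y ∈ Icc 0 (Γ.len f)) :
    Γ.ext S g j f y = Γ.ev g j f y := by
  rw [ext_of_le g j f hy.2, extBond, if_pos hy.1]
  simp [bond, pos, sgn]

theorem ext_pos (g : Γ.Jet) (j : Fin 3) (h : E × Bool) {s : ℝ} (hs : s ≤ Γ.len h.1) :
    ((sgn h ^ (j : ℕ) : ℝ) : ℂ) * Γ.ext S g j h.1 (Γ.pos h s) = Γ.extBond S g j h s := by
  obtain ⟨f, b⟩ := h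
  cases b
  · simp only [sgn, pos, Bool.false_eq_true, if_false]
    rw [ext_of_le g j f hs]
    simp
  · simp only [sgn, pos, if_true]
    rw [ext_of_nonneg g j f (sub_nonneg.2 hs), sub_sub_cancel, ← mul_assoc]
    push_cast
    rw [← pow_add, Even.neg_one_pow ⟨_, rfl⟩, one_mul]

theorem continuous_ext (g : Γ.stateSpace S) (j : Fin 3) (f : E) : Continuous (Γ.ext S g j f) := by
  refine Continuous.if_le (continuous_extBond g j _) ?_ continuous_id continuous_const ?_
  · exact continuous_const.mul ((continuous_extBond g j _).comp
      (continuous_const.sub continuous_id))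
  · intro y hy
    rw [← ext_of_le (g : Γ.Jet) j f hy.le,
      ← ext_of_nonneg (g : Γ.Jet) j f (hy ▸ (Γ.len_pos f).le)]

theorem norm_ext_le (g : Γ.Jet) (j : Fin 3) (f : E) (y : ℝ) :
    ‖Γ.ext S g j f y‖ ≤ (1 + ∑ h, ∑ h', ‖S h h'‖) * ‖g‖ := by
  rw [ext]
  split_ifs
  · exact norm_extBond_le g j _ _
  · rw [norm_mul, norm_pow, norm_neg, norm_one, one_pow, one_mul]
    exact norm_extBond_le g j _ _

theorem ext_hasDerivAt (g : Γ.stateSpace S) (j : Fin 2) (f : E) {ℓ y : ℝ}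
    (hℓ : ∀ f, ℓ ≤ Γ.len f) (hy : -ℓ < y) (hy' : y < Γ.len f + ℓ) :
    HasDerivAt (Γ.ext S g j.castSucc f) (Γ.ext S g j.succ f y) y := by
  rcases lt_or_ge y (Γ.len f) with h | h
  · have h1 := extBond_hasDerivAt g j (f, false) hℓ hy h
    rw [ext_of_le _ _ _ h.le]
    refine h1.congr_of_eventuallyEq ?_
    filter_upwards [Iio_mem_nhds h] with z hz using ext_of_le _ _ _ (le_of_lt hz)
  · have h0 : 0 < y := (Γ.len_pos f).trans_le h
    have h1 := extBond_hasDerivAt g j (f, true) (s := Γ.len f - y) hℓ (by linarith)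
      (by simp only; linarith)
    have h2 := (h1.comp_const_sub (Γ.len f) y).const_mul ((-1 : ℂ) ^ (j : ℕ))
    rw [ext_of_nonneg _ _ _ h0.le, Fin.val_succ, pow_succ]
    refine (h2.congr_of_eventuallyEq ?_).congr_deriv (by ring)
    filter_upwards [Ioi_mem_nhds h0] with z hz using ext_of_nonneg _ _ _ (le_of_lt hz)

theorem ext_add (g g' : Γ.Jet) (j : Fin 3) (f : E) (y : ℝ) :
    Γ.ext S (g + g') j f y = Γ.ext S g j f y + Γ.ext S g' j f y := by
  have hb : ∀ h s, Γ.bond (g + g') j h s = Γ.bond g j h s + Γ.bond g' j h s := fun h s => by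
    simp [bond, ev, IccExtend, mul_add]
  have he : ∀ h s, Γ.extBond S (g + g') j h s = Γ.extBond S g j h s + Γ.extBond S g' j h s := by
    intro h s
    simp only [extBond, hb, mul_add, Finset.sum_add_distrib]
    split_ifs <;> rfl
  simp only [ext, he, mul_add]
  split_ifs <;> rfl

theorem ext_smul (c : ℂ) (g : Γ.Jet) (j : Fin 3) (f : E) (y : ℝ) :
    Γ.ext S (c • g) j f y = c * Γ.ext S g j f y := by
  have hb : ∀ h s, Γ.bond (c • g) j h s = c * Γ.bond g j h s := fun h s => by
    simp [bond, ev, IccExtend]; ring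
  have he : ∀ h s, Γ.extBond S (c • g) j h s = c * Γ.extBond S g j h s := by
    intro h s
    simp only [extBond, hb]
    split_ifs
    · rfl
    · simp only [Finset.mul_sum]
      exact Finset.sum_congr rfl fun h' _ => by ring
  simp only [ext, he]
  split_ifs
  · rfl
  · ring

end MetricGraph

/-! ### Gaussian averages -/

/-- The heat kernel of the real line. -/
noncomputable def gaussKernel (t z : ℝ) : ℝ := Real.exp (-z ^ 2 / (4 * t)) / √(4 * π * t)

theorem gaussKernel_nonneg (t z : ℝ) : 0 ≤ gaussKernel t z := by unfold gaussKernel; positivity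

theorem gaussKernel_neg (t z : ℝ) : gaussKernel t (-z) = gaussKernel t z := by
  simp [gaussKernel]

theorem continuous_gaussKernel (t : ℝ) : Continuous (gaussKernel t) := by
  unfold gaussKernel; fun_prop

theorem gaussKernel_one_eq (v : ℝ) :
    gaussKernel 1 v = Real.exp (-(1 / 4) * v ^ 2) * (√(4 * π))⁻¹ := by
  rw [gaussKernel, mul_one, mul_one, div_eq_mul_inv]; congr 2; ring

theorem integrable_pow_mul_gaussKernel (n : ℕ) :
    MeasureTheory.Integrable fun v : ℝ => v ^ n * gaussKernel 1 v := by
  have h := (integrable_rpow_mul_exp_neg_mul_sq (b := 1 / 4) (by norm_num) (s := n)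
    (by linarith [n.cast_nonneg (α := ℝ)])).mul_const (√(4 * π))⁻¹
  refine h.congr (Eventually.of_forall fun v => ?_)
  simp only [Real.rpow_natCast, gaussKernel_one_eq]
  ring

theorem integral_gaussKernel_one : ∫ v : ℝ, gaussKernel 1 v = 1 := by
  simp only [gaussKernel_one_eq]
  rw [MeasureTheory.integral_mul_const, integral_gaussian]
  rw [show π / (1 / 4) = 4 * π by ring]
  exact mul_inv_cancel₀ (by positivity)

theorem gaussKernel_one_scale {t : ℝ} (ht : 0 < t) (v : ℝ) :
    gaussKernel 1 v = √t * gaussKernel t (√t * v) := by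
  have h1 : √(4 * π * t) = √(4 * π) * √t := Real.sqrt_mul (by positivity) t
  have h2 : √t ≠ 0 := (Real.sqrt_pos.2 ht).ne'
  have h3 : √t ^ 2 = t := Real.sq_sqrt ht.le
  rw [gaussKernel, gaussKernel, h1, mul_pow, h3]
  have h4 : -(t * v ^ 2) / (4 * t) = -v ^ 2 / (4 * 1) := by field_simp
  rw [h4, mul_one]
  field_simp

theorem gaussKernel_hasDerivAt_right {t : ℝ} (ht : 0 < t) (z : ℝ) :
    HasDerivAt (gaussKernel t) (-(z / (2 * t)) * gaussKernel t z) z := by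
  have h1 : HasDerivAt (fun z : ℝ => -z ^ 2 / (4 * t)) (-(z / (2 * t))) z := by
    have := ((hasDerivAt_pow 2 z).neg).div_const (4 * t)
    refine this.congr_deriv ?_
    field_simp
    ring
  have := h1.exp.div_const √(4 * π * t)
  refine this.congr_deriv ?_
  rw [gaussKernel]; ring

theorem gaussKernel_hasDerivAt_left {t : ℝ} (ht : 0 < t) (z : ℝ) :
    HasDerivAt (fun t => gaussKernel t z)
      ((z ^ 2 / (4 * t ^ 2) - 1 / (2 * t)) * gaussKernel t z) t := by
  have hs : √(4 * π * t) ≠ 0 := (Real.sqrt_pos.2 (by positivity)).ne'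
  have h1 : HasDerivAt (fun t : ℝ => -z ^ 2 / (4 * t)) (z ^ 2 / (4 * t ^ 2)) t := by
    have := ((hasDerivAt_id t).const_mul 4).fun_inv (by simpa using ht.ne')
    have := this.const_mul (-z ^ 2)
    simp only [← div_eq_mul_inv] at this
    refine this.congr_deriv ?_
    simp only [id]
    field_simp
  have h2 : HasDerivAt (fun t : ℝ => √(4 * π * t)) (4 * π / (2 * √(4 * π * t))) t := by
    have := ((hasDerivAt_id t).const_mul (4 * π)).sqrt (by simp [Real.pi_ne_zero, ht.ne'])
    simpa using this
  have := h1.exp.div h2 hs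
  refine this.congr_deriv ?_
  have h3 : √(4 * π * t) ^ 2 = 4 * π * t := Real.sq_sqrt (by positivity)
  rw [gaussKernel]
  generalize √(4 * π * t) = s at hs h3 ⊢
  have h4 : 4 * π = s ^ 2 / t := by rw [h3]; field_simp
  rw [h4]
  field_simp

/-- A weight for Gaussian averages over `|u| < ℓ`, where `u = √τ v`: even, of quadratic growth
in `v`, and supported away from `|u| = ℓ`. -/
structure IsWeight (ℓ : ℝ) (wt : ℝ → ℝ → ℝ) : Prop where
  cont : Continuous fun p : ℝ × ℝ => wt p.1 p.2
  bound : ∃ C, ∀ u v, |wt u v| ≤ C * (1 + v ^ 2)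
  supp : ∃ a, 0 < a ∧ a < ℓ ∧ ∀ u v, a ≤ |u| → wt u v = 0
  even : ∀ u v, wt (-u) (-v) = wt u v

/-- The average `∫ γ(v) wt(√τ v, v) G(y + √τ v) dv` against the Gaussian `γ` of variance `2`. As
`√τ = 0` for `τ ≤ 0`, it depends continuously on all real `τ`. -/
noncomputable def gaussAvg (wt : ℝ → ℝ → ℝ) (τ : ℝ) (G : ℝ → ℂ) (y : ℝ) : ℂ :=
  ∫ v : ℝ, ((gaussKernel 1 v * wt (√τ * v) v : ℝ) : ℂ) * G (y + √τ * v)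

section GaussAvg

variable {ℓ : ℝ} {wt : ℝ → ℝ → ℝ}

theorem integrable_gaussKernel_mul_one_add :
    MeasureTheory.Integrable fun v : ℝ => gaussKernel 1 v * (1 + v ^ 2) := by
  have := (integrable_pow_mul_gaussKernel 0).add (integrable_pow_mul_gaussKernel 2)
  refine this.congr (Eventually.of_forall fun v => ?_)
  simp only [Pi.add_apply]; ring

theorem norm_gaussAvg_integrand_le {C M : ℝ} (hC : ∀ u v, |wt u v| ≤ C * (1 + v ^ 2))
    {G : ℝ → ℂ} (hM : ∀ y, ‖G y‖ ≤ M) (τ y v : ℝ) :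
    ‖((gaussKernel 1 v * wt (√τ * v) v : ℝ) : ℂ) * G (y + √τ * v)‖
      ≤ C * M * (gaussKernel 1 v * (1 + v ^ 2)) := by
  rw [norm_mul, Complex.norm_real, Real.norm_eq_abs, abs_mul,
    abs_of_nonneg (gaussKernel_nonneg 1 v)]
  calc gaussKernel 1 v * |wt (√τ * v) v| * ‖G (y + √τ * v)‖
      ≤ gaussKernel 1 v * (C * (1 + v ^ 2)) * M :=
        mul_le_mul (mul_le_mul_of_nonneg_left (hC _ _) (gaussKernel_nonneg 1 v)) (hM _)
          (norm_nonneg _) (mul_nonneg (gaussKernel_nonneg 1 v)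
            ((abs_nonneg _).trans (hC 0 v)))
    _ = _ := by ring

theorem continuous_gaussAvg_integrand (hwt : IsWeight ℓ wt) {G : ℝ → ℂ} (hG : Continuous G) :
    Continuous fun p : (ℝ × ℝ) × ℝ =>
      ((gaussKernel 1 p.2 * wt (√p.1.1 * p.2) p.2 : ℝ) : ℂ) * G (p.1.2 + √p.1.1 * p.2) := by
  have h1 := (continuous_gaussKernel 1).comp (continuous_snd (X := ℝ × ℝ) (Y := ℝ))
  have h2 := hwt.cont.comp (f := fun p : (ℝ × ℝ) × ℝ => (√p.1.1 * p.2, p.2)) (by fun_prop)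
  exact (Complex.continuous_ofReal.comp (h1.mul h2)).mul (hG.comp (by fun_prop))

theorem integrable_gaussAvg (hwt : IsWeight ℓ wt) {G : ℝ → ℂ} (hG : Continuous G) {M : ℝ}
    (hM : ∀ y, ‖G y‖ ≤ M) (τ y : ℝ) :
    MeasureTheory.Integrable fun v : ℝ =>
      ((gaussKernel 1 v * wt (√τ * v) v : ℝ) : ℂ) * G (y + √τ * v) := by
  obtain ⟨C, hC⟩ := hwt.bound
  refine (integrable_gaussKernel_mul_one_add.const_mul (C * M)).mono' ?_
    (Eventually.of_forall fun v => norm_gaussAvg_integrand_le hC hM τ y v)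
  exact ((continuous_gaussAvg_integrand hwt hG).comp
    (f := fun v : ℝ => ((τ, y), v)) (by fun_prop)).aestronglyMeasurable

theorem norm_gaussAvg_le {C M : ℝ} (hC : ∀ u v, |wt u v| ≤ C * (1 + v ^ 2))
    {G : ℝ → ℂ} (hM : ∀ y, ‖G y‖ ≤ M) (τ y : ℝ) :
    ‖gaussAvg wt τ G y‖ ≤ C * M * ∫ v : ℝ, gaussKernel 1 v * (1 + v ^ 2) := by
  rw [← MeasureTheory.integral_const_mul]
  exact MeasureTheory.norm_integral_le_of_norm_le
    (integrable_gaussKernel_mul_one_add.const_mul (C * M))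
    (Eventually.of_forall fun v => norm_gaussAvg_integrand_le hC hM τ y v)

theorem continuous_gaussAvg (hwt : IsWeight ℓ wt) {G : ℝ → ℂ} (hG : Continuous G) {M : ℝ}
    (hM : ∀ y, ‖G y‖ ≤ M) : Continuous fun p : ℝ × ℝ => gaussAvg wt p.1 G p.2 := by
  obtain ⟨C, hC⟩ := hwt.bound
  refine MeasureTheory.continuous_of_dominated
    (bound := fun v => C * M * (gaussKernel 1 v * (1 + v ^ 2))) ?_ ?_ ?_ ?_
  · exact fun p => (integrable_gaussAvg hwt hG hM p.1 p.2).aestronglyMeasurable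
  · exact fun p => Eventually.of_forall fun v => norm_gaussAvg_integrand_le hC hM p.1 p.2 v
  · exact integrable_gaussKernel_mul_one_add.const_mul _
  · exact Eventually.of_forall fun v => (continuous_gaussAvg_integrand hwt hG).comp
      (f := fun p : ℝ × ℝ => (p, v)) (by fun_prop)

theorem gaussAvg_hasDerivAt (hwt : IsWeight ℓ wt) {G G' : ℝ → ℂ} (hG : Continuous G)
    (hG' : Continuous G') {M M' : ℝ} (hM : ∀ y, ‖G y‖ ≤ M) (hM' : ∀ y, ‖G' y‖ ≤ M') {y : ℝ}
    (hd : ∀ z, y - ℓ < z → z < y + ℓ → HasDerivAt G (G' z) z) (τ : ℝ) :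
    HasDerivAt (gaussAvg wt τ G) (gaussAvg wt τ G' y) y := by
  obtain ⟨C, hC⟩ := hwt.bound
  obtain ⟨a, ha0, ha, hsupp⟩ := hwt.supp
  refine (hasDerivAt_integral_of_dominated_loc_of_deriv_le
    (F := fun y v => ((gaussKernel 1 v * wt (√τ * v) v : ℝ) : ℂ) * G (y + √τ * v))
    (F' := fun y v => ((gaussKernel 1 v * wt (√τ * v) v : ℝ) : ℂ) * G' (y + √τ * v))
    (bound := fun v => C * M' * (gaussKernel 1 v * (1 + v ^ 2)))
    (Metric.ball_mem_nhds y (sub_pos.2 ha)) ?_ ?_ ?_ ?_ ?_ ?_).2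
  · exact Eventually.of_forall fun z => (integrable_gaussAvg hwt hG hM τ z).aestronglyMeasurable
  · exact integrable_gaussAvg hwt hG hM τ y
  · exact (integrable_gaussAvg hwt hG' hM' τ y).aestronglyMeasurable
  · exact Eventually.of_forall fun v z _ => norm_gaussAvg_integrand_le hC hM' τ z v
  · exact integrable_gaussKernel_mul_one_add.const_mul _
  · refine Eventually.of_forall fun v z hz => ?_
    rw [Metric.mem_ball, Real.dist_eq, abs_lt] at hz
    rcases lt_or_ge |√τ * v| a with h | h
    · rw [abs_lt] at h
      exact ((hd (z + √τ * v) (by linarith [hz.1, h.1]) (by linarith [hz.2, h.2])).comp_add_const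
        z (√τ * v)).const_mul _
    · rw [hsupp _ v h]
      simpa using hasDerivAt_const z (0 : ℂ)

theorem gaussAvg_add (hwt : IsWeight ℓ wt) {G G' : ℝ → ℂ} (hG : Continuous G)
    (hG' : Continuous G') {M M' : ℝ} (hM : ∀ y, ‖G y‖ ≤ M) (hM' : ∀ y, ‖G' y‖ ≤ M') (τ y : ℝ) :
    gaussAvg wt τ (fun z => G z + G' z) y = gaussAvg wt τ G y + gaussAvg wt τ G' y := by
  rw [gaussAvg, gaussAvg, gaussAvg, ← MeasureTheory.integral_add
    (integrable_gaussAvg hwt hG hM τ y) (integrable_gaussAvg hwt hG' hM' τ y)]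
  simp only [mul_add]

theorem gaussAvg_const_mul (c : ℂ) (G : ℝ → ℂ) (τ y : ℝ) :
    gaussAvg wt τ (fun z => c * G z) y = c * gaussAvg wt τ G y := by
  rw [gaussAvg, gaussAvg, ← MeasureTheory.integral_const_mul]
  refine MeasureTheory.integral_congr_ae (Eventually.of_forall fun v => ?_)
  simp only; ring

/-- Gaussian averages see only the values of `G` at distance less than `ℓ`, and are invariant under
reflection. -/
theorem gaussAvg_congr (hwt : IsWeight ℓ wt) {G G' : ℝ → ℂ} {ε y y' : ℝ} (hε : ε = 1 ∨ ε = -1)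
    (h : ∀ u, |u| < ℓ → G (y + ε * u) = G' (y' + u)) (τ : ℝ) :
    gaussAvg wt τ G y = gaussAvg wt τ G' y' := by
  obtain ⟨a, ha0, ha, hsupp⟩ := hwt.supp
  have key : ∀ v, ((gaussKernel 1 v * wt (√τ * v) v : ℝ) : ℂ) * G (y + ε * (√τ * v))
      = ((gaussKernel 1 v * wt (√τ * v) v : ℝ) : ℂ) * G' (y' + √τ * v) := by
    intro v
    rcases lt_or_ge |√τ * v| a with h1 | h1
    · rw [h _ (h1.trans ha)]
    · rw [hsupp _ v h1]; simp
  rcases hε with rfl | rfl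
  · exact MeasureTheory.integral_congr_ae (Eventually.of_forall fun v => by
      have := key v
      rw [one_mul] at this
      exact this)
  · rw [gaussAvg, gaussAvg, ← MeasureTheory.integral_neg_eq_self]
    refine MeasureTheory.integral_congr_ae (Eventually.of_forall fun v => ?_)
    have := key v
    simp only
    rw [gaussKernel_neg, mul_neg, hwt.even, ← this]
    congr 2
    ring

/-- Gaussian averages as integrals against the heat kernel of the line. -/
theorem gaussAvg_eq_integral {a : ℝ} (hsupp : ∀ u v, a ≤ |u| → wt u v = 0)
    {τ : ℝ} (hτ : 0 < τ) (G : ℝ → ℂ) (y : ℝ) :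
    gaussAvg wt τ G y =
      ∫ u in (-a)..a, ((gaussKernel τ u * wt u (u / √τ) : ℝ) : ℂ) * G (y + u) := by
  have hs : 0 < √τ := Real.sqrt_pos.2 hτ
  set Φ : ℝ → ℂ := fun u =>
    ((√τ : ℝ) : ℂ) * (((gaussKernel τ u * wt u (u / √τ) : ℝ) : ℂ) * G (y + u)) with hΦ
  have h1 : gaussAvg wt τ G y = ∫ v : ℝ, Φ (√τ * v) := by
    refine MeasureTheory.integral_congr_ae (Eventually.of_forall fun v => ?_)
    simp only [hΦ]
    rw [mul_div_cancel_left₀ v hs.ne', gaussKernel_one_scale hτ v]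
    push_cast; ring
  rw [h1, MeasureTheory.Measure.integral_comp_mul_left, hΦ, MeasureTheory.integral_const_mul,
    abs_of_pos (inv_pos.2 hs), Complex.real_smul, ← mul_assoc, ← Complex.ofReal_mul,
    inv_mul_cancel₀ hs.ne', Complex.ofReal_one, one_mul]
  symm
  refine intervalIntegral.integral_eq_integral_of_support_subset fun u hu => ?_
  have : |u| < a := by
    by_contra hcon
    refine hu ?_
    simp only
    rw [hsupp u _ (not_lt.1 hcon)]
    simp
  rw [abs_lt] at this
  exact ⟨this.1, this.2.le⟩

end GaussAvg

/-! ### The cut-off heat kernel -/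

/-- A smooth function of `w = u²` that is `1` for `w ≤ ℓ²/3` and `0` for `w ≥ 2ℓ²/3`. -/
noncomputable def cutoff (ℓ w : ℝ) : ℝ := Real.smoothTransition (2 - 3 * w / ℓ ^ 2)

theorem contDiff_cutoff (ℓ : ℝ) : ContDiff ℝ ∞ (cutoff ℓ) := by
  unfold cutoff
  exact Real.smoothTransition.contDiff.comp (by fun_prop)

theorem cutoff_eq_zero {ℓ w : ℝ} (hℓ : 0 < ℓ) (hw : 2 * ℓ ^ 2 / 3 < w) : cutoff ℓ w = 0 := by
  refine Real.smoothTransition.zero_of_nonpos ?_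
  rw [sub_nonpos, le_div_iff₀ (by positivity)]
  linarith

theorem cutoff_zero (ℓ : ℝ) : cutoff ℓ 0 = 1 :=
  Real.smoothTransition.one_of_one_le (by norm_num)

theorem iteratedDeriv_cutoff_eq_zero {ℓ w : ℝ} (hℓ : 0 < ℓ) (hw : 2 * ℓ ^ 2 / 3 < w) (n : ℕ) :
    iteratedDeriv n (cutoff ℓ) w = 0 := by
  have : cutoff ℓ =ᶠ[𝓝 w] fun _ => 0 := by
    filter_upwards [Ioi_mem_nhds hw] with z hz using cutoff_eq_zero hℓ hz
  rw [this.iteratedDeriv_eq n]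
  simp

theorem continuous_iteratedDeriv_cutoff (ℓ : ℝ) (n : ℕ) :
    Continuous (iteratedDeriv n (cutoff ℓ)) :=
  (contDiff_cutoff ℓ).continuous_iteratedDeriv n (by exact_mod_cast le_top)

theorem hasDerivAt_iteratedDeriv_cutoff (ℓ : ℝ) (n : ℕ) (w : ℝ) :
    HasDerivAt (iteratedDeriv n (cutoff ℓ)) (iteratedDeriv (n + 1) (cutoff ℓ) w) w := by
  rw [iteratedDeriv_succ]
  exact ((contDiff_cutoff ℓ).differentiable_iteratedDeriv n
    (by exact_mod_cast WithTop.coe_lt_top _) w).hasDerivAt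

/-- The weight of the cut-off heat kernel. -/
noncomputable def heatWeight (ℓ u _v : ℝ) : ℝ := cutoff ℓ (u ^ 2)

/-- The weight of the defect of the cut-off heat kernel in the heat equation. -/
noncomputable def defectWeight (ℓ u v : ℝ) : ℝ :=
  2 * v ^ 2 * iteratedDeriv 1 (cutoff ℓ) (u ^ 2) - 2 * iteratedDeriv 1 (cutoff ℓ) (u ^ 2)
    - 4 * u ^ 2 * iteratedDeriv 2 (cutoff ℓ) (u ^ 2)

theorem two_thirds_lt_sq {ℓ u : ℝ} (hℓ : 0 < ℓ) (hu : 9 / 10 * ℓ ≤ |u|) :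
    2 * ℓ ^ 2 / 3 < u ^ 2 := by
  have h1 : (9 / 10 * ℓ) ^ 2 ≤ u ^ 2 := by
    rw [← sq_abs u]
    exact pow_le_pow_left₀ (by positivity) hu 2
  nlinarith [sq_pos_of_pos hℓ]

theorem heatWeight_supp {ℓ : ℝ} (hℓ : 0 < ℓ) (u v : ℝ) (hu : 9 / 10 * ℓ ≤ |u|) :
    heatWeight ℓ u v = 0 := cutoff_eq_zero hℓ (two_thirds_lt_sq hℓ hu)

theorem defectWeight_supp {ℓ : ℝ} (hℓ : 0 < ℓ) (u v : ℝ) (hu : 9 / 10 * ℓ ≤ |u|) :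
    defectWeight ℓ u v = 0 := by
  have := two_thirds_lt_sq hℓ hu
  rw [defectWeight, iteratedDeriv_cutoff_eq_zero hℓ this, iteratedDeriv_cutoff_eq_zero hℓ this]
  ring

theorem isWeight_heatWeight {ℓ : ℝ} (hℓ : 0 < ℓ) : IsWeight ℓ (heatWeight ℓ) where
  cont := (contDiff_cutoff ℓ).continuous.comp (continuous_fst.pow 2)
  bound := ⟨1, fun u v => by
    rw [heatWeight, cutoff, abs_of_nonneg (Real.smoothTransition.nonneg _)]
    nlinarith [Real.smoothTransition.le_one (2 - 3 * u ^ 2 / ℓ ^ 2), sq_nonneg v]⟩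
  supp := ⟨9 / 10 * ℓ, by positivity, by linarith, heatWeight_supp hℓ⟩
  even u v := by simp [heatWeight]

theorem isWeight_defectWeight {ℓ : ℝ} (hℓ : 0 < ℓ) : IsWeight ℓ (defectWeight ℓ) where
  cont := by
    have h1 : Continuous fun p : ℝ × ℝ => iteratedDeriv 1 (cutoff ℓ) (p.1 ^ 2) :=
      (continuous_iteratedDeriv_cutoff ℓ 1).comp (continuous_fst.pow 2)
    have h2 : Continuous fun p : ℝ × ℝ => iteratedDeriv 2 (cutoff ℓ) (p.1 ^ 2) :=
      (continuous_iteratedDeriv_cutoff ℓ 2).comp (continuous_fst.pow 2)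
    unfold defectWeight
    fun_prop
  bound := by
    obtain ⟨C₁, hC₁⟩ := (isCompact_Icc (a := -ℓ) (b := ℓ)).exists_bound_of_continuousOn
      (f := fun u => iteratedDeriv 1 (cutoff ℓ) (u ^ 2))
      ((continuous_iteratedDeriv_cutoff ℓ 1).comp (continuous_pow 2)).continuousOn
    obtain ⟨C₂, hC₂⟩ := (isCompact_Icc (a := -ℓ) (b := ℓ)).exists_bound_of_continuousOn
      (f := fun u => 4 * u ^ 2 * iteratedDeriv 2 (cutoff ℓ) (u ^ 2))
      (((continuous_const.mul (continuous_pow 2))).mul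
        ((continuous_iteratedDeriv_cutoff ℓ 2).comp (continuous_pow 2))).continuousOn
    have h0 : (0 : ℝ) ∈ Icc (-ℓ) ℓ := ⟨by linarith, hℓ.le⟩
    have hC₁0 : 0 ≤ C₁ := (norm_nonneg _).trans (hC₁ 0 h0)
    have hC₂0 : 0 ≤ C₂ := (norm_nonneg _).trans (hC₂ 0 h0)
    refine ⟨2 * C₁ + C₂, fun u v => ?_⟩
    rcases lt_or_ge |u| ℓ with hu | hu
    · have hu' : u ∈ Icc (-ℓ) ℓ := ⟨(abs_lt.1 hu).1.le, (abs_lt.1 hu).2.le⟩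
      have b1 := abs_le.1 (hC₁ u hu')
      have b2 := abs_le.1 (hC₂ u hu')
      rw [abs_le, defectWeight]
      constructor <;> nlinarith [sq_nonneg v]
    · rw [defectWeight_supp hℓ u v (by linarith), abs_zero]
      positivity
  supp := ⟨9 / 10 * ℓ, by positivity, by linarith, defectWeight_supp hℓ⟩
  even u v := by simp [defectWeight]

/-- The cut-off heat kernel solves the heat equation up to the defect, by two integrations by parts.
The functions need to be differentiable only within the distance `ℓ` from `y`. -/
theorem gaussAvg_heatWeight_hasDerivAt {ℓ : ℝ} (hℓ : 0 < ℓ) {G₀ G₁ G₂ : ℝ → ℂ}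
    (h₀ : Continuous G₀) (h₂ : Continuous G₂) {y : ℝ}
    (hd₀ : ∀ z, y - ℓ < z → z < y + ℓ → HasDerivAt G₀ (G₁ z) z)
    (hd₁ : ∀ z, y - ℓ < z → z < y + ℓ → HasDerivAt G₁ (G₂ z) z) {τ : ℝ} (hτ : 0 < τ) :
    HasDerivAt (fun τ => gaussAvg (heatWeight ℓ) τ G₀ y)
      (gaussAvg (heatWeight ℓ) τ G₂ y + gaussAvg (defectWeight ℓ) τ G₀ y) τ := by
  set a := 9 / 10 * ℓ with ha
  have ha0 : 0 < a := by positivity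
  set C : ℝ → ℝ := fun u => cutoff ℓ (u ^ 2)
  set C₁ : ℝ → ℝ := fun u => iteratedDeriv 1 (cutoff ℓ) (u ^ 2)
  set C₂ : ℝ → ℝ := fun u => iteratedDeriv 2 (cutoff ℓ) (u ^ 2)
  have hCc : Continuous C := (contDiff_cutoff ℓ).continuous.comp (continuous_pow 2)
  have hC₁c : Continuous C₁ := (continuous_iteratedDeriv_cutoff ℓ 1).comp (continuous_pow 2)
  have hC₂c : Continuous C₂ := (continuous_iteratedDeriv_cutoff ℓ 2).comp (continuous_pow 2)
  have hCd : ∀ u, HasDerivAt C (2 * u * C₁ u) u := fun u => by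
    have h1 := hasDerivAt_iteratedDeriv_cutoff ℓ 0 (u ^ 2)
    rw [iteratedDeriv_zero] at h1
    have := HasDerivAt.comp (h₂ := cutoff ℓ) (h := fun u => u ^ 2) u h1 (hasDerivAt_pow 2 u)
    refine this.congr_deriv ?_
    simp only [C₁]; norm_num; ring
  have hC₁d : ∀ u, HasDerivAt C₁ (2 * u * C₂ u) u := fun u => by
    have := HasDerivAt.comp (h₂ := iteratedDeriv 1 (cutoff ℓ)) (h := fun u => u ^ 2) u
      (hasDerivAt_iteratedDeriv_cutoff ℓ 1 (u ^ 2)) (hasDerivAt_pow 2 u)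
    refine this.congr_deriv ?_
    simp only [C₂]; norm_num; ring
  -- the cut-off kernel as a function of `u`, with its first two derivatives
  set w : ℝ → ℝ := fun u => gaussKernel τ u * C u with hw
  set w₁ : ℝ → ℝ := fun u => gaussKernel τ u * (2 * u * C₁ u - u / (2 * τ) * C u) with hw₁
  set w₂ : ℝ → ℝ := fun u => gaussKernel τ u *
    ((u ^ 2 / (4 * τ ^ 2) - 1 / (2 * τ)) * C u - 2 * (u ^ 2 / τ) * C₁ u + 2 * C₁ u
      + 4 * u ^ 2 * C₂ u) with hw₂
  have hwd : ∀ u, HasDerivAt w (w₁ u) u := fun u => by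
    refine ((gaussKernel_hasDerivAt_right hτ u).mul (hCd u)).congr_deriv ?_
    simp only [hw₁]; ring
  have hw₁d : ∀ u, HasDerivAt w₁ (w₂ u) u := fun u => by
    have h1 := (((hasDerivAt_id u).const_mul 2).mul (hC₁d u)).sub
      (((hasDerivAt_id u).div_const (2 * τ)).mul (hCd u))
    refine ((gaussKernel_hasDerivAt_right hτ u).mul h1).congr_deriv ?_
    simp only [hw₂, id, Pi.sub_apply, Pi.mul_apply]
    field_simp
    ring
  have hK := continuous_gaussKernel τ
  have hwc : Continuous w := hK.mul hCc
  have hw₂c : Continuous w₂ := by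
    simp only [hw₂]
    fun_prop
  have hend : ∀ u, |u| = a → w u = 0 ∧ w₁ u = 0 := by
    intro u hu
    have h1 := two_thirds_lt_sq hℓ hu.ge
    have h2 : C u = 0 := cutoff_eq_zero hℓ h1
    have h3 : C₁ u = 0 := iteratedDeriv_cutoff_eq_zero hℓ h1 1
    simp [hw, hw₁, h2, h3]
  have hrange : ∀ u ∈ Icc (-a) a, y - ℓ < y + u ∧ y + u < y + ℓ := fun u hu =>
    ⟨by linarith [hu.1], by linarith [hu.2]⟩
  have hyc : Continuous fun u : ℝ => y + u := by fun_prop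
  have hofR : ∀ {φ : ℝ → ℝ}, Continuous φ → Continuous fun u => ((φ u : ℝ) : ℂ) :=
    fun h => Complex.continuous_ofReal.comp h
  have i1 : IntervalIntegrable (fun u => ((w u : ℝ) : ℂ) * G₂ (y + u))
      MeasureTheory.volume (-a) a := ((hofR hwc).mul (h₂.comp hyc)).intervalIntegrable _ _
  have i2 : IntervalIntegrable (fun u => ((w₂ u : ℝ) : ℂ) * G₀ (y + u))
      MeasureTheory.volume (-a) a := ((hofR hw₂c).mul (h₀.comp hyc)).intervalIntegrable _ _
  -- integration by parts: `w G₁ - w₁ G₀` is a primitive and vanishes at `±a`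
  have hparts : ∫ u in (-a)..a, (((w u : ℝ) : ℂ) * G₂ (y + u) - ((w₂ u : ℝ) : ℂ) * G₀ (y + u))
      = 0 := by
    have hde : ∀ u ∈ Icc (-a) a,
        HasDerivAt (fun u => ((w u : ℝ) : ℂ) * G₁ (y + u) - ((w₁ u : ℝ) : ℂ) * G₀ (y + u))
          (((w u : ℝ) : ℂ) * G₂ (y + u) - ((w₂ u : ℝ) : ℂ) * G₀ (y + u)) u := by
      intro u hu
      obtain ⟨r1, r2⟩ := hrange u hu
      have e1 := (hwd u).ofReal_comp.mul ((hd₁ _ r1 r2).comp_const_add y u)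
      have e2 := (hw₁d u).ofReal_comp.mul ((hd₀ _ r1 r2).comp_const_add y u)
      refine (e1.sub e2).congr_deriv ?_
      ring
    rw [intervalIntegral.integral_eq_sub_of_hasDerivAt_of_le (by linarith)
      (fun u hu => (hde u hu).continuousAt.continuousWithinAt)
      (fun u hu => hde u (Ioo_subset_Icc_self hu)) (i1.sub i2)]
    obtain ⟨p1, p2⟩ := hend a (abs_of_pos ha0)
    obtain ⟨p3, p4⟩ := hend (-a) (by rw [abs_neg, abs_of_pos ha0])
    rw [p1, p2, p3, p4]
    simp
  have hgoal : gaussAvg (heatWeight ℓ) τ G₂ y + gaussAvg (defectWeight ℓ) τ G₀ y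
      = ∫ u in (-a)..a, (((u ^ 2 / (4 * τ ^ 2) - 1 / (2 * τ)) * gaussKernel τ u * C u : ℝ) : ℂ)
          * G₀ (y + u) := by
    rw [gaussAvg_eq_integral (heatWeight_supp hℓ) hτ,
      gaussAvg_eq_integral (defectWeight_supp hℓ) hτ]
    have e1 : ∫ u in (-a)..a, ((gaussKernel τ u * heatWeight ℓ u (u / √τ) : ℝ) : ℂ) * G₂ (y + u)
        = ∫ u in (-a)..a, ((w₂ u : ℝ) : ℂ) * G₀ (y + u) := by
      rw [intervalIntegral.integral_sub i1 i2] at hparts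
      exact sub_eq_zero.1 hparts
    rw [e1, ← intervalIntegral.integral_add i2]
    · refine intervalIntegral.integral_congr fun u _ => ?_
      have hsq : (u / √τ) ^ 2 = u ^ 2 / τ := by rw [div_pow, Real.sq_sqrt hτ.le]
      simp only [defectWeight, hsq, hw₂]
      rw [← add_mul, ← Complex.ofReal_add]
      congr 2
      simp only [C, C₁, C₂]
      ring
    · refine Continuous.intervalIntegrable ((hofR (hK.mul ?_)).mul (h₀.comp hyc)) _ _
      exact (isWeight_defectWeight hℓ).cont.comp (f := fun u => (u, u / √τ)) (by fun_prop)
  rw [hgoal]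
  have hmain : HasDerivAt (fun τ => ∫ u in (-a)..a, ((gaussKernel τ u * C u : ℝ) : ℂ) *
      G₀ (y + u)) (∫ u in (-a)..a,
        (((u ^ 2 / (4 * τ ^ 2) - 1 / (2 * τ)) * gaussKernel τ u * C u : ℝ) : ℂ)
          * G₀ (y + u)) τ := by
    refine hasDerivAt_intervalIntegral_of_continuousOn (by linarith) (Ioi_mem_nhds hτ)
      (f := fun τ u => ((gaussKernel τ u * C u : ℝ) : ℂ) * G₀ (y + u))
      (f' := fun τ u => (((u ^ 2 / (4 * τ ^ 2) - 1 / (2 * τ)) * gaussKernel τ u * C u : ℝ) : ℂ)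
          * G₀ (y + u)) ?_ ?_ ?_
    · exact fun r _ => ((hofR ((continuous_gaussKernel r).mul hCc)).mul
        (h₀.comp hyc)).continuousOn
    · have c1 : ContinuousOn (fun p : ℝ × ℝ => gaussKernel p.1 p.2) (Ioi 0 ×ˢ Icc (-a) a) := by
        intro p hp
        have hp1 : (0 : ℝ) < p.1 := hp.1
        unfold gaussKernel
        have : √(4 * π * p.1) ≠ 0 := (Real.sqrt_pos.2 (by positivity)).ne'
        have : 4 * p.1 ≠ 0 := by positivity
        fun_prop (disch := assumption)
      have c2 : ContinuousOn (fun p : ℝ × ℝ => p.2 ^ 2 / (4 * p.1 ^ 2) - 1 / (2 * p.1))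
          (Ioi 0 ×ˢ Icc (-a) a) := by
        intro p hp
        have hp1 : (0 : ℝ) < p.1 := hp.1
        have : 4 * p.1 ^ 2 ≠ 0 := by positivity
        have : 2 * p.1 ≠ 0 := by positivity
        fun_prop (disch := assumption)
      have c3 : ContinuousOn (fun p : ℝ × ℝ => C p.2) (Ioi 0 ×ˢ Icc (-a) a) :=
        (hCc.comp continuous_snd).continuousOn
      exact (Complex.continuous_ofReal.comp_continuousOn ((c2.mul c1).mul c3)).mul
        ((h₀.comp (by fun_prop : Continuous fun p : ℝ × ℝ => y + p.2)).continuousOn)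
    · intro r hr u _
      exact (((gaussKernel_hasDerivAt_left hr u).mul_const (C u)).ofReal_comp).mul_const _
  refine hmain.congr_of_eventuallyEq ?_
  filter_upwards [Ioi_mem_nhds hτ] with r hr
  exact gaussAvg_eq_integral (heatWeight_supp hℓ) hr G₀ y

/-! ### Averaging operators on the graph -/

theorem gaussAvg_sum {ι : Type*} (s : Finset ι) {ℓ : ℝ} {wt : ℝ → ℝ → ℝ} (hwt : IsWeight ℓ wt)
    {c : ι → ℂ} {G : ι → ℝ → ℂ} (hG : ∀ i, Continuous (G i)) {M : ℝ} (hM : ∀ i y, ‖G i y‖ ≤ M)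
    (τ y : ℝ) :
    gaussAvg wt τ (fun z => ∑ i ∈ s, c i * G i z) y = ∑ i ∈ s, c i * gaussAvg wt τ (G i) y := by
  simp only [gaussAvg, Finset.mul_sum, ← MeasureTheory.integral_const_mul]
  rw [← MeasureTheory.integral_finsetSum s fun i _ =>
    (integrable_gaussAvg hwt (hG i) (hM i) τ y).const_mul (c i)]
  refine MeasureTheory.integral_congr_ae (Eventually.of_forall fun v => ?_)
  exact Finset.sum_congr rfl fun i _ => by ring

namespace MetricGraph

variable {V E : Type*} [Fintype E] {Γ : MetricGraph V E} {S : E × Bool → E × Bool → ℂ}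
  {ℓ : ℝ} {wt : ℝ → ℝ → ℝ}

theorem continuous_gaussAvg_ext (hwt : IsWeight ℓ wt) (g : Γ.stateSpace S) (j : Fin 3) (f : E) :
    Continuous fun p : ℝ × ℝ => gaussAvg wt p.1 (Γ.ext S g j f) p.2 :=
  continuous_gaussAvg hwt (continuous_ext g j f) (norm_ext_le (S := S) (g : Γ.Jet) j f)

/-- The Gaussian averages of a continued function and of its derivatives. -/
noncomputable def avgJet (hwt : IsWeight ℓ wt) (τ : ℝ) (g : Γ.stateSpace S) : Γ.Jet := fun j f =>
  ⟨fun y => gaussAvg wt τ (Γ.ext S g j f) y,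
    (continuous_gaussAvg_ext hwt g j f).comp (continuous_const.prodMk continuous_subtype_val)⟩

theorem ev_avgJet (hwt : IsWeight ℓ wt) (τ : ℝ) (g : Γ.stateSpace S) (j : Fin 3) (f : E) {y : ℝ}
    (hy : y ∈ Icc 0 (Γ.len f)) :
    Γ.ev (avgJet hwt τ g) j f y = gaussAvg wt τ (Γ.ext S g j f) y := Γ.ev_apply _ j f hy

theorem bond_avgJet (hwt : IsWeight ℓ wt) (hℓ : ∀ f, ℓ ≤ Γ.len f) (τ : ℝ) (g : Γ.stateSpace S)
    (j : Fin 3) (h : E × Bool) :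
    Γ.bond (avgJet hwt τ g) j h 0 = gaussAvg wt τ (Γ.extBond S g j h) 0 := by
  rw [bond, pos_zero, ev_avgJet hwt τ g j h.1 (Γ.endPos_mem h), ← gaussAvg_const_mul]
  refine gaussAvg_congr hwt (ε := sgn h) (by unfold sgn; split_ifs <;> simp) (fun u hu => ?_) τ
  rw [← pos_eq, ext_pos, zero_add]
  exact (le_abs_self u).trans (hu.le.trans (hℓ _))

variable [DecidableEq E]

/-- By the reflection symmetry of the continued functions, Gaussian averaging preserves the vertex
conditions. -/
theorem avgJet_mem (hS : Γ.IsScattering S) (hwt : IsWeight ℓ wt) (hℓ : ∀ f, ℓ ≤ Γ.len f) (τ : ℝ)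
    (g : Γ.stateSpace S) : avgJet hwt τ g ∈ Γ.stateSpace S := by
  refine mem_stateSpace (fun j f y hy => ?_) (fun j h => ?_)
  · have h1 := gaussAvg_hasDerivAt hwt (continuous_ext g j.castSucc f)
      (continuous_ext g j.succ f) (norm_ext_le (S := S) (g : Γ.Jet) _ f)
      (norm_ext_le (S := S) (g : Γ.Jet) _ f) (y := y)
      (fun z hz hz' => ext_hasDerivAt g j f hℓ (by linarith [hy.1]) (by linarith [hy.2])) τ
    rw [ev_avgJet hwt τ g _ f hy]
    exact h1.hasDerivWithinAt.congr (fun z hz => ev_avgJet hwt τ g _ f hz)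
      (ev_avgJet hwt τ g _ f hy)
  · simp only [bond_avgJet hwt hℓ]
    rw [← gaussAvg_sum Finset.univ hwt (fun h' => continuous_extBond g j h')
      (norm_extBond_le (S := S) (g : Γ.Jet) j), ← gaussAvg_const_mul]
    refine gaussAvg_congr hwt (ε := -1) (Or.inr rfl) (fun u _ => ?_) τ
    rw [sum_mul_extBond hS]
    simp

/-- Gaussian averaging of continued functions, as an operator of the state space. -/
noncomputable def avgOp (hS : Γ.IsScattering S) (hwt : IsWeight ℓ wt) (hℓ : ∀ f, ℓ ≤ Γ.len f)
    (τ : ℝ) : Γ.stateSpace S →ₗ[ℂ] Γ.stateSpace S where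
  toFun g := ⟨avgJet hwt τ g, avgJet_mem hS hwt hℓ τ g⟩
  map_add' g g' := by
    refine Subtype.ext ?_
    funext j f
    ext y
    refine Eq.trans ?_ (gaussAvg_add hwt (continuous_ext g j f) (continuous_ext g' j f)
      (norm_ext_le (S := S) (g : Γ.Jet) j f) (norm_ext_le (S := S) (g' : Γ.Jet) j f) τ y)
    show gaussAvg wt τ (Γ.ext S ((g + g' : Γ.stateSpace S) : Γ.Jet) j f) y = _
    congr 1
    funext z
    exact ext_add (g : Γ.Jet) g' j f z
  map_smul' c g := by
    refine Subtype.ext ?_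
    funext j f
    ext y
    refine Eq.trans ?_ (gaussAvg_const_mul c (Γ.ext S g j f) τ y)
    show gaussAvg wt τ (Γ.ext S ((c • g : Γ.stateSpace S) : Γ.Jet) j f) y = _
    congr 1
    funext z
    exact ext_smul c (g : Γ.Jet) j f z

theorem exists_norm_avgOp_le (hS : Γ.IsScattering S) (hwt : IsWeight ℓ wt)
    (hℓ : ∀ f, ℓ ≤ Γ.len f) :
    ∃ M, 0 ≤ M ∧ ∀ τ (g : Γ.stateSpace S), ‖avgOp hS hwt hℓ τ g‖ ≤ M * ‖g‖ := by
  obtain ⟨C, hC⟩ := hwt.bound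
  set K := 1 + ∑ h, ∑ h', ‖S h h'‖
  set I := ∫ v : ℝ, gaussKernel 1 v * (1 + v ^ 2)
  have hC0 : 0 ≤ C := by simpa using (abs_nonneg _).trans (hC 0 0)
  have hK0 : 0 ≤ K := by positivity
  have hI0 : 0 ≤ I := MeasureTheory.integral_nonneg fun v =>
    mul_nonneg (gaussKernel_nonneg 1 v) (by positivity)
  refine ⟨C * K * I, by positivity, fun τ g => ?_⟩
  have h0 : 0 ≤ C * K * I * ‖g‖ := by positivity
  refine (pi_norm_le_iff_of_nonneg h0).2 fun j => (pi_norm_le_iff_of_nonneg h0).2 fun f =>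
    (ContinuousMap.norm_le _ h0).2 fun y => ?_
  refine (norm_gaussAvg_le hC (norm_ext_le (S := S) (g : Γ.Jet) j f) τ y).trans ?_
  refine le_of_eq ?_
  show C * (K * ‖g‖) * I = _
  ring

theorem continuous_avgOp_left (hS : Γ.IsScattering S) (hwt : IsWeight ℓ wt)
    (hℓ : ∀ f, ℓ ≤ Γ.len f) (g : Γ.stateSpace S) : Continuous fun τ => avgOp hS hwt hℓ τ g := by
  refine Continuous.subtype_mk (continuous_pi fun j => continuous_pi fun f => ?_) _
  refine ContinuousMap.continuous_of_continuous_uncurry _ ?_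
  exact (continuous_gaussAvg_ext hwt g j f).comp
    (continuous_fst.prodMk (continuous_subtype_val.comp continuous_snd))

/-- A strongly continuous and uniformly bounded family of operators is jointly continuous. -/
theorem continuous_uncurry_of_bound {X Y : Type*} [NormedAddCommGroup X] [NormedSpace ℂ X]
    [TopologicalSpace Y] {T : Y → X →ₗ[ℂ] X} {M : ℝ} (hM : ∀ τ g, ‖T τ g‖ ≤ M * ‖g‖)
    (hT : ∀ g, Continuous fun τ => T τ g) : Continuous fun p : Y × X => T p.1 p.2 := by
  refine continuous_iff_continuousAt.2 fun ⟨τ₀, g₀⟩ => ?_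
  have h1 : Tendsto (fun p : Y × X => M * ‖p.2 - g₀‖ + ‖T p.1 g₀ - T τ₀ g₀‖) (𝓝 (τ₀, g₀))
      (𝓝 0) := by
    have : Continuous fun p : Y × X => M * ‖p.2 - g₀‖ + ‖T p.1 g₀ - T τ₀ g₀‖ := by
      have := (hT g₀).comp (continuous_fst (X := Y) (Y := X))
      exact (continuous_const.mul (continuous_snd.sub continuous_const).norm).add
        (this.sub continuous_const).norm
    simpa using this.tendsto (τ₀, g₀)
  refine tendsto_iff_norm_sub_tendsto_zero.2 (squeeze_zero (fun _ => norm_nonneg _) ?_ h1)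
  rintro ⟨τ, g⟩
  have : T τ g - T τ₀ g₀ = T τ (g - g₀) + (T τ g₀ - T τ₀ g₀) := by rw [map_sub]; abel
  show ‖T τ g - T τ₀ g₀‖ ≤ _
  rw [this]
  exact (norm_add_le _ _).trans (add_le_add (hM _ _) le_rfl)

/-- The cut-off heat kernel solves the heat equation up to a bounded defect. -/
theorem ev_avgOp_eq (hS : Γ.IsScattering S) (hℓ0 : 0 < ℓ) (hℓ : ∀ f, ℓ ≤ Γ.len f)
    (g : Γ.stateSpace S) (f : E) {y : ℝ} (hy : y ∈ Icc 0 (Γ.len f)) {τ : ℝ} (hτ : 0 ≤ τ) :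
    Γ.ev (avgOp hS (isWeight_heatWeight hℓ0) hℓ τ g : Γ.Jet) 0 f y = Γ.ev (g : Γ.Jet) 0 f y +
      ∫ u in (0 : ℝ)..τ, (Γ.ev (avgOp hS (isWeight_heatWeight hℓ0) hℓ u g : Γ.Jet) 2 f y
        + Γ.ev (avgOp hS (isWeight_defectWeight hℓ0) hℓ u g : Γ.Jet) 0 f y) := by
  have e : ∀ {wt : ℝ → ℝ → ℝ} (hwt : IsWeight ℓ wt) u j,
      Γ.ev (avgOp hS hwt hℓ u g : Γ.Jet) j f y = gaussAvg wt u (Γ.ext S g j f) y :=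
    fun hwt u j => ev_avgJet hwt u g j f hy
  simp only [e]
  have hc : ∀ {wt : ℝ → ℝ → ℝ} (hwt : IsWeight ℓ wt) j,
      Continuous fun u => gaussAvg wt u (Γ.ext S g j f) y := fun hwt j =>
    (continuous_gaussAvg_ext hwt g j f).comp (continuous_id.prodMk continuous_const)
  have h0 : gaussAvg (heatWeight ℓ) 0 (Γ.ext S g 0 f) y = Γ.ev (g : Γ.Jet) 0 f y := by
    simp only [gaussAvg, Real.sqrt_zero, zero_mul, add_zero, heatWeight]
    rw [zero_pow two_ne_zero, cutoff_zero, MeasureTheory.integral_mul_const,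
      ext_of_mem _ _ _ hy]
    simp only [mul_one]
    rw [integral_complex_ofReal, integral_gaussKernel_one]
    simp
  rw [intervalIntegral.integral_eq_sub_of_hasDerivAt_of_le hτ
    (f := fun u => gaussAvg (heatWeight ℓ) u (Γ.ext S g 0 f) y)
    (f' := fun u => gaussAvg (heatWeight ℓ) u (Γ.ext S g 2 f) y
      + gaussAvg (defectWeight ℓ) u (Γ.ext S g 0 f) y)
    (hc (isWeight_heatWeight hℓ0) 0).continuousOn (fun u hu => ?_)
    (((hc (isWeight_heatWeight hℓ0) 2).add (hc (isWeight_defectWeight hℓ0) 0)).intervalIntegrable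
      _ _), h0]
  · ring
  · exact gaussAvg_heatWeight_hasDerivAt hℓ0 (continuous_ext g 0 f) (continuous_ext g 2 f)
      (fun z hz hz' => ext_hasDerivAt g 0 f hℓ (by linarith [hy.1]) (by linarith [hy.2]))
      (fun z hz hz' => ext_hasDerivAt g 1 f hℓ (by linarith [hy.1]) (by linarith [hy.2])) hu.1

end MetricGraph

/-! ### Multiplication by the potential -/

namespace MetricGraph

variable {V E : Type*} {Γ : MetricGraph V E} {S : E × Bool → E × Bool → ℂ}

theorem IsSmoothPotential.hasDerivWithinAt {U : E → ℝ → ℝ} (hU : Γ.IsSmoothPotential U) (j : ℕ)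
    (f : E) {y : ℝ} (hy : y ∈ Icc 0 (Γ.len f)) :
    HasDerivWithinAt (Γ.edgeDeriv U j f) (Γ.edgeDeriv U (j + 1) f y) (Icc 0 (Γ.len f)) y :=
  ContDiffOn.hasDerivWithinAt_iteratedDerivWithin (Γ.len_pos f) (n := ⊤) (hU.contDiffOn f)
    (WithTop.coe_lt_top j) hy

theorem IsSmoothPotential.continuousOn {U : E → ℝ → ℝ} (hU : Γ.IsSmoothPotential U) (j : ℕ)
    (f : E) : ContinuousOn (Γ.edgeDeriv U j f) (Icc 0 (Γ.len f)) := fun _ hy =>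
  (hU.hasDerivWithinAt j f hy).continuousWithinAt

theorem edgeDeriv_zero {F : Type*} [NormedAddCommGroup F] [NormedSpace ℝ F] (U : E → ℝ → F)
    (f : E) (y : ℝ) : Γ.edgeDeriv U 0 f y = U f y := by
  rw [edgeDeriv, iteratedDerivWithin_zero]

/-- A derivative of the potential, as a continuous function on a closed edge. -/
noncomputable def potJet {U : E → ℝ → ℝ} (hU : Γ.IsSmoothPotential U) (j : ℕ) (f : E) :
    C(Icc (0 : ℝ) (Γ.len f), ℂ) :=
  ⟨fun y => ((Γ.edgeDeriv U j f y : ℝ) : ℂ),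
    Complex.continuous_ofReal.comp (continuousOn_iff_continuous_domRestrict.1 (hU.continuousOn j f))⟩

/-- Multiplication of a jet by the potential, by the Leibniz rule. -/
noncomputable def mulJet {U : E → ℝ → ℝ} (hU : Γ.IsSmoothPotential U) (g : Γ.Jet) : Γ.Jet :=
  ![fun f => potJet hU 0 f * g 0 f,
    fun f => potJet hU 1 f * g 0 f + potJet hU 0 f * g 1 f,
    fun f => potJet hU 2 f * g 0 f + 2 * (potJet hU 1 f * g 1 f) + potJet hU 0 f * g 2 f]

theorem ev_mulJet_zero {U : E → ℝ → ℝ} (hU : Γ.IsSmoothPotential U) (g : Γ.Jet) (f : E) {y : ℝ}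
    (hy : y ∈ Icc 0 (Γ.len f)) :
    Γ.ev (mulJet hU g) 0 f y = (Γ.edgeDeriv U 0 f y : ℝ) * Γ.ev g 0 f y := by
  rw [ev_apply _ _ _ _ hy, ev_apply _ _ _ _ hy]; rfl

theorem ev_mulJet_one {U : E → ℝ → ℝ} (hU : Γ.IsSmoothPotential U) (g : Γ.Jet) (f : E) {y : ℝ}
    (hy : y ∈ Icc 0 (Γ.len f)) :
    Γ.ev (mulJet hU g) 1 f y = (Γ.edgeDeriv U 1 f y : ℝ) * Γ.ev g 0 f y
      + (Γ.edgeDeriv U 0 f y : ℝ) * Γ.ev g 1 f y := by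
  rw [ev_apply _ _ _ _ hy, ev_apply _ _ _ _ hy, ev_apply _ _ _ _ hy]; rfl

theorem ev_mulJet_two {U : E → ℝ → ℝ} (hU : Γ.IsSmoothPotential U) (g : Γ.Jet) (f : E) {y : ℝ}
    (hy : y ∈ Icc 0 (Γ.len f)) :
    Γ.ev (mulJet hU g) 2 f y = (Γ.edgeDeriv U 2 f y : ℝ) * Γ.ev g 0 f y
      + 2 * ((Γ.edgeDeriv U 1 f y : ℝ) * Γ.ev g 1 f y) + (Γ.edgeDeriv U 0 f y : ℝ) * Γ.ev g 2 f y := by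
  rw [ev_apply _ _ _ _ hy, ev_apply _ _ _ _ hy, ev_apply _ _ _ _ hy, ev_apply _ _ _ _ hy]; rfl

theorem endDeriv_eq {F : Type*} [NormedAddCommGroup F] [NormedSpace ℝ F] (U : E → ℝ → F) (j : ℕ)
    (h : E × Bool) : Γ.endDeriv U j h = (sgn h ^ j) • Γ.edgeDeriv U j h.1 (Γ.endPos h) := rfl

theorem IsSmoothPotential.edgeDeriv_odd {U : E → ℝ → ℝ} (hU : Γ.IsSmoothPotential U) (l : ℕ)
    (h : E × Bool) : Γ.edgeDeriv U (2 * l + 1) h.1 (Γ.endPos h) = 0 := by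
  have h1 := hU.odd_eq_zero l h
  rw [endDeriv_eq, smul_eq_zero] at h1
  refine h1.resolve_left (pow_ne_zero _ ?_)
  unfold sgn; split_ifs <;> norm_num

theorem sgn_pow_even (h : E × Bool) (l : ℕ) : sgn h ^ (2 * l) = 1 := by
  rw [pow_mul, sq, sgn_mul_self, one_pow]

theorem IsSmoothPotential.edgeDeriv_even {U : E → ℝ → ℝ} (hU : Γ.IsSmoothPotential U) (l : ℕ)
    {h h' : E × Bool} (hv : Γ.vert h' = Γ.vert h) :
    Γ.edgeDeriv U (2 * l) h'.1 (Γ.endPos h') = Γ.edgeDeriv U (2 * l) h.1 (Γ.endPos h) := by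
  have h1 := hU.even_eq l h' h hv
  rwa [endDeriv_eq, endDeriv_eq, sgn_pow_even, sgn_pow_even, one_smul, one_smul] at h1

variable [Fintype E] [DecidableEq E]

/-- As the odd derivatives of the potential vanish at the vertices and the even ones are continuous,
multiplication by the potential preserves the vertex conditions. -/
theorem mulJet_mem (hS : Γ.IsScattering S) {U : E → ℝ → ℝ} (hU : Γ.IsSmoothPotential U)
    (g : Γ.stateSpace S) : mulJet hU g ∈ Γ.stateSpace S := by
  have hd : ∀ (j : ℕ) (f : E), ∀ y ∈ Icc 0 (Γ.len f),
      HasDerivWithinAt (fun y => ((Γ.edgeDeriv U j f y : ℝ) : ℂ)) ((Γ.edgeDeriv U (j + 1) f y : ℝ) : ℂ)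
        (Icc 0 (Γ.len f)) y := fun j f y hy => (hU.hasDerivWithinAt j f hy).ofReal_comp
  refine mem_stateSpace (fun j f y hy => ?_) (fun j h => ?_)
  · have hg := fun i : Fin 2 => ev_hasDerivWithinAt g i f hy
    have hg0 : HasDerivWithinAt (Γ.ev g 0 f) (Γ.ev g 1 f y) (Icc 0 (Γ.len f)) y := hg 0
    have hg1 : HasDerivWithinAt (Γ.ev g 1 f) (Γ.ev g 2 f y) (Icc 0 (Γ.len f)) y := hg 1
    fin_cases j
    · refine HasDerivWithinAt.congr_deriv (((hd 0 f y hy).mul hg0).congr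
        (fun z hz => ev_mulJet_zero hU _ f hz) (ev_mulJet_zero hU _ f hy)) ?_
      exact (ev_mulJet_one hU _ f hy).symm
    · refine HasDerivWithinAt.congr_deriv ((((hd 1 f y hy).mul hg0).add
        ((hd 0 f y hy).mul hg1)).congr
        (fun z hz => ev_mulJet_one hU _ f hz) (ev_mulJet_one hU _ f hy)) ?_
      refine Eq.trans ?_ (ev_mulJet_two hU _ f hy).symm
      norm_num
      ring
  · set u : ℕ → E × Bool → ℂ := fun i h => (Γ.edgeDeriv U i h.1 (Γ.endPos h) : ℝ)
    have hu1 : ∀ h, ((Γ.edgeDeriv U 1 h.1 (Γ.endPos h) : ℝ) : ℂ) = 0 := fun h => by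
      exact_mod_cast hU.edgeDeriv_odd 0 h
    have b0 : ∀ h, Γ.bond (mulJet hU g) 0 h 0 = u 0 h * Γ.bond g 0 h 0 := fun h => by
      simp only [bond, pos_zero, u]
      rw [ev_mulJet_zero hU _ _ (Γ.endPos_mem h)]
      ring
    have b1 : ∀ h, Γ.bond (mulJet hU g) 1 h 0 = u 0 h * Γ.bond g 1 h 0 := fun h => by
      simp only [bond, pos_zero, u]
      rw [ev_mulJet_one hU _ _ (Γ.endPos_mem h), hu1]
      ring
    have hs : ∀ h : E × Bool, ((sgn h : ℝ) : ℂ) ^ 2 = 1 := fun h => by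
      exact_mod_cast sgn_pow_even h 1
    have b2 : ∀ h, Γ.bond (mulJet hU g) 2 h 0
        = u 2 h * Γ.bond g 0 h 0 + u 0 h * Γ.bond g 2 h 0 := fun h => by
      simp only [bond, pos_zero, u]
      rw [ev_mulJet_two hU _ _ (Γ.endPos_mem h), hu1]
      simp only [Fin.val_two, Fin.val_zero, Complex.ofReal_pow, hs]
      ring
    have hSu : ∀ l h', S h h' * u (2 * l) h' = u (2 * l) h * S h h' := fun l h' => by
      rcases eq_or_ne (S h h') 0 with h0 | h0
      · rw [h0]; ring
      · simp only [u]
        rw [hU.edgeDeriv_even l (hS.vert_eq h h' h0), mul_comm]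
    have hsum : ∀ l i, ∑ h', S h h' * (u (2 * l) h' * Γ.bond g i h' 0)
        = (-1) ^ (i : ℕ) * (u (2 * l) h * Γ.bond g i h 0) := fun l i => by
      calc _ = u (2 * l) h * ∑ h', S h h' * Γ.bond g i h' 0 := by
            rw [Finset.mul_sum]
            exact Finset.sum_congr rfl fun h' _ => by rw [← mul_assoc, hSu, mul_assoc]
        _ = _ := by rw [g.2.2 i h]; ring
    fin_cases j
    · show ∑ h', S h h' * Γ.bond (mulJet hU g) 0 h' 0 = _ * Γ.bond (mulJet hU g) 0 h 0
      simp only [b0]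
      exact hsum 0 0
    · show ∑ h', S h h' * Γ.bond (mulJet hU g) 1 h' 0 = _ * Γ.bond (mulJet hU g) 1 h 0
      simp only [b1]
      exact hsum 0 1
    · show ∑ h', S h h' * Γ.bond (mulJet hU g) 2 h' 0 = _ * Γ.bond (mulJet hU g) 2 h 0
      simp only [b2, mul_add, Finset.sum_add_distrib]
      have e1 := hsum 1 0
      have e2 := hsum 0 2
      simp only [Fin.val_two, Fin.val_zero] at e1 e2 ⊢
      norm_num at e1 e2 ⊢
      rw [e1, e2]

/-- Multiplication by the potential, as an operator of the state space. -/
noncomputable def mulOp (hS : Γ.IsScattering S) {U : E → ℝ → ℝ} (hU : Γ.IsSmoothPotential U) :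
    Γ.stateSpace S →ₗ[ℂ] Γ.stateSpace S where
  toFun g := ⟨mulJet hU g, mulJet_mem hS hU g⟩
  map_add' g g' := by
    refine Subtype.ext ?_
    funext j f
    obtain rfl | rfl | rfl : j = 0 ∨ j = 1 ∨ j = 2 := by omega
    · show potJet hU 0 f * ((g : Γ.Jet) 0 f + (g' : Γ.Jet) 0 f)
        = potJet hU 0 f * (g : Γ.Jet) 0 f + potJet hU 0 f * (g' : Γ.Jet) 0 f
      ring
    · show potJet hU 1 f * ((g : Γ.Jet) 0 f + (g' : Γ.Jet) 0 f)
          + potJet hU 0 f * ((g : Γ.Jet) 1 f + (g' : Γ.Jet) 1 f)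
        = (potJet hU 1 f * (g : Γ.Jet) 0 f + potJet hU 0 f * (g : Γ.Jet) 1 f)
          + (potJet hU 1 f * (g' : Γ.Jet) 0 f + potJet hU 0 f * (g' : Γ.Jet) 1 f)
      ring
    · show potJet hU 2 f * ((g : Γ.Jet) 0 f + (g' : Γ.Jet) 0 f)
          + 2 * (potJet hU 1 f * ((g : Γ.Jet) 1 f + (g' : Γ.Jet) 1 f))
          + potJet hU 0 f * ((g : Γ.Jet) 2 f + (g' : Γ.Jet) 2 f)
        = (potJet hU 2 f * (g : Γ.Jet) 0 f + 2 * (potJet hU 1 f * (g : Γ.Jet) 1 f)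
            + potJet hU 0 f * (g : Γ.Jet) 2 f)
          + (potJet hU 2 f * (g' : Γ.Jet) 0 f + 2 * (potJet hU 1 f * (g' : Γ.Jet) 1 f)
            + potJet hU 0 f * (g' : Γ.Jet) 2 f)
      ring
  map_smul' c g := by
    refine Subtype.ext ?_
    funext j f
    obtain rfl | rfl | rfl : j = 0 ∨ j = 1 ∨ j = 2 := by omega
    · exact mul_smul_comm c (potJet hU 0 f) ((g : Γ.Jet) 0 f)
    · show potJet hU 1 f * (c • (g : Γ.Jet) 0 f) + potJet hU 0 f * (c • (g : Γ.Jet) 1 f)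
        = c • (potJet hU 1 f * (g : Γ.Jet) 0 f + potJet hU 0 f * (g : Γ.Jet) 1 f)
      ext y
      show potJet hU 1 f y * (c * (g : Γ.Jet) 0 f y) + potJet hU 0 f y * (c * (g : Γ.Jet) 1 f y)
        = c * (potJet hU 1 f y * (g : Γ.Jet) 0 f y + potJet hU 0 f y * (g : Γ.Jet) 1 f y)
      ring
    · show potJet hU 2 f * (c • (g : Γ.Jet) 0 f) + 2 * (potJet hU 1 f * (c • (g : Γ.Jet) 1 f))
          + potJet hU 0 f * (c • (g : Γ.Jet) 2 f)
        = c • (potJet hU 2 f * (g : Γ.Jet) 0 f + 2 * (potJet hU 1 f * (g : Γ.Jet) 1 f)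
            + potJet hU 0 f * (g : Γ.Jet) 2 f)
      ext y
      show potJet hU 2 f y * (c * (g : Γ.Jet) 0 f y)
          + 2 * (potJet hU 1 f y * (c * (g : Γ.Jet) 1 f y))
          + potJet hU 0 f y * (c * (g : Γ.Jet) 2 f y)
        = c * (potJet hU 2 f y * (g : Γ.Jet) 0 f y
            + 2 * (potJet hU 1 f y * (g : Γ.Jet) 1 f y)
            + potJet hU 0 f y * (g : Γ.Jet) 2 f y)
      ring

theorem exists_norm_mulOp_le (hS : Γ.IsScattering S) {U : E → ℝ → ℝ}
    (hU : Γ.IsSmoothPotential U) :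
    ∃ M, 0 ≤ M ∧ ∀ g : Γ.stateSpace S, ‖mulOp hS hU g‖ ≤ M * ‖g‖ := by
  set u : ℕ → ℝ := fun j => ∑ f, ‖potJet hU j f‖
  have hu : ∀ j f, ‖potJet hU j f‖ ≤ u j := fun j f =>
    Finset.single_le_sum (f := fun f => ‖potJet hU j f‖) (fun _ _ => norm_nonneg _)
      (Finset.mem_univ f)
  have hu0 : ∀ j, 0 ≤ u j := fun j => Finset.sum_nonneg fun _ _ => norm_nonneg _
  refine ⟨2 * (u 0 + u 1 + u 2), by linarith [hu0 0, hu0 1, hu0 2], fun g => ?_⟩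
  have hg : ∀ j f, ‖(g : Γ.Jet) j f‖ ≤ ‖g‖ := fun j f =>
    (norm_le_pi_norm _ f).trans (norm_le_pi_norm (g : Γ.Jet) j)
  have hprod : ∀ i j f, ‖potJet hU i f * (g : Γ.Jet) j f‖ ≤ u i * ‖g‖ := fun i j f =>
    (norm_mul_le _ _).trans (mul_le_mul (hu i f) (hg j f) (norm_nonneg _) (hu0 i))
  have h0 : 0 ≤ 2 * (u 0 + u 1 + u 2) * ‖g‖ :=
    mul_nonneg (by linarith [hu0 0, hu0 1, hu0 2]) (norm_nonneg g)
  have m : ∀ i, 0 ≤ u i * ‖g‖ := fun i => mul_nonneg (hu0 i) (norm_nonneg g)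
  refine (pi_norm_le_iff_of_nonneg h0).2 fun j => (pi_norm_le_iff_of_nonneg h0).2 fun f => ?_
  fin_cases j
  · refine (hprod 0 0 f).trans ?_
    nlinarith [m 0, m 1, m 2]
  · refine (norm_add_le _ _).trans ?_
    nlinarith [m 0, m 1, m 2, hprod 1 0 f, hprod 0 1 f]
  · refine (norm_add_le _ _).trans ?_
    have h2 : ‖potJet hU 2 f * (g : Γ.Jet) 0 f + 2 * (potJet hU 1 f * (g : Γ.Jet) 1 f)‖
        ≤ u 2 * ‖g‖ + 2 * (u 1 * ‖g‖) := by
      rw [two_mul]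
      refine (norm_add_le _ _).trans (add_le_add (hprod 2 0 f) ?_)
      rw [two_mul]
      exact (norm_add_le _ _).trans (add_le_add (hprod 1 1 f) (hprod 1 1 f))
    have := hprod 0 2 f
    nlinarith [m 0, m 1, m 2]

end MetricGraph

/-! ### The Cauchy problem on the graph -/

namespace MetricGraph

variable {V E : Type*} [Fintype E] {Γ : MetricGraph V E} {S : E × Bool → E × Bool → ℂ}

/-- The state space as a Banach space. -/
def State (Γ : MetricGraph V E) (S : E × Bool → E × Bool → ℂ) : Type _ := Γ.stateSpace S

noncomputable instance : NormedAddCommGroup (State Γ S) :=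
  inferInstanceAs (NormedAddCommGroup (Γ.stateSpace S))

noncomputable instance : NormedSpace ℂ (State Γ S) :=
  inferInstanceAs (NormedSpace ℂ (Γ.stateSpace S))

instance : CompleteSpace (State Γ S) := inferInstanceAs (CompleteSpace (Γ.stateSpace S))

/-- The function of a state, with its first two derivatives. -/
def State.jet (g : State Γ S) : Γ.Jet := Subtype.val g

theorem continuous_state_iff {X : Type*} [TopologicalSpace X] {F : X → State Γ S} :
    Continuous F ↔ ∀ j f, Continuous fun x => (F x).jet j f := by
  constructor
  · intro h j f
    have h1 : Continuous fun x => (F x).jet :=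
      continuous_subtype_val.comp (X := X) (Y := Γ.stateSpace S) h
    exact (continuous_apply f).comp ((continuous_apply j).comp h1)
  · intro h
    exact Continuous.subtype_mk (continuous_pi fun j => continuous_pi fun f => h j f)
      (fun x => (F x).2)

theorem State.norm_le_iff {g : State Γ S} {C : ℝ} (hC : 0 ≤ C) :
    ‖g‖ ≤ C ↔ ∀ j f, ∀ y ∈ Icc 0 (Γ.len f), ‖Γ.ev g.jet j f y‖ ≤ C := by
  constructor
  · exact fun h j f y _ => (Γ.norm_ev_le g.jet j f y).trans h
  · intro h
    refine (pi_norm_le_iff_of_nonneg hC).2 fun j => (pi_norm_le_iff_of_nonneg hC).2 fun f =>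
      (ContinuousMap.norm_le _ hC).2 fun y => ?_
    have := h j f y y.2
    rwa [ev_apply _ _ _ _ y.2] at this

/-- Evaluation of a component of a state at a point, as a continuous functional. -/
noncomputable def evL (Γ : MetricGraph V E) (S : E × Bool → E × Bool → ℂ) (j : Fin 3) (f : E)
    (y : ℝ) : State Γ S →L[ℂ] ℂ :=
  LinearMap.mkContinuous
    { toFun := fun g => Γ.ev g.jet j f y
      map_add' := fun _ _ => rfl
      map_smul' := fun _ _ => rfl } 1
    (fun g => by rw [one_mul]; exact Γ.norm_ev_le g.jet j f y)

theorem evL_apply (g : State Γ S) (j : Fin 3) (f : E) (y : ℝ) :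
    Γ.evL S j f y g = Γ.ev g.jet j f y := rfl

/-- A bounded operator of the state space. -/
noncomputable def stateOp (T : Γ.stateSpace S →ₗ[ℂ] Γ.stateSpace S) (M : ℝ)
    (hM : ∀ g, ‖T g‖ ≤ M * ‖g‖) : State Γ S →L[ℂ] State Γ S :=
  LinearMap.mkContinuous
    { toFun := fun g => T g
      map_add' := fun g g' => T.map_add g g'
      map_smul' := fun c g => T.map_smul c g } M hM

theorem norm_stateOp_le (T : Γ.stateSpace S →ₗ[ℂ] Γ.stateSpace S) {M : ℝ} (hM0 : 0 ≤ M)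
    (hM : ∀ g, ‖T g‖ ≤ M * ‖g‖) : ‖stateOp T M hM‖ ≤ M := LinearMap.mkContinuous_norm_le _ hM0 _

variable [DecidableEq E]

/-- An approximate heat semigroup `P` on the state space, with its defect `R`: in integrated form,
`∂_τ P = ∂² P + R` and `P 0 = 1`. -/
theorem exists_approximate_semigroup (hS : Γ.IsScattering S) :
    ∃ (P R : ℝ → State Γ S →L[ℂ] State Γ S) (M : ℝ), 0 ≤ M ∧
      (∀ τ, ‖P τ‖ ≤ M) ∧ (∀ τ, ‖R τ‖ ≤ M) ∧
      (Continuous fun p : ℝ × State Γ S => P p.1 p.2) ∧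
      (Continuous fun p : ℝ × State Γ S => R p.1 p.2) ∧
      ∀ g f, ∀ y ∈ Icc 0 (Γ.len f), ∀ τ, 0 ≤ τ →
        Γ.evL S 0 f y (P τ g) = Γ.evL S 0 f y g
          + ∫ u in (0 : ℝ)..τ, (Γ.evL S 2 f y (P u g) + Γ.evL S 0 f y (R u g)) := by
  obtain ⟨ℓ, hℓ0, hℓ⟩ : ∃ ℓ, 0 < ℓ ∧ ∀ f, ℓ ≤ Γ.len f := by
    rcases isEmpty_or_nonempty E with hE | hE
    · exact ⟨1, one_pos, fun f => hE.elim f⟩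
    · obtain ⟨f, hf⟩ := Finite.exists_min Γ.len
      exact ⟨Γ.len f, Γ.len_pos f, hf⟩
  obtain ⟨MP, hMP0, hMP⟩ := exists_norm_avgOp_le hS (isWeight_heatWeight hℓ0) hℓ
  obtain ⟨MR, hMR0, hMR⟩ := exists_norm_avgOp_le hS (isWeight_defectWeight hℓ0) hℓ
  refine ⟨fun τ => stateOp (avgOp hS (isWeight_heatWeight hℓ0) hℓ τ) MP (hMP τ),
    fun τ => stateOp (avgOp hS (isWeight_defectWeight hℓ0) hℓ τ) MR (hMR τ),
    MP + MR, by positivity, fun τ => ?_, fun τ => ?_, ?_, ?_, fun g f y hy τ hτ => ?_⟩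
  · exact (norm_stateOp_le _ hMP0 _).trans (by linarith)
  · exact (norm_stateOp_le _ hMR0 _).trans (by linarith)
  · exact continuous_uncurry_of_bound hMP (continuous_avgOp_left hS _ hℓ)
  · exact continuous_uncurry_of_bound hMR (continuous_avgOp_left hS _ hℓ)
  · exact ev_avgOp_eq hS hℓ0 hℓ g f hy hτ

theorem exists_mul_operator (hS : Γ.IsScattering S) {U : E → ℝ → ℝ}
    (hU : Γ.IsSmoothPotential U) :
    ∃ T : State Γ S →L[ℂ] State Γ S, ∀ g f, ∀ y ∈ Icc 0 (Γ.len f),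
      Γ.evL S 0 f y (T g) = U f y * Γ.evL S 0 f y g := by
  obtain ⟨MU, hMU0, hMU⟩ := exists_norm_mulOp_le hS hU
  refine ⟨stateOp (mulOp hS hU) MU hMU, fun g f y hy => ?_⟩
  have := ev_mulJet_zero hU g.jet f hy
  rw [edgeDeriv_zero] at this
  exact this

/-- The inhomogeneous heat equation on the graph with initial value zero is solvable in the state
space, with a bound for the solution. The cut-off heat kernel `P` with the defect `R` turns it into
the Volterra equation `f = F + ∫ (U P - R)(t - s) f(s) ds` for a density `f`, the solution being
`∫ P(t - s) f(s) ds`. -/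
theorem exists_cauchy_solution (hS : Γ.IsScattering S) {U : E → ℝ → ℝ}
    (hU : Γ.IsSmoothPotential U) {Z : Type*} [TopologicalSpace Z] [CompactSpace Z]
    {F : ℝ × Z → State Γ S} (hF : Continuous F) :
    ∃ w : ℝ × Z → State Γ S, Continuous w ∧
      (∀ t, 0 < t → ∀ z f, ∀ y ∈ Icc 0 (Γ.len f),
        HasDerivAt (fun t => Γ.ev (w (t, z)).jet 0 f y)
          (Γ.ev (w (t, z)).jet 2 f y + (U f y : ℂ) * Γ.ev (w (t, z)).jet 0 f y
            + Γ.ev (F (t, z)).jet 0 f y) t) ∧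
      ∃ C, 0 ≤ C ∧ ∀ T ∈ Icc (0 : ℝ) 1, ∀ B z, (∀ s ∈ Icc 0 T, ‖F (s, z)‖ ≤ B) →
        ‖w (T, z)‖ ≤ C * B := by
  obtain ⟨P, R, M, hM0, hPM, hRM, hPc, hRc, hPR⟩ := exists_approximate_semigroup hS
  obtain ⟨W, hW⟩ := exists_mul_operator hS hU
  set K : ℝ → State Γ S →L[ℂ] State Γ S := fun τ => W.comp (P τ) - R τ with hK
  have hKapp : ∀ τ g, K τ g = W (P τ g) - R τ g := fun τ g => rfl
  have hKM : ∀ τ, ‖K τ‖ ≤ ‖W‖ * M + M := fun τ =>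
    (norm_sub_le _ _).trans (add_le_add ((ContinuousLinearMap.opNorm_comp_le _ _).trans
      (mul_le_mul_of_nonneg_left (hPM τ) (norm_nonneg W))) (hRM τ))
  have hKc : Continuous fun p : ℝ × State Γ S => K p.1 p.2 :=
    (W.continuous.comp hPc).sub hRc
  simp only [← evL_apply]
  obtain ⟨φ, hφc, hφ, hφb⟩ := exists_volterra_solution hKM hKc hF
  have hφs : ∀ z, Continuous fun s => φ (s, z) := fun z =>
    hφc.comp (continuous_id.prodMk continuous_const)
  -- integrands on the time interval
  have hcomp : ∀ {Q : ℝ × State Γ S → State Γ S}, Continuous Q → ∀ t z,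
      Continuous fun s => Q (t - s, φ (s, z)) := fun hT t z =>
    hT.comp ((continuous_const.sub continuous_id).prodMk (hφs z))
  set w : ℝ × Z → State Γ S := fun p => ∫ s in (0 : ℝ)..p.1, P (p.1 - s) (φ (s, p.2))
    with hw
  have hwev : ∀ t z j f y, Γ.evL S j f y (w (t, z))
      = ∫ s in (0 : ℝ)..t, Γ.evL S j f y (P (t - s) (φ (s, z))) := fun t z j f y =>
    ((Γ.evL S j f y).intervalIntegral_comp_comm
      ((hcomp hPc t z).intervalIntegrable _ _)).symm
  refine ⟨w, ?_, fun t ht z f y hy => ?_, M * Real.exp (‖W‖ * M + M), by positivity, ?_⟩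
  · refine intervalIntegral.continuous_parametric_intervalIntegral_of_continuous
      (f := fun (p : ℝ × Z) s => P (p.1 - s) (φ (s, p.2))) ?_ continuous_fst
    exact hPc.comp (Continuous.prodMk (by fun_prop) (hφc.comp (by fun_prop)))
  · set ψ : ℝ → ℝ → ℂ := fun u s => Γ.evL S 2 f y (P u (φ (s, z)))
      + Γ.evL S 0 f y (R u (φ (s, z))) with hψ
    have hψc : Continuous fun p : ℝ × ℝ => ψ p.1 p.2 := by
      have hp : Continuous fun p : ℝ × ℝ => (p.1, φ (p.2, z)) :=
        continuous_fst.prodMk ((hφs z).comp continuous_snd)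
      exact ((Γ.evL S 2 f y).continuous.comp (hPc.comp hp)).add
        ((Γ.evL S 0 f y).continuous.comp (hRc.comp hp))
    have hφ0 : Continuous fun s => Γ.evL S 0 f y (φ (s, z)) :=
      (Γ.evL S 0 f y).continuous.comp (hφs z)
    have hw0 : ∀ t, 0 ≤ t → Γ.evL S 0 f y (w (t, z))
        = (∫ s in (0 : ℝ)..t, Γ.evL S 0 f y (φ (s, z)))
          + ∫ s in (0 : ℝ)..t, ∫ u in (0 : ℝ)..(t - s), ψ u s := fun t ht => by
      rw [hwev, ← intervalIntegral.integral_add (hφ0.intervalIntegrable _ _)]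
      · refine intervalIntegral.integral_congr fun s hs => ?_
        rw [uIcc_of_le ht] at hs
        exact hPR _ f y hy _ (sub_nonneg.2 hs.2)
      · refine Continuous.intervalIntegrable ?_ _ _
        exact intervalIntegral.continuous_parametric_intervalIntegral_of_continuous
          (f := fun s u => ψ u s) (hψc.comp continuous_swap) (by fun_prop)
    have hd := ((intervalIntegral.integral_hasDerivAt_right (hφ0.intervalIntegrable 0 t)
      (hφ0.stronglyMeasurableAtFilter _ _) hφ0.continuousAt).add
      (hasDerivAt_integral_triangle hψc ht)).congr_of_eventuallyEq
      (f₁ := fun t => Γ.evL S 0 f y (w (t, z)))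
      (by filter_upwards [Ioi_mem_nhds ht] with s hs using hw0 s (le_of_lt hs))
    refine hd.congr_deriv ?_
    have c2 : Continuous fun s => Γ.evL S 2 f y (P (t - s) (φ (s, z))) :=
      (Γ.evL S 2 f y).continuous.comp (hcomp hPc t z)
    have cR : Continuous fun s => Γ.evL S 0 f y (R (t - s) (φ (s, z))) :=
      (Γ.evL S 0 f y).continuous.comp (hcomp hRc t z)
    have c0 : Continuous fun s => Γ.evL S 0 f y (P (t - s) (φ (s, z))) :=
      (Γ.evL S 0 f y).continuous.comp (hcomp hPc t z)
    have hc0 : Continuous fun s => (U f y : ℂ) * Γ.evL S 0 f y (P (t - s) (φ (s, z))) :=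
      continuous_const.mul c0
    have e1 : ∫ s in (0 : ℝ)..t, ψ (t - s) s = Γ.evL S 2 f y (w (t, z))
        + ∫ s in (0 : ℝ)..t, Γ.evL S 0 f y (R (t - s) (φ (s, z))) := by
      rw [hwev]
      exact intervalIntegral.integral_add (c2.intervalIntegrable _ _) (cR.intervalIntegrable _ _)
    have e2 : Γ.evL S 0 f y (φ (t, z)) = Γ.evL S 0 f y (F (t, z))
        + ((U f y : ℂ) * Γ.evL S 0 f y (w (t, z))
        - ∫ s in (0 : ℝ)..t, Γ.evL S 0 f y (R (t - s) (φ (s, z)))) := by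
      have := congrArg (Γ.evL S 0 f y) (hφ t z ht.le)
      rw [map_add, ← (Γ.evL S 0 f y).intervalIntegral_comp_comm
        ((hcomp hKc t z).intervalIntegrable _ _)] at this
      refine this.trans (congrArg₂ _ rfl ?_)
      rw [hwev, ← intervalIntegral.integral_const_mul,
        ← intervalIntegral.integral_sub (hc0.intervalIntegrable _ _) (cR.intervalIntegrable _ _)]
      refine intervalIntegral.integral_congr fun s _ => ?_
      show Γ.evL S 0 f y (K (t - s) (φ (s, z))) = _
      rw [hKapp, map_sub]
      refine congrArg₂ _ ?_ rfl
      exact hW _ f y hy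
    rw [e1, e2]
    ring
  · intro T hT B z hB
    have h1 : ∀ s ∈ Icc 0 T, ‖φ (s, z)‖ ≤ B * Real.exp (‖W‖ * M + M) := fun s hs => by
      refine (hφb T B z hT.1 hB s hs).trans ?_
      have hB0 : 0 ≤ B := (norm_nonneg _).trans (hB s hs)
      gcongr
      have : 0 ≤ ‖W‖ * M + M := by positivity
      nlinarith [hT.2]
    have h2 := intervalIntegral.norm_integral_le_of_norm_le_const (a := 0) (b := T)
      (f := fun s => P (T - s) (φ (s, z))) (C := M * (B * Real.exp (‖W‖ * M + M)))
      (fun s hs => by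
        rw [uIoc_of_le hT.1] at hs
        exact ((P _).le_of_opNorm_le (hPM _) _).trans (mul_le_mul_of_nonneg_left (h1 s ⟨hs.1.le, hs.2⟩) hM0))
    have hB0 : 0 ≤ B := (norm_nonneg _).trans (hB 0 ⟨le_rfl, hT.1⟩)
    have h3 : 0 ≤ M * (B * Real.exp (‖W‖ * M + M)) := by positivity
    refine h2.trans ?_
    rw [sub_zero, abs_of_nonneg hT.1]
    nlinarith [hT.2]

end MetricGraph

/-! ### The universal polynomials -/

/-- The polynomial in the derivatives `X 0, X 1, …` of a potential `u` at `x` that expresses the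
`j`-th derivative at `y = x` of the `k`-th coefficient `u_k(x, y)` in the expansion
`exp(-(y - x)² / 4t) / √(4πt) * ∑ t ^ k u_k(x, y)` of the heat kernel of the line. The recursion is
the `j`-th derivative at `y = x` of the transport equation
`(y - x) ∂ u_{k+1} + (k + 1) u_{k+1} = ∂² u_k + u u_k`. -/
noncomputable def transportJet : ℕ → ℕ → MvPolynomial ℕ ℝ
  | 0, j => if j = 0 then 1 else 0
  | k + 1, j => MvPolynomial.C ((j : ℝ) + k + 1)⁻¹ * (transportJet k (j + 2) +
      ∑ i ∈ Finset.range (j + 1),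
        MvPolynomial.C (j.choose i : ℝ) * (MvPolynomial.X i * transportJet k (j - i)))

theorem eval_transportJet_zero (a : ℕ → ℝ) (j : ℕ) :
    MvPolynomial.eval a (transportJet 0 j) = if j = 0 then 1 else 0 := by
  rw [transportJet]; split_ifs <;> simp

theorem eval_transportJet_succ (a : ℕ → ℝ) (k j : ℕ) :
    ((j : ℝ) + k + 1) * MvPolynomial.eval a (transportJet (k + 1) j)
      = MvPolynomial.eval a (transportJet k (j + 2)) + ∑ i ∈ Finset.range (j + 1),
          (j.choose i : ℝ) * (a i * MvPolynomial.eval a (transportJet k (j - i))) := by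
  have : (j : ℝ) + k + 1 ≠ 0 := by positivity
  rw [transportJet]
  simp only [map_mul, map_add, map_sum, MvPolynomial.eval_C, MvPolynomial.eval_X]
  rw [mul_inv_cancel_left₀ this]

/-- The substitution `X i ↦ (-1) ^ i X i`: the effect of reflecting the potential. -/
noncomputable def reflectVars : MvPolynomial ℕ ℝ →ₐ[ℝ] MvPolynomial ℕ ℝ :=
  MvPolynomial.aeval fun i => MvPolynomial.C ((-1) ^ i) * MvPolynomial.X i

theorem eval_reflectVars (a : ℕ → ℝ) (p : MvPolynomial ℕ ℝ) :
    MvPolynomial.eval a (reflectVars p) = MvPolynomial.eval (fun i => (-1) ^ i * a i) p := by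
  induction p using MvPolynomial.induction_on with
  | C c => simp [reflectVars]
  | add p q hp hq => simp [hp, hq]
  | mul_X p i hp =>
    have hX : reflectVars (MvPolynomial.X i) = MvPolynomial.C ((-1) ^ i) * MvPolynomial.X i := by
      simp [reflectVars]
    rw [map_mul, map_mul, hp, hX, map_mul]
    simp only [map_mul, MvPolynomial.eval_C, MvPolynomial.eval_X]

/-- Reflecting the potential reflects the heat kernel of the line. -/
theorem reflectVars_transportJet (k j : ℕ) :
    reflectVars (transportJet k j) = MvPolynomial.C ((-1) ^ j) * transportJet k j := by
  induction k generalizing j with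
  | zero =>
    rw [transportJet]
    split_ifs with h
    · simp [h]
    · simp
  | succ k ih =>
    have hC : ∀ c : ℝ, reflectVars (MvPolynomial.C c) = MvPolynomial.C c := fun c => by
      simp [reflectVars]
    have hX : ∀ i, reflectVars (MvPolynomial.X i) = MvPolynomial.C ((-1) ^ i) * MvPolynomial.X i :=
      fun i => by simp [reflectVars]
    rw [transportJet]
    have h1 : reflectVars (transportJet k (j + 2))
        = MvPolynomial.C ((-1) ^ j) * transportJet k (j + 2) := by
      rw [ih, pow_add]; simp
    have h2 : ∀ i ∈ Finset.range (j + 1), reflectVars (MvPolynomial.C (j.choose i : ℝ) *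
        (MvPolynomial.X i * transportJet k (j - i))) = MvPolynomial.C ((-1) ^ j) *
          (MvPolynomial.C (j.choose i : ℝ) * (MvPolynomial.X i * transportJet k (j - i))) := by
      intro i hi
      have : (-1 : ℝ) ^ j = (-1) ^ i * (-1) ^ (j - i) := by
        rw [← pow_add, Nat.add_sub_cancel' (Nat.lt_succ_iff.1 (Finset.mem_range.1 hi))]
      rw [map_mul, map_mul, hC, hX, ih, this, MvPolynomial.C_mul]
      ring
    rw [map_mul, map_add, map_sum, hC, h1, Finset.sum_congr rfl h2, ← Finset.mul_sum]
    ring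

theorem eval_neg_transportJet (a : ℕ → ℝ) (k j : ℕ) :
    MvPolynomial.eval (fun i => (-1) ^ i * a i) (transportJet k j)
      = (-1) ^ j * MvPolynomial.eval a (transportJet k j) := by
  rw [← eval_reflectVars, reflectVars_transportJet]
  simp

/-- The derivation `X i ↦ X (i + 1)`: the derivative along the edge. -/
noncomputable def jetDeriv : Derivation ℝ (MvPolynomial ℕ ℝ) (MvPolynomial ℕ ℝ) :=
  MvPolynomial.mkDerivation ℝ fun i => MvPolynomial.X (i + 1)

theorem jetDeriv_X (i : ℕ) : jetDeriv (MvPolynomial.X i) = MvPolynomial.X (i + 1) := by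
  simp [jetDeriv]

theorem jetDeriv_C (c : ℝ) : jetDeriv (MvPolynomial.C c) = 0 := MvPolynomial.derivation_C _ _

theorem jetDeriv_C_mul (c : ℝ) (p : MvPolynomial ℕ ℝ) :
    jetDeriv (MvPolynomial.C c * p) = MvPolynomial.C c * jetDeriv p := by
  rw [Derivation.leibniz, jetDeriv_C, smul_zero, add_zero, smul_eq_mul]

theorem reflectVars_jetDeriv (p : MvPolynomial ℕ ℝ) :
    reflectVars (jetDeriv p) = -jetDeriv (reflectVars p) := by
  induction p using MvPolynomial.induction_on with
  | C c => simp [reflectVars]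
  | add p q hp hq => rw [map_add, map_add, map_add, map_add, hp, hq]; ring
  | mul_X p i hp =>
    have hX : ∀ i, reflectVars (MvPolynomial.X i) = MvPolynomial.C ((-1) ^ i) * MvPolynomial.X i :=
      fun i => by simp [reflectVars]
    simp only [Derivation.leibniz, map_add, map_mul, smul_eq_mul, hp, hX, jetDeriv_X,
      jetDeriv_C, mul_zero, add_zero, pow_succ]
    simp only [map_neg, map_one]
    ring

theorem reflectVars_jetDeriv_iterate (i k j : ℕ) :
    reflectVars (jetDeriv^[i] (transportJet k j))
      = MvPolynomial.C ((-1) ^ (i + j)) * jetDeriv^[i] (transportJet k j) := by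
  induction i with
  | zero => simp [reflectVars_transportJet]
  | succ i ih =>
    rw [Function.iterate_succ_apply', reflectVars_jetDeriv, ih, jetDeriv_C_mul,
      show i + 1 + j = (i + j) + 1 by ring, pow_succ]
    simp

/-- The derivative of a polynomial in the derivatives of a function. -/
theorem hasDerivWithinAt_eval_jet {a : ℕ → ℝ → ℝ} {I : Set ℝ} {x : ℝ}
    (ha : ∀ i, HasDerivWithinAt (a i) (a (i + 1) x) I x) (p : MvPolynomial ℕ ℝ) :
    HasDerivWithinAt (fun x => MvPolynomial.eval (fun i => a i x) p)
      (MvPolynomial.eval (fun i => a i x) (jetDeriv p)) I x := by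
  induction p using MvPolynomial.induction_on with
  | C c =>
    simp only [MvPolynomial.eval_C, jetDeriv_C, map_zero]
    exact hasDerivWithinAt_const _ _ _
  | add p q hp hq =>
    simp only [map_add]
    exact hp.add hq
  | mul_X p i hp =>
    simp only [Derivation.leibniz, map_mul, map_add, smul_eq_mul, MvPolynomial.eval_X, jetDeriv_X]
    refine (hp.mul (ha i)).congr_deriv ?_
    ring

/-- The `l`-th Taylor coefficient at a vertex of `s ↦ u_k(s, -s)`, where `u_k` is the `k`-th
coefficient in the expansion of the heat kernel of the line. -/
noncomputable def mirrorJet (k l : ℕ) : MvPolynomial ℕ ℝ :=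
  ∑ j ∈ Finset.range (l + 1), MvPolynomial.C ((-2) ^ j / (((l - j).factorial : ℝ) * j.factorial)) *
    jetDeriv^[l - j] (transportJet k j)

/-- The universal polynomials of the interior heat coefficients: the values of `u_n(x, y)` at
`y = x`. -/
noncomputable def interiorPoly (n : ℕ) : MvPolynomial ℕ ℝ := transportJet n 0

/-- The universal polynomials of the vertex heat coefficients of integer index `n`. The numbers
`(2j - 1)‼ / 2 ^ j` come from the moments of the Gaussian. -/
noncomputable def vertexPolyInt (n : ℕ) : MvPolynomial ℕ ℝ :=
  ∑ j ∈ Finset.range (n + 1),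
    MvPolynomial.C (((2 * j - 1).doubleFactorial : ℝ) / 2 ^ j) * mirrorJet (n - j) (2 * j)

/-- The universal polynomials of the vertex heat coefficients of index `m / 2`. -/
noncomputable def vertexPoly (m : ℕ) : MvPolynomial ℕ ℝ :=
  if Odd m then 0 else vertexPolyInt (m / 2)

theorem vertexPoly_odd {m : ℕ} (hm : Odd m) : vertexPoly m = 0 := if_pos hm

theorem vertexPoly_two_mul (n : ℕ) : vertexPoly (2 * n) = vertexPolyInt n := by
  rw [vertexPoly, if_neg (by simp), Nat.mul_div_cancel_left _ two_pos]

/-- If the potential is even about the vertex, so is `s ↦ u_k(s, -s)`: this function turns into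
`u_k(-s, s)` under `s ↦ -s`, which reflection of the potential turns back. -/
theorem eval_mirrorJet_odd {a : ℕ → ℝ} (ha : ∀ l, a (2 * l + 1) = 0) (k l : ℕ) :
    MvPolynomial.eval a (mirrorJet k (2 * l + 1)) = 0 := by
  have hrefl : (fun i => (-1) ^ i * a i) = a := by
    funext i
    rcases Nat.even_or_odd' i with ⟨m, rfl | rfl⟩
    · simp
    · simp [ha]
  rw [mirrorJet, map_sum]
  refine Finset.sum_eq_zero fun j hj => ?_
  have hj' : 2 * l + 1 - j + j = 2 * l + 1 := Nat.sub_add_cancel (by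
    have := Finset.mem_range.1 hj; omega)
  have h1 := congrArg (MvPolynomial.eval a)
    (reflectVars_jetDeriv_iterate (2 * l + 1 - j) k j)
  rw [eval_reflectVars, hrefl, hj', map_mul, MvPolynomial.eval_C,
    Odd.neg_one_pow ⟨l, rfl⟩] at h1
  rw [map_mul]
  have : MvPolynomial.eval a (jetDeriv^[2 * l + 1 - j] (transportJet k j)) = 0 := by linarith
  rw [this, mul_zero]

section FirstCoefficients

open MvPolynomial

theorem transportJet_one (j : ℕ) : transportJet 1 j = C ((j : ℝ) + 1)⁻¹ * X j := by
  rw [transportJet]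
  have h1 : transportJet 0 (j + 2) = 0 := by rw [transportJet, if_neg (by omega)]
  have h2 : ∑ i ∈ Finset.range (j + 1), C (j.choose i : ℝ) * (X i * transportJet 0 (j - i))
      = X j := by
    rw [Finset.sum_range_succ, Finset.sum_eq_zero fun i hi => ?_]
    · simp [transportJet]
    · have := Finset.mem_range.1 hi
      rw [transportJet, if_neg (by omega), mul_zero, mul_zero]
  rw [h1, h2, zero_add]
  norm_num

theorem eval_interiorPoly_first (a : ℕ → ℝ) :
    eval a (interiorPoly 0) = 1 ∧ eval a (interiorPoly 1) = a 0 ∧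
    eval a (interiorPoly 2) = 1 / 6 * a 2 + 1 / 2 * a 0 ^ 2 ∧
    eval a (interiorPoly 3) = 1 / 60 * a 4 + 1 / 6 * a 2 * a 0 + 1 / 12 * a 1 ^ 2
      + 1 / 6 * a 0 ^ 3 := by
  refine ⟨by simp [interiorPoly, transportJet], by simp [interiorPoly, transportJet_one], ?_, ?_⟩
  · rw [interiorPoly, transportJet]
    simp [transportJet_one]
    ring
  · rw [interiorPoly, transportJet, transportJet]
    simp [transportJet, Finset.sum_range_succ, Nat.choose]
    ring

theorem eval_vertexPolyInt_first {a : ℕ → ℝ} (ha : ∀ l, a (2 * l + 1) = 0) :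
    eval a (vertexPolyInt 0) = 1 ∧ eval a (vertexPolyInt 1) = a 0 ∧
    eval a (vertexPolyInt 2) = 1 / 4 * a 2 + 1 / 2 * a 0 ^ 2 ∧
    eval a (vertexPolyInt 3) = 1 / 32 * a 4 + 1 / 4 * a 0 * a 2 + 1 / 6 * a 0 ^ 3 := by
  have h1 : a 1 = 0 := ha 0
  have h3 : a 3 = 0 := ha 1
  have z : ∀ j, transportJet 0 (j + 1) = 0 := fun j => by rw [transportJet, if_neg (by omega)]
  have z0 : transportJet 0 0 = 1 := by rw [transportJet, if_pos rfl]
  have hd1 : ∀ i, jetDeriv^[i + 1] (1 : MvPolynomial ℕ ℝ) = 0 := fun i => by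
    rw [Function.iterate_succ_apply, Derivation.map_one_eq_zero]
    exact Function.iterate_fixed (map_zero _) i
  have hm0 : ∀ l, mirrorJet 0 (l + 1) = 0 := fun l => by
    rw [mirrorJet]
    refine Finset.sum_eq_zero fun j hj => ?_
    rcases j with _ | j
    · rw [z0, Nat.sub_zero, hd1, mul_zero]
    · rw [z, Function.iterate_fixed (map_zero _), mul_zero]
  have hm00 : mirrorJet 0 0 = 1 := by simp [mirrorJet, z0]
  have hk0 : ∀ k, eval a (mirrorJet k 0) = eval a (interiorPoly k) := fun k => by
    simp [mirrorJet, interiorPoly]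
  obtain ⟨p0, p1, p2, p3⟩ := eval_interiorPoly_first a
  have dX : ∀ i l, jetDeriv^[l] (X i : MvPolynomial ℕ ℝ) = X (i + l) := fun i l => by
    induction l with
    | zero => rfl
    | succ l ih => rw [Function.iterate_succ_apply', ih, jetDeriv_X]; rfl
  have dCX : ∀ (c : ℝ) i l, jetDeriv^[l] (C c * X i : MvPolynomial ℕ ℝ) = C c * X (i + l) :=
    fun c i l => by
      induction l with
      | zero => rfl
      | succ l ih => rw [Function.iterate_succ_apply', ih, jetDeriv_C_mul, jetDeriv_X]; rfl
  have m1 : ∀ l, eval a (mirrorJet 1 l) = (∑ j ∈ Finset.range (l + 1),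
      (-2) ^ j / (((l - j).factorial : ℝ) * j.factorial) * ((j : ℝ) + 1)⁻¹) * a l := fun l => by
    rw [mirrorJet, map_sum, Finset.sum_mul]
    refine Finset.sum_congr rfl fun j hj => ?_
    rw [transportJet_one, dCX, Nat.add_sub_cancel' (Nat.lt_succ_iff.1 (Finset.mem_range.1 hj))]
    simp only [map_mul, eval_C, eval_X]
    ring
  refine ⟨?_, ?_, ?_, ?_⟩
  · simp [vertexPolyInt, hm00]
  · simp [vertexPolyInt, Finset.sum_range_succ, hk0, p1, hm0]
  · simp [vertexPolyInt, Finset.sum_range_succ, hk0, p2, hm0, m1, Nat.factorial]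
    ring
  · have m2 : eval a (mirrorJet 2 2) = 1 / 60 * a 4 + 1 / 6 * a 0 * a 2 := by
      simp [mirrorJet, Finset.sum_range_succ, transportJet, Nat.factorial,
        Nat.choose, jetDeriv_X, h1]
      ring
    simp [vertexPolyInt, Finset.sum_range_succ, hk0, p3, hm0, m1, m2, Nat.factorial, h1]
    ring

end FirstCoefficients

/-! ### Families of smooth functions -/

section Families

variable {F : Type*} [NormedAddCommGroup F] [NormedSpace ℝ F] {I I' : Set ℝ} {r : ℕ∞}

theorem iteratedDerivWithin_eqOn {D : ℕ → ℝ → F} (hI : UniqueDiffOn ℝ I)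
    (hd : ∀ j : ℕ, (j : ℕ∞) < r → ∀ y ∈ I, HasDerivWithinAt (D j) (D (j + 1) y) I y) {j : ℕ}
    (hj : (j : ℕ∞) ≤ r) : EqOn (iteratedDerivWithin j (D 0) I) (D j) I := by
  induction j with
  | zero => intro y _; rw [iteratedDerivWithin_zero]
  | succ j ih =>
    have hj' : (j : ℕ∞) < r := lt_of_lt_of_le (by exact_mod_cast j.lt_succ_self) hj
    intro y hy
    rw [iteratedDerivWithin_succ, derivWithin_congr (ih hj'.le) (ih hj'.le hy)]
    exact (hd j hj' y hy).derivWithin (hI y hy)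

theorem contDiffOn_of_hasDerivWithinAt {D : ℕ → ℝ → F} (hI : UniqueDiffOn ℝ I)
    (hc : ∀ j : ℕ, (j : ℕ∞) ≤ r → ContinuousOn (D j) I)
    (hd : ∀ j : ℕ, (j : ℕ∞) < r → ∀ y ∈ I, HasDerivWithinAt (D j) (D (j + 1) y) I y) :
    ContDiffOn ℝ r (D 0) I := by
  refine contDiffOn_of_continuousOn_differentiableOn_deriv (fun j hj => ?_) (fun j hj => ?_)
  · exact (hc j hj).congr (iteratedDerivWithin_eqOn hI hd hj)
  · exact fun y hy => ((hd j hj y hy).congr (fun z hz => iteratedDerivWithin_eqOn hI hd hj.le hz)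
      (iteratedDerivWithin_eqOn hI hd hj.le hy)).differentiableWithinAt

theorem ContDiffOn.hasDerivWithinAt_iteratedDerivWithin' {g : ℝ → F} (hI : UniqueDiffOn ℝ I)
    (hg : ContDiffOn ℝ r g I) {j : ℕ} (hj : (j : ℕ∞) < r) {y : ℝ} (hy : y ∈ I) :
    HasDerivWithinAt (iteratedDerivWithin j g I) (iteratedDerivWithin (j + 1) g I y) I y := by
  rw [iteratedDerivWithin_succ]
  exact ((hg.differentiableOn_iteratedDerivWithin (by exact_mod_cast hj) hI) y
    hy).hasDerivWithinAt

/-- Restriction to a smaller set keeps the derivatives. -/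
theorem iteratedDerivWithin_mono {g : ℝ → F} (hI : UniqueDiffOn ℝ I) (hI' : UniqueDiffOn ℝ I')
    (hg : ContDiffOn ℝ r g I) (h : I' ⊆ I) {j : ℕ} (hj : (j : ℕ∞) ≤ r) :
    EqOn (iteratedDerivWithin j g I') (iteratedDerivWithin j g I) I' := by
  have := iteratedDerivWithin_eqOn (D := fun j => iteratedDerivWithin j g I) hI' (r := r)
    (fun j hj y hy => (hg.hasDerivWithinAt_iteratedDerivWithin' hI hj (h hy)).mono h) hj
  simpa only [iteratedDerivWithin_zero] using this

theorem iteratedDerivWithin_comp_affine {g : ℝ → F} (hI : UniqueDiffOn ℝ I)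
    (hI' : UniqueDiffOn ℝ I') (hg : ContDiffOn ℝ r g I) {c ε : ℝ}
    (h : MapsTo (fun y => c + ε * y) I' I) {j : ℕ} (hj : (j : ℕ∞) ≤ r) :
    EqOn (iteratedDerivWithin j (fun y => g (c + ε * y)) I')
      (fun y => ε ^ j • iteratedDerivWithin j g I (c + ε * y)) I' := by
  have := iteratedDerivWithin_eqOn
    (D := fun j y => ε ^ j • iteratedDerivWithin j g I (c + ε * y)) hI' (r := r)
    (fun j hj y hy => by
      have h1 : HasDerivWithinAt (fun y : ℝ => c + ε * y) ε I' y := by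
        simpa using (((hasDerivAt_id y).const_mul ε).const_add c).hasDerivWithinAt
      have h2 := ((hg.hasDerivWithinAt_iteratedDerivWithin' hI hj (h hy)).scomp y h1 h).const_smul
        (ε ^ j)
      refine h2.congr_deriv ?_
      rw [smul_smul, pow_succ]) hj
  simpa only [iteratedDerivWithin_zero, pow_zero, one_smul] using this

theorem iteratedDerivWithin_ofReal {g : ℝ → ℝ} (hI : UniqueDiffOn ℝ I) (hg : ContDiffOn ℝ r g I)
    {j : ℕ} (hj : (j : ℕ∞) ≤ r) :
    EqOn (iteratedDerivWithin j (fun y => (g y : ℂ)) I)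
      (fun y => ((iteratedDerivWithin j g I y : ℝ) : ℂ)) I := by
  have := iteratedDerivWithin_eqOn
    (D := fun j y => ((iteratedDerivWithin j g I y : ℝ) : ℂ)) hI (r := r)
    (fun j hj y hy => (hg.hasDerivWithinAt_iteratedDerivWithin' hI hj hy).ofReal_comp) hj
  simpa only [iteratedDerivWithin_zero] using this

theorem ContDiffOn.ofReal {g : ℝ → ℝ} {n : ℕ∞ω} (hg : ContDiffOn ℝ n g I) :
    ContDiffOn ℝ n (fun y => (g y : ℂ)) I :=
  Complex.ofRealCLM.contDiff.comp_contDiffOn hg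

/-- If the derivatives of order less than `n` of a function vanish at `c` and the `n`-th derivative
is bounded, the derivatives decay like powers of the distance from `c`. -/
theorem norm_iteratedDerivWithin_le_pow {a b c C : ℝ} {g : ℝ → F} {n : ℕ}
    (hab : a < b) (hg : ContDiffOn ℝ ∞ g (Icc a b)) (hc : c ∈ Icc a b)
    (h0 : ∀ i < n, iteratedDerivWithin i g (Icc a b) c = 0)
    (hC : ∀ y ∈ Icc a b, ‖iteratedDerivWithin n g (Icc a b) y‖ ≤ C) {m i : ℕ} (hi : i + m = n)
    {y : ℝ} (hy : y ∈ Icc a b) :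
    ‖iteratedDerivWithin i g (Icc a b) y‖ ≤ C * |y - c| ^ m := by
  have hI := uniqueDiffOn_Icc hab
  have hC0 : 0 ≤ C := (norm_nonneg _).trans (hC c hc)
  induction m generalizing i y with
  | zero =>
    obtain rfl : i = n := by omega
    simpa using hC y hy
  | succ m ih =>
    have hsub : uIcc c y ⊆ Icc a b := OrdConnected.uIcc_subset ordConnected_Icc hc hy
    have h1 : ∀ z ∈ uIcc c y, HasDerivWithinAt (iteratedDerivWithin i g (Icc a b))
        (iteratedDerivWithin (i + 1) g (Icc a b) z) (uIcc c y) z := fun z hz =>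
      (ContDiffOn.hasDerivWithinAt_iteratedDerivWithin' (r := ⊤) hI hg
        (WithTop.coe_lt_top i) (hsub hz)).mono hsub
    have h2 : ∀ z ∈ uIcc c y, ‖iteratedDerivWithin (i + 1) g (Icc a b) z‖ ≤ C * |y - c| ^ m := by
      intro z hz
      refine (ih (by omega) (hsub hz)).trans ?_
      exact mul_le_mul_of_nonneg_left
        (pow_le_pow_left₀ (abs_nonneg _) (abs_sub_left_of_mem_uIcc hz) m) hC0
    have h3 := (convex_uIcc c y).norm_image_sub_le_of_norm_hasDerivWithin_le h1 h2
      left_mem_uIcc right_mem_uIcc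
    rw [h0 i (by omega), sub_zero, Real.norm_eq_abs] at h3
    rwa [pow_succ, ← mul_assoc]

variable {X Y : Type*} [TopologicalSpace X] [TopologicalSpace Y] {K : Set X}
  {H H' : X → ℝ → ℂ}

/-- A family of functions on `I`, with parameters in `K`, that are `r` times continuously
differentiable and whose derivatives depend continuously on all variables. -/
def SmoothFam (r : ℕ∞) (K : Set X) (I : Set ℝ) (H : X → ℝ → ℂ) : Prop :=
  (∀ x ∈ K, ContDiffOn ℝ r (H x) I) ∧
    ∀ j : ℕ, (j : ℕ∞) ≤ r →
      ContinuousOn (fun p : X × ℝ => iteratedDerivWithin j (H p.1) I p.2) (K ×ˢ I)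

namespace SmoothFam

theorem of_family {D : ℕ → X → ℝ → ℂ} (hI : UniqueDiffOn ℝ I)
    (hc : ∀ j : ℕ, (j : ℕ∞) ≤ r → ContinuousOn (fun p : X × ℝ => D j p.1 p.2) (K ×ˢ I))
    (hd : ∀ j : ℕ, (j : ℕ∞) < r → ∀ x ∈ K, ∀ y ∈ I,
      HasDerivWithinAt (D j x) (D (j + 1) x y) I y) : SmoothFam r K I (D 0) := by
  refine ⟨fun x hx => contDiffOn_of_hasDerivWithinAt (D := fun j => D j x) hI (fun j hj => ?_)
    (fun j hj y hy => hd j hj x hx y hy), fun j hj => ?_⟩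
  · exact (hc j hj).comp (f := fun y => (x, y)) (by fun_prop) fun y hy => ⟨hx, hy⟩
  · refine (hc j hj).congr fun p hp => ?_
    exact iteratedDerivWithin_eqOn (D := fun j => D j p.1) hI
      (fun j hj y hy => hd j hj p.1 hp.1 y hy) hj hp.2

theorem congr (h : SmoothFam r K I H) (hH : ∀ x ∈ K, EqOn (H' x) (H x) I) :
    SmoothFam r K I H' :=
  ⟨fun x hx => (h.1 x hx).congr (hH x hx), fun j hj => (h.2 j hj).congr fun p hp =>
    iteratedDerivWithin_congr (hH p.1 hp.1) hp.2⟩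

theorem of_le {r' : ℕ∞} (h : SmoothFam r K I H) (hr : r' ≤ r) : SmoothFam r' K I H :=
  ⟨fun x hx => (h.1 x hx).of_le (by exact_mod_cast hr), fun j hj => h.2 j (hj.trans hr)⟩

theorem add (hI : UniqueDiffOn ℝ I) (h : SmoothFam r K I H) (h' : SmoothFam r K I H') :
    SmoothFam r K I fun x y => H x y + H' x y := by
  refine ⟨fun x hx => (h.1 x hx).add (h'.1 x hx), fun j hj => ?_⟩
  refine ((h.2 j hj).add (h'.2 j hj)).congr fun p hp => ?_
  exact iteratedDerivWithin_fun_add hp.2 hI ((h.1 p.1 hp.1 p.2 hp.2).of_le (by exact_mod_cast hj))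
    ((h'.1 p.1 hp.1 p.2 hp.2).of_le (by exact_mod_cast hj))

theorem mul (hI : UniqueDiffOn ℝ I) (h : SmoothFam r K I H) (h' : SmoothFam r K I H') :
    SmoothFam r K I fun x y => H x y * H' x y := by
  refine ⟨fun x hx => (h.1 x hx).mul (h'.1 x hx), fun j hj => ?_⟩
  have hc : ContinuousOn (fun p : X × ℝ => ∑ i ∈ Finset.range (j + 1),
      (j.choose i : ℂ) * iteratedDerivWithin i (H p.1) I p.2
        * iteratedDerivWithin (j - i) (H' p.1) I p.2) (K ×ˢ I) := by
    refine continuousOn_finsetSum _ fun i hi => ?_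
    have hi' : i ≤ j := Nat.lt_succ_iff.1 (Finset.mem_range.1 hi)
    exact (continuousOn_const.mul (h.2 i (le_trans (by exact_mod_cast hi') hj))).mul
      (h'.2 (j - i) (le_trans (by exact_mod_cast Nat.sub_le j i) hj))
  refine hc.congr fun p hp => ?_
  exact iteratedDerivWithin_mul hp.2 hI ((h.1 p.1 hp.1 p.2 hp.2).of_le (by exact_mod_cast hj))
    ((h'.1 p.1 hp.1 p.2 hp.2).of_le (by exact_mod_cast hj))

theorem param {c : X → ℂ} (hc : ContinuousOn c K) : SmoothFam r K I fun x _ => c x := by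
  refine ⟨fun x _ => contDiffOn_const, fun j _ => ?_⟩
  simp only [iteratedDerivWithin_const]
  split_ifs
  · exact hc.comp continuousOn_fst fun p hp => hp.1
  · exact continuousOn_const

theorem var (hI : UniqueDiffOn ℝ I) {f : ℝ → ℂ} (hf : ContDiffOn ℝ r f I) :
    SmoothFam r K I fun _ y => f y :=
  ⟨fun _ _ => hf, fun _ hj => (hf.continuousOn_iteratedDerivWithin (by exact_mod_cast hj) hI).comp
    continuousOn_snd fun _ hp => hp.2⟩

theorem const_mul (hI : UniqueDiffOn ℝ I) (c : ℂ) (h : SmoothFam r K I H) :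
    SmoothFam r K I fun x y => c * H x y := (param continuousOn_const).mul hI h

theorem neg (hI : UniqueDiffOn ℝ I) (h : SmoothFam r K I H) :
    SmoothFam r K I fun x y => -H x y :=
  (h.const_mul hI (-1)).congr fun _ _ _ _ => by ring

theorem sub (hI : UniqueDiffOn ℝ I) (h : SmoothFam r K I H) (h' : SmoothFam r K I H') :
    SmoothFam r K I fun x y => H x y - H' x y :=
  (h.add hI (h'.neg hI)).congr fun _ _ _ _ => by ring

theorem sum (hI : UniqueDiffOn ℝ I) {ι : Type*} (s : Finset ι) {G : ι → X → ℝ → ℂ}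
    (h : ∀ i ∈ s, SmoothFam r K I (G i)) : SmoothFam r K I fun x y => ∑ i ∈ s, G i x y := by
  classical
  induction s using Finset.induction_on with
  | empty => simpa using param (c := fun _ : X => (0 : ℂ)) continuousOn_const
  | insert i s hi ih =>
    simp only [Finset.sum_insert hi]
    exact (h i (Finset.mem_insert_self i s)).add hI
      (ih fun k hk => h k (Finset.mem_insert_of_mem hk))

theorem pow (hI : UniqueDiffOn ℝ I) (h : SmoothFam r K I H) (n : ℕ) :
    SmoothFam r K I fun x y => H x y ^ n := by
  induction n with
  | zero => simpa using param (c := fun _ : X => (1 : ℂ)) continuousOn_const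
  | succ n ih => simpa only [pow_succ] using ih.mul hI h

theorem mono (hI : UniqueDiffOn ℝ I) (hI' : UniqueDiffOn ℝ I') (h : SmoothFam r K I H)
    (hs : I' ⊆ I) : SmoothFam r K I' H := by
  refine ⟨fun x hx => (h.1 x hx).mono hs, fun j hj => ?_⟩
  exact ((h.2 j hj).mono (prod_mono subset_rfl hs)).congr fun p hp =>
    iteratedDerivWithin_mono hI hI' (h.1 p.1 hp.1) hs hj hp.2

theorem comp_param {K' : Set Y} (h : SmoothFam r K I H) {φ : Y → X} (hφ : ContinuousOn φ K')
    (hm : MapsTo φ K' K) : SmoothFam r K' I fun x => H (φ x) := by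
  refine ⟨fun x hx => h.1 _ (hm hx), fun j hj => ?_⟩
  exact (h.2 j hj).comp (f := fun p : Y × ℝ => (φ p.1, p.2))
    ((hφ.comp continuousOn_fst fun p hp => hp.1).prodMk continuousOn_snd)
    fun p hp => ⟨hm hp.1, hp.2⟩

theorem comp_affine (hI : UniqueDiffOn ℝ I) (hI' : UniqueDiffOn ℝ I') (h : SmoothFam r K I H)
    {c ε : ℝ} (hm : MapsTo (fun y => c + ε * y) I' I) :
    SmoothFam r K I' fun x y => H x (c + ε * y) := by
  refine ⟨fun x hx => (h.1 x hx).comp (by fun_prop) hm, fun j hj => ?_⟩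
  have h1 : ContinuousOn (fun p : X × ℝ => ε ^ j • iteratedDerivWithin j (H p.1) I (c + ε * p.2))
      (K ×ˢ I') := by
    have h2 : Continuous fun p : X × ℝ => (p.1, c + ε * p.2) := by fun_prop
    exact ((h.2 j hj).comp (s := K ×ˢ I') h2.continuousOn
      fun p hp => ⟨hp.1, hm hp.2⟩).const_smul (ε ^ j)
  exact h1.congr fun p hp => iteratedDerivWithin_comp_affine hI hI' (h.1 p.1 hp.1) hm hj hp.2

theorem deriv (h : SmoothFam ⊤ K univ H) : SmoothFam ⊤ K univ fun x => deriv (H x) := by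
  refine ⟨fun x hx => ?_, fun j _ => ?_⟩
  · have := h.1 x hx
    rw [contDiffOn_univ] at this ⊢
    exact (contDiff_infty_iff_deriv.1 this).2
  · refine (h.2 (j + 1) le_top).congr fun p _ => ?_
    simp only [iteratedDerivWithin_univ, iteratedDeriv_succ']

/-- If the derivatives of `H x` of order less than `n` vanish at `c`, then the derivatives are bounded
by powers of the distance from `c`, uniformly in `x`. -/
theorem exists_bound {a b : ℝ} (hab : a < b) (hK : IsCompact K)
    (h : SmoothFam ⊤ K (Icc a b) H) (n : ℕ) :
    ∃ C, 0 ≤ C ∧ ∀ x ∈ K, ∀ c ∈ Icc a b,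
      (∀ i < n, iteratedDerivWithin i (H x) (Icc a b) c = 0) →
      ∀ i ≤ n, ∀ y ∈ Icc a b,
        ‖iteratedDerivWithin i (H x) (Icc a b) y‖ ≤ C * |y - c| ^ (n - i) := by
  obtain ⟨C, hC⟩ := (hK.prod isCompact_Icc).exists_bound_of_continuousOn (h.2 n le_top)
  refine ⟨max C 0, le_max_right _ _, fun x hx c hc h0 i hi y hy => ?_⟩
  exact norm_iteratedDerivWithin_le_pow hab (h.1 x hx) hc h0
    (fun z hz => (hC (x, z) ⟨hx, hz⟩).trans (le_max_left _ _)) (by omega) hy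

end SmoothFam

end Families

/-! ### The parametrix on the line -/

section LineParametrix

variable {J I : Set ℝ} {a b : ℝ}

theorem continuousOn_eval_jet {α : Type*} [TopologicalSpace α] {s : Set α} {X : α → ℕ → ℝ}
    (hX : ∀ i, ContinuousOn (fun x => X x i) s) (p : MvPolynomial ℕ ℝ) :
    ContinuousOn (fun x => MvPolynomial.eval (X x) p) s := by
  induction p using MvPolynomial.induction_on with
  | C c => simpa using continuousOn_const
  | add p q hp hq => simp only [map_add]; exact hp.add hq
  | mul_X p i hp => simp only [map_mul, MvPolynomial.eval_X]; exact hp.mul (hX i)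

/-- The Taylor polynomial in `z = y - x` of the `k`-th coefficient of the heat kernel of the line,
if the derivatives of the potential at `x` are `X 0, X 1, …`. -/
noncomputable def transportSum (D : ℕ) (X : ℕ → ℝ) (k : ℕ) (z : ℝ) : ℝ :=
  ∑ j ∈ Finset.range D, MvPolynomial.eval X (transportJet k j) / (j.factorial : ℝ) * z ^ j

theorem transportSum_zero {D : ℕ} (hD : 0 < D) (X : ℕ → ℝ) (k : ℕ) :
    transportSum D X k 0 = MvPolynomial.eval X (interiorPoly k) := by
  obtain ⟨D, rfl⟩ := Nat.exists_eq_add_of_lt hD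
  rw [transportSum, zero_add, Finset.sum_range_succ', Finset.sum_eq_zero fun j _ => by simp]
  simp [interiorPoly]

theorem transportSum_neg (D : ℕ) (X : ℕ → ℝ) (k : ℕ) (z : ℝ) :
    transportSum D (fun i => (-1) ^ i * X i) k (-z) = transportSum D X k z := by
  refine Finset.sum_congr rfl fun j _ => ?_
  rw [eval_neg_transportJet, neg_pow z j]
  have : ((-1 : ℝ) ^ j) * (-1) ^ j = 1 := by rw [← mul_pow]; simp
  linear_combination
    (MvPolynomial.eval X (transportJet k j) / (j.factorial : ℝ) * z ^ j) * this

/-- The amplitudes of the parametrix: the first `N + 1` heat kernel coefficients on the line, as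
functions of the source `σ` and the target `ζ`, replaced by Taylor polynomials in `ζ - σ` and cut
off by `χ`. The degree of the Taylor polynomials is chosen such that the remainder of the
parametrix is of the order of its last term. -/
noncomputable def amplitude (N : ℕ) (χ : ℝ → ℝ) (X : ℝ → ℕ → ℝ) (k : ℕ) (σ ζ : ℝ) : ℂ :=
  if k ≤ N then ((χ ζ * transportSum (2 * N + 6) (X σ) k (ζ - σ) : ℝ) : ℂ) else 0

theorem smoothFam_amplitude {χ : ℝ → ℝ} (hχ : ContDiff ℝ ∞ χ) {X : ℝ → ℕ → ℝ}
    (hX : ∀ i, ContinuousOn (fun σ => X σ i) J) (N k : ℕ) :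
    SmoothFam ⊤ J univ (amplitude N χ X k) := by
  unfold amplitude
  by_cases hk : k ≤ N
  · simp only [if_pos hk]
    have hI := uniqueDiffOn_univ (𝕜 := ℝ) (E := ℝ)
    have h1 : SmoothFam ⊤ J univ fun _ ζ => (χ ζ : ℂ) :=
      SmoothFam.var hI (ContDiffOn.ofReal hχ.contDiffOn)
    have h2 : SmoothFam ⊤ J univ fun σ ζ : ℝ => (ζ : ℂ) - σ :=
      (SmoothFam.var hI (ContDiffOn.ofReal contDiffOn_id)).sub hI
        (SmoothFam.param Complex.continuous_ofReal.continuousOn)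
    have h3 : SmoothFam ⊤ J univ fun σ ζ : ℝ => ∑ j ∈ Finset.range (2 * N + 6),
        ((MvPolynomial.eval (X σ) (transportJet k j) / (j.factorial : ℝ) : ℝ) : ℂ)
          * ((ζ : ℂ) - σ) ^ j := by
      refine SmoothFam.sum hI _ fun j _ => SmoothFam.mul hI (SmoothFam.param ?_) (h2.pow hI j)
      exact Complex.continuous_ofReal.comp_continuousOn
        ((continuousOn_eval_jet hX _).div_const _)
    refine (h1.mul hI h3).congr fun σ _ ζ _ => ?_
    simp only [transportSum]
    push_cast
    rfl
  · simp only [if_neg hk]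
    exact SmoothFam.param continuousOn_const

/-- The coefficients of the remainder of a parametrix with amplitudes `A k` for the potential `u`,
see `hasDerivAt_heatSum`. -/
noncomputable def defect (A : ℕ → ℝ → ℝ → ℂ) (u : ℝ → ℝ) : ℕ → ℝ → ℝ → ℂ
  | 0, σ, ζ => -((ζ - σ : ℂ) * deriv (A 0 σ) ζ)
  | m + 1, σ, ζ => deriv (deriv (A m σ)) ζ + u ζ * A m σ ζ - (m + 1 : ℂ) * A (m + 1) σ ζ
      - (ζ - σ : ℂ) * deriv (A (m + 1) σ) ζ

theorem smoothFam_defect {A : ℕ → ℝ → ℝ → ℂ} (hA : ∀ k, SmoothFam ⊤ J univ (A k)) {u : ℝ → ℝ}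
    (hI : UniqueDiffOn ℝ I) (hu : ContDiffOn ℝ ∞ u I) (m : ℕ) :
    SmoothFam ⊤ J I (defect A u m) := by
  have hU := uniqueDiffOn_univ (𝕜 := ℝ) (E := ℝ)
  have h2 : SmoothFam ⊤ J univ fun σ ζ : ℝ => (ζ : ℂ) - σ :=
    (SmoothFam.var hU (ContDiffOn.ofReal contDiffOn_id)).sub hU
      (SmoothFam.param Complex.continuous_ofReal.continuousOn)
  have h3 : ∀ m, SmoothFam ⊤ J univ fun σ ζ : ℝ => ((ζ : ℂ) - σ) * deriv (A m σ) ζ :=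
    fun m => h2.mul hU (hA m).deriv
  rcases m with _ | m
  · exact ((h3 0).neg hU).mono hU hI (subset_univ _)
  · have h4 := ((hA m).deriv.deriv).mono hU hI (subset_univ I)
    have h5 : SmoothFam ⊤ J I fun σ ζ => (u ζ : ℂ) * A m σ ζ :=
      (SmoothFam.var hI (ContDiffOn.ofReal hu)).mul hI ((hA m).mono hU hI (subset_univ _))
    have h6 := ((hA (m + 1)).const_mul hU ((m : ℂ) + 1)).mono hU hI (subset_univ _)
    exact (((h4.add hI h5).sub hI h6).sub hI ((h3 (m + 1)).mono hU hI (subset_univ _)))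

theorem iteratedDeriv_sum_pow (D : ℕ) (c : ℕ → ℂ) (σ : ℝ) {i : ℕ} (hi : i < D) :
    iteratedDeriv i (fun ζ : ℝ => ∑ j ∈ Finset.range D, c j * ((ζ : ℂ) - σ) ^ j) σ
      = i.factorial * c i := by
  have key := iteratedDerivWithin_eqOn (r := ⊤) (I := univ) (j := i)
    (D := fun i ζ => ∑ j ∈ Finset.range D,
      c j * ((j.descFactorial i : ℂ) * ((ζ : ℂ) - σ) ^ (j - i)))
    uniqueDiffOn_univ (fun i _ ζ _ => by
      refine HasDerivAt.hasDerivWithinAt (HasDerivAt.fun_sum fun j _ => ?_)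
      have h1 : HasDerivAt (fun ζ : ℝ => (ζ : ℂ) - σ) 1 ζ :=
        (HasDerivAt.ofReal_comp (hasDerivAt_id ζ)).sub_const _
      refine (((h1.pow (j - i)).const_mul (j.descFactorial i : ℂ)).const_mul (c j)).congr_deriv ?_
      rw [Nat.descFactorial_succ, Nat.sub_sub, mul_one]
      push_cast
      ring) le_top (mem_univ σ)
  rw [iteratedDerivWithin_univ] at key
  simp only [Nat.descFactorial_zero, Nat.cast_one, one_mul, Nat.sub_zero, sub_self] at key
  rw [key, Finset.sum_eq_single_of_mem i (Finset.mem_range.2 hi)]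
  · simp [Nat.descFactorial_self, mul_comm]
  · intro j _ hj
    rcases lt_or_gt_of_ne hj with h | h
    · simp [Nat.descFactorial_eq_zero_iff_lt.2 h]
    · rw [zero_pow (by omega), mul_zero, mul_zero]

/-- The transport equations make the defects vanish to high order on the diagonal. -/
theorem iteratedDerivWithin_defect_amplitude {χ : ℝ → ℝ} {X : ℝ → ℕ → ℝ} {u : ℝ → ℝ}
    (hI : UniqueDiffOn ℝ I) (hu : ContDiffOn ℝ ∞ u I) {σ : ℝ} (hσ : σ ∈ I)
    (hX : ∀ i, X σ i = iteratedDerivWithin i u I σ) (hχ : χ =ᶠ[𝓝 σ] 1) {N m i : ℕ} (hm : m ≤ N)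
    (hi : i < 2 * N + 4) :
    iteratedDerivWithin i (defect (amplitude N χ X) u m σ) I σ = 0 := by
  set D := 2 * N + 6 with hD
  let W : ℕ → ℕ → ℝ := fun k j => MvPolynomial.eval (X σ) (transportJet k j)
  let P : (ℕ → ℂ) → ℝ → ℂ := fun c ζ => ∑ j ∈ Finset.range D, c j * ((ζ : ℂ) - σ) ^ j
  let c : ℕ → ℕ → ℂ := fun k j => ((W k j / (j.factorial : ℝ) : ℝ) : ℂ)
  have hz : ∀ ζ : ℝ, HasDerivAt (fun ζ : ℝ => (ζ : ℂ) - σ) 1 ζ := fun ζ =>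
    (HasDerivAt.ofReal_comp (hasDerivAt_id ζ)).sub_const _
  have hP : ∀ d, ContDiff ℝ ∞ (P d) := fun d =>
    ContDiff.sum fun j _ => contDiff_const.mul
      ((Complex.ofRealCLM.contDiff.sub contDiff_const).pow j)
  have hPi : ∀ d, ∀ j < D, iteratedDerivWithin j (P d) I σ = j.factorial * d j := fun d j hj => by
    rw [iteratedDerivWithin_eq_iteratedDeriv hI
      (((hP d).of_le (by exact_mod_cast le_top)).contDiffAt) hσ]
    exact iteratedDeriv_sum_pow D d σ hj
  have hfac : ∀ k j, (j.factorial : ℂ) * c k j = W k j := fun k j => by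
    have : (j.factorial : ℂ) ≠ 0 := by exact_mod_cast j.factorial_ne_zero
    simp only [c]; push_cast; field_simp
  have hPz : ∀ (d : ℕ → ℂ) (ζ : ℝ), ((ζ : ℂ) - σ) * deriv (P d) ζ = P (fun j => j * d j) ζ := by
    intro d ζ
    have : HasDerivAt (P d) (∑ j ∈ Finset.range D, d j * (j * ((ζ : ℂ) - σ) ^ (j - 1) * 1)) ζ :=
      HasDerivAt.fun_sum fun j _ => ((hz ζ).pow j).const_mul (d j)
    rw [this.deriv, Finset.mul_sum]
    refine Finset.sum_congr rfl fun j _ => ?_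
    rcases j with _ | j
    · simp
    · rw [Nat.add_sub_cancel, pow_succ]; push_cast; ring
  -- near the diagonal the amplitudes are polynomials
  have hAP : ∀ k ≤ N, amplitude N χ X k σ =ᶠ[𝓝 σ] P (c k) := fun k hk => by
    filter_upwards [hχ] with ζ hζ
    simp only [amplitude, if_pos hk, hζ, Pi.one_apply, one_mul, transportSum, P, c, W]
    push_cast
    rfl
  rcases m with _ | m
  · have heq : defect (amplitude N χ X) u 0 σ =ᶠ[𝓝 σ] P (fun j => -(j * c 0 j)) := by
      filter_upwards [(hAP 0 hm).deriv] with ζ hζ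
      rw [defect, hζ, hPz]
      simp only [P, neg_mul, Finset.sum_neg_distrib]
    rw [(heq.filter_mono nhdsWithin_le_nhds).iteratedDerivWithin_eq heq.self_of_nhds,
      hPi _ i (by omega), mul_neg, mul_left_comm, hfac]
    simp only [W, eval_transportJet_zero]
    split_ifs with h
    · simp [h]
    · simp
  · have heq : defect (amplitude N χ X) u (m + 1) σ =ᶠ[𝓝 σ] fun ζ =>
        deriv (deriv (P (c m))) ζ + u ζ * P (c m) ζ - P (fun j => (m + 1 + j) * c (m + 1) j) ζ := by
      filter_upwards [(hAP m (by omega)).deriv.deriv, hAP m (by omega), hAP (m + 1) hm,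
        (hAP (m + 1) hm).deriv] with ζ h1 h2 h3 h4
      rw [defect, h1, h2, h3, h4, hPz]
      simp only [P, add_mul, Finset.sum_add_distrib, Finset.mul_sum, mul_assoc]
      ring
    rw [(heq.filter_mono nhdsWithin_le_nhds).iteratedDerivWithin_eq heq.self_of_nhds]
    have hle : ((i : ℕ∞) : ℕ∞ω) ≤ ∞ := by exact_mod_cast le_top
    have hd2 : ContDiff ℝ ∞ (deriv (deriv (P (c m)))) :=
      (contDiff_infty_iff_deriv.1 (contDiff_infty_iff_deriv.1 (hP _)).2).2
    have huc := ContDiffOn.ofReal hu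
    have hi' : (i : ℕ∞ω) ≤ ∞ := hle
    have e1 : ContDiffWithinAt ℝ i (deriv (deriv (P (c m)))) I σ :=
      (hd2.of_le hi').contDiffWithinAt
    have e2 : ContDiffWithinAt ℝ i (fun ζ => (u ζ : ℂ)) I σ := (huc σ hσ).of_le hi'
    have e3 : ∀ d, ContDiffWithinAt ℝ i (P d) I σ := fun d => ((hP d).of_le hi').contDiffWithinAt
    have e23 : ContDiffWithinAt ℝ i (fun ζ => (u ζ : ℂ) * P (c m) ζ) I σ := e2.mul (e3 _)
    have e123 : ContDiffWithinAt ℝ i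
      (fun ζ => deriv (deriv (P (c m))) ζ + (u ζ : ℂ) * P (c m) ζ) I σ := e1.add e23
    refine (iteratedDerivWithin_sub hσ hI e123
      (e3 fun j => (m + 1 + j) * c (m + 1) j)).trans ?_
    rw [iteratedDerivWithin_fun_add hσ hI e1 e23,
      show iteratedDerivWithin i (fun ζ => (u ζ : ℂ) * P (c m) ζ) I σ = _ from
        iteratedDerivWithin_mul hσ hI e2 (e3 _), hPi _ i (by omega),
      iteratedDerivWithin_eq_iteratedDeriv hI (hd2.of_le hi').contDiffAt hσ,
      ← iteratedDeriv_succ', ← iteratedDeriv_succ',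
      show iteratedDeriv (i + 1 + 1) (P (c m)) σ = _ from
        iteratedDeriv_sum_pow D (c m) σ (by omega : i + 2 < D), hfac]
    have hsum : ∑ l ∈ Finset.range (i + 1), (i.choose l : ℂ) *
        iteratedDerivWithin l (fun ζ => (u ζ : ℂ)) I σ * iteratedDerivWithin (i - l) (P (c m)) I σ
        = ((∑ l ∈ Finset.range (i + 1), (i.choose l : ℝ) * (X σ l * W m (i - l)) : ℝ) : ℂ) := by
      push_cast
      refine Finset.sum_congr rfl fun l hl => ?_
      rw [hPi _ (i - l) (by omega), hfac, iteratedDerivWithin_ofReal (r := ⊤) hI hu le_top hσ, hX,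
        mul_assoc]
    have hrec := eval_transportJet_succ (X σ) m i
    rw [hsum, mul_left_comm, hfac]
    simp only [W]
    rw [← Complex.ofReal_add, ← hrec]
    push_cast
    ring

/-- The derivatives of order at most two of the heat kernel of the line. -/
noncomputable def gaussJet : ℕ → ℝ → ℝ → ℝ
  | 0, t, z => gaussKernel t z
  | 1, t, z => -(z / (2 * t)) * gaussKernel t z
  | _ + 2, t, z => (z ^ 2 / (4 * t ^ 2) - 1 / (2 * t)) * gaussKernel t z

theorem hasDerivAt_gaussJet {j : ℕ} (hj : j < 2) {t : ℝ} (ht : 0 < t) (z : ℝ) :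
    HasDerivAt (gaussJet j t) (gaussJet (j + 1) t z) z := by
  interval_cases j
  · exact gaussKernel_hasDerivAt_right ht z
  · have h1 : HasDerivAt (fun z : ℝ => -(z / (2 * t))) (-(1 / (2 * t))) z :=
      ((hasDerivAt_id z).div_const (2 * t)).neg
    refine (h1.mul (gaussKernel_hasDerivAt_right ht z)).congr_deriv ?_
    simp only [gaussJet]
    field_simp
    ring

theorem continuousOn_gaussKernel :
    ContinuousOn (fun p : ℝ × ℝ => gaussKernel p.1 p.2) (Ioi 0 ×ˢ univ) := by
  unfold gaussKernel
  refine ContinuousOn.div ?_ (by fun_prop) fun p hp =>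
    (Real.sqrt_pos.2 (by have : 0 < p.1 := hp.1; positivity)).ne'
  refine ContinuousOn.rexp (ContinuousOn.div (by fun_prop) (by fun_prop) fun p hp => ?_)
  have : 0 < p.1 := hp.1
  positivity

theorem continuousOn_gaussJet (j : ℕ) :
    ContinuousOn (fun p : ℝ × ℝ => gaussJet j p.1 p.2) (Ioi 0 ×ˢ univ) := by
  have h0 : ∀ p ∈ (Ioi 0 ×ˢ univ : Set (ℝ × ℝ)), 0 < p.1 := fun p hp => hp.1
  rcases j with _ | _ | j
  · exact continuousOn_gaussKernel
  · refine ContinuousOn.mul ?_ continuousOn_gaussKernel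
    exact (ContinuousOn.div (by fun_prop) (by fun_prop) fun p hp => by
      have := h0 p hp; positivity).neg
  · refine ContinuousOn.mul (ContinuousOn.sub ?_ ?_) continuousOn_gaussKernel
    all_goals
      exact ContinuousOn.div (by fun_prop) (by fun_prop) fun p hp => by
        have := h0 p hp; positivity

theorem gaussFam_aux (hI : UniqueDiffOn ℝ I) :
    SmoothFam 2 (Ioi 0 ×ˢ J) I (fun (p : ℝ × ℝ) ζ => (gaussKernel p.1 (ζ - p.2) : ℂ)) ∧
      ∀ j ≤ 2, ∀ p ∈ (Ioi (0 : ℝ) ×ˢ J), EqOn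
        (iteratedDerivWithin j (fun ζ => (gaussKernel p.1 (ζ - p.2) : ℂ)) I)
        (fun ζ => (gaussJet j p.1 (ζ - p.2) : ℂ)) I := by
  have hd : ∀ j : ℕ, (j : ℕ∞) < 2 → ∀ p ∈ (Ioi (0 : ℝ) ×ˢ J), ∀ ζ ∈ I,
      HasDerivWithinAt (fun ζ => (gaussJet j p.1 (ζ - p.2) : ℂ))
        (gaussJet (j + 1) p.1 (ζ - p.2) : ℂ) I ζ := fun j hj p hp ζ _ =>
    ((hasDerivAt_gaussJet (by exact_mod_cast hj) hp.1 _).comp_sub_const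
      ζ p.2).ofReal_comp.hasDerivWithinAt
  refine ⟨SmoothFam.of_family
    (D := fun j (p : ℝ × ℝ) ζ => (gaussJet j p.1 (ζ - p.2) : ℂ)) hI (fun j _ => ?_) hd,
    fun j hj p hp => iteratedDerivWithin_eqOn (r := 2)
      (D := fun j ζ => (gaussJet j p.1 (ζ - p.2) : ℂ)) hI
      (fun j hj ζ hζ => hd j hj p hp ζ hζ) (by exact_mod_cast hj)⟩
  refine Complex.continuous_ofReal.comp_continuousOn ?_
  exact (continuousOn_gaussJet j).comp (f := fun p : (ℝ × ℝ) × ℝ => (p.1.1, p.2 - p.1.2))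
    (by fun_prop) fun p hp => ⟨hp.1.1, mem_univ _⟩

theorem smoothFam_gauss (hI : UniqueDiffOn ℝ I) :
    SmoothFam 2 (Ioi 0 ×ˢ J) I (fun (p : ℝ × ℝ) ζ => (gaussKernel p.1 (ζ - p.2) : ℂ)) :=
  (gaussFam_aux hI).1

theorem iteratedDerivWithin_gauss (hI : UniqueDiffOn ℝ I) {j : ℕ} (hj : j ≤ 2) {t σ : ℝ}
    (ht : 0 < t) :
    EqOn (iteratedDerivWithin j (fun ζ => (gaussKernel t (ζ - σ) : ℂ)) I)
      (fun ζ => (gaussJet j t (ζ - σ) : ℂ)) I :=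
  (gaussFam_aux (J := univ) hI).2 j hj (t, σ) ⟨ht, mem_univ _⟩

theorem abs_gaussJet_le {t z R : ℝ} (ht : 0 < t) (ht1 : t ≤ 1) (hR : 0 ≤ R) (hz : |z| ≤ R)
    (j : ℕ) : |gaussJet j t z| ≤ (1 + R + R ^ 2) * (gaussKernel t z / t ^ 2) := by
  have hg := gaussKernel_nonneg t z
  have h1 : 1 ≤ 1 / t := by rwa [one_le_div ht]
  have h2 : 1 / t ≤ 1 / t ^ 2 := by
    rw [div_le_div_iff₀ ht (by positivity)]; nlinarith
  have hz2 : z ^ 2 ≤ R ^ 2 := by rw [← sq_abs]; exact pow_le_pow_left₀ (abs_nonneg _) hz 2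
  have key : ∀ q : ℝ, |q| ≤ (1 + R + R ^ 2) * (1 / t ^ 2) →
      |q * gaussKernel t z| ≤ (1 + R + R ^ 2) * (gaussKernel t z / t ^ 2) := fun q hq => by
    rw [abs_mul, abs_of_nonneg hg]
    calc _ ≤ (1 + R + R ^ 2) * (1 / t ^ 2) * gaussKernel t z := by gcongr
      _ = _ := by ring
  have hR2 : 0 ≤ R ^ 2 := sq_nonneg R
  rcases j with _ | _ | j
  · rw [gaussJet, ← one_mul (gaussKernel t z), ← one_mul (gaussKernel t z)]
    refine (key (1 * 1) ?_).trans' (by simp) |>.trans (by simp)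
    rw [mul_one, abs_one]
    nlinarith
  · refine key _ ?_
    have e : |-(z / (2 * t))| = |z| * (1 / t) / 2 := by
      rw [abs_neg, abs_div, abs_of_pos (by positivity : (0 : ℝ) < 2 * t)]; ring
    rw [e]
    have := abs_nonneg z
    nlinarith [mul_le_mul hz h2 (by positivity) hR]
  · refine key _ ?_
    have e1 : |z ^ 2 / (4 * t ^ 2)| ≤ R ^ 2 * (1 / t ^ 2) := by
      rw [abs_of_nonneg (by positivity)]
      rw [div_le_iff₀ (by positivity)]
      have : R ^ 2 * (1 / t ^ 2) * (4 * t ^ 2) = 4 * R ^ 2 := by field_simp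
      nlinarith
    have e2 : |1 / (2 * t)| ≤ 1 / t ^ 2 := by
      rw [abs_of_nonneg (by positivity)]
      refine le_trans ?_ h2
      rw [div_le_div_iff₀ (by positivity) ht]; linarith
    have e3 : 0 ≤ R * (1 / t ^ 2) := by positivity
    calc _ ≤ _ := abs_sub _ _
      _ ≤ _ := add_le_add e1 e2
      _ ≤ _ := by nlinarith

/-- Powers of the distance to the diagonal are as good as half as many powers of `t`, up to the
factor `1 / √(4πt)`, which is estimated by `1 / t`. -/
theorem exists_pow_mul_gaussKernel_le (p : ℕ) :
    ∃ C, 0 ≤ C ∧ ∀ t z : ℝ, 0 < t → t ≤ 1 → |z| ^ (2 * p) * gaussKernel t z ≤ C * t ^ p / t := by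
  refine ⟨4 ^ p * p.factorial, by positivity, fun t z ht ht1 => ?_⟩
  have h1 := Real.pow_div_factorial_le_exp (z ^ 2 / (4 * t)) (by positivity) p
  have h2 : 1 * t ≤ √(4 * π * t) := by
    rw [one_mul]
    refine Real.le_sqrt_of_sq_le ?_
    nlinarith [Real.pi_gt_three]
  have h3 : (|z| ^ (2 * p)) = (z ^ 2 / (4 * t)) ^ p / p.factorial * (4 ^ p * p.factorial * t ^ p) := by
    have : (p.factorial : ℝ) ≠ 0 := by exact_mod_cast p.factorial_ne_zero
    rw [pow_mul, sq_abs, div_pow, mul_pow]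
    field_simp
  rw [gaussKernel, neg_div, Real.exp_neg, h3, div_eq_mul_inv _ (√_)]
  have h5 : (√(4 * π * t))⁻¹ ≤ 1 / t := by
    rw [← one_div]
    exact one_div_le_one_div_of_le ht (by linarith)
  have hE := Real.exp_pos (z ^ 2 / (4 * t))
  calc _ = ((z ^ 2 / (4 * t)) ^ p / p.factorial * (Real.exp (z ^ 2 / (4 * t)))⁻¹)
        * (4 ^ p * p.factorial * t ^ p) * (√(4 * π * t))⁻¹ := by ring
    _ ≤ 1 * (4 ^ p * p.factorial * t ^ p) * (1 / t) := by
        gcongr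
        rw [← div_eq_mul_inv, div_le_one hE]
        exact h1
    _ = _ := by ring

/-- A Gaussian times a power series in `t` with the coefficients `A k`. -/
noncomputable def heatSum (N : ℕ) (A : ℕ → ℝ → ℝ → ℂ) (t σ ζ : ℝ) : ℂ :=
  gaussKernel t (ζ - σ) * ∑ k ∈ Finset.range (N + 1), (t : ℂ) ^ k * A k σ ζ

/-- The remainder of `heatSum` in the heat equation. -/
noncomputable def heatRemainder (N : ℕ) (A : ℕ → ℝ → ℝ → ℂ) (u : ℝ → ℝ) (t σ ζ : ℝ) : ℂ :=
  -((t : ℂ)⁻¹ * ∑ m ∈ Finset.range (N + 2),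
    (t : ℂ) ^ m * (gaussKernel t (ζ - σ) * defect A u m σ ζ))

theorem smoothFam_sum_pow {A : ℕ → ℝ → ℝ → ℂ} (hA : ∀ k, SmoothFam ⊤ J univ (A k))
    (hI : UniqueDiffOn ℝ I) (N : ℕ) :
    SmoothFam 2 (Ioi 0 ×ˢ J) I fun (p : ℝ × ℝ) ζ =>
      ∑ k ∈ Finset.range (N + 1), (p.1 : ℂ) ^ k * A k p.2 ζ :=
  SmoothFam.sum hI _ fun k _ => SmoothFam.mul hI
    (SmoothFam.param ((Complex.continuous_ofReal.comp continuous_fst).pow k).continuousOn)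
    (((((hA k).mono uniqueDiffOn_univ hI (subset_univ _)).of_le le_top).comp_param
      continuousOn_snd fun _ hp => hp.2))

theorem smoothFam_heatSum {A : ℕ → ℝ → ℝ → ℂ} (hA : ∀ k, SmoothFam ⊤ J univ (A k))
    (hI : UniqueDiffOn ℝ I) (N : ℕ) :
    SmoothFam 2 (Ioi 0 ×ˢ J) I fun (p : ℝ × ℝ) => heatSum N A p.1 p.2 :=
  (smoothFam_gauss hI).mul hI (smoothFam_sum_pow hA hI N)

theorem smoothFam_gauss_defect {A : ℕ → ℝ → ℝ → ℂ} (hA : ∀ k, SmoothFam ⊤ J univ (A k))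
    {u : ℝ → ℝ} (hI : UniqueDiffOn ℝ I) (hu : ContDiffOn ℝ ∞ u I) (m : ℕ) :
    SmoothFam 2 (Ioi 0 ×ˢ J) I fun (p : ℝ × ℝ) ζ =>
      (gaussKernel p.1 (ζ - p.2) : ℂ) * defect A u m p.2 ζ :=
  (smoothFam_gauss hI).mul hI (((smoothFam_defect hA hI hu m).of_le le_top).comp_param
    continuousOn_snd fun _ hp => hp.2)

theorem smoothFam_heatRemainder {A : ℕ → ℝ → ℝ → ℂ} (hA : ∀ k, SmoothFam ⊤ J univ (A k))
    {u : ℝ → ℝ} (hI : UniqueDiffOn ℝ I) (hu : ContDiffOn ℝ ∞ u I) (N : ℕ) :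
    SmoothFam 2 (Ioi 0 ×ˢ J) I fun (p : ℝ × ℝ) => heatRemainder N A u p.1 p.2 := by
  refine SmoothFam.neg hI (SmoothFam.mul hI (SmoothFam.param ?_)
    (SmoothFam.sum hI _ fun m _ => SmoothFam.mul hI (SmoothFam.param (by fun_prop))
      (smoothFam_gauss_defect hA hI hu m)))
  refine ContinuousOn.inv₀ (by fun_prop) fun p hp => ?_
  have : p.1 ≠ 0 := ne_of_gt hp.1
  exact_mod_cast this

theorem iteratedDerivWithin_sum_pow {A : ℕ → ℝ → ℝ → ℂ} (hA : ∀ k, SmoothFam ⊤ J univ (A k))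
    (hI : UniqueDiffOn ℝ I) (N j : ℕ) (t : ℝ) {σ ζ : ℝ} (hσ : σ ∈ J) (hζ : ζ ∈ I) :
    iteratedDerivWithin j (fun ζ => ∑ k ∈ Finset.range (N + 1), (t : ℂ) ^ k * A k σ ζ) I ζ
      = ∑ k ∈ Finset.range (N + 1), (t : ℂ) ^ k * iteratedDeriv j (A k σ) ζ := by
  have hc : ∀ k, ContDiff ℝ j (A k σ) := fun k =>
    (contDiffOn_univ.1 ((hA k).1 σ hσ)).of_le (by exact_mod_cast le_top)
  rw [iteratedDerivWithin_fun_sum hζ hI fun k _ => (contDiff_const.mul (hc k)).contDiffWithinAt]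
  refine Finset.sum_congr rfl fun k _ => ?_
  rw [iteratedDerivWithin_const_mul_field,
    iteratedDerivWithin_eq_iteratedDeriv hI (hc k).contDiffAt hζ]

theorem hasDerivAt_heatSum {A : ℕ → ℝ → ℝ → ℂ} (hA : ∀ k, SmoothFam ⊤ J univ (A k)) {u : ℝ → ℝ}
    (hI : UniqueDiffOn ℝ I) {N : ℕ} (hN : A (N + 1) = 0) {t σ ζ : ℝ} (ht : 0 < t) (hσ : σ ∈ J)
    (hζ : ζ ∈ I) :
    HasDerivAt (fun t => heatSum N A t σ ζ)
      (iteratedDerivWithin 2 (heatSum N A t σ) I ζ + u ζ * heatSum N A t σ ζ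
        + heatRemainder N A u t σ ζ) t := by
  have ht0 : (t : ℂ) ≠ 0 := by exact_mod_cast ht.ne'
  have h1 := (gaussKernel_hasDerivAt_left ht (ζ - σ)).ofReal_comp
  have h2 : HasDerivAt (fun t : ℝ => ∑ k ∈ Finset.range (N + 1), (t : ℂ) ^ k * A k σ ζ)
      (∑ k ∈ Finset.range (N + 1), (k : ℂ) * (t : ℂ) ^ (k - 1) * A k σ ζ) t := by
    refine HasDerivAt.fun_sum fun k _ => ?_
    have := ((HasDerivAt.ofReal_comp (hasDerivAt_id t)).pow k).mul_const (A k σ ζ)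
    simpa using this
  refine (h1.mul h2).congr_deriv ?_
  have hp : (t, σ) ∈ (Ioi (0 : ℝ) ×ˢ J) := ⟨ht, hσ⟩
  have hle : (((2 : ℕ) : ℕ∞) : ℕ∞ω) ≤ ((2 : ℕ∞) : ℕ∞ω) := by exact_mod_cast le_rfl
  have hD : iteratedDerivWithin 2 (heatSum N A t σ) I ζ = _ := iteratedDerivWithin_mul hζ hI
    (((smoothFam_gauss hI).1 (t, σ) hp ζ hζ).of_le hle)
    (((smoothFam_sum_pow hA hI N).1 (t, σ) hp ζ hζ).of_le hle)
  simp only [Finset.sum_range_succ (n := 2), Finset.sum_range_succ (n := 1),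
    Finset.sum_range_one, Nat.choose_zero_right, Nat.choose_one_right, Nat.choose_self,
    iteratedDerivWithin_sum_pow hA hI N _ t hσ hζ, Nat.sub_zero, Nat.sub_self, Nat.add_one_sub_one,
    iteratedDerivWithin_gauss hI (show 0 ≤ 2 by norm_num) ht hζ,
    iteratedDerivWithin_gauss hI (show 1 ≤ 2 by norm_num) ht hζ,
    iteratedDerivWithin_gauss hI (show 2 ≤ 2 by norm_num) ht hζ, gaussJet, iteratedDeriv_zero,
    iteratedDeriv_one, iteratedDeriv_succ (n := 1)] at hD
  rw [hD, heatRemainder, heatSum]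
  have hS : ∑ m ∈ Finset.range (N + 2),
      (t : ℂ) ^ m * (gaussKernel t (ζ - σ) * defect A u m σ ζ)
      = gaussKernel t (ζ - σ) * (t * (∑ k ∈ Finset.range (N + 1), (t : ℂ) ^ k * deriv (deriv (A k σ)) ζ
          + u ζ * ∑ k ∈ Finset.range (N + 1), (t : ℂ) ^ k * A k σ ζ)
        - (t * ∑ k ∈ Finset.range (N + 1), (k : ℂ) * (t : ℂ) ^ (k - 1) * A k σ ζ
          + (ζ - σ) * ∑ k ∈ Finset.range (N + 1), (t : ℂ) ^ k * deriv (A k σ) ζ)) := by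
    let f : ℕ → ℂ := fun k => (t : ℂ) ^ k * (k * A k σ ζ + (ζ - σ) * deriv (A k σ) ζ)
    have hf : ∑ m ∈ Finset.range (N + 1), f (m + 1) + f 0 = ∑ m ∈ Finset.range (N + 1), f m := by
      rw [← Finset.sum_range_succ', Finset.sum_range_succ]
      simp [f, hN]
    have hf' : ∑ m ∈ Finset.range (N + 1), f m
        = t * ∑ k ∈ Finset.range (N + 1), (k : ℂ) * (t : ℂ) ^ (k - 1) * A k σ ζ
          + (ζ - σ) * ∑ k ∈ Finset.range (N + 1), (t : ℂ) ^ k * deriv (A k σ) ζ := by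
      rw [Finset.mul_sum, Finset.mul_sum, ← Finset.sum_add_distrib]
      refine Finset.sum_congr rfl fun k _ => ?_
      rcases k with _ | k
      · simp [f]
      · simp only [f, Nat.add_sub_cancel, pow_succ]; ring
    rw [← hf', ← hf, Finset.sum_range_succ', Finset.mul_sum, ← Finset.sum_add_distrib,
      Finset.mul_sum, ← sub_sub, ← Finset.sum_sub_distrib, mul_sub, Finset.mul_sum]
    simp only [f, defect]
    push_cast
    have : ∀ a b c d : ℂ, a = b → c = -d → a + c = b - d := fun a b c d h1 h2 => by
      rw [h1, h2, sub_eq_add_neg]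
    refine this _ _ _ _ (Finset.sum_congr rfl fun m _ => ?_) (by ring)
    rw [pow_succ]
    ring
  rw [hS]
  push_cast
  field_simp
  ring

theorem iteratedDerivWithin_heatRemainder {A : ℕ → ℝ → ℝ → ℂ}
    (hA : ∀ k, SmoothFam ⊤ J univ (A k)) {u : ℝ → ℝ} (hI : UniqueDiffOn ℝ I)
    (hu : ContDiffOn ℝ ∞ u I) (N : ℕ) {j : ℕ} (hj : j ≤ 2) {t σ ζ : ℝ} (ht : 0 < t) (hσ : σ ∈ J)
    (hζ : ζ ∈ I) :
    iteratedDerivWithin j (heatRemainder N A u t σ) I ζ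
      = -((t : ℂ)⁻¹ * ∑ m ∈ Finset.range (N + 2), (t : ℂ) ^ m *
          iteratedDerivWithin j (fun ζ => gaussKernel t (ζ - σ) * defect A u m σ ζ) I ζ) := by
  have hc : ∀ m, ContDiffWithinAt ℝ j (fun ζ => gaussKernel t (ζ - σ) * defect A u m σ ζ) I ζ :=
    fun m => ((smoothFam_gauss_defect hA hI hu m).1 (t, σ) ⟨ht, hσ⟩ ζ hζ).of_le
      (by exact_mod_cast hj)
  unfold heatRemainder
  rw [iteratedDerivWithin_fun_neg, iteratedDerivWithin_const_mul_field,
    iteratedDerivWithin_fun_sum hζ hI fun m _ => contDiffWithinAt_const.mul (hc m)]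
  congr 2
  exact Finset.sum_congr rfl fun m _ => iteratedDerivWithin_const_mul_field _ _

/-- A factor of order `2p` on the diagonal gains `t ^ p`. The three powers of `t` that are lost come
from two derivatives of the Gaussian and from its factor `1 / √(4πt)`. -/
theorem exists_norm_gauss_mul_le (hab : a < b) (hJI : J ⊆ Icc a b) {H : ℝ → ℝ → ℂ}
    (hH : SmoothFam 2 J (Icc a b) H) {p : ℕ} {C : ℝ} (hC : 0 ≤ C)
    (h : ∀ σ ∈ J, ∀ i ≤ 2, ∀ ζ ∈ Icc a b,
      ‖iteratedDerivWithin i (H σ) (Icc a b) ζ‖ ≤ C * |ζ - σ| ^ (2 * p)) :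
    ∃ C', 0 ≤ C' ∧ ∀ t, 0 < t → t ≤ 1 → ∀ σ ∈ J, ∀ j ≤ 2, ∀ ζ ∈ Icc a b,
      ‖iteratedDerivWithin j (fun ζ => gaussKernel t (ζ - σ) * H σ ζ) (Icc a b) ζ‖
        ≤ C' * (t ^ p / t ^ 3) := by
  have hI := uniqueDiffOn_Icc hab
  obtain ⟨Cp, hCp0, hCp⟩ := exists_pow_mul_gaussKernel_le p
  set R := b - a with hR
  have hR0 : 0 ≤ R := by linarith
  have hK : 0 ≤ 1 + R + R ^ 2 := by positivity
  refine ⟨4 * ((1 + R + R ^ 2) * C * Cp), by positivity, fun t ht ht1 σ hσ j hj ζ hζ => ?_⟩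
  have hz : |ζ - σ| ≤ R := by
    have := hJI hσ
    rw [abs_le]; constructor <;> linarith [hζ.1, hζ.2, this.1, this.2]
  have hle : ((j : ℕ∞) : ℕ∞ω) ≤ ((2 : ℕ∞) : ℕ∞ω) := by exact_mod_cast hj
  have hD : iteratedDerivWithin j (fun ζ => gaussKernel t (ζ - σ) * H σ ζ) (Icc a b) ζ = _ :=
    iteratedDerivWithin_mul hζ hI
    (((smoothFam_gauss (J := J) hI).1 (t, σ) ⟨ht, hσ⟩ ζ hζ).of_le hle)
    ((hH.1 σ hσ ζ hζ).of_le hle)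
  rw [hD]
  refine (norm_sum_le _ _).trans ?_
  have hterm : ∀ i ∈ Finset.range (j + 1), ‖(j.choose i : ℂ) *
      iteratedDerivWithin i (fun ζ => (gaussKernel t (ζ - σ) : ℂ)) (Icc a b) ζ *
      iteratedDerivWithin (j - i) (H σ) (Icc a b) ζ‖
      ≤ j.choose i * ((1 + R + R ^ 2) * C * Cp * (t ^ p / t ^ 3)) := by
    intro i hi
    have hi' := Finset.mem_range.1 hi
    rw [norm_mul, norm_mul, iteratedDerivWithin_gauss hI (by omega) ht hζ, Complex.norm_natCast,
      Complex.norm_real, Real.norm_eq_abs, mul_assoc]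
    refine mul_le_mul_of_nonneg_left ?_ (Nat.cast_nonneg _)
    have hg := gaussKernel_nonneg t (ζ - σ)
    calc _ ≤ ((1 + R + R ^ 2) * (gaussKernel t (ζ - σ) / t ^ 2)) * (C * |ζ - σ| ^ (2 * p)) :=
          mul_le_mul (abs_gaussJet_le ht ht1 hR0 hz i) (h σ hσ (j - i) (by omega) ζ hζ)
            (norm_nonneg _) (by positivity)
      _ = (1 + R + R ^ 2) * C * (|ζ - σ| ^ (2 * p) * gaussKernel t (ζ - σ)) / t ^ 2 := by ring
      _ ≤ (1 + R + R ^ 2) * C * (Cp * t ^ p / t) / t ^ 2 := by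
          gcongr
          exact hCp t (ζ - σ) ht ht1
      _ = _ := by field_simp
  refine (Finset.sum_le_sum hterm).trans ?_
  rw [← Finset.sum_mul, ← Nat.cast_sum, Nat.sum_range_choose]
  have : ((2 ^ j : ℕ) : ℝ) ≤ 4 := by
    interval_cases j <;> norm_num
  have h0 : 0 ≤ (1 + R + R ^ 2) * C * Cp * (t ^ p / t ^ 3) := by positivity
  nlinarith

/-- The remainder of the parametrix is small together with two derivatives. The `M + 3` steps of the
parametrix make up for the powers of `t` lost in `exists_norm_gauss_mul_le`. -/
theorem exists_norm_heatRemainder_le {χ : ℝ → ℝ} {X : ℝ → ℕ → ℝ} {u : ℝ → ℝ} (hab : a < b)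
    (hJ : IsCompact J) (hJI : J ⊆ Icc a b) (hu : ContDiffOn ℝ ∞ u (Icc a b))
    (hX : ∀ σ ∈ J, ∀ i, X σ i = iteratedDerivWithin i u (Icc a b) σ) (hχ : ContDiff ℝ ∞ χ)
    (hχ1 : ∀ σ ∈ J, χ =ᶠ[𝓝 σ] 1) (M : ℕ) :
    ∃ C, 0 ≤ C ∧ ∀ t, 0 < t → t ≤ 1 → ∀ σ ∈ J, ∀ j ≤ 2, ∀ ζ ∈ Icc a b,
      ‖iteratedDerivWithin j (heatRemainder (M + 3) (amplitude (M + 3) χ X) u t σ) (Icc a b) ζ‖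
        ≤ C * t ^ M := by
  have hI := uniqueDiffOn_Icc hab
  have hXc : ∀ i, ContinuousOn (fun σ => X σ i) J := fun i =>
    ((hu.continuousOn_iteratedDerivWithin (by exact_mod_cast le_top) hI).mono hJI).congr
      fun σ hσ => hX σ hσ i
  have hA := smoothFam_amplitude hχ hXc (M + 3)
  have hR0 : 0 ≤ b - a := by linarith
  have key : ∀ m ∈ Finset.range (M + 5), ∃ C, 0 ≤ C ∧ ∀ t, 0 < t → t ≤ 1 → ∀ σ ∈ J, ∀ j ≤ 2,
      ∀ ζ ∈ Icc a b, t ^ m * ‖iteratedDerivWithin j (fun ζ => gaussKernel t (ζ - σ) *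
        defect (amplitude (M + 3) χ X) u m σ ζ) (Icc a b) ζ‖ ≤ C * t ^ (M + 1) := by
    intro m hm
    have hH := smoothFam_defect hA hI hu m
    -- the last defect does not vanish on the diagonal, but has the factor `t ^ (M + 4)`
    obtain ⟨p, hp, C, hC0, hC⟩ : ∃ p, M + 4 ≤ m + p ∧ ∃ C, 0 ≤ C ∧ ∀ σ ∈ J, ∀ i ≤ 2,
        ∀ ζ ∈ Icc a b, ‖iteratedDerivWithin i (defect (amplitude (M + 3) χ X) u m σ) (Icc a b) ζ‖
          ≤ C * |ζ - σ| ^ (2 * p) := by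
      by_cases hmN : m ≤ M + 3
      · obtain ⟨C, hC0, hC⟩ := hH.exists_bound hab hJ (2 * (M + 3) + 4)
        refine ⟨M + 4, by omega, C * (1 + (b - a) + (b - a) ^ 2), by positivity,
          fun σ hσ i hi ζ hζ => ?_⟩
        refine (hC σ hσ σ (hJI hσ) (fun i hi => iteratedDerivWithin_defect_amplitude hI hu
          (hJI hσ) (hX σ hσ) (hχ1 σ hσ) hmN hi) i (by omega) ζ hζ).trans ?_
        have hz : |ζ - σ| ≤ b - a := by
          have := hJI hσ
          rw [abs_le]; constructor <;> linarith [hζ.1, hζ.2, this.1, this.2]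
        rw [show 2 * (M + 3) + 4 - i = (2 - i) + 2 * (M + 4) by omega, pow_add, mul_assoc]
        have h0 := abs_nonneg (ζ - σ)
        have h3 : |ζ - σ| ^ (2 - i) ≤ 1 + (b - a) + (b - a) ^ 2 := by
          have h4 := pow_le_pow_left₀ h0 hz (2 - i)
          refine h4.trans ?_
          interval_cases i <;> norm_num <;> nlinarith
        gcongr
      · obtain ⟨B, hB⟩ : ∃ B : ℝ, ∀ i ≤ 2, ∀ q ∈ J ×ˢ Icc a b,
            ‖iteratedDerivWithin i (defect (amplitude (M + 3) χ X) u m q.1) (Icc a b) q.2‖ ≤ B := by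
          have := fun i => (hJ.prod isCompact_Icc).exists_bound_of_continuousOn (hH.2 i le_top)
          choose B hB using this
          refine ⟨max (B 0) (max (B 1) (B 2)), fun i hi q hq => ?_⟩
          have := hB i q hq
          interval_cases i
          · exact this.trans (le_max_left _ _)
          · exact this.trans ((le_max_left _ _).trans (le_max_right _ _))
          · exact this.trans ((le_max_right _ _).trans (le_max_right _ _))
        refine ⟨0, by have := Finset.mem_range.1 hm; omega, max B 0, le_max_right _ _,
          fun σ hσ i hi ζ hζ => ?_⟩
        simpa using Or.inl (hB i hi (σ, ζ) ⟨hσ, hζ⟩)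
    obtain ⟨C', hC'0, hC'⟩ := exists_norm_gauss_mul_le hab hJI (hH.of_le le_top) hC0 hC
    refine ⟨C', hC'0, fun t ht ht1 σ hσ j hj ζ hζ => ?_⟩
    calc _ ≤ t ^ m * (C' * (t ^ p / t ^ 3)) := by
          gcongr
          exact hC' t ht ht1 σ hσ j hj ζ hζ
      _ = C' * (t ^ (m + p) / t ^ 3) := by rw [pow_add]; ring
      _ ≤ C' * (t ^ (M + 4) / t ^ 3) := by
          gcongr ?_ * (?_ / _)
          exact pow_le_pow_of_le_one ht.le ht1 hp
      _ = C' * t ^ (M + 1) := by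
          congr 1
          rw [div_eq_iff (by positivity)]; ring
  choose! C hC0 hC using key
  refine ⟨∑ m ∈ Finset.range (M + 5), C m, Finset.sum_nonneg hC0,
    fun t ht ht1 σ hσ j hj ζ hζ => ?_⟩
  rw [iteratedDerivWithin_heatRemainder hA hI hu _ hj ht hσ hζ, norm_neg, norm_mul, norm_inv,
    Complex.norm_real, Real.norm_of_nonneg ht.le, inv_mul_le_iff₀ ht]
  refine (norm_sum_le _ _).trans ?_
  rw [Finset.sum_mul, Finset.mul_sum]
  refine Finset.sum_le_sum fun m hm => ?_
  rw [norm_mul, norm_pow, Complex.norm_real, Real.norm_of_nonneg ht.le]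
  refine (hC m hm t ht ht1 σ hσ j hj ζ hζ).trans (le_of_eq ?_)
  ring

end LineParametrix

/-! ### Direct and reflected waves -/

namespace MetricGraph

variable {V E : Type*} {Γ : MetricGraph V E} {S : E × Bool → E × Bool → ℂ}

/-- The line segment on which a wave lives that comes from the edge `e` and passes a vertex into the
edge `f`: the coordinate is the distance from the vertex, negative on `f`. -/
def passSeg (Γ : MetricGraph V E) (e f : E) : Set ℝ := Icc (-Γ.len f) (Γ.len e)

theorem uniqueDiffOn_passSeg (e f : E) : UniqueDiffOn ℝ (Γ.passSeg e f) :=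
  uniqueDiffOn_Icc (by linarith [Γ.len_pos e, Γ.len_pos f])

theorem uniqueDiffOn_edge (e : E) : UniqueDiffOn ℝ (Icc 0 (Γ.len e)) :=
  uniqueDiffOn_Icc (Γ.len_pos e)

theorem edge_subset_passSeg (e f : E) : Icc 0 (Γ.len e) ⊆ Γ.passSeg e f :=
  Icc_subset_Icc (by linarith [Γ.len_pos f]) le_rfl

theorem neg_pos_mem_passSeg (e : E) (h : E × Bool) {y : ℝ} (hy : y ∈ Icc 0 (Γ.len h.1)) :
    -(Γ.pos h y) ∈ Γ.passSeg e h.1 := by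
  have := Γ.pos_mem h hy
  exact ⟨neg_le_neg this.2, by linarith [this.1, Γ.len_pos e]⟩

theorem neg_pos_eq (h : E × Bool) : (fun y => -(Γ.pos h y)) = fun y => -Γ.endPos h + -sgn h * y := by
  funext y; rw [pos_eq]; ring

theorem pos_endPos_self (h : E × Bool) : Γ.pos h (Γ.endPos h) = 0 := by
  rw [← pos_zero, pos_pos]

theorem pos_endPos_not (f : E) (b : Bool) : Γ.pos (f, !b) (Γ.endPos (f, b)) = Γ.len f := by
  cases b <;> simp [pos, endPos]

/-- If a passing wave continues the direct wave, so do its derivatives. -/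
theorem iteratedDerivWithin_pass {q₀ q : ℝ → ℂ} {b : Bool} {e f : E}
    (h₀ : ContDiffOn ℝ 2 q₀ (Icc 0 (Γ.len e))) (hq : ContDiffOn ℝ 2 q (Γ.passSeg e f))
    (h : ∀ s ∈ Icc 0 (Γ.len e), q s = q₀ (Γ.pos (e, b) s)) {j : ℕ} (hj : j ≤ 2) {s : ℝ}
    (hs : s ∈ Icc 0 (Γ.len e)) :
    iteratedDerivWithin j q (Γ.passSeg e f) s = ((sgn (e, b) ^ j : ℝ) : ℂ) *
      iteratedDerivWithin j q₀ (Icc 0 (Γ.len e)) (Γ.pos (e, b) s) := by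
  have hI := Γ.uniqueDiffOn_edge e
  have hj' : (j : ℕ∞) ≤ 2 := by exact_mod_cast hj
  have hm : MapsTo (fun y => Γ.endPos (e, b) + sgn (e, b) * y) (Icc 0 (Γ.len e))
      (Icc 0 (Γ.len e)) := fun y hy => by
    have := Γ.pos_mem (e, b) hy
    rwa [pos_eq] at this
  rw [← iteratedDerivWithin_mono (r := 2) (Γ.uniqueDiffOn_passSeg e f) hI hq
    (edge_subset_passSeg e f) hj' hs, iteratedDerivWithin_congr
      (g := fun s => q₀ (Γ.endPos (e, b) + sgn (e, b) * s)) (fun s hs => by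
      rw [h s hs, pos_eq]) hs,
    iteratedDerivWithin_comp_affine (r := 2) hI hI h₀ hm hj' hs]
  beta_reduce
  rw [Complex.real_smul, pos_eq]

section

variable {U : E → ℝ → ℝ}

/-- The derivatives of the potential in the direction away from the end `h`, at the distance `s`
from that end. -/
noncomputable def alongJet (Γ : MetricGraph V E) (U : E → ℝ → ℝ) (h : E × Bool) (s : ℝ) (i : ℕ) :
    ℝ := sgn h ^ i * Γ.edgeDeriv U i h.1 (Γ.pos h s)

/-- The derivatives of the potential along the path that runs from the end `h'` to the vertex, and
from there along the end `h`. -/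
noncomputable def passJet (Γ : MetricGraph V E) (U : E → ℝ → ℝ) (h h' : E × Bool) (i : ℕ) (ζ : ℝ) :
    ℝ := if 0 ≤ ζ then Γ.alongJet U h ζ i else (-1) ^ i * Γ.alongJet U h' (-ζ) i

theorem passJet_of_nonneg {h h' : E × Bool} {i : ℕ} {ζ : ℝ} (hζ : 0 ≤ ζ) :
    Γ.passJet U h h' i ζ = Γ.alongJet U h ζ i := if_pos hζ

theorem passJet_of_nonpos (hU : Γ.IsSmoothPotential U) {h h' : E × Bool}
    (hv : Γ.vert h' = Γ.vert h) {i : ℕ} {ζ : ℝ} (hζ : ζ ≤ 0) :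
    Γ.passJet U h h' i ζ = (-1) ^ i * Γ.alongJet U h' (-ζ) i := by
  rcases hζ.lt_or_eq with hζ | rfl
  · exact if_neg (not_le.2 hζ)
  · rw [passJet_of_nonneg le_rfl, neg_zero, alongJet, alongJet, pos_zero, pos_zero]
    rcases Nat.even_or_odd' i with ⟨l, rfl | rfl⟩
    · rw [sgn_pow_even, sgn_pow_even, hU.edgeDeriv_even l hv]; simp
    · rw [hU.edgeDeriv_odd, hU.edgeDeriv_odd]; simp

theorem alongJet_hasDerivWithinAt (hU : Γ.IsSmoothPotential U) (h : E × Bool) (i : ℕ) {s : ℝ}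
    (hs : s ∈ Icc 0 (Γ.len h.1)) :
    HasDerivWithinAt (fun s => Γ.alongJet U h s i) (Γ.alongJet U h s (i + 1))
      (Icc 0 (Γ.len h.1)) s := by
  have := ((hU.hasDerivWithinAt i h.1 (Γ.pos_mem h hs)).scomp s
    (Γ.hasDerivAt_pos h s).hasDerivWithinAt (fun z hz => Γ.pos_mem h hz)).const_mul (sgn h ^ i)
  refine this.congr_deriv ?_
  rw [alongJet, pow_succ, smul_eq_mul, mul_assoc]

/-- The potential is smooth along paths that pass a vertex: by the conditions on its derivatives
`passJet_of_nonpos` holds also at the vertex. -/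
theorem passJet_hasDerivWithinAt (hU : Γ.IsSmoothPotential U) {h h' : E × Bool}
    (hv : Γ.vert h' = Γ.vert h) (i : ℕ) {ζ : ℝ} (hζ : ζ ∈ Γ.passSeg h.1 h'.1) :
    HasDerivWithinAt (Γ.passJet U h h' i) (Γ.passJet U h h' (i + 1) ζ) (Γ.passSeg h.1 h'.1) ζ := by
  have hL := Γ.len_pos h.1
  have hL' := Γ.len_pos h'.1
  have hr : 0 ≤ ζ → HasDerivWithinAt (Γ.passJet U h h' i) (Γ.passJet U h h' (i + 1) ζ)
      (Icc 0 (Γ.len h.1)) ζ := fun h0 => by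
    rw [passJet_of_nonneg h0]
    exact (alongJet_hasDerivWithinAt hU h i ⟨h0, hζ.2⟩).congr
      (fun z hz => passJet_of_nonneg hz.1) (passJet_of_nonneg h0)
  have hl : ζ ≤ 0 → HasDerivWithinAt (Γ.passJet U h h' i) (Γ.passJet U h h' (i + 1) ζ)
      (Icc (-Γ.len h'.1) 0) ζ := fun h0 => by
    have h1 := ((alongJet_hasDerivWithinAt hU h' i (s := -ζ)
      ⟨by linarith, by linarith [hζ.1]⟩).scomp ζ (hasDerivAt_neg ζ).hasDerivWithinAt
      (s := Icc (-Γ.len h'.1) 0) (fun z hz => ⟨by linarith [hz.2], by linarith [hz.1]⟩)).const_mul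
      ((-1 : ℝ) ^ i)
    rw [passJet_of_nonpos hU hv h0]
    refine (h1.congr (fun z hz => passJet_of_nonpos hU hv hz.2)
      (passJet_of_nonpos hU hv h0)).congr_deriv ?_
    rw [smul_eq_mul, pow_succ]; ring
  have hun : Icc (-Γ.len h'.1) 0 ∪ Icc 0 (Γ.len h.1) = Γ.passSeg h.1 h'.1 :=
    Icc_union_Icc_eq_Icc (by linarith) hL.le
  rcases lt_trichotomy ζ 0 with h0 | h0 | h0
  · refine (hl h0.le).mono_of_mem_nhdsWithin ?_
    filter_upwards [self_mem_nhdsWithin, nhdsWithin_le_nhds (Iio_mem_nhds h0)] with z hz hz'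
      using ⟨hz.1, le_of_lt hz'⟩
  · rw [← hun]
    exact (hl h0.le).union (hr h0.ge)
  · refine (hr h0.le).mono_of_mem_nhdsWithin ?_
    filter_upwards [self_mem_nhdsWithin, nhdsWithin_le_nhds (Ioi_mem_nhds h0)] with z hz hz'
      using ⟨le_of_lt hz', hz.2⟩

theorem contDiffOn_passJet (hU : Γ.IsSmoothPotential U) {h h' : E × Bool}
    (hv : Γ.vert h' = Γ.vert h) : ContDiffOn ℝ ∞ (Γ.passJet U h h' 0) (Γ.passSeg h.1 h'.1) :=
  contDiffOn_of_hasDerivWithinAt (r := ⊤) (Γ.uniqueDiffOn_passSeg _ _)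
    (fun i _ _ hζ => (passJet_hasDerivWithinAt hU hv i hζ).continuousWithinAt)
    (fun i _ _ hζ => passJet_hasDerivWithinAt hU hv i hζ)

theorem iteratedDerivWithin_passJet (hU : Γ.IsSmoothPotential U) {h h' : E × Bool}
    (hv : Γ.vert h' = Γ.vert h) (i : ℕ) {ζ : ℝ} (hζ : ζ ∈ Γ.passSeg h.1 h'.1) :
    iteratedDerivWithin i (Γ.passJet U h h' 0) (Γ.passSeg h.1 h'.1) ζ = Γ.passJet U h h' i ζ :=
  iteratedDerivWithin_eqOn (r := ⊤) (Γ.uniqueDiffOn_passSeg _ _)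
    (fun i _ _ hζ => passJet_hasDerivWithinAt hU hv i hζ) le_top hζ

theorem passJet_neg_pos (hU : Γ.IsSmoothPotential U) {h h' : E × Bool}
    (hv : Γ.vert h' = Γ.vert h) {y : ℝ} (hy : y ∈ Icc 0 (Γ.len h'.1)) :
    Γ.passJet U h h' 0 (-(Γ.pos h' y)) = U h'.1 y := by
  rw [passJet_of_nonpos hU hv (by linarith [(Γ.pos_mem h' hy).1]), neg_neg, alongJet, pos_pos,
    edgeDeriv_zero]
  simp

end

variable [DecidableEq E]

/-- The superposition of a wave `q₀` on the edge `e` and of the waves `q b h` that run from the end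
`(e, b)` into the end `h`, with the scattering amplitudes `S`. -/
noncomputable def fold (Γ : MetricGraph V E) (S : E × Bool → E × Bool → ℂ) (e : E) (q₀ : ℝ → ℂ)
    (q : Bool → E × Bool → ℝ → ℂ) (f : E) (y : ℝ) : ℂ :=
  (if f = e then q₀ y else 0) +
    ∑ b', ∑ b, S (f, b') (e, b) * q b (f, b') (-(Γ.pos (f, b') y))

section

variable {X : Type*} [TopologicalSpace X] {K : Set X} {e : E}

theorem smoothFam_fold {q₀ : X → ℝ → ℂ} {q : Bool → E × Bool → X → ℝ → ℂ}
    (h₀ : SmoothFam 2 K (Icc 0 (Γ.len e)) q₀)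
    (hq : ∀ b h, SmoothFam 2 K (Γ.passSeg e h.1) (q b h)) (f : E) :
    SmoothFam 2 K (Icc 0 (Γ.len f)) fun x => Γ.fold S e (q₀ x) (fun b h => q b h x) f := by
  have hI := Γ.uniqueDiffOn_edge f
  refine SmoothFam.add hI ?_ (SmoothFam.sum hI _ fun b' _ => SmoothFam.sum hI _ fun b _ =>
    SmoothFam.const_mul hI _ ?_)
  · by_cases h : f = e
    · subst h
      simpa only [if_true] using h₀
    · simp only [if_neg h]
      exact SmoothFam.param continuousOn_const
  · have hm : MapsTo (fun y => -(Γ.pos (f, b') y)) (Icc 0 (Γ.len f)) (Γ.passSeg e f) :=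
      fun y hy => neg_pos_mem_passSeg e (f, b') hy
    have e1 := Γ.neg_pos_eq (f, b')
    rw [e1] at hm
    refine ((hq b (f, b')).comp_affine (Γ.uniqueDiffOn_passSeg e f) hI hm).congr
      fun x _ y _ => ?_
    exact congrArg _ (congrFun e1 y)

theorem iteratedDerivWithin_fold {q₀ : ℝ → ℂ} {q : Bool → E × Bool → ℝ → ℂ}
    (h₀ : ContDiffOn ℝ 2 q₀ (Icc 0 (Γ.len e)))
    (hq : ∀ b h, ContDiffOn ℝ 2 (q b h) (Γ.passSeg e h.1)) (f : E) {j : ℕ} (hj : j ≤ 2) {y : ℝ}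
    (hy : y ∈ Icc 0 (Γ.len f)) :
    iteratedDerivWithin j (Γ.fold S e q₀ q f) (Icc 0 (Γ.len f)) y
      = (if f = e then iteratedDerivWithin j q₀ (Icc 0 (Γ.len e)) y else 0) +
        ∑ b', ∑ b, S (f, b') (e, b) * ((((-sgn (f, b')) ^ j : ℝ) : ℂ) *
          iteratedDerivWithin j (q b (f, b')) (Γ.passSeg e f) (-(Γ.pos (f, b') y))) := by
  have hI := Γ.uniqueDiffOn_edge f
  have hj2 : (j : ℕ∞ω) ≤ 2 := by exact_mod_cast hj
  have hm : ∀ b', MapsTo (fun y => -Γ.endPos (f, b') + -sgn (f, b') * y) (Icc 0 (Γ.len f))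
      (Γ.passSeg e f) := fun b' => by
    rw [← neg_pos_eq]
    exact fun y hy => neg_pos_mem_passSeg e (f, b') hy
  have hc : ∀ b' b, ContDiffOn ℝ 2 (fun y => q b (f, b') (-(Γ.pos (f, b') y)))
      (Icc 0 (Γ.len f)) := fun b' b => by
    have : (fun y => q b (f, b') (-(Γ.pos (f, b') y)))
        = q b (f, b') ∘ fun y => -Γ.endPos (f, b') + -sgn (f, b') * y := by
      rw [← neg_pos_eq]; rfl
    rw [this]
    exact (hq b (f, b')).comp (by fun_prop) (hm b')
  have hcd : ∀ b' b, iteratedDerivWithin j (fun y => q b (f, b') (-(Γ.pos (f, b') y)))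
      (Icc 0 (Γ.len f)) y = (((-sgn (f, b')) ^ j : ℝ) : ℂ) *
        iteratedDerivWithin j (q b (f, b')) (Γ.passSeg e f) (-(Γ.pos (f, b') y)) := fun b' b => by
    have h1 := iteratedDerivWithin_comp_affine (r := 2) (Γ.uniqueDiffOn_passSeg e f) hI
      (hq b (f, b')) (hm b') (by exact_mod_cast hj) hy
    rw [show (fun y => q b (f, b') (-(Γ.pos (f, b') y)))
        = fun y => q b (f, b') (-Γ.endPos (f, b') + -sgn (f, b') * y) by
      funext y; rw [pos_eq]; congr 1; ring, h1]
    beta_reduce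
    rw [Complex.real_smul, pos_eq, neg_add, neg_mul]
  have h1 : ∀ b' b, ContDiffWithinAt ℝ j
      (fun y => S (f, b') (e, b) * q b (f, b') (-(Γ.pos (f, b') y))) (Icc 0 (Γ.len f)) y :=
    fun b' b => contDiffWithinAt_const.mul (((hc b' b) y hy).of_le hj2)
  have h2 : ∀ b', ContDiffWithinAt ℝ j (fun y => ∑ b, S (f, b') (e, b) *
      q b (f, b') (-(Γ.pos (f, b') y))) (Icc 0 (Γ.len f)) y := fun b' =>
    ContDiffWithinAt.sum fun b _ => h1 b' b
  have h3 : ContDiffWithinAt ℝ j (fun y => if f = e then q₀ y else 0) (Icc 0 (Γ.len f)) y := by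
    by_cases h : f = e
    · subst h
      simpa only [if_true] using (h₀ y hy).of_le hj2
    · simp only [if_neg h]
      exact contDiffWithinAt_const
  unfold fold
  rw [iteratedDerivWithin_fun_add hy hI h3 (ContDiffWithinAt.sum fun b' _ => h2 b'),
    iteratedDerivWithin_fun_sum hy hI fun b' _ => h2 b']
  congr 1
  · by_cases h : f = e
    · subst h
      simp only [if_true]
    · simp only [if_neg h]
      exact iteratedDerivWithin_fun_const_zero
  · refine Finset.sum_congr rfl fun b' _ => ?_
    rw [iteratedDerivWithin_fun_sum hy hI fun b _ => h1 b' b]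
    refine Finset.sum_congr rfl fun b _ => ?_
    rw [iteratedDerivWithin_const_mul_field, hcd]

/-- At the end `h` a superposition of waves consists of the direct wave and of its scattered images;
waves from the far end of the edge of `h` have been cut off. -/
theorem endDeriv_fold {q₀ : ℝ → ℂ} {q : Bool → E × Bool → ℝ → ℂ}
    (h₀ : ContDiffOn ℝ 2 q₀ (Icc 0 (Γ.len e)))
    (hq : ∀ b h, ContDiffOn ℝ 2 (q b h) (Γ.passSeg e h.1))
    (h1 : ∀ b h, S h (e, b) ≠ 0 → ∀ s ∈ Icc 0 (Γ.len e), q b h s = q₀ (Γ.pos (e, b) s))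
    (h2 : ∀ b h, ∀ ζ ∈ Γ.passSeg e h.1, ζ < -(2 / 3 * Γ.len h.1) → q b h ζ = 0) {j : ℕ}
    (hj : j ≤ 2) (h : E × Bool) :
    Γ.endDeriv (Γ.fold S e q₀ q) j h = ∑ b, ((if h = (e, b) then 1 else 0) +
      (-1) ^ j * S h (e, b)) * (((sgn (e, b) ^ j : ℝ) : ℂ) *
        iteratedDerivWithin j q₀ (Icc 0 (Γ.len e)) (Γ.endPos (e, b))) := by
  obtain ⟨f, c⟩ := h
  have hmem := Γ.endPos_mem (f, c)
  have hzero : ∀ b, iteratedDerivWithin j (q b (f, !c)) (Γ.passSeg e f) (-Γ.len f) = 0 := by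
    intro b
    have hl : -Γ.len f ∈ Γ.passSeg e f :=
      ⟨le_rfl, by linarith [Γ.len_pos e, Γ.len_pos f]⟩
    have hlt : -Γ.len f < -(2 / 3 * Γ.len f) := by linarith [Γ.len_pos f]
    have : q b (f, !c) =ᶠ[𝓝[Γ.passSeg e f] (-Γ.len f)] fun _ => 0 := by
      filter_upwards [self_mem_nhdsWithin, nhdsWithin_le_nhds (Iio_mem_nhds hlt)] with ζ hζ hζ'
        using h2 b (f, !c) ζ hζ hζ'
    rw [this.iteratedDerivWithin_eq (h2 b (f, !c) _ hl hlt)]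
    exact iteratedDerivWithin_fun_const_zero
  have hpass : ∀ b, S (f, c) (e, b) * iteratedDerivWithin j (q b (f, c)) (Γ.passSeg e f) 0
      = S (f, c) (e, b) * (((sgn (e, b) ^ j : ℝ) : ℂ) *
        iteratedDerivWithin j q₀ (Icc 0 (Γ.len e)) (Γ.endPos (e, b))) := fun b => by
    by_cases hS : S (f, c) (e, b) = 0
    · rw [hS, zero_mul, zero_mul]
    · rw [iteratedDerivWithin_pass h₀ (hq b (f, c)) (h1 b (f, c) hS) hj
        ⟨le_rfl, (Γ.len_pos e).le⟩, pos_zero]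
  have hs : ((sgn (f, c) ^ j : ℝ) : ℂ) * (((-sgn (f, c)) ^ j : ℝ) : ℂ) = (-1) ^ j := by
    rw [← Complex.ofReal_mul, ← mul_pow, mul_neg, sgn_mul_self]; push_cast; rfl
  rw [endDeriv_eq, edgeDeriv, seg, iteratedDerivWithin_fold h₀ hq f hj hmem, Complex.real_smul]
  have hsum : ∑ b', ∑ b, S (f, b') (e, b) * ((((-sgn (f, b')) ^ j : ℝ) : ℂ) *
      iteratedDerivWithin j (q b (f, b')) (Γ.passSeg e f) (-(Γ.pos (f, b') (Γ.endPos (f, c)))))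
      = ∑ b, (((-sgn (f, c)) ^ j : ℝ) : ℂ) * (S (f, c) (e, b) * (((sgn (e, b) ^ j : ℝ) : ℂ) *
        iteratedDerivWithin j q₀ (Icc 0 (Γ.len e)) (Γ.endPos (e, b)))) := by
    rw [Finset.sum_eq_single_of_mem c (Finset.mem_univ c)]
    · refine Finset.sum_congr rfl fun b _ => ?_
      rw [pos_endPos_self, neg_zero, mul_left_comm, hpass]
    · intro b' _ hb'
      obtain rfl : b' = !c := by cases b' <;> cases c <;> simp_all
      refine Finset.sum_eq_zero fun b _ => ?_
      rw [pos_endPos_not, hzero, mul_zero, mul_zero]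
  rw [hsum, mul_add, ← Finset.mul_sum, ← mul_assoc, hs, Finset.mul_sum]
  simp only [add_mul, Finset.sum_add_distrib, mul_assoc]
  congr 1
  by_cases hf : f = e
  · subst hf
    simp only [if_true, Prod.mk.injEq, true_and]
    rw [Finset.sum_eq_single_of_mem c (Finset.mem_univ c)]
    · simp
    · intro b _ hb
      rw [if_neg hb.symm, zero_mul]
  · simp [hf]

variable [Fintype E]

/-- A superposition of waves with scattering amplitudes `S` satisfies the vertex conditions. -/
theorem sum_mul_endDeriv_fold (hS : Γ.IsScattering S) {q₀ : ℝ → ℂ} {q : Bool → E × Bool → ℝ → ℂ}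
    (h₀ : ContDiffOn ℝ 2 q₀ (Icc 0 (Γ.len e)))
    (hq : ∀ b h, ContDiffOn ℝ 2 (q b h) (Γ.passSeg e h.1))
    (h1 : ∀ b h, S h (e, b) ≠ 0 → ∀ s ∈ Icc 0 (Γ.len e), q b h s = q₀ (Γ.pos (e, b) s))
    (h2 : ∀ b h, ∀ ζ ∈ Γ.passSeg e h.1, ζ < -(2 / 3 * Γ.len h.1) → q b h ζ = 0) {j : ℕ}
    (hj : j ≤ 2) (h : E × Bool) :
    ∑ h', S h h' * Γ.endDeriv (Γ.fold S e q₀ q) j h'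
      = (-1) ^ j * Γ.endDeriv (Γ.fold S e q₀ q) j h := by
  simp only [endDeriv_fold h₀ hq h1 h2 hj, Finset.mul_sum]
  rw [Finset.sum_comm]
  refine Finset.sum_congr rfl fun b _ => ?_
  set α := ((sgn (e, b) ^ j : ℝ) : ℂ) *
    iteratedDerivWithin j q₀ (Icc 0 (Γ.len e)) (Γ.endPos (e, b))
  have h3 : ∑ h', S h h' * (if h' = (e, b) then 1 else 0) = S h (e, b) := by simp
  have h4 := hS.sq h (e, b)
  have h5 : ((-1 : ℂ) ^ j) * (-1) ^ j = 1 := by rw [← mul_pow]; simp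
  calc ∑ h', S h h' * (((if h' = (e, b) then 1 else 0) + (-1) ^ j * S h' (e, b)) * α)
      = (∑ h', S h h' * (if h' = (e, b) then 1 else 0)
          + (-1) ^ j * ∑ h', S h h' * S h' (e, b)) * α := by
        rw [Finset.mul_sum, ← Finset.sum_add_distrib, Finset.sum_mul]
        exact Finset.sum_congr rfl fun h' _ => by ring
    _ = _ := by
        rw [h3, h4]
        linear_combination (-(S h (e, b)) * α) * h5

end

end MetricGraph

/-! ### The parametrix on the graph -/

namespace MetricGraph

variable {V E : Type*} {Γ : MetricGraph V E} {S : E × Bool → E × Bool → ℂ}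
  {U : E → ℝ → ℝ}

/-- A cutoff that equals `1` near the end `h` of an edge and `0` near the other end of this edge,
which has the coordinate `-len`. -/
noncomputable def passCutoff (Γ : MetricGraph V E) (h : E × Bool) (ζ : ℝ) : ℝ :=
  Real.smoothTransition (2 + 3 * ζ / Γ.len h.1)

theorem contDiff_passCutoff (h : E × Bool) : ContDiff ℝ ∞ (Γ.passCutoff h) :=
  Real.smoothTransition.contDiff.comp (by fun_prop)

theorem passCutoff_eq_one {h : E × Bool} {ζ : ℝ} (hζ : -(1 / 3 * Γ.len h.1) ≤ ζ) :
    Γ.passCutoff h ζ = 1 := by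
  refine Real.smoothTransition.one_of_one_le ?_
  have : -1 ≤ 3 * ζ / Γ.len h.1 := by rw [le_div_iff₀ (Γ.len_pos _)]; linarith
  linarith

theorem passCutoff_eventuallyEq {h : E × Bool} {ζ : ℝ} (hζ : 0 ≤ ζ) :
    Γ.passCutoff h =ᶠ[𝓝 ζ] 1 := by
  filter_upwards [Ioi_mem_nhds (show -(1 / 3 * Γ.len h.1) < ζ by linarith [Γ.len_pos h.1])]
    with z hz using passCutoff_eq_one (le_of_lt hz)

theorem passCutoff_eq_zero {h : E × Bool} {ζ : ℝ} (hζ : ζ < -(2 / 3 * Γ.len h.1)) :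
    Γ.passCutoff h ζ = 0 := by
  refine Real.smoothTransition.zero_of_nonpos ?_
  have : 3 * ζ / Γ.len h.1 ≤ -2 := by rw [div_le_iff₀ (Γ.len_pos _)]; linarith
  linarith

/-- The amplitudes of the direct wave on the edge `e`. -/
noncomputable def directAmp (Γ : MetricGraph V E) (U : E → ℝ → ℝ) (N : ℕ) (e : E) :
    ℕ → ℝ → ℝ → ℂ := amplitude N (fun _ => 1) fun x i => Γ.edgeDeriv U i e x

/-- The amplitudes of the wave that runs from the end `h` into the end `h'`. -/
noncomputable def passAmp (Γ : MetricGraph V E) (U : E → ℝ → ℝ) (N : ℕ) (h h' : E × Bool) :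
    ℕ → ℝ → ℝ → ℂ := amplitude N (Γ.passCutoff h') (Γ.alongJet U h)

/-- The heat that spreads from the point `x` of the edge `e` along this edge. -/
noncomputable def directWave (Γ : MetricGraph V E) (U : E → ℝ → ℝ) (N : ℕ) (e : E) (t x : ℝ) :
    ℝ → ℂ := heatSum N (Γ.directAmp U N e) t x

/-- The remainder of `directWave` in the heat equation. -/
noncomputable def directRem (Γ : MetricGraph V E) (U : E → ℝ → ℝ) (N : ℕ) (e : E) (t x : ℝ) :
    ℝ → ℂ := heatRemainder N (Γ.directAmp U N e) (U e) t x

section Waves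

variable (hU : Γ.IsSmoothPotential U) (N : ℕ) (e : E) (b : Bool) (h : E × Bool)

theorem continuous_pos (h : E × Bool) : Continuous (Γ.pos h) :=
  continuous_iff_continuousAt.2 fun s => (Γ.hasDerivAt_pos h s).continuousAt

theorem SmoothFam.comp_pos {I : Set ℝ} {H : ℝ × ℝ → ℝ → ℂ}
    (hH : SmoothFam 2 (Ioi 0 ×ˢ Icc 0 (Γ.len e)) I H) :
    SmoothFam 2 (Ioi 0 ×ˢ Icc 0 (Γ.len e)) I fun p => H (p.1, Γ.pos (e, b) p.2) :=
  hH.comp_param (continuous_fst.prodMk ((Γ.continuous_pos (e, b)).comp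
    continuous_snd)).continuousOn fun _ hp => ⟨hp.1, Γ.pos_mem (e, b) hp.2⟩

section

include hU

theorem smoothFam_directAmp (k : ℕ) :
    SmoothFam ⊤ (Icc 0 (Γ.len e)) univ (Γ.directAmp U N e k) :=
  smoothFam_amplitude contDiff_const (fun i => hU.continuousOn i e) N k

theorem smoothFam_passAmp (h' : E × Bool) (k : ℕ) :
    SmoothFam ⊤ (Icc 0 (Γ.len h.1)) univ (Γ.passAmp U N h h' k) :=
  smoothFam_amplitude (Γ.contDiff_passCutoff h')
    (fun i _ hs => (alongJet_hasDerivWithinAt hU h i hs).continuousWithinAt) N k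

theorem smoothFam_directWave : SmoothFam 2 (Ioi 0 ×ˢ Icc 0 (Γ.len e)) (Icc 0 (Γ.len e))
    fun p : ℝ × ℝ => Γ.directWave U N e p.1 p.2 :=
  smoothFam_heatSum (smoothFam_directAmp hU N e) (Γ.uniqueDiffOn_edge e) N

theorem smoothFam_directRem : SmoothFam 2 (Ioi 0 ×ˢ Icc 0 (Γ.len e)) (Icc 0 (Γ.len e))
    fun p : ℝ × ℝ => Γ.directRem U N e p.1 p.2 :=
  smoothFam_heatRemainder (smoothFam_directAmp hU N e) (Γ.uniqueDiffOn_edge e)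
    (hU.contDiffOn e) N

theorem hasDerivAt_directWave {t x y : ℝ} (ht : 0 < t) (hx : x ∈ Icc 0 (Γ.len e))
    (hy : y ∈ Icc 0 (Γ.len e)) :
    HasDerivAt (fun t => Γ.directWave U N e t x y)
      (iteratedDerivWithin 2 (Γ.directWave U N e t x) (Icc 0 (Γ.len e)) y
        + U e y * Γ.directWave U N e t x y + Γ.directRem U N e t x y) t := by
  refine hasDerivAt_heatSum (smoothFam_directAmp hU N e) (Γ.uniqueDiffOn_edge e) ?_ ht hx hy
  funext σ ζ
  exact if_neg (by omega)

theorem exists_norm_directRem_le (M : ℕ) :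
    ∃ C, 0 ≤ C ∧ ∀ t, 0 < t → t ≤ 1 → ∀ x ∈ Icc 0 (Γ.len e), ∀ j ≤ 2, ∀ y ∈ Icc 0 (Γ.len e),
      ‖iteratedDerivWithin j (Γ.directRem U (M + 3) e t x) (Icc 0 (Γ.len e)) y‖ ≤ C * t ^ M :=
  exists_norm_heatRemainder_le (Γ.len_pos e) isCompact_Icc subset_rfl (hU.contDiffOn e)
    (fun _ _ _ => rfl) contDiff_const (fun _ _ => EventuallyEq.rfl) M

end

variable [DecidableEq V]

/-- The heat that spreads from the point `x` of the edge `e` through its end `b` into the edge of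
the end `h`, if both ends have the same vertex. -/
noncomputable def passWave (Γ : MetricGraph V E) (U : E → ℝ → ℝ) (N : ℕ) (e : E) (b : Bool)
    (h : E × Bool) (t x ζ : ℝ) : ℂ :=
  if Γ.vert h = Γ.vert (e, b) then heatSum N (Γ.passAmp U N (e, b) h) t (Γ.pos (e, b) x) ζ else 0

/-- The remainder of `passWave` in the heat equation. -/
noncomputable def passRem (Γ : MetricGraph V E) (U : E → ℝ → ℝ) (N : ℕ) (e : E) (b : Bool)
    (h : E × Bool) (t x ζ : ℝ) : ℂ :=
  if Γ.vert h = Γ.vert (e, b) then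
    heatRemainder N (Γ.passAmp U N (e, b) h) (Γ.passJet U (e, b) h 0) t (Γ.pos (e, b) x) ζ
  else 0

/-- On the edge of the source the passing wave coincides with the direct wave, as the heat kernel of
the line is invariant under reflections of the edge. -/
theorem passWave_eq_directWave {h : E × Bool} (hv : Γ.vert h = Γ.vert (e, b)) (t x : ℝ) {s : ℝ}
    (hs : 0 ≤ s) : Γ.passWave U N e b h t x s = Γ.directWave U N e t x (Γ.pos (e, b) s) := by
  have hsub : Γ.pos (e, b) s - x = sgn (e, b) * (s - Γ.pos (e, b) x) := by
    rw [← sub_eq_zero, pos_eq, pos_eq]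
    have : Γ.endPos (e, b) + sgn (e, b) * Γ.endPos (e, b) = 0 := by
      cases b <;> simp [sgn, endPos]
    linear_combination x * sgn_mul_self (e, b) + this
  rw [passWave, if_pos hv, directWave, heatSum, heatSum, hsub]
  have hg : gaussKernel t (sgn (e, b) * (s - Γ.pos (e, b) x))
      = gaussKernel t (s - Γ.pos (e, b) x) := by
    unfold sgn; split_ifs
    · rw [neg_one_mul, gaussKernel_neg]
    · rw [one_mul]
  rw [hg]
  congr 1
  refine Finset.sum_congr rfl fun k _ => ?_
  congr 1
  unfold passAmp directAmp amplitude
  congr 2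
  rw [passCutoff_eq_one (by linarith [Γ.len_pos h.1]), hsub]
  congr 1
  unfold alongJet
  rw [pos_pos]
  unfold sgn
  split_ifs
  · rw [neg_one_mul, ← transportSum_neg]
    simp [← mul_assoc, ← mul_pow]
  · simp

theorem passWave_eq_zero (t x : ℝ) {ζ : ℝ} (hζ : ζ < -(2 / 3 * Γ.len h.1)) :
    Γ.passWave U N e b h t x ζ = 0 := by
  unfold passWave
  split_ifs
  · rw [heatSum, Finset.sum_eq_zero, mul_zero]
    intro k _
    simp [passAmp, amplitude, passCutoff_eq_zero hζ]
  · rfl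

theorem passRem_eq_zero (t x : ℝ) {ζ : ℝ} (hζ : ζ < -(2 / 3 * Γ.len h.1)) :
    Γ.passRem U N e b h t x ζ = 0 := by
  unfold passRem
  split_ifs
  · have hA : ∀ k σ, Γ.passAmp U N (e, b) h k σ =ᶠ[𝓝 ζ] fun _ => 0 := fun k σ => by
      filter_upwards [Iio_mem_nhds hζ] with z hz
      simp [passAmp, amplitude, passCutoff_eq_zero hz]
    have h0 : ∀ m σ, defect (Γ.passAmp U N (e, b) h) (Γ.passJet U (e, b) h 0) m σ ζ = 0 := by
      intro m σ
      have h1 : ∀ k, deriv (Γ.passAmp U N (e, b) h k σ) ζ = 0 := fun k => by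
        rw [(hA k σ).deriv_eq, deriv_const]
      have h2 : ∀ k, deriv (deriv (Γ.passAmp U N (e, b) h k σ)) ζ = 0 := fun k => by
        rw [(hA k σ).deriv.deriv_eq]; simp
      rcases m with _ | m
      · rw [defect, h1]; simp
      · rw [defect, h1, h2, (hA m σ).self_of_nhds, (hA (m + 1) σ).self_of_nhds]; simp
    simp [heatRemainder, h0]
  · rfl

include hU

theorem smoothFam_passWave : SmoothFam 2 (Ioi 0 ×ˢ Icc 0 (Γ.len e)) (Γ.passSeg e h.1)
    fun p : ℝ × ℝ => Γ.passWave U N e b h p.1 p.2 := by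
  unfold passWave
  by_cases hv : Γ.vert h = Γ.vert (e, b)
  · simp only [if_pos hv]
    exact SmoothFam.comp_pos e b (smoothFam_heatSum (smoothFam_passAmp hU N (e, b) h)
      (Γ.uniqueDiffOn_passSeg e h.1) N)
  · simp only [if_neg hv]
    exact SmoothFam.param continuousOn_const

theorem smoothFam_passRem : SmoothFam 2 (Ioi 0 ×ˢ Icc 0 (Γ.len e)) (Γ.passSeg e h.1)
    fun p : ℝ × ℝ => Γ.passRem U N e b h p.1 p.2 := by
  unfold passRem
  by_cases hv : Γ.vert h = Γ.vert (e, b)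
  · simp only [if_pos hv]
    exact SmoothFam.comp_pos e b (smoothFam_heatRemainder (smoothFam_passAmp hU N (e, b) h)
      (Γ.uniqueDiffOn_passSeg e h.1) (contDiffOn_passJet hU hv) N)
  · simp only [if_neg hv]
    exact SmoothFam.param continuousOn_const

theorem hasDerivAt_passWave {t x ζ : ℝ} (ht : 0 < t) (hx : x ∈ Icc 0 (Γ.len e))
    (hζ : ζ ∈ Γ.passSeg e h.1) :
    HasDerivAt (fun t => Γ.passWave U N e b h t x ζ)
      (iteratedDerivWithin 2 (Γ.passWave U N e b h t x) (Γ.passSeg e h.1) ζ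
        + Γ.passJet U (e, b) h 0 ζ * Γ.passWave U N e b h t x ζ + Γ.passRem U N e b h t x ζ) t := by
  unfold passWave passRem
  by_cases hv : Γ.vert h = Γ.vert (e, b)
  · simp only [if_pos hv]
    refine hasDerivAt_heatSum (smoothFam_passAmp hU N (e, b) h) (Γ.uniqueDiffOn_passSeg e h.1) ?_
      ht (Γ.pos_mem (e, b) hx) hζ
    funext σ ζ
    exact if_neg (by omega)
  · simp only [if_neg hv, mul_zero, add_zero, iteratedDerivWithin_fun_const_zero]
    exact hasDerivAt_const t _

theorem passRem_eq_directRem {h : E × Bool} (hv : Γ.vert h = Γ.vert (e, b)) {t x s : ℝ}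
    (ht : 0 < t) (hx : x ∈ Icc 0 (Γ.len e)) (hs : s ∈ Icc 0 (Γ.len e)) :
    Γ.passRem U N e b h t x s = Γ.directRem U N e t x (Γ.pos (e, b) s) := by
  have h1 := hasDerivAt_passWave hU N e b h ht hx (edge_subset_passSeg e h.1 hs)
  have h2 := hasDerivAt_directWave hU N e ht hx (Γ.pos_mem (e, b) hs)
  have hp : (t, x) ∈ (Ioi (0 : ℝ) ×ˢ Icc 0 (Γ.len e)) := ⟨ht, hx⟩
  simp only [passWave_eq_directWave N e b hv _ _ hs.1] at h1
  have h3 := h1.unique h2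
  rw [iteratedDerivWithin_pass (b := b) ((smoothFam_directWave hU N e).1 (t, x) hp)
    ((smoothFam_passWave hU N e b h).1 (t, x) hp)
    (fun s hs => passWave_eq_directWave N e b hv t x hs.1) le_rfl hs, sgn_pow_even (e, b) 1,
    passJet_of_nonneg hs.1, alongJet, edgeDeriv_zero] at h3
  simpa using h3

theorem exists_norm_passRem_le (M : ℕ) :
    ∃ C, 0 ≤ C ∧ ∀ t, 0 < t → t ≤ 1 → ∀ x ∈ Icc 0 (Γ.len e), ∀ j ≤ 2, ∀ ζ ∈ Γ.passSeg e h.1,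
      ‖iteratedDerivWithin j (Γ.passRem U (M + 3) e b h t x) (Γ.passSeg e h.1) ζ‖
        ≤ C * t ^ M := by
  unfold passRem
  by_cases hv : Γ.vert h = Γ.vert (e, b)
  · simp only [if_pos hv]
    obtain ⟨C, hC0, hC⟩ := exists_norm_heatRemainder_le (X := Γ.alongJet U (e, b))
      (show -Γ.len h.1 < Γ.len e by linarith [Γ.len_pos e, Γ.len_pos h.1])
      (isCompact_Icc (a := 0) (b := Γ.len e)) (edge_subset_passSeg e h.1)
      (contDiffOn_passJet hU hv)
      (fun σ hσ i => by
        rw [← passJet_of_nonneg (h' := h) hσ.1]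
        exact (iteratedDerivWithin_passJet hU hv i (edge_subset_passSeg e h.1 hσ)).symm)
      (Γ.contDiff_passCutoff h) (fun σ hσ => passCutoff_eventuallyEq hσ.1) M
    exact ⟨C, hC0, fun t ht ht1 x hx j hj ζ hζ =>
      hC t ht ht1 _ (Γ.pos_mem (e, b) hx) j hj ζ hζ⟩
  · simp only [if_neg hv, iteratedDerivWithin_fun_const_zero, norm_zero]
    exact ⟨0, le_rfl, fun t _ _ x _ j _ ζ _ => by simp⟩

end Waves

variable [DecidableEq V] [DecidableEq E]

/-- The parametrix of the heat kernel of the graph with source at the point `x` of `e`: the direct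
wave and its images scattered at the two ends of `e`. -/
noncomputable def graphWave (Γ : MetricGraph V E) (S : E × Bool → E × Bool → ℂ) (U : E → ℝ → ℝ)
    (N : ℕ) (e : E) (t x : ℝ) : E → ℝ → ℂ :=
  Γ.fold S e (Γ.directWave U N e t x) fun b h => Γ.passWave U N e b h t x

/-- The remainder of `graphWave` in the heat equation. -/
noncomputable def graphRem (Γ : MetricGraph V E) (S : E × Bool → E × Bool → ℂ) (U : E → ℝ → ℝ)
    (N : ℕ) (e : E) (t x : ℝ) : E → ℝ → ℂ :=
  Γ.fold S e (Γ.directRem U N e t x) fun b h => Γ.passRem U N e b h t x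

section

variable (hU : Γ.IsSmoothPotential U) (N : ℕ) (e : E)

include hU

theorem smoothFam_graphWave (f : E) :
    SmoothFam 2 (Ioi 0 ×ˢ Icc 0 (Γ.len e)) (Icc 0 (Γ.len f))
      fun p : ℝ × ℝ => Γ.graphWave S U N e p.1 p.2 f :=
  smoothFam_fold (smoothFam_directWave hU N e) (fun b h => smoothFam_passWave hU N e b h) f

theorem smoothFam_graphRem (f : E) :
    SmoothFam 2 (Ioi 0 ×ˢ Icc 0 (Γ.len e)) (Icc 0 (Γ.len f))
      fun p : ℝ × ℝ => Γ.graphRem S U N e p.1 p.2 f :=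
  smoothFam_fold (smoothFam_directRem hU N e) (fun b h => smoothFam_passRem hU N e b h) f

theorem exists_norm_graphRem_le [Finite E] (M : ℕ) :
    ∃ C, 0 ≤ C ∧ ∀ t, 0 < t → t ≤ 1 → ∀ x ∈ Icc 0 (Γ.len e), ∀ j ≤ 2, ∀ f, ∀ y ∈ Icc 0 (Γ.len f),
      ‖Γ.edgeDeriv (Γ.graphRem S U (M + 3) e t x) j f y‖ ≤ C * t ^ M := by
  obtain ⟨C₀, hC₀, h₀⟩ := exists_norm_directRem_le hU e M
  choose C hC h using fun b h => exists_norm_passRem_le hU e b h M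
  obtain ⟨B, hB⟩ := (Set.finite_range fun f => C₀ + ∑ b', ∑ b,
    ‖S (f, b') (e, b)‖ * C b (f, b')).bddAbove
  refine ⟨max B 0, le_max_right _ _, fun t ht ht1 x hx j hj f y hy => ?_⟩
  have hp : (t, x) ∈ (Ioi (0 : ℝ) ×ˢ Icc 0 (Γ.len e)) := ⟨ht, hx⟩
  have htM : 0 ≤ t ^ M := by positivity
  rw [edgeDeriv, seg, graphRem, iteratedDerivWithin_fold ((smoothFam_directRem hU _ e).1 (t, x) hp)
    (fun b h => (smoothFam_passRem hU _ e b h).1 (t, x) hp) f hj hy]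
  have hs : ∀ b', ‖(((-sgn (f, b')) ^ j : ℝ) : ℂ)‖ = 1 := fun b' => by
    rw [Complex.norm_real, norm_pow, norm_neg]
    have : ‖sgn (f, b')‖ = 1 := by unfold sgn; split_ifs <;> norm_num
    rw [this, one_pow]
  calc _ ≤ C₀ * t ^ M + ∑ b', ∑ b, ‖S (f, b') (e, b)‖ * C b (f, b') * t ^ M := by
        refine (norm_add_le _ _).trans (add_le_add ?_ ((norm_sum_le _ _).trans
          (Finset.sum_le_sum fun b' _ => (norm_sum_le _ _).trans
            (Finset.sum_le_sum fun b _ => ?_))))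
        · by_cases hf : f = e
          · subst hf
            rw [if_pos rfl]
            exact h₀ t ht ht1 x hx j hj y hy
          · rw [if_neg hf, norm_zero]; positivity
        · rw [norm_mul, norm_mul, hs, one_mul, mul_assoc]
          exact mul_le_mul_of_nonneg_left
            (h b (f, b') t ht ht1 x hx j hj _ (neg_pos_mem_passSeg e (f, b') hy)) (norm_nonneg _)
    _ = (C₀ + ∑ b', ∑ b, ‖S (f, b') (e, b)‖ * C b (f, b')) * t ^ M := by
        simp only [add_mul, Finset.sum_mul]
    _ ≤ _ := mul_le_mul_of_nonneg_right ((hB ⟨f, rfl⟩).trans (le_max_left _ _)) htM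

variable [Fintype E] (hS : Γ.IsScattering S)

include hS

theorem hasDerivAt_graphWave {t x y : ℝ} (ht : 0 < t) (hx : x ∈ Icc 0 (Γ.len e)) (f : E)
    (hy : y ∈ Icc 0 (Γ.len f)) :
    HasDerivAt (fun t => Γ.graphWave S U N e t x f y)
      (Γ.edgeDeriv (Γ.graphWave S U N e t x) 2 f y + U f y * Γ.graphWave S U N e t x f y
        + Γ.graphRem S U N e t x f y) t := by
  have hp : (t, x) ∈ (Ioi (0 : ℝ) ×ˢ Icc 0 (Γ.len e)) := ⟨ht, hx⟩
  have hd : HasDerivAt (fun t => if f = e then Γ.directWave U N e t x y else 0)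
      ((if f = e then iteratedDerivWithin 2 (Γ.directWave U N e t x) (Icc 0 (Γ.len e)) y else 0)
        + U f y * (if f = e then Γ.directWave U N e t x y else 0)
        + (if f = e then Γ.directRem U N e t x y else 0)) t := by
    by_cases hf : f = e
    · subst hf
      simpa only [if_true] using hasDerivAt_directWave hU N f ht hx hy
    · simp only [if_neg hf, mul_zero, add_zero]
      exact hasDerivAt_const t _
  have hi : ∀ b' b, HasDerivAt
      (fun t => S (f, b') (e, b) * Γ.passWave U N e b (f, b') t x (-(Γ.pos (f, b') y)))
      (S (f, b') (e, b) * ((((-sgn (f, b')) ^ 2 : ℝ) : ℂ) *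
          iteratedDerivWithin 2 (Γ.passWave U N e b (f, b') t x) (Γ.passSeg e f)
            (-(Γ.pos (f, b') y)))
        + U f y * (S (f, b') (e, b) * Γ.passWave U N e b (f, b') t x (-(Γ.pos (f, b') y)))
        + S (f, b') (e, b) * Γ.passRem U N e b (f, b') t x (-(Γ.pos (f, b') y))) t := by
    intro b' b
    by_cases h0 : S (f, b') (e, b) = 0
    · simp only [h0, zero_mul, mul_zero, add_zero]
      exact hasDerivAt_const t _
    · have hv := hS.vert_eq _ _ h0
      refine ((hasDerivAt_passWave hU N e b (f, b') ht hx
        (neg_pos_mem_passSeg e (f, b') hy)).const_mul _).congr_deriv ?_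
      rw [passJet_neg_pos hU hv.symm hy, neg_sq, sgn_pow_even (f, b') 1]
      push_cast
      ring
  refine (hd.add (HasDerivAt.fun_sum fun b' _ => HasDerivAt.fun_sum fun b _ =>
    hi b' b)).congr_deriv ?_
  rw [edgeDeriv, seg, graphWave, iteratedDerivWithin_fold
    ((smoothFam_directWave hU N e).1 (t, x) hp)
    (fun b h => (smoothFam_passWave hU N e b h).1 (t, x) hp) f le_rfl hy, graphRem, fold, fold]
  simp only [Finset.sum_add_distrib, mul_add, Finset.mul_sum]
  ring

theorem sum_mul_endDeriv_graphWave {t x : ℝ} (ht : 0 < t) (hx : x ∈ Icc 0 (Γ.len e)) {j : ℕ}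
    (hj : j ≤ 2) (h : E × Bool) :
    ∑ h', S h h' * Γ.endDeriv (Γ.graphWave S U N e t x) j h'
      = (-1) ^ j * Γ.endDeriv (Γ.graphWave S U N e t x) j h := by
  have hp : (t, x) ∈ (Ioi (0 : ℝ) ×ˢ Icc 0 (Γ.len e)) := ⟨ht, hx⟩
  exact sum_mul_endDeriv_fold hS ((smoothFam_directWave hU N e).1 (t, x) hp)
    (fun b h => (smoothFam_passWave hU N e b h).1 (t, x) hp)
    (fun b h h0 s hs => passWave_eq_directWave N e b (hS.vert_eq _ _ h0).symm t x hs.1)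
    (fun b h ζ _ hζ => passWave_eq_zero N e b h t x hζ) hj h

theorem sum_mul_endDeriv_graphRem {t x : ℝ} (ht : 0 < t) (hx : x ∈ Icc 0 (Γ.len e)) {j : ℕ}
    (hj : j ≤ 2) (h : E × Bool) :
    ∑ h', S h h' * Γ.endDeriv (Γ.graphRem S U N e t x) j h'
      = (-1) ^ j * Γ.endDeriv (Γ.graphRem S U N e t x) j h := by
  have hp : (t, x) ∈ (Ioi (0 : ℝ) ×ˢ Icc 0 (Γ.len e)) := ⟨ht, hx⟩
  exact sum_mul_endDeriv_fold hS ((smoothFam_directRem hU N e).1 (t, x) hp)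
    (fun b h => (smoothFam_passRem hU N e b h).1 (t, x) hp)
    (fun b h h0 s hs => passRem_eq_directRem hU N e b (hS.vert_eq _ _ h0).symm ht hx hs)
    (fun b h ζ _ hζ => passRem_eq_zero N e b h t x hζ) hj h

end

end MetricGraph

/-! ### Existence of the heat kernel -/

theorem tendsto_integral_gaussKernel_mul {L : ℝ} {Φ : ℝ → ℂ} (hΦ : ContinuousOn Φ (Icc 0 L))
    {x : ℝ} (hx : x ∈ Ioo 0 L) :
    Tendsto (fun t => ∫ y in (0 : ℝ)..L, (gaussKernel t (y - x) : ℂ) * Φ y) (𝓝[>] 0)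
      (𝓝 (Φ x)) := by
  have hL : 0 ≤ L := (hx.1.trans hx.2).le
  set Φ' : ℝ → ℂ := IccExtend hL ((Icc 0 L).domRestrict Φ) with hΦ'
  have hΦ'c : Continuous Φ' := (continuousOn_iff_continuous_domRestrict.1 hΦ).Icc_extend'
  have hΦ'e : ∀ y ∈ Icc 0 L, Φ' y = Φ y := fun y hy => IccExtend_of_mem _ _ hy
  set Ψ : ℝ → ℂ := (Icc 0 L).indicator Φ' with hΨ
  obtain ⟨B, hB⟩ := isCompact_Icc.exists_bound_of_continuousOn hΦ
  have hΨB : ∀ y, ‖Ψ y‖ ≤ max B 0 := fun y => by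
    by_cases hy : y ∈ Icc 0 L
    · rw [hΨ, indicator_of_mem hy, hΦ'e y hy]
      exact (hB y hy).trans (le_max_left _ _)
    · rw [hΨ, indicator_of_notMem hy, norm_zero]
      exact le_max_right _ _
  have hΨm : Measurable Ψ := hΦ'c.measurable.indicator measurableSet_Icc
  have hΨx : ContinuousAt Ψ x := by
    refine hΦ'c.continuousAt.congr ?_
    filter_upwards [Icc_mem_nhds hx.1 hx.2] with y hy
    rw [hΨ, indicator_of_mem hy]
  have key : ∀ t, 0 < t → ∫ y in (0 : ℝ)..L, (gaussKernel t (y - x) : ℂ) * Φ y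
      = ∫ v : ℝ, (gaussKernel 1 v : ℂ) * Ψ (√t * v + x) := by
    intro t ht
    have hs : 0 < √t := Real.sqrt_pos.2 ht
    rw [intervalIntegral.integral_of_le hL, ← MeasureTheory.integral_Icc_eq_integral_Ioc,
      ← MeasureTheory.integral_indicator measurableSet_Icc]
    have h1 : ∀ y, (Icc 0 L).indicator (fun y => (gaussKernel t (y - x) : ℂ) * Φ y) y
        = (gaussKernel t (y - x) : ℂ) * Ψ y := fun y => by
      by_cases hy : y ∈ Icc 0 L
      · rw [indicator_of_mem hy, hΨ, indicator_of_mem hy, hΦ'e y hy]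
      · rw [indicator_of_notMem hy, hΨ, indicator_of_notMem hy, mul_zero]
    simp only [h1]
    rw [← MeasureTheory.integral_add_right_eq_self _ x]
    simp only [add_sub_cancel_right]
    have h2 := MeasureTheory.Measure.integral_comp_mul_left
      (fun u : ℝ => (gaussKernel t u : ℂ) * Ψ (u + x)) √t
    have h3 : ∀ v, (gaussKernel 1 v : ℂ) * Ψ (√t * v + x)
        = (√t : ℂ) * ((gaussKernel t (√t * v) : ℂ) * Ψ (√t * v + x)) := fun v => by
      rw [gaussKernel_one_scale ht]; push_cast; ring
    simp only [h3]
    rw [MeasureTheory.integral_const_mul, h2, abs_of_pos (inv_pos.2 hs), Complex.real_smul,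
      Complex.ofReal_inv, mul_inv_cancel_left₀ (by exact_mod_cast hs.ne')]
  have hlim : Tendsto (fun t => ∫ v : ℝ, (gaussKernel 1 v : ℂ) * Ψ (√t * v + x)) (𝓝[>] 0)
      (𝓝 (∫ v : ℝ, (gaussKernel 1 v : ℂ) * Φ x)) := by
    refine MeasureTheory.tendsto_integral_filter_of_dominated_convergence
      (fun v => gaussKernel 1 v * max B 0) ?_ ?_ ?_ ?_
    · refine Eventually.of_forall fun t => Measurable.aestronglyMeasurable ?_
      refine Measurable.mul ?_ (hΨm.comp (by fun_prop))
      exact (Complex.continuous_ofReal.comp (continuous_gaussKernel 1)).measurable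
    · refine Eventually.of_forall fun t => Eventually.of_forall fun v => ?_
      rw [norm_mul, Complex.norm_real, Real.norm_of_nonneg (gaussKernel_nonneg _ _)]
      exact mul_le_mul_of_nonneg_left (hΨB _) (gaussKernel_nonneg _ _)
    · simpa using (integrable_pow_mul_gaussKernel 0).mul_const (max B 0)
    · refine Eventually.of_forall fun v => Tendsto.const_mul _ ?_
      have h1 : Tendsto (fun t => √t * v + x) (𝓝[>] 0) (𝓝 x) := by
        have : Continuous fun t => √t * v + x := by fun_prop
        simpa using (this.tendsto 0).mono_left nhdsWithin_le_nhds
      have h2 : Ψ x = Φ x := by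
        rw [hΨ, indicator_of_mem (Ioo_subset_Icc_self hx), hΦ'e x (Ioo_subset_Icc_self hx)]
      rw [← h2]
      exact hΨx.tendsto.comp h1
  have hone : ∫ v : ℝ, (gaussKernel 1 v : ℂ) = 1 :=
    integral_complex_ofReal.trans (by rw [integral_gaussKernel_one, Complex.ofReal_one])
  rw [MeasureTheory.integral_mul_const, hone, one_mul] at hlim
  refine hlim.congr' ?_
  filter_upwards [self_mem_nhdsWithin] with t ht using (key t ht).symm

/-- At a distance `d` from the diagonal `heatSum` is smaller than every power of `t`. -/
theorem exists_norm_heatSum_le {A : ℕ → ℝ → ℝ → ℂ} {J : Set ℝ} {a b d : ℝ} (hab : a < b)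
    (hA : ∀ k, SmoothFam ⊤ J univ (A k)) (hJ : IsCompact J) (hd : 0 < d) (N p : ℕ) :
    ∃ C, 0 ≤ C ∧ ∀ t, 0 < t → t ≤ 1 → ∀ σ ∈ J, ∀ ζ ∈ Icc a b, d ≤ |ζ - σ| →
      ‖heatSum N A t σ ζ‖ ≤ C * t ^ p := by
  obtain ⟨Cp, hCp0, hCp⟩ := exists_pow_mul_gaussKernel_le (p + 1)
  have h1 := fun k => (hJ.prod (isCompact_Icc (a := a) (b := b))).exists_bound_of_continuousOn
    (((hA k).mono uniqueDiffOn_univ (uniqueDiffOn_Icc hab) (subset_univ _)).2 0 le_top)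
  choose B hB using h1
  refine ⟨Cp / d ^ (2 * (p + 1)) * ∑ k ∈ Finset.range (N + 1), max (B k) 0, by positivity,
    fun t ht ht1 σ hσ ζ hζ hdz => ?_⟩
  rw [heatSum, norm_mul, Complex.norm_real, Real.norm_of_nonneg (gaussKernel_nonneg _ _)]
  have h2 : gaussKernel t (ζ - σ) ≤ Cp / d ^ (2 * (p + 1)) * t ^ p := by
    have h3 := hCp t (ζ - σ) ht ht1
    rw [div_mul_eq_mul_div, le_div_iff₀ (by positivity), mul_comm]
    calc _ ≤ |ζ - σ| ^ (2 * (p + 1)) * gaussKernel t (ζ - σ) := by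
          gcongr
          exact gaussKernel_nonneg _ _
      _ ≤ _ := h3
      _ = _ := by field_simp; ring
  have h4 : ‖∑ k ∈ Finset.range (N + 1), (t : ℂ) ^ k * A k σ ζ‖
      ≤ ∑ k ∈ Finset.range (N + 1), max (B k) 0 := by
    refine (norm_sum_le _ _).trans (Finset.sum_le_sum fun k _ => ?_)
    rw [norm_mul, norm_pow, Complex.norm_real, Real.norm_of_nonneg ht.le]
    have h5 := hB k (σ, ζ) ⟨hσ, hζ⟩
    simp only [iteratedDerivWithin_zero] at h5
    calc _ ≤ 1 * max (B k) 0 := mul_le_mul (pow_le_one₀ ht.le ht1) (h5.trans (le_max_left _ _))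
          (norm_nonneg _) zero_le_one
      _ = _ := one_mul _
  calc _ ≤ (Cp / d ^ (2 * (p + 1)) * t ^ p) * ∑ k ∈ Finset.range (N + 1), max (B k) 0 :=
        mul_le_mul h2 h4 (norm_nonneg _) (by positivity)
    _ = _ := by ring

namespace MetricGraph

variable {V E : Type*} [Fintype E] {Γ : MetricGraph V E} {S : E × Bool → E × Bool → ℂ}
  {U : E → ℝ → ℝ}

/-- Functions on the graph that satisfy the vertex conditions, as states. -/
theorem exists_state {g : E → ℝ → ℂ} (hg : ∀ f, ContDiffOn ℝ 2 (g f) (Icc 0 (Γ.len f)))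
    (h : ∀ j ≤ 2, ∀ h, ∑ h', S h h' * Γ.endDeriv g j h' = (-1) ^ j * Γ.endDeriv g j h) :
    ∃ s : State Γ S, ∀ (j : Fin 3) f, ∀ y ∈ Icc 0 (Γ.len f),
      Γ.ev s.jet j f y = Γ.edgeDeriv g j f y := by
  have hc : ∀ (j : Fin 3) f, ContinuousOn (Γ.edgeDeriv g j f) (Icc 0 (Γ.len f)) := fun j f =>
    (hg f).continuousOn_iteratedDerivWithin (by exact_mod_cast Nat.lt_succ_iff.1 j.2)
      (Γ.uniqueDiffOn_edge f)
  set G : Γ.Jet := fun j f => ⟨fun y => Γ.edgeDeriv g j f y,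
    continuousOn_iff_continuous_domRestrict.1 (hc j f)⟩ with hG
  have hev : ∀ (j : Fin 3) f, ∀ y ∈ Icc 0 (Γ.len f), Γ.ev G j f y = Γ.edgeDeriv g j f y :=
    fun j f y hy => Γ.ev_apply G j f hy
  have hb : ∀ (j : Fin 3) h, Γ.bond G j h 0 = Γ.endDeriv g j h := fun j h => by
    rw [bond, pos_zero, hev j _ _ (Γ.endPos_mem h), endDeriv_eq, Complex.real_smul]
  refine ⟨⟨G, mem_stateSpace (fun j f y hy => ?_) (fun j h' => ?_)⟩, hev⟩
  · have h1 := (hg f).hasDerivWithinAt_iteratedDerivWithin' (r := 2) (Γ.uniqueDiffOn_edge f)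
      (j := j) (by exact_mod_cast j.2) hy
    rw [hev _ f y hy]
    exact h1.congr (fun z hz => hev _ f z hz) (hev _ f y hy)
  · simp only [hb]
    exact h j (Nat.lt_succ_iff.1 j.2) h'

theorem smoothFam_ev {X : Type*} [TopologicalSpace X] {w : X → State Γ S} (hw : Continuous w)
    (K : Set X) (f : E) :
    SmoothFam 2 K (Icc 0 (Γ.len f)) (fun x => Γ.ev (w x).jet 0 f) ∧
    ∀ j : Fin 3, ∀ x ∈ K, EqOn (iteratedDerivWithin j (Γ.ev (w x).jet 0 f) (Icc 0 (Γ.len f)))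
      (Γ.ev (w x).jet j f) (Icc 0 (Γ.len f)) := by
  have hI := Γ.uniqueDiffOn_edge f
  let D : ℕ → X → ℝ → ℂ := fun j x => Γ.ev (w x).jet (Fin.ofNat 3 j) f
  have hD : ∀ j : ℕ, (j : ℕ∞) < 2 → ∀ x ∈ K, ∀ y ∈ Icc 0 (Γ.len f),
      HasDerivWithinAt (D j x) (D (j + 1) x y) (Icc 0 (Γ.len f)) y := fun j hj x _ y hy => by
    have hj' : j < 2 := by exact_mod_cast hj
    interval_cases j
    · exact ev_hasDerivWithinAt (w x) 0 f hy
    · exact ev_hasDerivWithinAt (w x) 1 f hy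
  refine ⟨SmoothFam.of_family (D := D) hI (fun j _ => ?_) hD, fun j x hx => ?_⟩
  · have hw' : Continuous fun x => (w x).jet :=
      continuous_subtype_val.comp (X := X) (Y := Γ.stateSpace S) hw
    exact ((Γ.continuous_ev_uncurry (Fin.ofNat 3 j) f).comp
      ((hw'.comp continuous_fst).prodMk continuous_snd)).continuousOn
  · have := iteratedDerivWithin_eqOn (r := 2) (D := fun j => D j x) (j := j) hI
      (fun j hj y hy => hD j hj x hx y hy) (by exact_mod_cast Nat.lt_succ_iff.1 j.2)
    have hj : Fin.ofNat 3 (j : ℕ) = j := by simp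
    simp only [D] at this
    rw [hj] at this
    exact this

variable [DecidableEq V] [DecidableEq E] (hS : Γ.IsScattering S) (hU : Γ.IsSmoothPotential U)

include hS hU

/-- The parametrix can be corrected to a solution of the heat equation: the remainder, extended by `0`
to `t ≤ 0`, is a continuous source in the state space. -/
theorem exists_correction (e : E) {M : ℕ} (hM : 1 ≤ M) :
    ∃ w : ℝ × ℝ → State Γ S, Continuous w ∧
      (∀ t, 0 < t → ∀ x ∈ Icc 0 (Γ.len e), ∀ f, ∀ y ∈ Icc 0 (Γ.len f),
        HasDerivAt (fun t => Γ.ev (w (t, x)).jet 0 f y)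
          (Γ.ev (w (t, x)).jet 2 f y + (U f y : ℂ) * Γ.ev (w (t, x)).jet 0 f y
            - Γ.graphRem S U (M + 3) e t x f y) t) ∧
      ∃ C, 0 ≤ C ∧ ∀ t, 0 < t → t ≤ 1 → ∀ x, ‖w (t, x)‖ ≤ C * t ^ M := by
  have hL := (Γ.len_pos e).le
  obtain ⟨C, hC0, hC⟩ := exists_norm_graphRem_le (S := S) hU e M
  have hex : ∀ p : ℝ × Icc 0 (Γ.len e), ∃ s : State Γ S, ∀ (j : Fin 3) f, ∀ y ∈ Icc 0 (Γ.len f),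
      Γ.ev s.jet j f y
        = if 0 < p.1 then -Γ.edgeDeriv (Γ.graphRem S U (M + 3) e p.1 p.2) j f y else 0 := by
    rintro ⟨t, x⟩
    by_cases ht : 0 < t
    · obtain ⟨s, hs⟩ := exists_state (S := S) (g := Γ.graphRem S U (M + 3) e t x)
        (fun f => (smoothFam_graphRem hU _ e f).1 (t, x) ⟨ht, x.2⟩)
        (fun j hj h => sum_mul_endDeriv_graphRem hU _ e hS ht x.2 hj h)
      refine ⟨-s, fun j f y hy => ?_⟩
      rw [if_pos ht, ← hs j f y hy, ← evL_apply, ← evL_apply, map_neg]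
    · refine ⟨0, fun j f y hy => ?_⟩
      rw [if_neg ht, ← evL_apply, map_zero]
  choose F hF using hex
  have hFn : ∀ t, t ≤ 1 → ∀ z, ∀ j f, ∀ y ∈ Icc 0 (Γ.len f),
      ‖Γ.ev (F (t, z)).jet j f y‖ ≤ C * (max t 0) ^ M := fun t ht1 z j f y hy => by
    rw [hF _ j f y hy]
    split_ifs with h
    · rw [norm_neg, max_eq_left (le_of_lt h)]
      exact hC t h ht1 z z.2 j (Nat.lt_succ_iff.1 j.2) f y hy
    · rw [norm_zero]
      have : 0 ≤ max t 0 := le_max_right _ _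
      positivity
  have hFc : Continuous F := by
    refine continuous_state_iff.2 fun j f => ContinuousMap.continuous_of_continuous_uncurry _ ?_
    have hval : ∀ q : (ℝ × Icc 0 (Γ.len e)) × Icc 0 (Γ.len f), (F q.1).jet j f q.2
        = if 0 < q.1.1 then -Γ.edgeDeriv (Γ.graphRem S U (M + 3) e q.1.1 q.1.2) j f q.2 else 0 :=
      fun q => by rw [← hF q.1 j f q.2 q.2.2, ev_apply _ _ _ _ q.2.2]
    show Continuous fun q : (ℝ × Icc 0 (Γ.len e)) × Icc 0 (Γ.len f) => (F q.1).jet j f q.2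
    refine continuous_iff_continuousAt.2 fun q => ?_
    rcases lt_or_ge 0 q.1.1 with hq | hq
    · have h1 := (smoothFam_graphRem (S := S) hU (M + 3) e f).2 j
        (by exact_mod_cast Nat.lt_succ_iff.1 j.2)
      have h2 : ContinuousOn (fun q : (ℝ × Icc 0 (Γ.len e)) × Icc 0 (Γ.len f) =>
          Γ.edgeDeriv (Γ.graphRem S U (M + 3) e q.1.1 q.1.2) j f q.2) {q | 0 < q.1.1} :=
        h1.comp (f := fun q : (ℝ × Icc 0 (Γ.len e)) × Icc 0 (Γ.len f) =>
          ((q.1.1, (q.1.2 : ℝ)), (q.2 : ℝ))) (by fun_prop)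
          fun q hq => ⟨⟨hq, q.1.2.2⟩, q.2.2⟩
      have ho : IsOpen {q : (ℝ × Icc 0 (Γ.len e)) × Icc 0 (Γ.len f) | 0 < q.1.1} :=
        isOpen_lt continuous_const (by fun_prop)
      refine ((h2.continuousAt (ho.mem_nhds hq)).neg).congr ?_
      filter_upwards [ho.mem_nhds hq] with z hz
      rw [hval, if_pos hz]
      rfl
    · have h0 : (F q.1).jet j f q.2 = 0 := by rw [hval, if_neg (not_lt.2 hq)]
      rw [ContinuousAt, h0]
      refine squeeze_zero_norm' (a := fun q : (ℝ × Icc 0 (Γ.len e)) × Icc 0 (Γ.len f) =>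
        C * (max q.1.1 0) ^ M) ?_ ?_
      · have ho : IsOpen {q : (ℝ × Icc 0 (Γ.len e)) × Icc 0 (Γ.len f) | q.1.1 < 1} :=
          isOpen_lt (by fun_prop) continuous_const
        filter_upwards [ho.mem_nhds (show q.1.1 < 1 by linarith)] with z hz
        have := hFn z.1.1 (le_of_lt hz) z.1.2 j f z.2 z.2.2
        rwa [ev_apply _ _ _ _ z.2.2] at this
      · have hc : Continuous fun q : (ℝ × Icc 0 (Γ.len e)) × Icc 0 (Γ.len f) =>
            C * (max q.1.1 0) ^ M := by fun_prop
        have := hc.tendsto q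
        rwa [max_eq_right hq, zero_pow (by omega), mul_zero] at this
  obtain ⟨w, hwc, hwd, C', hC'0, hC'⟩ := exists_cauchy_solution hS hU hFc
  refine ⟨fun p => w (p.1, projIcc 0 (Γ.len e) hL p.2), ?_, fun t ht x hx f y hy => ?_,
    C' * C, by positivity, fun t ht ht1 x => ?_⟩
  · exact hwc.comp (continuous_fst.prodMk (continuous_projIcc.comp continuous_snd))
  · have hd := hwd t ht (projIcc 0 (Γ.len e) hL x) f y hy
    refine HasDerivAt.congr_deriv hd ?_
    beta_reduce
    rw [hF _ 0 f y hy, if_pos ht, projIcc_of_mem hL hx]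
    simp only [Fin.val_zero, edgeDeriv_zero]
    ring
  · rw [mul_assoc]
    refine hC' t ⟨ht.le, ht1⟩ _ _ fun s hs => ?_
    refine (State.norm_le_iff (by positivity)).2 fun j f y hy => ?_
    refine (hFn s (hs.2.trans ht1) _ j f y hy).trans ?_
    rw [max_eq_left hs.1]
    have := hs.1
    gcongr
    exact hs.2

end MetricGraph

namespace MetricGraph

variable {V E : Type*} {Γ : MetricGraph V E} {S : E × Bool → E × Bool → ℂ} {U : E → ℝ → ℝ}

theorem tendsto_integral_directWave (hU : Γ.IsSmoothPotential U) (N : ℕ) (e : E) {x : ℝ}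
    (hx : x ∈ Ioo 0 (Γ.len e)) {ψ : ℝ → ℂ} (hψ : ContinuousOn ψ (Icc 0 (Γ.len e))) :
    Tendsto (fun t => ∫ y in (0 : ℝ)..Γ.len e, Γ.directWave U N e t x y * ψ y) (𝓝[>] 0)
      (𝓝 (ψ x)) := by
  have hL := (Γ.len_pos e).le
  have hxI := Ioo_subset_Icc_self hx
  have hA : ∀ k, ContinuousOn (Γ.directAmp U N e k x) (Icc 0 (Γ.len e)) := fun k =>
    ((smoothFam_directAmp hU N e k).1 x hxI).continuousOn.mono (subset_univ _)
  have hAψ : ∀ k, ContinuousOn (fun y => Γ.directAmp U N e k x y * ψ y) (Icc 0 (Γ.len e)) :=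
    fun k => (hA k).mul hψ
  have h1 : Tendsto (fun t : ℝ => ∑ k ∈ Finset.range (N + 1), (t : ℂ) ^ k *
      ∫ y in (0 : ℝ)..Γ.len e, (gaussKernel t (y - x) : ℂ) * (Γ.directAmp U N e k x y * ψ y))
      (𝓝[>] 0) (𝓝 (∑ k ∈ Finset.range (N + 1),
        ((0 : ℝ) : ℂ) ^ k * (Γ.directAmp U N e k x x * ψ x))) := by
    refine tendsto_finsetSum _ fun k _ => Tendsto.mul ?_
      (tendsto_integral_gaussKernel_mul (hAψ k) hx)
    have : Continuous fun t : ℝ => (t : ℂ) ^ k := by fun_prop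
    exact (this.tendsto 0).mono_left nhdsWithin_le_nhds
  have h2 : ∑ k ∈ Finset.range (N + 1), ((0 : ℝ) : ℂ) ^ k * (Γ.directAmp U N e k x x * ψ x)
      = ψ x := by
    rw [Finset.sum_range_succ', Finset.sum_eq_zero fun k _ => by simp]
    simp only [directAmp, amplitude, zero_le, if_true, sub_self, one_mul]
    rw [transportSum_zero (by omega), interiorPoly, eval_transportJet_zero]
    simp
  rw [h2] at h1
  refine h1.congr fun t => ?_
  have hg : Continuous fun y => (gaussKernel t (y - x) : ℂ) :=
    Complex.continuous_ofReal.comp ((continuous_gaussKernel t).comp (by fun_prop))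
  simp only [← intervalIntegral.integral_const_mul]
  rw [← intervalIntegral.integral_finsetSum fun k _ => ?_]
  · refine intervalIntegral.integral_congr fun y _ => ?_
    simp only [directWave, heatSum, Finset.mul_sum, Finset.sum_mul]
    exact Finset.sum_congr rfl fun k _ => by ring
  · refine ContinuousOn.intervalIntegrable ?_
    rw [uIcc_of_le hL]
    exact continuousOn_const.mul (hg.continuousOn.mul (hAψ k))

variable [DecidableEq V]

theorem exists_norm_passWave_le (hU : Γ.IsSmoothPotential U) (N : ℕ) (e : E) (b : Bool)
    (h : E × Bool) {d : ℝ} (hd : 0 < d) (p : ℕ) :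
    ∃ C, 0 ≤ C ∧ ∀ t, 0 < t → t ≤ 1 → ∀ x ∈ Icc 0 (Γ.len e), ∀ ζ ∈ Γ.passSeg e h.1,
      d ≤ |ζ - Γ.pos (e, b) x| → ‖Γ.passWave U N e b h t x ζ‖ ≤ C * t ^ p := by
  obtain ⟨C, hC0, hC⟩ := exists_norm_heatSum_le
    (show -Γ.len h.1 < Γ.len e by linarith [Γ.len_pos e, Γ.len_pos h.1])
    (smoothFam_passAmp hU N (e, b) h) isCompact_Icc hd N p
  refine ⟨C, hC0, fun t ht ht1 x hx ζ hζ hz => ?_⟩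
  unfold passWave
  split_ifs
  · exact hC t ht ht1 _ (Γ.pos_mem (e, b) hx) ζ hζ hz
  · rw [norm_zero]; positivity

variable [DecidableEq E]

/-- If the source lies inside an edge, the waves that passed a vertex are negligible: they have
covered at least the distance of the source from the ends. -/
theorem exists_norm_graphWave_sub_le [Finite E] (hU : Γ.IsSmoothPotential U) (N : ℕ) (e : E)
    {x : ℝ} (hx : x ∈ Ioo 0 (Γ.len e)) (p : ℕ) :
    ∃ C, 0 ≤ C ∧ ∀ t, 0 < t → t ≤ 1 → ∀ f, ∀ y ∈ Icc 0 (Γ.len f),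
      ‖Γ.graphWave S U N e t x f y - if f = e then Γ.directWave U N e t x y else 0‖
        ≤ C * t ^ p := by
  have hd : 0 < min x (Γ.len e - x) := lt_min hx.1 (sub_pos.2 hx.2)
  choose C hC h using fun b h => exists_norm_passWave_le hU N e b h hd p
  obtain ⟨B, hB⟩ := (Set.finite_range fun f => ∑ b', ∑ b,
    ‖S (f, b') (e, b)‖ * C b (f, b')).bddAbove
  refine ⟨max B 0, le_max_right _ _, fun t ht ht1 f y hy => ?_⟩
  rw [graphWave, fold, add_sub_cancel_left]
  calc _ ≤ ∑ b', ∑ b, ‖S (f, b') (e, b)‖ * C b (f, b') * t ^ p := by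
        refine (norm_sum_le _ _).trans (Finset.sum_le_sum fun b' _ => (norm_sum_le _ _).trans
          (Finset.sum_le_sum fun b _ => ?_))
        rw [norm_mul, mul_assoc]
        refine mul_le_mul_of_nonneg_left (h b (f, b') t ht ht1 x (Ioo_subset_Icc_self hx) _
          (neg_pos_mem_passSeg e (f, b') hy) ?_) (norm_nonneg _)
        have h1 : min x (Γ.len e - x) ≤ Γ.pos (e, b) x := by
          unfold pos; split_ifs
          · exact min_le_right _ _
          · exact min_le_left _ _
        have h2 := (Γ.pos_mem (f, b') hy).1
        rw [abs_sub_comm]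
        exact le_trans (by linarith) (le_abs_self _)
    _ = (∑ b', ∑ b, ‖S (f, b') (e, b)‖ * C b (f, b')) * t ^ p := by
        simp only [Finset.sum_mul]
    _ ≤ _ := mul_le_mul_of_nonneg_right ((hB ⟨f, rfl⟩).trans (le_max_left _ _)) (by positivity)

variable [Fintype E] {A B : ∀ v, Matrix (Γ.Star v) (Γ.Star v) ℂ}

/-- The heat kernel exists, and it is close to the parametrix. The vertex conditions and the heat
equation hold by construction; the initial condition is that of the direct wave, as everything else
tends to zero uniformly. -/
theorem exists_heatKernel (hU : Γ.IsSmoothPotential U) (hAB : ∀ v, IsNonRobin (A v) (B v)) {M : ℕ}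
    (hM : 1 ≤ M) :
    ∃ k, Γ.IsHeatKernel U A B k ∧ ∃ C, 0 ≤ C ∧ ∀ t, 0 < t → t ≤ 1 → ∀ e, ∀ x ∈ Icc 0 (Γ.len e),
      ∀ f, ∀ y ∈ Icc 0 (Γ.len f),
        ‖k t e x f y - Γ.graphWave (Γ.scatter A B) U (M + 3) e t x f y‖ ≤ C * t ^ M := by
  have hS := isScattering_scatter Γ hAB
  choose w hwc hwd C hC0 hC using fun e => exists_correction hS hU e hM
  obtain ⟨C', hC'⟩ := (Set.finite_range C).bddAbove
  set k : ℝ → E → ℝ → E → ℝ → ℂ := fun t e x f y =>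
    Γ.graphWave (Γ.scatter A B) U (M + 3) e t x f y + Γ.ev (w e (t, x)).jet 0 f y with hk
  have hclose : ∀ t, 0 < t → t ≤ 1 → ∀ e x f y,
      ‖k t e x f y - Γ.graphWave (Γ.scatter A B) U (M + 3) e t x f y‖ ≤ max C' 0 * t ^ M := by
    intro t ht ht1 e x f y
    simp only [hk, add_sub_cancel_left]
    refine (Γ.norm_ev_le _ _ _ _).trans ((hC e t ht ht1 x).trans ?_)
    gcongr
    exact (hC' ⟨e, rfl⟩).trans (le_max_left _ _)
  have hI := Γ.uniqueDiffOn_edge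
  have hw := fun e f => smoothFam_ev (hwc e) (Ioi 0 ×ˢ Icc 0 (Γ.len e)) f
  have hg := fun e f => smoothFam_graphWave (S := Γ.scatter A B) hU (M + 3) e f
  have hfam : ∀ e f, SmoothFam 2 (Ioi 0 ×ˢ Icc 0 (Γ.len e)) (Icc 0 (Γ.len f))
      fun p : ℝ × ℝ => k p.1 e p.2 f := fun e f => (hg e f).add (hI f) (hw e f).1
  have hder : ∀ (j : Fin 3) t, 0 < t → ∀ e, ∀ x ∈ Icc 0 (Γ.len e), ∀ f, ∀ y ∈ Icc 0 (Γ.len f),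
      Γ.edgeDeriv (k t e x) j f y
        = Γ.edgeDeriv (Γ.graphWave (Γ.scatter A B) U (M + 3) e t x) j f y
          + Γ.ev (w e (t, x)).jet j f y := by
    intro j t ht e x hx f y hy
    have hp : (t, x) ∈ (Ioi (0 : ℝ) ×ˢ Icc 0 (Γ.len e)) := ⟨ht, hx⟩
    have hj : ((j : ℕ) : ℕ∞ω) ≤ ((2 : ℕ∞) : ℕ∞ω) := by exact_mod_cast Nat.lt_succ_iff.1 j.2
    rw [← (hw e f).2 j (t, x) hp hy]
    exact iteratedDerivWithin_fun_add hy (hI f) (((hg e f).1 (t, x) hp y hy).of_le hj)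
      (((hw e f).1.1 (t, x) hp y hy).of_le hj)
  have hend : ∀ (j : Fin 3) t, 0 < t → ∀ e, ∀ x ∈ Icc 0 (Γ.len e), ∀ h,
      ∑ h', Γ.scatter A B h h' * Γ.endDeriv (k t e x) j h'
        = (-1) ^ (j : ℕ) * Γ.endDeriv (k t e x) j h := by
    intro j t ht e x hx h
    have h1 : ∀ h, Γ.endDeriv (k t e x) j h
        = Γ.endDeriv (Γ.graphWave (Γ.scatter A B) U (M + 3) e t x) j h
          + Γ.bond (w e (t, x)).jet j h 0 := fun h => by
      rw [endDeriv_eq, hder j t ht e x hx _ _ (Γ.endPos_mem h), smul_add, endDeriv_eq, bond,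
        pos_zero, Complex.real_smul, Complex.real_smul]
    simp only [h1, mul_add, Finset.sum_add_distrib]
    rw [sum_mul_endDeriv_graphWave hU _ e hS ht hx (Nat.lt_succ_iff.1 j.2)]
    congr 1
    exact (w e (t, x)).2.2 j h
  refine ⟨k, ⟨fun e f => ?_, fun t ht e x hx f => ?_, fun e x hx f j hj => ?_,
    fun t ht e x hx f y hy => ?_, fun t ht e x hx => ?_, fun e x hx ψ hψ => ?_⟩,
    max C' 0, le_max_right _ _, fun t ht ht1 e x _ f y _ => hclose t ht ht1 e x f y⟩
  · refine ((hfam e f).2 0 (by norm_num)).comp (f := fun p : ℝ × ℝ × ℝ => ((p.1, p.2.1), p.2.2))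
      (by fun_prop) (fun p hp => ⟨⟨hp.1, hp.2.1⟩, hp.2.2⟩) |>.congr fun p _ => ?_
    simp only [Function.comp, iteratedDerivWithin_zero]
  · exact (hfam e f).1 (t, x) ⟨ht, hx⟩
  · exact ((hfam e f).2 j (by exact_mod_cast hj)).comp (f := fun p : ℝ × ℝ => ((p.1, x), p.2))
      (by fun_prop) fun p hp => ⟨⟨hp.1, hx⟩, hp.2⟩
  · refine ((hasDerivAt_graphWave hU (M + 3) e hS ht hx f hy).add
      (hwd e t ht x hx f y hy)).congr_deriv ?_
    have := hder 2 t ht e x hx f y hy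
    rw [Fin.val_two] at this
    rw [this]
    simp only [hk]
    ring
  · refine (vertex_cond_iff Γ hAB _ _).2 ⟨fun h => ?_, fun h => ?_⟩
    · simpa using hend 0 t ht e x hx h
    · simpa using hend 1 t ht e x hx h
  · -- only the direct wave contributes in the limit
    obtain ⟨C₁, hC₁0, hC₁⟩ := exists_norm_graphWave_sub_le (S := Γ.scatter A B) hU (M + 3) e hx 1
    have hxI := Ioo_subset_Icc_self hx
    have hR : ∀ t, 0 < t → t ≤ 1 → ∀ f, ∀ y ∈ Icc 0 (Γ.len f),
        ‖k t e x f y - if f = e then Γ.directWave U (M + 3) e t x y else 0‖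
          ≤ (max C' 0 + C₁) * t := by
      intro t ht ht1 f y hy
      have h1 := hC₁ t ht ht1 f y hy
      have h2 := hclose t ht ht1 e x f y
      have h3 : t ^ M ≤ t := by simpa using pow_le_pow_of_le_one ht.le ht1 hM
      have h4 : max C' 0 * t ^ M ≤ max C' 0 * t :=
        mul_le_mul_of_nonneg_left h3 (le_max_right _ _)
      rw [pow_one] at h1
      calc _ = ‖(k t e x f y - Γ.graphWave (Γ.scatter A B) U (M + 3) e t x f y)
            + (Γ.graphWave (Γ.scatter A B) U (M + 3) e t x f y
              - if f = e then Γ.directWave U (M + 3) e t x y else 0)‖ := by congr 1; ring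
        _ ≤ _ := norm_add_le _ _
        _ ≤ _ := by rw [add_mul]; linarith
    have hkc : ∀ t, 0 < t → ∀ f, ContinuousOn (fun y => k t e x f y) (Icc 0 (Γ.len f)) :=
      fun t ht f => ((hfam e f).1 (t, x) ⟨ht, hxI⟩).continuousOn
    have hdc : ∀ t, 0 < t → ContinuousOn (Γ.directWave U (M + 3) e t x) (Icc 0 (Γ.len e)) :=
      fun t ht => ((smoothFam_directWave hU (M + 3) e).1 (t, x) ⟨ht, hxI⟩).continuousOn
    have hf : ∀ f, Tendsto (fun t => ∫ y in (0 : ℝ)..Γ.len f, k t e x f y * ψ f y) (𝓝[>] 0)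
        (𝓝 (if f = e then ψ e x else 0)) := by
      intro f
      have hLf := (Γ.len_pos f).le
      have hmain : Tendsto (fun t => ∫ y in (0 : ℝ)..Γ.len f,
          (if f = e then Γ.directWave U (M + 3) e t x y else 0) * ψ f y) (𝓝[>] 0)
          (𝓝 (if f = e then ψ e x else 0)) := by
        by_cases hfe : f = e
        · subst hfe
          simpa only [if_true] using tendsto_integral_directWave hU (M + 3) f hx (hψ f)
        · simp [hfe]
      have hdiff : Tendsto (fun t => (∫ y in (0 : ℝ)..Γ.len f, k t e x f y * ψ f y)
          - ∫ y in (0 : ℝ)..Γ.len f,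
            (if f = e then Γ.directWave U (M + 3) e t x y else 0) * ψ f y) (𝓝[>] 0) (𝓝 0) := by
        obtain ⟨B', hB'⟩ := (isCompact_Icc (a := 0) (b := Γ.len f)).exists_bound_of_continuousOn
          (hψ f)
        have hB'0 : 0 ≤ B' := (norm_nonneg _).trans (hB' 0 ⟨le_rfl, hLf⟩)
        refine squeeze_zero_norm' (a := fun t => (max C' 0 + C₁) * t * B' * Γ.len f) ?_ ?_
        · filter_upwards [Ioc_mem_nhdsGT one_pos] with t ht
          have hdc' : ContinuousOn (fun y => if f = e then Γ.directWave U (M + 3) e t x y else 0)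
              (Icc 0 (Γ.len f)) := by
            by_cases hfe : f = e
            · subst hfe
              simpa only [if_true] using hdc t ht.1
            · simp only [if_neg hfe]
              exact continuousOn_const
          rw [← intervalIntegral.integral_sub]
          · have := intervalIntegral.norm_integral_le_of_norm_le_const (a := 0) (b := Γ.len f)
              (f := fun y => k t e x f y * ψ f y -
                (if f = e then Γ.directWave U (M + 3) e t x y else 0) * ψ f y)
              (C := (max C' 0 + C₁) * t * B') fun y hy => by
                rw [uIoc_of_le hLf] at hy
                rw [← sub_mul, norm_mul]
                have h0 : 0 ≤ max C' 0 := le_max_right _ _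
                have ht0 := ht.1
                exact mul_le_mul (hR t ht.1 ht.2 f y (Ioc_subset_Icc_self hy))
                  (hB' y (Ioc_subset_Icc_self hy)) (norm_nonneg _) (by positivity)
            rwa [sub_zero, abs_of_nonneg hLf] at this
          · refine ContinuousOn.intervalIntegrable ?_
            rw [uIcc_of_le hLf]
            exact (hkc t ht.1 f).mul (hψ f)
          · refine ContinuousOn.intervalIntegrable ?_
            rw [uIcc_of_le hLf]
            exact hdc'.mul (hψ f)
        · have : Continuous fun t => (max C' 0 + C₁) * t * B' * Γ.len f := by fun_prop
          have h0 := (this.tendsto 0).mono_left (nhdsWithin_le_nhds (s := Ioi 0))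
          simpa using h0
      simpa using hdiff.add hmain
    have := tendsto_finsetSum Finset.univ fun f _ => hf f
    simpa using this

end MetricGraph

/-! ### Asymptotics of Gaussian integrals over an edge -/

section HalfLine

/-- The moments of the Gaussian on the half-line, `∫₀^∞ γ_t(2s) s ^ l ds = halfMoment l * √t ^ l`
for the heat kernel `γ_t` of the line. -/
noncomputable def halfMoment (l : ℕ) : ℝ := Real.Gamma ((l + 1) / 2) / (4 * √π)

theorem halfMoment_two_mul (j : ℕ) :
    halfMoment (2 * j) = 1 / 4 * (((2 * j - 1).doubleFactorial : ℝ) / 2 ^ j) := by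
  have h1 : (((2 * j : ℕ) : ℝ) + 1) / 2 = j + 1 / 2 := by push_cast; ring
  have h2 : √π ≠ 0 := (Real.sqrt_pos.2 Real.pi_pos).ne'
  rw [halfMoment, h1, Real.Gamma_nat_add_half]
  field_simp

theorem gaussKernel_two_mul {t : ℝ} (s : ℝ) :
    gaussKernel t (2 * s) = Real.exp (-(1 / t) * s ^ 2) * (√(4 * π * t))⁻¹ := by
  rw [gaussKernel, div_eq_mul_inv _ (√_)]
  congr 2
  rcases eq_or_ne t 0 with rfl | ht
  · simp
  · field_simp; ring

theorem integrableOn_pow_mul_gaussKernel {t : ℝ} (ht : 0 < t) (l : ℕ) :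
    MeasureTheory.IntegrableOn (fun s => gaussKernel t (2 * s) * s ^ l) (Ioi 0) := by
  have h := (integrableOn_rpow_mul_exp_neg_mul_sq (b := 1 / t) (by positivity) (s := l)
    (by linarith [l.cast_nonneg (α := ℝ)])).mul_const (√(4 * π * t))⁻¹
  refine h.congr (Eventually.of_forall fun s => ?_)
  simp only [Real.rpow_natCast, gaussKernel_two_mul]
  ring

theorem integral_pow_mul_gaussKernel {t : ℝ} (ht : 0 < t) (l : ℕ) :
    ∫ s in Ioi 0, gaussKernel t (2 * s) * s ^ l = halfMoment l * √t ^ l := by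
  have h := integral_rpow_mul_exp_neg_mul_rpow (p := 2) (q := l) (b := 1 / t) two_pos
    (by linarith [l.cast_nonneg (α := ℝ)]) (by positivity)
  have h1 : ∀ s ∈ Ioi (0 : ℝ), gaussKernel t (2 * s) * s ^ l
      = (s ^ (l : ℝ) * Real.exp (-(1 / t) * s ^ (2 : ℝ))) * (√(4 * π * t))⁻¹ := fun s _ => by
    rw [gaussKernel_two_mul, Real.rpow_natCast, Real.rpow_two]; ring
  rw [MeasureTheory.setIntegral_congr_fun measurableSet_Ioi h1, MeasureTheory.integral_mul_const,
    h, halfMoment]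
  have h2 : (1 / t) ^ (-((l : ℝ) + 1) / 2) = √t ^ l * √t := by
    rw [one_div, Real.inv_rpow ht.le, ← Real.rpow_neg ht.le, ← pow_succ,
      Real.sqrt_eq_rpow, ← Real.rpow_natCast, ← Real.rpow_mul ht.le]
    congr 1
    push_cast
    ring
  have h3 : √(4 * π * t) = 2 * √π * √t := by
    rw [Real.sqrt_mul (by positivity), Real.sqrt_mul (by norm_num),
      show (4 : ℝ) = 2 ^ 2 by norm_num, Real.sqrt_sq two_pos.le]
  have h4 : √t ≠ 0 := (Real.sqrt_pos.2 ht).ne'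
  have h5 : √π ≠ 0 := (Real.sqrt_pos.2 Real.pi_pos).ne'
  rw [h2, h3]
  field_simp
  norm_num

/-- Watson's lemma for the Gaussian: a Taylor expansion of the integrand at `0` yields an expansion
of the integral in powers of `√t`. -/
theorem isBigO_integral_gaussKernel {L : ℝ} (hL : 0 < L) {Φ : ℝ → ℝ}
    (hΦ : ContinuousOn Φ (Icc 0 L)) {n : ℕ} {m : ℕ → ℝ}
    (hm : (fun s => Φ s - ∑ l ∈ Finset.range n, m l * s ^ l) =O[𝓝[>] 0] fun s => s ^ n) :
    (fun t => (∫ s in (0 : ℝ)..L, gaussKernel t (2 * s) * Φ s)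
        - ∑ l ∈ Finset.range n, m l * (halfMoment l * √t ^ l)) =O[𝓝[>] 0] fun t => √t ^ n := by
  set P : ℝ → ℝ := fun s => ∑ l ∈ Finset.range n, m l * s ^ l with hP
  have hPc : Continuous P := by fun_prop
  set Ψ : ℝ → ℝ := (Icc 0 L).indicator Φ with hΨ
  -- a bound of the Taylor remainder on the whole half-line
  obtain ⟨C, hC0, hC⟩ : ∃ C, 0 ≤ C ∧ ∀ s, 0 < s → |Ψ s - P s| ≤ C * s ^ n := by
    obtain ⟨C₁, hC₁0, hC₁⟩ := hm.exists_nonneg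
    rw [isBigOWith_iff] at hC₁
    obtain ⟨ε, hε0, hε⟩ := mem_nhdsGT_iff_exists_Ioo_subset.1 hC₁
    obtain ⟨B, hB⟩ := isCompact_Icc.exists_bound_of_continuousOn (hΦ.sub hPc.continuousOn)
    set δ := min ε L with hδ
    have hδ0 : 0 < δ := lt_min hε0 hL
    set C₂ := ∑ l ∈ Finset.range n, |m l| / L ^ (n - l) with hC₂
    have hC₂0 : 0 ≤ C₂ := by positivity
    refine ⟨C₁ + |B| / δ ^ n + C₂, by positivity, fun s hs => ?_⟩
    have e1 : 0 ≤ C₁ * s ^ n := by positivity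
    have e2 : 0 ≤ |B| / δ ^ n * s ^ n := by positivity
    have e3 : 0 ≤ C₂ * s ^ n := by positivity
    rw [add_mul, add_mul]
    rcases le_or_gt s L with hsL | hsL
    · rw [hΨ, indicator_of_mem (show s ∈ Icc 0 L from ⟨hs.le, hsL⟩)]
      rcases lt_or_ge s δ with h | h
      · have h1 := hε ⟨hs, h.trans_le (min_le_left _ _)⟩
        rw [mem_ofPred_eq, Real.norm_eq_abs, Real.norm_of_nonneg (by positivity)] at h1
        exact h1.trans (by linarith)
      · have h1 := hB s ⟨hs.le, hsL⟩
        rw [Real.norm_eq_abs] at h1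
        have h2 : |B| ≤ |B| / δ ^ n * s ^ n := by
          rw [div_mul_eq_mul_div, le_div_iff₀ (by positivity)]
          gcongr
        exact h1.trans ((le_abs_self B).trans (by linarith))
    · rw [hΨ, indicator_of_notMem (fun h => absurd h.2 (not_le.2 hsL)), zero_sub, abs_neg]
      have : |P s| ≤ C₂ * s ^ n := by
        rw [hP, hC₂, Finset.sum_mul]
        refine (Finset.abs_sum_le_sum_abs _ _).trans (Finset.sum_le_sum fun l hl => ?_)
        have hln := (Finset.mem_range.1 hl).le
        rw [abs_mul, abs_of_nonneg (by positivity : 0 ≤ s ^ l), div_mul_eq_mul_div,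
          le_div_iff₀ (by positivity), mul_assoc]
        refine mul_le_mul_of_nonneg_left ?_ (abs_nonneg _)
        calc s ^ l * L ^ (n - l) ≤ s ^ l * s ^ (n - l) := by gcongr
          _ = s ^ n := by rw [← pow_add, Nat.add_sub_cancel' hln]
      linarith
  refine IsBigO.of_bound (C * halfMoment n) ?_
  filter_upwards [self_mem_nhdsWithin] with t ht
  have ht0 : 0 < t := ht
  have hgc : Continuous fun s => gaussKernel t (2 * s) := (continuous_gaussKernel t).comp (by fun_prop)
  have h1 : ∫ s in (0 : ℝ)..L, gaussKernel t (2 * s) * Φ s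
      = ∫ s in Ioi 0, gaussKernel t (2 * s) * Ψ s := by
    have : ∀ s, gaussKernel t (2 * s) * Ψ s
        = (Icc 0 L).indicator (fun s => gaussKernel t (2 * s) * Φ s) s := fun s => by
      by_cases hs : s ∈ Icc 0 L
      · rw [hΨ, indicator_of_mem hs, indicator_of_mem hs]
      · rw [hΨ, indicator_of_notMem hs, indicator_of_notMem hs, mul_zero]
    simp only [this]
    rw [MeasureTheory.setIntegral_indicator measurableSet_Icc, intervalIntegral.integral_of_le hL.le]
    congr 2
    ext s
    simp only [mem_Ioc, mem_inter_iff, mem_Ioi, mem_Icc]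
    exact ⟨fun h => ⟨h.1, h.1.le, h.2⟩, fun h => ⟨h.1, h.2.2⟩⟩
  have hPi : MeasureTheory.IntegrableOn (fun s => gaussKernel t (2 * s) * P s) (Ioi 0) := by
    simp only [hP, Finset.mul_sum]
    refine MeasureTheory.integrable_finsetSum _ fun l _ => ?_
    refine ((integrableOn_pow_mul_gaussKernel ht0 l).const_mul (m l)).congr
      (Eventually.of_forall fun s => ?_)
    simp only; ring
  have h2 : ∑ l ∈ Finset.range n, m l * (halfMoment l * √t ^ l)
      = ∫ s in Ioi 0, gaussKernel t (2 * s) * P s := by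
    simp only [hP, Finset.mul_sum]
    rw [MeasureTheory.integral_finsetSum]
    · refine Finset.sum_congr rfl fun l _ => ?_
      rw [← integral_pow_mul_gaussKernel ht0, ← MeasureTheory.integral_const_mul]
      refine MeasureTheory.integral_congr_ae (Eventually.of_forall fun s => ?_)
      simp only; ring
    · intro l _
      refine ((integrableOn_pow_mul_gaussKernel ht0 l).const_mul (m l)).congr
        (Eventually.of_forall fun s => ?_)
      simp only; ring
  have hΨi : MeasureTheory.IntegrableOn (fun s => gaussKernel t (2 * s) * Ψ s) (Ioi 0) := by
    have : ∀ s, gaussKernel t (2 * s) * Ψ s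
        = (Icc 0 L).indicator (fun s => gaussKernel t (2 * s) * Φ s) s := fun s => by
      by_cases hs : s ∈ Icc 0 L
      · rw [hΨ, indicator_of_mem hs, indicator_of_mem hs]
      · rw [hΨ, indicator_of_notMem hs, indicator_of_notMem hs, mul_zero]
    simp only [this]
    exact (((hgc.continuousOn.mul hΦ).integrableOn_Icc).integrable_indicator
      measurableSet_Icc).integrableOn
  rw [h1, h2, ← MeasureTheory.integral_sub hΨi hPi, Real.norm_of_nonneg (by positivity : 0 ≤ √t ^ n),
    mul_assoc, ← integral_pow_mul_gaussKernel ht0, ← MeasureTheory.integral_const_mul]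
  refine MeasureTheory.norm_integral_le_of_norm_le
    ((integrableOn_pow_mul_gaussKernel ht0 n).const_mul C) ?_
  refine (MeasureTheory.ae_restrict_iff' measurableSet_Ioi).2 (Eventually.of_forall fun s hs => ?_)
  rw [← mul_sub, norm_mul, Real.norm_of_nonneg (gaussKernel_nonneg _ _), Real.norm_eq_abs,
    mul_left_comm]
  exact mul_le_mul_of_nonneg_left (hC s hs) (gaussKernel_nonneg _ _)

end HalfLine

section Mirror

variable {L : ℝ} {X : ℝ → ℕ → ℝ}

/-- Taylor's formula for a polynomial in the derivatives of a function. -/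
theorem isBigO_eval_jet_sub (hL : 0 < L)
    (hX : ∀ i, ∀ s ∈ Icc 0 L, HasDerivWithinAt (fun s => X s i) (X s (i + 1)) (Icc 0 L) s)
    (p : MvPolynomial ℕ ℝ) (n : ℕ) :
    (fun s => MvPolynomial.eval (X s) p - ∑ i ∈ Finset.range n,
      MvPolynomial.eval (X 0) (jetDeriv^[i] p) / (i.factorial : ℝ) * s ^ i)
      =O[𝓝[>] 0] fun s => s ^ n := by
  have hI := uniqueDiffOn_Icc hL
  have h0 : (0 : ℝ) ∈ Icc 0 L := ⟨le_rfl, hL.le⟩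
  have hd : ∀ i, ∀ s ∈ Icc 0 L, HasDerivWithinAt (fun s => MvPolynomial.eval (X s) (jetDeriv^[i] p))
      (MvPolynomial.eval (X s) (jetDeriv^[i + 1] p)) (Icc 0 L) s := fun i s hs => by
    rw [Function.iterate_succ_apply']
    exact hasDerivWithinAt_eval_jet (a := fun i s => X s i) (fun i => hX i s hs) _
  have hc : ContDiffOn ℝ ∞ (fun s => MvPolynomial.eval (X s) p) (Icc 0 L) :=
    contDiffOn_of_hasDerivWithinAt (r := ⊤)
      (D := fun i s => MvPolynomial.eval (X s) (jetDeriv^[i] p)) hI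
      (fun i _ s hs => (hd i s hs).continuousWithinAt) (fun i _ s hs => hd i s hs)
  rcases n with _ | n
  · simp only [Finset.range_zero, Finset.sum_empty, sub_zero, pow_zero]
    have : Tendsto (fun s => MvPolynomial.eval (X s) p) (𝓝[>] 0)
        (𝓝 (MvPolynomial.eval (X 0) p)) := by
      refine (hc.continuousOn 0 h0).mono_left ?_
      rw [← nhdsWithin_Ioo_eq_nhdsGT hL]
      exact nhdsWithin_mono _ Ioo_subset_Icc_self
    exact this.isBigO_one ℝ
  · obtain ⟨C, hC⟩ := exists_taylor_mean_remainder_bound (n := n) hL.le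
      (hc.of_le (by exact_mod_cast le_top))
    refine IsBigO.of_bound C ?_
    filter_upwards [Ioo_mem_nhdsGT hL] with s hs
    have h1 := hC s (Ioo_subset_Icc_self hs)
    rw [taylor_within_apply] at h1
    rw [Real.norm_of_nonneg (pow_nonneg hs.1.le _)]
    refine (le_of_eq ?_).trans (h1.trans (le_of_eq (by rw [sub_zero])))
    congr 2
    refine Finset.sum_congr rfl fun i _ => ?_
    have h2 := iteratedDerivWithin_eqOn (r := ⊤) (j := i)
      (D := fun i s => MvPolynomial.eval (X s) (jetDeriv^[i] p))
      hI (fun i _ s hs => hd i s hs) le_top h0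
    rw [show iteratedDerivWithin i (fun s => MvPolynomial.eval (X s) p) (Icc 0 L) 0 = _ from h2,
      sub_zero, smul_eq_mul]
    ring

/-- The Taylor expansion at a vertex of the `k`-th coefficient of the heat kernel, evaluated at a
point and its mirror image. -/
theorem isBigO_transportSum_mirror (hL : 0 < L)
    (hX : ∀ i, ∀ s ∈ Icc 0 L, HasDerivWithinAt (fun s => X s i) (X s (i + 1)) (Icc 0 L) s)
    {χ : ℝ → ℝ} (hχ : χ =ᶠ[𝓝 0] 1) (k : ℕ) {n D : ℕ} (hn : n ≤ D) :
    (fun s => χ (-s) * transportSum D (X s) k (-s - s)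
      - ∑ l ∈ Finset.range n, MvPolynomial.eval (X 0) (mirrorJet k l) * s ^ l)
      =O[𝓝[>] 0] fun s => s ^ n := by
  let E : ℕ → ℝ → ℝ := fun j s => MvPolynomial.eval (X s) (transportJet k j)
  let c : ℕ → ℝ := fun j => (-2) ^ j / (j.factorial : ℝ)
  let e : ℕ → ℕ → ℝ := fun j i =>
    MvPolynomial.eval (X 0) (jetDeriv^[i] (transportJet k j)) / (i.factorial : ℝ)
  have h1 : ∀ j < n, (fun s => c j * s ^ j * E j s
      - ∑ i ∈ Finset.range (n - j), c j * e j i * s ^ (j + i)) =O[𝓝[>] 0] fun s => s ^ n := by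
    intro j hj
    have h := (((isBigO_refl (fun s : ℝ => s ^ j) (𝓝[>] 0)).mul
      (isBigO_eval_jet_sub hL hX (transportJet k j) (n - j))).const_mul_left (c j))
    refine (h.congr_left fun s => ?_).congr_right fun s => ?_
    · rw [mul_sub, mul_sub, ← mul_assoc, Finset.mul_sum, Finset.mul_sum]
      congr 1
      refine Finset.sum_congr rfl fun i _ => ?_
      simp only [e, pow_add]; ring
    · rw [← pow_add, Nat.add_sub_cancel' hj.le]
  have h2 : ∀ j, n ≤ j → (fun s => c j * s ^ j * E j s) =O[𝓝[>] 0] fun s => s ^ n := by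
    intro j hj
    have h0 : E j =O[𝓝[>] 0] fun _ => (1 : ℝ) := by
      simpa using isBigO_eval_jet_sub hL hX (transportJet k j) 0
    have h3 : (fun s : ℝ => s ^ j) =O[𝓝[>] 0] fun s => s ^ n := by
      refine IsBigO.of_bound 1 ?_
      filter_upwards [Ioo_mem_nhdsGT one_pos] with s hs
      rw [Real.norm_of_nonneg (pow_nonneg hs.1.le _), Real.norm_of_nonneg (pow_nonneg hs.1.le _),
        one_mul]
      exact pow_le_pow_of_le_one hs.1.le hs.2.le hj
    have := ((h3.const_mul_left (c j)).mul h0)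
    simpa using this
  have hsplit : ∀ s, transportSum D (X s) k (-s - s) = ∑ j ∈ Finset.range n, c j * s ^ j * E j s
      + ∑ j ∈ Finset.Ico n D, c j * s ^ j * E j s := fun s => by
    rw [Finset.sum_range_add_sum_Ico _ hn, transportSum]
    refine Finset.sum_congr rfl fun j _ => ?_
    rw [show -s - s = -2 * s by ring, mul_pow]
    simp only [c, E]; ring
  have hsum := (IsBigO.fun_sum fun j hj => h1 j (Finset.mem_range.1 hj)).add
    (IsBigO.fun_sum fun j hj => h2 j (Finset.mem_Ico.1 hj).1 : (fun s => ∑ j ∈ Finset.Ico n D,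
      c j * s ^ j * E j s) =O[𝓝[>] 0] fun s => s ^ n)
  refine hsum.congr' ?_ EventuallyEq.rfl
  have hχ' : ∀ᶠ s in 𝓝[>] (0 : ℝ), χ (-s) = 1 := by
    have : Tendsto (fun s : ℝ => -s) (𝓝[>] 0) (𝓝 0) := by
      simpa using (continuous_neg.tendsto (0 : ℝ)).mono_left nhdsWithin_le_nhds
    exact this.eventually hχ
  filter_upwards [hχ'] with s hs
  rw [hs, one_mul, hsplit, Finset.sum_sub_distrib]
  have hflip : ∑ j ∈ Finset.range n, ∑ i ∈ Finset.range (n - j), c j * e j i * s ^ (j + i)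
      = ∑ l ∈ Finset.range n, MvPolynomial.eval (X 0) (mirrorJet k l) * s ^ l := by
    rw [← Finset.sum_range_diag_flip n fun j i => c j * e j i * s ^ (j + i)]
    refine Finset.sum_congr rfl fun l _ => ?_
    rw [mirrorJet, map_sum, Finset.sum_mul]
    refine Finset.sum_congr rfl fun j hj => ?_
    rw [Nat.add_sub_cancel' (Nat.lt_succ_iff.1 (Finset.mem_range.1 hj)), map_mul,
      MvPolynomial.eval_C]
    simp only [c, e]
    field_simp
  rw [hflip]
  ring

/-- The contribution to the heat trace of a wave that is reflected at a vertex, where `s` is the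
distance from the vertex. The moments of odd order would yield half-integer powers of `t`, but they
meet vanishing Taylor coefficients. -/
theorem isBigO_integral_mirror (hL : 0 < L)
    (hX : ∀ i, ∀ s ∈ Icc 0 L, HasDerivWithinAt (fun s => X s i) (X s (i + 1)) (Icc 0 L) s)
    (hodd : ∀ l, X 0 (2 * l + 1) = 0) {χ : ℝ → ℝ} (hχc : Continuous χ) (hχ : χ =ᶠ[𝓝 0] 1)
    {N K D : ℕ} (hNK : N ≤ K) (hD : 2 * N + 1 ≤ D) :
    (fun t => (∫ s in (0 : ℝ)..L, gaussKernel t (2 * s) *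
        ∑ k ∈ Finset.range (K + 1), t ^ k * (χ (-s) * transportSum D (X s) k (-s - s)))
      - 1 / 4 * ∑ n ∈ Finset.range (N + 1), MvPolynomial.eval (X 0) (vertexPolyInt n) * t ^ n)
      =O[𝓝[>] 0] fun t => t ^ N * √t := by
  let Φ : ℕ → ℝ → ℝ := fun k s => χ (-s) * transportSum D (X s) k (-s - s)
  let I : ℕ → ℝ → ℝ := fun k t => ∫ s in (0 : ℝ)..L, gaussKernel t (2 * s) * Φ k s
  let v : ℕ → ℕ → ℝ := fun k j => 1 / 4 * (((2 * j - 1).doubleFactorial : ℝ) / 2 ^ j *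
    MvPolynomial.eval (X 0) (mirrorJet k (2 * j)))
  have hΦ : ∀ k, ContinuousOn (Φ k) (Icc 0 L) := fun k => by
    refine (hχc.comp continuous_neg).continuousOn.mul ?_
    unfold transportSum
    refine continuousOn_finsetSum _ fun j _ => ContinuousOn.mul (ContinuousOn.div_const ?_ _)
      (by fun_prop)
    exact continuousOn_eval_jet (fun i s hs => (hX i s hs).continuousWithinAt) _
  have hI : ∀ k n, 2 * n + 1 ≤ D → (fun t => I k t - ∑ j ∈ Finset.range (n + 1), v k j * t ^ j)
      =O[𝓝[>] 0] fun t => √t ^ (2 * n + 1) := by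
    intro k n hn
    have h := isBigO_integral_gaussKernel hL (hΦ k) (isBigO_transportSum_mirror hL hX hχ k hn)
    refine h.congr' ?_ EventuallyEq.rfl
    filter_upwards [self_mem_nhdsWithin] with t ht
    congr 1
    have hodd' : ∀ l, Odd l → MvPolynomial.eval (X 0) (mirrorJet k l) = 0 := by
      rintro l ⟨j, rfl⟩
      exact eval_mirrorJet_odd hodd k j
    -- the terms of odd index vanish, those of index `2j` carry `√t ^ (2j) = t ^ j`
    have hpair : ∀ n, ∑ l ∈ Finset.range (2 * n + 1),
        MvPolynomial.eval (X 0) (mirrorJet k l) * (halfMoment l * √t ^ l)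
        = ∑ j ∈ Finset.range (n + 1), v k j * t ^ j := by
      intro n
      have hev : ∀ j, MvPolynomial.eval (X 0) (mirrorJet k (2 * j)) *
          (halfMoment (2 * j) * √t ^ (2 * j)) = v k j * t ^ j := fun j => by
        rw [halfMoment_two_mul, pow_mul, Real.sq_sqrt (le_of_lt ht)]
        simp only [v]; ring
      induction n with
      | zero => simpa using hev 0
      | succ n ih =>
        rw [Finset.sum_range_succ _ (n + 1), ← ih, show 2 * (n + 1) + 1 = 2 * n + 1 + 1 + 1 by ring,
          Finset.sum_range_succ, Finset.sum_range_succ, hodd' (2 * n + 1) ⟨n, rfl⟩, ← hev (n + 1)]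
        rw [show 2 * n + 1 + 1 = 2 * (n + 1) by ring]
        ring
    exact hpair n
  have hsq : ∀ t : ℝ, 0 ≤ t → ∀ n, √t ^ (2 * n + 1) = t ^ n * √t := fun t ht n => by
    rw [pow_succ, pow_mul, Real.sq_sqrt ht]
  have h1 : ∀ k < N + 1, (fun t => t ^ k * I k t
      - ∑ j ∈ Finset.range (N + 1 - k), v k j * t ^ (k + j)) =O[𝓝[>] 0] fun t => t ^ N * √t := by
    intro k hk
    have hk' := Nat.lt_succ_iff.1 hk
    have h := (isBigO_refl (fun t : ℝ => t ^ k) (𝓝[>] 0)).mul (hI k (N - k) (by omega))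
    refine h.congr' (Eventually.of_forall fun t => ?_) ?_
    · simp only
      rw [mul_sub, Finset.mul_sum, show N - k + 1 = N + 1 - k by omega]
      congr 1
      refine Finset.sum_congr rfl fun j _ => ?_
      rw [pow_add]; ring
    · filter_upwards [self_mem_nhdsWithin] with t ht
      rw [hsq t (le_of_lt ht), ← mul_assoc, ← pow_add, Nat.add_sub_cancel' hk']
  have h2 : ∀ k, N + 1 ≤ k → (fun t => t ^ k * I k t) =O[𝓝[>] 0] fun t => t ^ N * √t := by
    intro k hk
    have h0 : I k =O[𝓝[>] 0] fun _ => (1 : ℝ) := by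
      have h3 := hI k 0 (by omega)
      have h4 : (fun t => √t ^ (2 * 0 + 1)) =O[𝓝[>] 0] fun _ => (1 : ℝ) := by
        have : Tendsto (fun t => √t ^ (2 * 0 + 1)) (𝓝[>] 0) (𝓝 (√0 ^ (2 * 0 + 1))) :=
          ((Real.continuous_sqrt.pow _).tendsto 0).mono_left nhdsWithin_le_nhds
        exact this.isBigO_one ℝ
      have h5 := (h3.trans h4).add (isBigO_const_const (v k 0) one_ne_zero (𝓝[>] (0 : ℝ)))
      refine h5.congr_left fun t => ?_
      rw [zero_add, Finset.sum_range_one]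
      ring
    have h3 : (fun t : ℝ => t ^ k) =O[𝓝[>] 0] fun t => t ^ N * √t := by
      refine IsBigO.of_bound 1 ?_
      filter_upwards [Ioo_mem_nhdsGT one_pos] with t ht
      have ht0 := ht.1.le
      rw [Real.norm_of_nonneg (by positivity), Real.norm_of_nonneg (by positivity), one_mul]
      calc t ^ k ≤ t ^ (N + 1) := pow_le_pow_of_le_one ht0 ht.2.le hk
        _ = t ^ N * t := pow_succ _ _
        _ ≤ t ^ N * √t := by
          gcongr
          exact Real.le_sqrt_of_sq_le (by nlinarith [ht.2])
    simpa using h3.mul h0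
  have hsum := (IsBigO.fun_sum fun k hk => h1 k (Finset.mem_range.1 hk)).add
    (IsBigO.fun_sum fun k hk => h2 k (Finset.mem_Ico.1 hk).1 : (fun t => ∑ k ∈ Finset.Ico (N + 1) (K + 1),
      t ^ k * I k t) =O[𝓝[>] 0] fun t => t ^ N * √t)
  refine hsum.congr_left fun t => ?_
  have hint : ∫ s in (0 : ℝ)..L, gaussKernel t (2 * s) * ∑ k ∈ Finset.range (K + 1), t ^ k * Φ k s
      = ∑ k ∈ Finset.range (K + 1), t ^ k * I k t := by
    simp only [I, ← intervalIntegral.integral_const_mul]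
    rw [← intervalIntegral.integral_finsetSum fun k _ => ?_]
    · refine intervalIntegral.integral_congr fun s _ => ?_
      simp only [Finset.mul_sum]
      exact Finset.sum_congr rfl fun k _ => by ring
    · refine ContinuousOn.intervalIntegrable ?_
      rw [uIcc_of_le hL.le]
      exact continuousOn_const.mul (((continuous_gaussKernel t).comp
        (by fun_prop)).continuousOn.mul (hΦ k))
  have hflip : ∑ k ∈ Finset.range (N + 1), ∑ j ∈ Finset.range (N + 1 - k), v k j * t ^ (k + j)
      = 1 / 4 * ∑ n ∈ Finset.range (N + 1), MvPolynomial.eval (X 0) (vertexPolyInt n) * t ^ n := by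
    rw [← Finset.sum_range_diag_flip (N + 1) fun k j => v k j * t ^ (k + j), Finset.mul_sum]
    refine Finset.sum_congr rfl fun n _ => ?_
    rw [vertexPolyInt, map_sum, Finset.sum_mul, Finset.mul_sum,
      ← Finset.sum_range_reflect _ (n + 1)]
    refine Finset.sum_congr rfl fun k hk => ?_
    have hk' := Nat.lt_succ_iff.1 (Finset.mem_range.1 hk)
    rw [show n + 1 - 1 - k + (n - (n + 1 - 1 - k)) = n by omega,
      show n - (n + 1 - 1 - k) = k by omega, show n + 1 - 1 - k = n - k by omega, map_mul,
      MvPolynomial.eval_C]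
    simp only [v]
    ring
  show _ = (∫ s in (0 : ℝ)..L, gaussKernel t (2 * s) *
    ∑ k ∈ Finset.range (K + 1), t ^ k * Φ k s) - _
  rw [hint, ← hflip, ← Finset.sum_range_add_sum_Ico _ (show N + 1 ≤ K + 1 by omega),
    Finset.sum_sub_distrib]
  ring

end Mirror

/-! ### The expansions of the diagonal and of the trace of the heat kernel -/

section PowersOfTime

theorem rpow_add_half {t : ℝ} (ht : 0 < t) (N : ℕ) : t ^ ((N : ℝ) + 1 / 2) = t ^ N * √t := by
  rw [Real.rpow_add ht, Real.rpow_natCast, Real.sqrt_eq_rpow]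

theorem pow_le_pow_mul_sqrt {t : ℝ} (ht : 0 < t) (ht1 : t ≤ 1) (N : ℕ) :
    t ^ (N + 1) ≤ t ^ N * √t := by
  rw [pow_succ]
  gcongr
  exact Real.le_sqrt_of_sq_le (by nlinarith)

theorem isBigO_of_norm_le_pow {F : Type*} [NormedAddCommGroup F] {f : ℝ → F} {C : ℝ} (hC : 0 ≤ C)
    {N : ℕ} (h : ∀ t, 0 < t → t ≤ 1 → ‖f t‖ ≤ C * t ^ (N + 1)) :
    f =O[𝓝[>] 0] fun t => t ^ N * √t := by
  refine IsBigO.of_bound C ?_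
  filter_upwards [Ioo_mem_nhdsGT one_pos] with t ht
  have ht0 := ht.1
  rw [Real.norm_of_nonneg (by positivity)]
  exact (h t ht.1 ht.2.le).trans (mul_le_mul_of_nonneg_left
    (pow_le_pow_mul_sqrt ht.1 ht.2.le N) hC)

/-- The terms of index above `N` of a heat expansion are negligible. -/
theorem isBigO_heat_tail (c : ℕ → ℝ) {N K : ℕ} (hNK : N ≤ K) :
    (fun t => 1 / √(4 * π * t) * ∑ n ∈ Finset.range (K + 1), c n * t ^ n
      - 1 / √(4 * π * t) * ∑ n ∈ Finset.range (N + 1), c n * t ^ n)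
      =O[𝓝[>] 0] fun t => t ^ N * √t := by
  refine IsBigO.of_bound (∑ n ∈ Finset.Ico (N + 1) (K + 1), |c n|) ?_
  filter_upwards [Ioo_mem_nhdsGT one_pos] with t ht
  obtain ⟨ht0, ht1⟩ := ht
  rw [← mul_sub, ← Finset.sum_range_add_sum_Ico _ (show N + 1 ≤ K + 1 by omega),
    add_sub_cancel_left, Real.norm_of_nonneg (by positivity : 0 ≤ t ^ N * √t), norm_mul,
    Real.norm_of_nonneg (by positivity)]
  have h1 : ‖∑ n ∈ Finset.Ico (N + 1) (K + 1), c n * t ^ n‖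
      ≤ (∑ n ∈ Finset.Ico (N + 1) (K + 1), |c n|) * t ^ (N + 1) := by
    rw [Finset.sum_mul]
    refine (norm_sum_le _ _).trans (Finset.sum_le_sum fun n hn => ?_)
    rw [norm_mul, Real.norm_of_nonneg (by positivity : 0 ≤ t ^ n), Real.norm_eq_abs]
    gcongr _ * ?_
    exact pow_le_pow_of_le_one ht0.le ht1.le (Finset.mem_Ico.1 hn).1
  have h2 : 1 / √(4 * π * t) ≤ 1 / √t := by
    have : t ≤ 4 * π * t := by nlinarith [Real.pi_gt_three]
    gcongr
  calc 1 / √(4 * π * t) * ‖∑ n ∈ Finset.Ico (N + 1) (K + 1), c n * t ^ n‖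
      ≤ 1 / √t * ((∑ n ∈ Finset.Ico (N + 1) (K + 1), |c n|) * t ^ (N + 1)) := by gcongr
    _ = (∑ n ∈ Finset.Ico (N + 1) (K + 1), |c n|) * (t ^ N * √t) := by
      have h3 : √t ≠ 0 := (Real.sqrt_pos.2 ht0).ne'
      rw [pow_succ]
      nth_rewrite 3 [← Real.sq_sqrt ht0.le]
      field_simp

theorem IsBigO.ofReal {f g : ℝ → ℝ} {l : Filter ℝ} (h : f =O[l] g) :
    (fun t => (f t : ℂ)) =O[l] g :=
  IsBigO.of_norm_left (by simpa only [Complex.norm_real] using h.norm_left)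

end PowersOfTime

namespace MetricGraph

variable {V E : Type*} {Γ : MetricGraph V E} {U : E → ℝ → ℝ}

/-- The heat coefficients `a_n(x)` on the edges. -/
noncomputable def edgeCoeff (Γ : MetricGraph V E) (U : E → ℝ → ℝ) (n : ℕ) (e : E) (x : ℝ) : ℝ :=
  MvPolynomial.eval (fun j => Γ.edgeDeriv U j e x) (interiorPoly n)

open Classical in
/-- The heat coefficients `a_{m/2}^b(v)` at the vertices, computed at an arbitrary edge end at the
vertex. They are set to `0` at isolated vertices, which do not contribute to the trace. -/
noncomputable def vertexCoeff (Γ : MetricGraph V E) (U : E → ℝ → ℝ) (m : ℕ) (v : V) : ℝ :=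
  if h : ∃ h, Γ.vert h = v then
    MvPolynomial.eval (fun j => Γ.endDeriv U j h.choose) (vertexPoly m) else 0

theorem IsSmoothPotential.endDeriv_congr (hU : Γ.IsSmoothPotential U) {h h' : E × Bool}
    (hv : Γ.vert h = Γ.vert h') (j : ℕ) : Γ.endDeriv U j h = Γ.endDeriv U j h' := by
  rcases Nat.even_or_odd' j with ⟨l, rfl | rfl⟩
  · exact hU.even_eq l h h' hv
  · rw [hU.odd_eq_zero, hU.odd_eq_zero]

theorem vertexCoeff_vert (hU : Γ.IsSmoothPotential U) (m : ℕ) (h : E × Bool) :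
    Γ.vertexCoeff U m (Γ.vert h)
      = MvPolynomial.eval (fun j => Γ.endDeriv U j h) (vertexPoly m) := by
  have hex : ∃ h', Γ.vert h' = Γ.vert h := ⟨h, rfl⟩
  rw [vertexCoeff, dif_pos hex]
  congr 2
  funext j
  exact hU.endDeriv_congr hex.choose_spec j

theorem vertexCoeff_odd {m : ℕ} (hm : Odd m) (v : V) : Γ.vertexCoeff U m v = 0 := by
  simp [vertexCoeff, vertexPoly_odd hm]

theorem alongJet_zero (h : E × Bool) (j : ℕ) : Γ.alongJet U h 0 j = Γ.endDeriv U j h := by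
  rw [alongJet, pos_zero, endDeriv_eq, smul_eq_mul]

theorem continuousOn_edgeCoeff (hU : Γ.IsSmoothPotential U) (n : ℕ) (e : E) :
    ContinuousOn (Γ.edgeCoeff U n e) (Icc 0 (Γ.len e)) :=
  continuousOn_eval_jet (fun i => hU.continuousOn i e) _

theorem directWave_self (K : ℕ) (e : E) (t x : ℝ) : Γ.directWave U K e t x x
    = ((1 / √(4 * π * t) * ∑ n ∈ Finset.range (K + 1), Γ.edgeCoeff U n e x * t ^ n : ℝ) : ℂ) := by
  rw [directWave, heatSum, sub_self]
  have h0 : gaussKernel t 0 = 1 / √(4 * π * t) := by simp [gaussKernel]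
  rw [h0]
  push_cast
  congr 1
  refine Finset.sum_congr rfl fun n hn => ?_
  rw [directAmp, amplitude, if_pos (Nat.lt_succ_iff.1 (Finset.mem_range.1 hn)), sub_self,
    transportSum_zero (by omega), one_mul, edgeCoeff, mul_comm]

variable [Fintype E] [DecidableEq V] {A B : ∀ v, Matrix (Γ.Star v) (Γ.Star v) ℂ}
  {k : ℝ → E → ℝ → E → ℝ → ℂ}

section

variable [DecidableEq E]

/-- By uniqueness every heat kernel is close to the parametrix. -/
theorem IsHeatKernel.exists_norm_sub_le (hU : Γ.IsSmoothPotential U)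
    (hAB : ∀ v, IsNonRobin (A v) (B v)) (hk : Γ.IsHeatKernel U A B k) {M : ℕ} (hM : 1 ≤ M) :
    ∃ C, 0 ≤ C ∧ ∀ t, 0 < t → t ≤ 1 → ∀ e, ∀ x ∈ Icc 0 (Γ.len e),
      ∀ f, ∀ y ∈ Icc 0 (Γ.len f),
        ‖k t e x f y - Γ.graphWave (Γ.scatter A B) U (M + 3) e t x f y‖ ≤ C * t ^ M := by
  obtain ⟨k₀, hk₀, C, hC0, hC⟩ := exists_heatKernel hU hAB hM
  refine ⟨C, hC0, fun t ht ht1 e x hx f y hy => ?_⟩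
  rw [hk.unique hAB hk₀ ht hx hy]
  exact hC t ht ht1 e x hx f y hy

theorem IsHeatKernel.hasDiagonalExpansion (hU : Γ.IsSmoothPotential U)
    (hAB : ∀ v, IsNonRobin (A v) (B v)) (hk : Γ.IsHeatKernel U A B k) :
    Γ.HasDiagonalExpansion k (Γ.edgeCoeff U) := by
  intro e x hx N
  obtain ⟨C, hC0, hC⟩ := hk.exists_norm_sub_le hU hAB (Nat.le_add_left 1 N)
  obtain ⟨C', hC'0, hC'⟩ := exists_norm_graphWave_sub_le (S := Γ.scatter A B) hU (N + 1 + 3) e hx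
    (N + 1)
  have hxI := Ioo_subset_Icc_self hx
  have h1 : (fun t => k t e x e x - Γ.graphWave (Γ.scatter A B) U (N + 1 + 3) e t x e x)
      =O[𝓝[>] 0] fun t : ℝ => t ^ N * √t :=
    isBigO_of_norm_le_pow hC0 fun t ht ht1 => hC t ht ht1 e x hxI e x hxI
  have h2 : (fun t => Γ.graphWave (Γ.scatter A B) U (N + 1 + 3) e t x e x
      - Γ.directWave U (N + 1 + 3) e t x x) =O[𝓝[>] 0] fun t : ℝ => t ^ N * √t :=
    isBigO_of_norm_le_pow hC'0 fun t ht ht1 => by simpa using hC' t ht ht1 e x hxI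
  have h3 := IsBigO.ofReal (isBigO_heat_tail (fun n => Γ.edgeCoeff U n e x)
    (show N ≤ N + 1 + 3 by omega))
  refine ((h1.add h2).add h3).congr' (Eventually.of_forall fun t => ?_) ?_
  · simp only [directWave_self, Complex.ofReal_sub]
    ring
  · filter_upwards [self_mem_nhdsWithin] with t ht using (rpow_add_half ht N).symm

end

section Waves

omit [Fintype E] in
theorem continuousOn_passWave_self (hU : Γ.IsSmoothPotential U) (K : ℕ) (e : E) (b b' : Bool) {t : ℝ} (ht : 0 < t) :
    ContinuousOn (fun x => Γ.passWave U K e b (e, b') t x (-(Γ.pos (e, b') x)))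
      (Icc 0 (Γ.len e)) := by
  have h := (smoothFam_passWave hU K e b (e, b')).2 0 zero_le
  simp only [iteratedDerivWithin_zero] at h
  exact h.comp (f := fun x : ℝ => ((t, x), -(Γ.pos (e, b') x)))
    ((continuous_const.prodMk continuous_id).prodMk (Γ.continuous_pos (e, b')).neg).continuousOn
    fun x hx => ⟨⟨ht, hx⟩, neg_pos_mem_passSeg e (e, b') hx⟩

omit [Fintype E] in
/-- Between the two ends of an edge a wave covers the whole length of the edge. -/
theorem isBigO_integral_passWave_of_ne (hU : Γ.IsSmoothPotential U) (K N : ℕ) (e : E)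
    {b b' : Bool} (hb : b' ≠ b) :
    (fun t => ∫ x in (0 : ℝ)..Γ.len e, Γ.passWave U K e b (e, b') t x (-(Γ.pos (e, b') x)))
      =O[𝓝[>] 0] fun t => t ^ N * √t := by
  obtain ⟨C, hC0, hC⟩ := exists_norm_passWave_le hU K e b (e, b') (Γ.len_pos e) (N + 1)
  have hL := Γ.len_pos e
  refine isBigO_of_norm_le_pow (C := C * Γ.len e) (by positivity) fun t ht ht1 => ?_
  refine (intervalIntegral.norm_integral_le_of_norm_le_const (C := C * t ^ (N + 1))
    fun x hx => ?_).trans (le_of_eq ?_)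
  · rw [uIoc_of_le hL.le] at hx
    have hx' := Ioc_subset_Icc_self hx
    refine hC t ht ht1 x hx' _ (neg_pos_mem_passSeg e (e, b') hx') ?_
    have : -(Γ.pos (e, b') x) - Γ.pos (e, b) x = -Γ.len e := by
      rcases b <;> rcases b' <;> simp only [pos, if_true, Bool.false_eq_true, if_false] <;>
        first | exact absurd rfl hb | ring
    rw [this, abs_neg, abs_of_pos hL]
  · rw [sub_zero, abs_of_pos hL]; ring

omit [Fintype E] in
theorem integral_passWave_self (K : ℕ) (e : E) (b : Bool) (t : ℝ) :
    ∫ x in (0 : ℝ)..Γ.len e, Γ.passWave U K e b (e, b) t x (-(Γ.pos (e, b) x))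
      = ((∫ s in (0 : ℝ)..Γ.len e, gaussKernel t (2 * s) * ∑ n ∈ Finset.range (K + 1),
          t ^ n * (Γ.passCutoff (e, b) (-s) *
            transportSum (2 * K + 6) (Γ.alongJet U (e, b) s) n (-s - s)) : ℝ) : ℂ) := by
  rw [← intervalIntegral.integral_ofReal]
  set F : ℝ → ℂ := fun s => ((gaussKernel t (2 * s) * ∑ n ∈ Finset.range (K + 1),
    t ^ n * (Γ.passCutoff (e, b) (-s) *
      transportSum (2 * K + 6) (Γ.alongJet U (e, b) s) n (-s - s)) : ℝ) : ℂ) with hF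
  have h1 : ∀ x, Γ.passWave U K e b (e, b) t x (-(Γ.pos (e, b) x)) = F (Γ.pos (e, b) x) := by
    intro x
    rw [passWave, if_pos rfl, heatSum, hF]
    simp only
    rw [show ∀ s : ℝ, -s - s = -(2 * s) from fun s => by ring, gaussKernel_neg]
    push_cast
    congr 1
    refine Finset.sum_congr rfl fun n hn => ?_
    rw [passAmp, amplitude, if_pos (Nat.lt_succ_iff.1 (Finset.mem_range.1 hn)),
      show ∀ s : ℝ, -s - s = -(2 * s) from fun s => by ring]
    push_cast
    rfl
  simp only [h1]
  cases b
  · rfl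
  · show ∫ x in (0 : ℝ)..Γ.len e, F (Γ.len e - x) = _
    rw [intervalIntegral.integral_comp_sub_left F, sub_self, sub_zero]

omit [Fintype E] in
/-- A wave that returns to its edge at the same end yields the contribution of the vertex. -/
theorem isBigO_integral_passWave_self (hU : Γ.IsSmoothPotential U) {K N : ℕ} (hNK : N ≤ K) (e : E)
    (b : Bool) :
    (fun t : ℝ => (∫ x in (0 : ℝ)..Γ.len e, Γ.passWave U K e b (e, b) t x (-(Γ.pos (e, b) x)))
      - ((1 / 4 * ∑ n ∈ Finset.range (N + 1),
        Γ.vertexCoeff U (2 * n) (Γ.vert (e, b)) * t ^ n : ℝ) : ℂ))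
      =O[𝓝[>] 0] fun t => t ^ N * √t := by
  have h := IsBigO.ofReal (isBigO_integral_mirror (Γ.len_pos e)
    (X := Γ.alongJet U (e, b)) (χ := Γ.passCutoff (e, b)) (N := N) (K := K) (D := 2 * K + 6)
    (fun i s hs => alongJet_hasDerivWithinAt hU (e, b) i hs)
    (fun l => by rw [alongJet_zero, hU.odd_eq_zero])
    (Γ.contDiff_passCutoff (e, b)).continuous (passCutoff_eventuallyEq le_rfl) hNK (by omega))
  refine h.congr_left fun t => ?_
  rw [integral_passWave_self, Complex.ofReal_sub]
  congr 3
  refine Finset.sum_congr rfl fun n _ => ?_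
  rw [vertexCoeff_vert hU, vertexPoly_two_mul]
  congr 3
  funext j
  exact alongJet_zero _ _

omit [Fintype E] [DecidableEq V] in
theorem isBigO_integral_directWave (hU : Γ.IsSmoothPotential U) {K N : ℕ} (hNK : N ≤ K) (e : E) :
    (fun t : ℝ => (∫ x in (0 : ℝ)..Γ.len e, Γ.directWave U K e t x x)
      - ((1 / √(4 * π * t) * ∑ n ∈ Finset.range (N + 1),
        (∫ x in (0 : ℝ)..Γ.len e, Γ.edgeCoeff U n e x) * t ^ n : ℝ) : ℂ))
      =O[𝓝[>] 0] fun t => t ^ N * √t := by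
  have h := IsBigO.ofReal (isBigO_heat_tail
    (fun n => ∫ x in (0 : ℝ)..Γ.len e, Γ.edgeCoeff U n e x) hNK)
  refine h.congr_left fun t => ?_
  rw [Complex.ofReal_sub]
  congr 1
  simp only [directWave_self]
  rw [intervalIntegral.integral_ofReal, intervalIntegral.integral_const_mul,
    intervalIntegral.integral_finsetSum fun n _ => ?_]
  · simp only [intervalIntegral.integral_mul_const]
  · refine ContinuousOn.intervalIntegrable ?_
    rw [uIcc_of_le (Γ.len_pos e).le]
    exact (continuousOn_edgeCoeff hU n e).mul continuousOn_const

variable [DecidableEq E] {S : E × Bool → E × Bool → ℂ}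

omit [Fintype E] in
theorem integral_graphWave_self (hU : Γ.IsSmoothPotential U) (K : ℕ) (e : E) {t : ℝ}
    (ht : 0 < t) :
    ∫ x in (0 : ℝ)..Γ.len e, Γ.graphWave S U K e t x e x
      = (∫ x in (0 : ℝ)..Γ.len e, Γ.directWave U K e t x x)
        + ∑ b', ∑ b, S (e, b') (e, b) *
          ∫ x in (0 : ℝ)..Γ.len e, Γ.passWave U K e b (e, b') t x (-(Γ.pos (e, b') x)) := by
  have hL := (Γ.len_pos e).le
  have hp : ∀ b' b, IntervalIntegrable (fun x => S (e, b') (e, b) *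
      Γ.passWave U K e b (e, b') t x (-(Γ.pos (e, b') x))) MeasureTheory.volume 0 (Γ.len e) := by
    intro b' b
    refine ContinuousOn.intervalIntegrable ?_
    rw [uIcc_of_le hL]
    exact continuousOn_const.mul (continuousOn_passWave_self hU K e b b' ht)
  have hd : IntervalIntegrable (fun x => Γ.directWave U K e t x x) MeasureTheory.volume 0
      (Γ.len e) := by
    refine ContinuousOn.intervalIntegrable ?_
    rw [uIcc_of_le hL]
    simp only [directWave_self]
    refine Complex.continuous_ofReal.comp_continuousOn (continuousOn_const.mul ?_)
    exact continuousOn_finsetSum _ fun n _ =>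
      (continuousOn_edgeCoeff hU n e).mul continuousOn_const
  have hp' : ∀ b', IntervalIntegrable (fun x => ∑ b, S (e, b') (e, b) *
      Γ.passWave U K e b (e, b') t x (-(Γ.pos (e, b') x))) MeasureTheory.volume 0 (Γ.len e) :=
    fun b' => by
      have := IntervalIntegrable.sum Finset.univ fun b _ => hp b' b
      rwa [Finset.sum_fn] at this
  have hp'' : IntervalIntegrable (fun x => ∑ b', ∑ b, S (e, b') (e, b) *
      Γ.passWave U K e b (e, b') t x (-(Γ.pos (e, b') x))) MeasureTheory.volume 0 (Γ.len e) := by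
    have := IntervalIntegrable.sum Finset.univ fun b' _ => hp' b'
    rwa [Finset.sum_fn] at this
  simp only [graphWave, fold, if_true]
  rw [intervalIntegral.integral_add hd hp'',
    intervalIntegral.integral_finsetSum fun b' _ => hp' b']
  congr 1
  refine Finset.sum_congr rfl fun b' _ => ?_
  rw [intervalIntegral.integral_finsetSum fun b _ => hp b' b]
  simp only [intervalIntegral.integral_const_mul]

omit [Fintype E] in
/-- The contribution of one edge to the heat trace. -/
theorem isBigO_integral_graphWave_self (hU : Γ.IsSmoothPotential U) {K N : ℕ} (hNK : N ≤ K)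
    (e : E) :
    (fun t : ℝ => (∫ x in (0 : ℝ)..Γ.len e, Γ.graphWave S U K e t x e x)
      - ((1 / √(4 * π * t) * ∑ n ∈ Finset.range (N + 1),
        (∫ x in (0 : ℝ)..Γ.len e, Γ.edgeCoeff U n e x) * t ^ n : ℝ) : ℂ)
      - ∑ b, S (e, b) (e, b) * ((1 / 4 * ∑ n ∈ Finset.range (N + 1),
        Γ.vertexCoeff U (2 * n) (Γ.vert (e, b)) * t ^ n : ℝ) : ℂ))
      =O[𝓝[>] 0] fun t => t ^ N * √t := by
  let v : Bool → ℝ → ℂ := fun b t => ((1 / 4 * ∑ n ∈ Finset.range (N + 1),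
    Γ.vertexCoeff U (2 * n) (Γ.vert (e, b)) * t ^ n : ℝ) : ℂ)
  have h1 : ∀ b' b, (fun t : ℝ => S (e, b') (e, b) *
      ((∫ x in (0 : ℝ)..Γ.len e, Γ.passWave U K e b (e, b') t x (-(Γ.pos (e, b') x)))
        - if b' = b then v b t else 0)) =O[𝓝[>] 0] fun t => t ^ N * √t := by
    intro b' b
    refine IsBigO.const_mul_left ?_ _
    by_cases hb : b' = b
    · subst hb
      simpa only [if_true] using isBigO_integral_passWave_self hU hNK e b'
    · simpa only [if_neg hb, sub_zero] using isBigO_integral_passWave_of_ne hU K N e hb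
  have h2 := (isBigO_integral_directWave hU hNK e).add
    (IsBigO.fun_sum fun b' (_ : b' ∈ Finset.univ) =>
      IsBigO.fun_sum fun b (_ : b ∈ Finset.univ) => h1 b' b)
  refine h2.congr' ?_ EventuallyEq.rfl
  filter_upwards [self_mem_nhdsWithin] with t ht
  rw [integral_graphWave_self hU K e ht]
  simp only [mul_sub, Finset.sum_sub_distrib, mul_ite, mul_zero, Finset.sum_ite_eq,
    Finset.mem_univ, if_true]
  simp only [v]
  ring

end Waves

section

variable [Fintype V] [DecidableEq E]

theorem IsHeatKernel.hasTraceExpansion (hU : Γ.IsSmoothPotential U)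
    (hAB : ∀ v, IsNonRobin (A v) (B v)) (hk : Γ.IsHeatKernel U A B k) :
    Γ.HasTraceExpansion A B k (Γ.edgeCoeff U) (Γ.vertexCoeff U) := by
  intro N
  obtain ⟨C, hC0, hC⟩ := hk.exists_norm_sub_le hU hAB (Nat.le_add_left 1 N)
  set S := Γ.scatter A B with hS
  have h1 : ∀ e, (fun t => (∫ x in (0 : ℝ)..Γ.len e, k t e x e x)
      - ∫ x in (0 : ℝ)..Γ.len e, Γ.graphWave S U (N + 1 + 3) e t x e x)
      =O[𝓝[>] 0] fun t : ℝ => t ^ N * √t := by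
    intro e
    have hL := Γ.len_pos e
    refine isBigO_of_norm_le_pow (C := C * Γ.len e) (by positivity) fun t ht ht1 => ?_
    have hki : IntervalIntegrable (fun x => k t e x e x) MeasureTheory.volume 0 (Γ.len e) := by
      refine ContinuousOn.intervalIntegrable ?_
      rw [uIcc_of_le hL.le]
      exact (hk.continuousOn e e).comp (f := fun x : ℝ => (t, x, x))
        (by fun_prop) fun x hx => ⟨ht, hx, hx⟩
    have hgi : IntervalIntegrable (fun x => Γ.graphWave S U (N + 1 + 3) e t x e x)
        MeasureTheory.volume 0 (Γ.len e) := by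
      refine ContinuousOn.intervalIntegrable ?_
      rw [uIcc_of_le hL.le]
      have h := (smoothFam_graphWave (S := S) hU (N + 1 + 3) e e).2 0 zero_le
      simp only [iteratedDerivWithin_zero] at h
      exact h.comp (f := fun x : ℝ => ((t, x), x)) (by fun_prop) fun x hx => ⟨⟨ht, hx⟩, hx⟩
    rw [← intervalIntegral.integral_sub hki hgi]
    refine (intervalIntegral.norm_integral_le_of_norm_le_const (C := C * t ^ (N + 1))
      fun x hx => ?_).trans (le_of_eq ?_)
    · rw [uIoc_of_le hL.le] at hx
      have hx' := Ioc_subset_Icc_self hx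
      exact hC t ht ht1 e x hx' e x hx'
    · rw [sub_zero, abs_of_pos hL]; ring
  have h2 := IsBigO.fun_sum fun e (_ : e ∈ Finset.univ) => (h1 e).add
    (isBigO_integral_graphWave_self (S := S) hU (show N ≤ N + 1 + 3 by omega) e)
  refine h2.congr' ?_ ?_
  · filter_upwards [self_mem_nhdsWithin] with t ht
    have ht0 : 0 < t := ht
    -- only the vertex coefficients of integer index do not vanish
    have heven : ∀ v, ∑ m ∈ Finset.range (2 * N + 1), Γ.vertexCoeff U m v * t ^ ((m : ℝ) / 2)
        = ∑ n ∈ Finset.range (N + 1), Γ.vertexCoeff U (2 * n) v * t ^ n := by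
      intro v
      have hev : ∀ n : ℕ, t ^ (((2 * n : ℕ) : ℝ) / 2) = t ^ n := fun n => by
        rw [← Real.rpow_natCast]; congr 1; push_cast; ring
      generalize N = N
      induction N with
      | zero => simp
      | succ N ih =>
        rw [Finset.sum_range_succ _ (N + 1), ← ih, show 2 * (N + 1) + 1 = 2 * N + 1 + 1 + 1 by ring,
          Finset.sum_range_succ, Finset.sum_range_succ, vertexCoeff_odd ⟨N, rfl⟩, ← hev (N + 1),
          show 2 * N + 1 + 1 = 2 * (N + 1) by ring]
        ring
    -- the ends of all edges, sorted by their vertices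
    have hreg : ∑ e, ∑ b, S (e, b) (e, b) * ((1 / 4 * ∑ n ∈ Finset.range (N + 1),
        Γ.vertexCoeff U (2 * n) (Γ.vert (e, b)) * t ^ n : ℝ) : ℂ)
        = 1 / 4 * ∑ v, ∑ α : Γ.Star v, vertexSigma (A v) (B v) α α *
          ((∑ m ∈ Finset.range (2 * N + 1), Γ.vertexCoeff U m v * t ^ ((m : ℝ) / 2) : ℝ) : ℂ) := by
      rw [← Fintype.sum_prod_type' (f := fun e b => S (e, b) (e, b) *
        ((1 / 4 * ∑ n ∈ Finset.range (N + 1),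
        Γ.vertexCoeff U (2 * n) (Γ.vert (e, b)) * t ^ n : ℝ) : ℂ)),
        ← Fintype.sum_fiberwise Γ.vert, Finset.mul_sum]
      refine Finset.sum_congr rfl fun v _ => ?_
      rw [Finset.mul_sum]
      refine Finset.sum_congr rfl fun α _ => ?_
      rw [heven, ← scatter_apply Γ A B v α α]
      have hα : Γ.vert (α.1.1, α.1.2) = v := α.2
      rw [hα]
      push_cast
      ring
    have hdir : ∑ e, ((1 / √(4 * π * t) * ∑ n ∈ Finset.range (N + 1),
        (∫ x in (0 : ℝ)..Γ.len e, Γ.edgeCoeff U n e x) * t ^ n : ℝ) : ℂ)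
        = ((1 / √(4 * π * t) * ∑ n ∈ Finset.range (N + 1),
          (∑ e, ∫ x in (0 : ℝ)..Γ.len e, Γ.edgeCoeff U n e x) * t ^ n : ℝ) : ℂ) := by
      rw [← Complex.ofReal_sum, ← Finset.mul_sum, Finset.sum_comm]
      simp only [Finset.sum_mul]
    rw [← hreg, ← hdir, heatTrace, ← Finset.sum_sub_distrib, ← Finset.sum_sub_distrib]
    exact Finset.sum_congr rfl fun e _ => by ring
  · filter_upwards [self_mem_nhdsWithin] with t ht using (rpow_add_half ht N).symm

end

end MetricGraph

/-! ### Uniqueness of the coefficients -/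

/-- The coefficients of an asymptotic expansion in powers are unique. -/
theorem eq_zero_of_isBigO_sum_pow {d : ℕ → ℝ} {p : ℕ}
    (h : (fun u : ℝ => ∑ m ∈ Finset.range p, d m * u ^ m) =O[𝓝[>] 0] fun u => u ^ p) {m : ℕ}
    (hm : m < p) : d m = 0 := by
  induction m using Nat.strong_induction_on with
  | _ m ih =>
    have hpow : ∀ i, m + 1 ≤ i → (fun u : ℝ => u ^ i) =O[𝓝[>] 0] fun u => u ^ (m + 1) := by
      intro i hi
      refine IsBigO.of_bound 1 ?_
      filter_upwards [Ioo_mem_nhdsGT one_pos] with u hu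
      rw [Real.norm_of_nonneg (pow_nonneg hu.1.le _), Real.norm_of_nonneg (pow_nonneg hu.1.le _),
        one_mul]
      exact pow_le_pow_of_le_one hu.1.le hu.2.le hi
    have h1 : (fun u : ℝ => d m * u ^ m) =O[𝓝[>] 0] fun u => u ^ (m + 1) := by
      refine ((h.trans (hpow p hm)).sub (IsBigO.fun_sum fun i (hi : i ∈ Finset.Ico (m + 1) p) =>
        (hpow i (Finset.mem_Ico.1 hi).1).const_mul_left (d i))).congr_left fun u => ?_
      rw [← Finset.sum_range_add_sum_Ico _ (show m + 1 ≤ p from hm), add_sub_cancel_right,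
        Finset.sum_range_succ, Finset.sum_eq_zero fun i hi => ?_, zero_add]
      have hi' := Finset.mem_range.1 hi
      rw [ih i hi' (hi'.trans hm), zero_mul]
    have h2 : (fun _ : ℝ => d m) =O[𝓝[>] 0] fun u : ℝ => u := by
      obtain ⟨C, hC⟩ := h1.bound
      refine IsBigO.of_bound C ?_
      filter_upwards [hC, self_mem_nhdsWithin] with u hu hu0
      have hu0' : 0 < u := hu0
      rw [norm_mul, norm_pow, norm_pow, pow_succ', ← mul_assoc] at hu
      exact le_of_mul_le_mul_right hu (pow_pos (norm_pos_iff.2 hu0'.ne') m)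
    have h3 : Tendsto (fun _ : ℝ => d m) (𝓝[>] 0) (𝓝 0) :=
      h2.trans_tendsto (tendsto_id.mono_left nhdsWithin_le_nhds)
    exact tendsto_nhds_unique tendsto_const_nhds h3

namespace MetricGraph

variable {V E : Type*} {Γ : MetricGraph V E} {U : E → ℝ → ℝ} {k : ℝ → E → ℝ → E → ℝ → ℂ}

theorem HasDiagonalExpansion.unique {a a' : ℕ → E → ℝ → ℝ} (h : Γ.HasDiagonalExpansion k a)
    (h' : Γ.HasDiagonalExpansion k a') {e : E} {x : ℝ} (hx : x ∈ Ioo 0 (Γ.len e)) (n : ℕ) :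
    a n e x = a' n e x := by
  have h1 : (fun t : ℝ => 1 / √(4 * π * t) * ∑ m ∈ Finset.range (n + 1),
      (a m e x - a' m e x) * t ^ m) =O[𝓝[>] 0] fun t : ℝ => t ^ ((n : ℝ) + 1 / 2) := by
    rw [← Complex.isBigO_ofReal_left]
    refine ((h' e x hx n).sub (h e x hx n)).congr_left fun t => ?_
    rw [sub_sub_sub_cancel_left, ← Complex.ofReal_sub, ← mul_sub, ← Finset.sum_sub_distrib]
    simp only [sub_mul]
  have h2 : (fun t : ℝ => √(4 * π * t)) =O[𝓝[>] 0] fun t : ℝ => √t := by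
    refine IsBigO.of_bound √(4 * π) (Eventually.of_forall fun t => ?_)
    rw [Real.sqrt_mul (by positivity), norm_mul, Real.norm_of_nonneg (Real.sqrt_nonneg _)]
  refine sub_eq_zero.1 (eq_zero_of_isBigO_sum_pow (d := fun m => a m e x - a' m e x) (p := n + 1)
    ((h2.mul h1).congr' ?_ ?_) n.lt_succ_self)
  · filter_upwards [self_mem_nhdsWithin] with t ht
    have ht0 : 0 < t := ht
    have : √(4 * π * t) ≠ 0 := (Real.sqrt_pos.2 (by positivity)).ne'
    rw [← mul_assoc, mul_one_div_cancel this, one_mul]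
  · filter_upwards [self_mem_nhdsWithin] with t ht
    have ht0 : 0 < t := ht
    rw [rpow_add_half ht0, mul_left_comm, Real.mul_self_sqrt ht0.le, pow_succ]

variable [Fintype V] [Fintype E] [DecidableEq V] [DecidableEq E]

theorem isHeatCoefficients_edgeCoeff (hU : Γ.IsSmoothPotential U) :
    Γ.IsHeatCoefficients U (Γ.edgeCoeff U) (Γ.vertexCoeff U) :=
  ⟨fun n e => continuousOn_edgeCoeff hU n e, fun _ _ hAB _ hk =>
    ⟨hk.hasDiagonalExpansion hU hAB, hk.hasTraceExpansion hU hAB⟩⟩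

section

variable {a a' : ℕ → E → ℝ → ℝ} {b b' : ℕ → V → ℝ}

/-- If the interior coefficients agree, two trace expansions of the same kernel differ only in the
contributions of the vertices. -/
theorem HasTraceExpansion.sub_isBigO {A B : ∀ v, Matrix (Γ.Star v) (Γ.Star v) ℂ}
    (h : Γ.HasTraceExpansion A B k a b) (h' : Γ.HasTraceExpansion A B k a' b')
    (ha : ∀ n e, ∀ x ∈ Γ.seg e, a n e x = a' n e x) (N : ℕ) :
    (fun t : ℝ => ∑ v, (∑ α : Γ.Star v, vertexSigma (A v) (B v) α α) *
      ((∑ m ∈ Finset.range (2 * N + 1), (b m v - b' m v) * t ^ ((m : ℝ) / 2) : ℝ) : ℂ))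
      =O[𝓝[>] 0] fun t : ℝ => t ^ ((N : ℝ) + 1 / 2) := by
  have hint : ∀ n e, ∫ x in (0 : ℝ)..Γ.len e, a n e x = ∫ x in (0 : ℝ)..Γ.len e, a' n e x :=
    fun n e => intervalIntegral.integral_congr fun x hx => by
      rw [uIcc_of_le (Γ.len_pos e).le] at hx
      exact ha n e x hx
  refine (((h' N).sub (h N)).const_mul_left 4).congr_left fun t => ?_
  simp only [hint, sub_mul, Finset.sum_sub_distrib, Complex.ofReal_sub, mul_sub, Finset.sum_mul]
  ring

/-- The kernels for Neumann conditions at all vertices, and for these with Dirichlet conditions at a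
single vertex, determine the coefficients at this vertex. -/
theorem IsHeatCoefficients.vertex_unique (hU : Γ.IsSmoothPotential U)
    (h : Γ.IsHeatCoefficients U a b) (h' : Γ.IsHeatCoefficients U a' b')
    (ha : ∀ n e, ∀ x ∈ Γ.seg e, a n e x = a' n e x) (n : ℕ) (η : E × Bool) :
    b n (Γ.vert η) = b' n (Γ.vert η) := by
  set v := Γ.vert η with hv
  let T : V → ℝ → ℂ := fun w t =>
    ((∑ m ∈ Finset.range (2 * n + 1), (b m w - b' m w) * t ^ ((m : ℝ) / 2) : ℝ) : ℂ)
  let A₁ : ∀ w, Matrix (Γ.Star w) (Γ.Star w) ℂ := fun w => if w = v then 1 else 0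
  let B₁ : ∀ w, Matrix (Γ.Star w) (Γ.Star w) ℂ := fun w => if w = v then 0 else 1
  have hN : ∀ w : V, IsNonRobin (0 : Matrix (Γ.Star w) (Γ.Star w) ℂ) 1 :=
    fun w => isNonRobin_neumann.1
  have hD : ∀ w, IsNonRobin (A₁ w) (B₁ w) := fun w => by
    simp only [A₁, B₁]
    split_ifs
    · exact isNonRobin_dirichlet.1
    · exact isNonRobin_neumann.1
  have hσN : ∀ w, ∑ α : Γ.Star w, vertexSigma (0 : Matrix (Γ.Star w) (Γ.Star w) ℂ) 1 α α
      = Fintype.card (Γ.Star w) := fun w => by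
    simp [isNonRobin_neumann.2]
  have hσD : ∀ w, ∑ α : Γ.Star w, vertexSigma (A₁ w) (B₁ w) α α
      = (if w = v then -1 else 1) * Fintype.card (Γ.Star w) := fun w => by
    simp only [A₁, B₁]
    split_ifs
    · simp [isNonRobin_dirichlet.2]
    · simp [isNonRobin_neumann.2]
  obtain ⟨k, hk, -⟩ := exists_heatKernel hU hN le_rfl
  obtain ⟨K, hK, -⟩ := exists_heatKernel hU hD le_rfl
  have h1 := (h.2 _ _ hN k hk).2.sub_isBigO (h'.2 _ _ hN k hk).2 ha n
  have h2 := (h.2 _ _ hD K hK).2.sub_isBigO (h'.2 _ _ hD K hK).2 ha n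
  simp only [hσN] at h1
  simp only [hσD] at h2
  have hcard : (Fintype.card (Γ.Star v) : ℂ) ≠ 0 :=
    Nat.cast_ne_zero.2 (Fintype.card_pos_iff.2 ⟨⟨η, rfl⟩⟩).ne'
  have h3 : T v =O[𝓝[>] 0] fun t : ℝ => t ^ ((n : ℝ) + 1 / 2) := by
    refine ((h1.sub h2).const_mul_left (2 * (Fintype.card (Γ.Star v) : ℂ))⁻¹).congr_left
      fun t => ?_
    rw [← Finset.sum_sub_distrib, Finset.sum_eq_single v]
    · rw [if_pos rfl]
      simp only [T]
      field_simp
      ring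
    · intro w _ hw
      rw [if_neg hw]; ring
    · exact fun hh => absurd (Finset.mem_univ v) hh
  -- with `t = u²` the powers of `√t` turn into powers of `u`
  have h4 := (Complex.isBigO_ofReal_left.1 h3).comp_tendsto
    (show Tendsto (fun u : ℝ => u ^ 2) (𝓝[>] 0) (𝓝[>] 0) from
      tendsto_nhdsWithin_iff.2 ⟨by
        simpa using ((continuous_pow 2).tendsto (0 : ℝ)).mono_left nhdsWithin_le_nhds,
        by filter_upwards [self_mem_nhdsWithin] with u hu using mem_Ioi.2 (pow_pos (mem_Ioi.1 hu) 2)⟩)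
  refine sub_eq_zero.1 (eq_zero_of_isBigO_sum_pow (d := fun m => b m v - b' m v)
    (p := 2 * n + 1) (h4.congr' ?_ ?_) (by omega))
  · filter_upwards [self_mem_nhdsWithin] with u hu
    have hu0 : 0 < u := hu
    simp only [Function.comp]
    refine Finset.sum_congr rfl fun m _ => ?_
    rw [← Real.rpow_natCast u 2, ← Real.rpow_mul hu0.le, ← Real.rpow_natCast u m]
    congr 2
    push_cast
    ring
  · filter_upwards [self_mem_nhdsWithin] with u hu
    have hu0 : 0 < u := hu
    simp only [Function.comp]
    rw [rpow_add_half (by positivity), Real.sqrt_sq hu0.le, ← pow_mul, pow_succ]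

theorem IsHeatCoefficients.edge_unique (hU : Γ.IsSmoothPotential U)
    (h : Γ.IsHeatCoefficients U a b) (h' : Γ.IsHeatCoefficients U a' b') (n : ℕ) (e : E) {x : ℝ}
    (hx : x ∈ Γ.seg e) : a n e x = a' n e x := by
  have hN : ∀ w : V, IsNonRobin (0 : Matrix (Γ.Star w) (Γ.Star w) ℂ) 1 :=
    fun w => isNonRobin_neumann.1
  obtain ⟨k, hk, -⟩ := exists_heatKernel hU hN le_rfl
  have h1 : EqOn (a n e) (a' n e) (Ioo 0 (Γ.len e)) := fun y hy =>
    (h.2 _ _ hN k hk).1.unique (h'.2 _ _ hN k hk).1 hy n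
  exact h1.of_subset_closure (h.1 n e) (h'.1 n e) Ioo_subset_Icc_self
    (closure_Ioo (Γ.len_pos e).ne).ge hx

end

end MetricGraph

theorem theorem6p4 :
    -- the universal polynomials that express the coefficients through the derivatives of `U`
    ∃ P Q : ℕ → MvPolynomial ℕ ℝ,
    ∀ (V : Type*) (E : Type*) [Fintype V] [Fintype E] [DecidableEq V] [DecidableEq E]
      (Γ : MetricGraph V E) (U : E → ℝ → ℝ), Γ.IsSmoothPotential U →
      -- the heat kernel exists, and its expansions exist
      (∀ A B : ∀ v, Matrix (Γ.Star v) (Γ.Star v) ℂ, (∀ v, IsNonRobin (A v) (B v)) →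
        ∃ k, Γ.IsHeatKernel U A B k) ∧
      (∃ a b, Γ.IsHeatCoefficients U a b) ∧
      ∀ (a : ℕ → E → ℝ → ℝ) (b : ℕ → V → ℝ), Γ.IsHeatCoefficients U a b →
        -- the coefficients are local and universal
        (∀ n e, ∀ x ∈ Γ.seg e,
          a n e x = MvPolynomial.eval (fun j => Γ.edgeDeriv U j e x) (P n)) ∧
        (∀ m h, b m (Γ.vert h) = MvPolynomial.eval (fun j => Γ.endDeriv U j h) (Q m)) ∧
        -- the vertex coefficients of non-integer index vanish
        (∀ m h, Odd m → b m (Γ.vert h) = 0) ∧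
        -- the first coefficients on the edges
        (∀ e, ∀ x ∈ Γ.seg e,
          a 0 e x = 1 ∧
          a 1 e x = U e x ∧
          a 2 e x = 1 / 6 * Γ.edgeDeriv U 2 e x + 1 / 2 * U e x ^ 2 ∧
          a 3 e x = 1 / 60 * Γ.edgeDeriv U 4 e x + 1 / 6 * Γ.edgeDeriv U 2 e x * U e x
            + 1 / 12 * Γ.edgeDeriv U 1 e x ^ 2 + 1 / 6 * U e x ^ 3) ∧
        -- the first coefficients at the vertices, of index 0, 1, 2 and 3
        (∀ h : E × Bool,
          b 0 (Γ.vert h) = 1 ∧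
          b 2 (Γ.vert h) = U h.1 (Γ.endPos h) ∧
          b 4 (Γ.vert h) = 1 / 4 * Γ.endDeriv U 2 h + 1 / 2 * U h.1 (Γ.endPos h) ^ 2 ∧
          b 6 (Γ.vert h) = 1 / 32 * Γ.endDeriv U 4 h
            + 1 / 4 * U h.1 (Γ.endPos h) * Γ.endDeriv U 2 h
            + 1 / 6 * U h.1 (Γ.endPos h) ^ 3) := by
  refine ⟨interiorPoly, vertexPoly, fun V E _ _ _ _ Γ U hU => ⟨fun A B hAB => ?_,
    ⟨_, _, MetricGraph.isHeatCoefficients_edgeCoeff hU⟩, fun a b hab => ?_⟩⟩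
  · obtain ⟨k, hk, -⟩ := MetricGraph.exists_heatKernel hU hAB le_rfl
    exact ⟨k, hk⟩
  have h' := MetricGraph.isHeatCoefficients_edgeCoeff hU
  have ha : ∀ n e, ∀ x ∈ Γ.seg e,
      a n e x = MvPolynomial.eval (fun j => Γ.edgeDeriv U j e x) (interiorPoly n) :=
    fun n e x hx => hab.edge_unique hU h' n e hx
  have hb : ∀ m h, b m (Γ.vert h)
      = MvPolynomial.eval (fun j => Γ.endDeriv U j h) (vertexPoly m) := fun m h => by
    rw [hab.vertex_unique hU h' (fun n e x hx => hab.edge_unique hU h' n e hx) m h,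
      MetricGraph.vertexCoeff_vert hU]
  refine ⟨ha, hb, fun m h hm => by rw [hb, vertexPoly_odd hm, map_zero], fun e x hx => ?_,
    fun h => ?_⟩
  · obtain ⟨h0, h1, h2, h3⟩ := eval_interiorPoly_first fun j => Γ.edgeDeriv U j e x
    simp only [ha _ e x hx, h0, h1, h2, h3, MetricGraph.edgeDeriv_zero, and_self]
  · obtain ⟨h0, h1, h2, h3⟩ := eval_vertexPolyInt_first (a := fun j => Γ.endDeriv U j h)
      fun l => hU.odd_eq_zero l h
    have hU0 : Γ.endDeriv U 0 h = U h.1 (Γ.endPos h) := by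
      rw [MetricGraph.endDeriv_eq, MetricGraph.edgeDeriv_zero, pow_zero, one_smul]
    rw [hb, hb, hb, hb, vertexPoly_two_mul 0, vertexPoly_two_mul 1, vertexPoly_two_mul 2,
      vertexPoly_two_mul 3, h0, h1, h2, h3, hU0]
    exact ⟨rfl, rfl, rfl, rfl⟩
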